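/- Let $V=\{1,\dots,n\}$ and $\mathcal T=\{1,\dots,t_{\max}\}$ with $t_{\max}\ge 1$. A graph sequence $(G,\tau)$ is a finite simple graph $G=(V,E)$ together with a map assigning to each edge $e$ a nonempty set $\tau(e)\subseteq\mathcal T$; the interval assumption says that every $\tau(e)$ is an interval of consecutive integers. For $F\subseteq E$ let $\tau(F)=\bigcap_{e\in F}\tau(e)$ (with $\tau(\emptyset)=\mathcal T$), let $V(F)$ be the set of endpoints of edges of $F$, and let $F_{\le i}$ be the set of edges of $F$ with both endpoints $\le i$. A clique is the edge set of a complete subgraph (the empty set included); it is active if $\tau(K)\ne\emptyset$, and closed if no clique $K'\supsetneq K$ has $\tau(K')=\tau(K)$. Edges are ordered by smaller endpoint, then by larger endpoint, and $F$ is lexicographically smaller than $F'$ if the smallest element of $F\triangle F'$ lies in $F$. For a clique $K$ let $X(K)$ be the lexicographically smallest closed clique $K'\supseteq K$ with $\tau(K')=\tau(K)$. The root is $X(\emptyset)$. For a closed active clique $K$ let $i(K)$ be the least $i$ with $X(K_{\le i})=K$ and, for $K$ other than the root, let $P(K)=X(K_{\le i(K)-1})$. For a vertex $v$ let $M(K,v)$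 be the set of edges joining $v$ to $V(K)$, and let $I(K,v)$ be the set of those $F\subseteq M(K,v)$ such that no $F'$ with $F\subsetneq F'\subseteq M(K,v)$ satisfies $\tau(F')\cap\tau(K)=\tau(F)\cap\tau(K)$. For $F\in I(K_{\le v},v)$ let $C(K,F)=X(\{e\in K_{\le v}: e\subseteq V(F)\}\cup F)$. Procedure EnumChildren$(K)$: for each pair $(v,F)$ with $v>i(K)$ and $F\in I(K_{\le v},v)$, in any order, put $K'=C(K,F)$ and output $K'$ if $K'$ is active, $P(K')=K$, $i(K')=v$, and $K_{\le v}\cap K'_{\le v}\neq\emptyset$. Algorithm EnumClosedActiveClique$(K)$: output $K$; call EnumClosedActiveClique$(K')$ for each $K'$ output by EnumChildren$(K)$; finally, if $K$ is the root, then for each $e\in E$, in any order, such that $X(\{e\})$ is not the root and $e$ is the smallest edge of $X(\{e\})$, call EnumClosedActiveClique$(X(\{e\}))$. The algorithm is started with $K=X(\emptyset)$. **Theorem.** Under the interval assumption, EnumClosedActiveClique terminates and outputs every closed active clique exactly once and nothing else, whatever the orders of its loops. Moreover, it can be implemented by a fixed word-RAM program that, on every graph sequence satisfying the interval assumption (given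 by its edge list with the end points of the intervals and by incidence lists, in arbitrary order), carries out such a run of the algorithm and outputs the cliques, listed by their edges, in $O(N\cdot\min\{\Delta^5,|E|^2\Delta\})$ time and $O(|V|+|E|)$ space, where $N$ is the number of closed active cliques and $\Delta$ is the maximum degree of $G$. Here words have $O(\log(|V|+|E|+t_{\max}))$ bits, space is counted in words excluding the write-only output, and in the degenerate case $E=\emptyset$ the minimum is read as $1$ (and, for $V=\emptyset$, $|V|+|E|$ as $1$). -/

import Mathlib

noncomputable section

/-! ## Graph sequences and closed active cliques -/

/-- A graph sequence `(G, τ)` on the vertices `1, …, n` (the vertex of index `i` is the element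
`i - 1` of `Fin n`), with time stamps `1, …, tmax`.  Only the values of `τ` on edges matter;
every edge is active at some time stamp. -/
structure GraphSeq where
  n : ℕ
  tmax : ℕ
  tmax_pos : 0 < tmax
  G : SimpleGraph (Fin n)
  τ : Sym2 (Fin n) → Finset ℕ
  τ_subset : ∀ e ∈ G.edgeSet, τ e ⊆ Finset.Icc 1 tmax
  τ_nonempty : ∀ e ∈ G.edgeSet, (τ e).Nonempty

namespace GraphSeq

/-- The index in `{1, …, n}` of a vertex. -/
def lbl {n : ℕ} (v : Fin n) : ℕ := v.val + 1

variable (S : GraphSeq)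

/-- Sets of (potential) edges; cliques are represented by their edge sets. -/
abbrev Edges : Type := Finset (Sym2 (Fin S.n))

/-- The active time stamp set of every edge is a (nonempty) interval. -/
def IntervalAssumption : Prop :=
  ∀ e ∈ S.G.edgeSet, ∃ a b : ℕ, a ≤ b ∧ S.τ e = Finset.Icc a b

/-- `|E|`. -/
def numEdges : ℕ := S.G.edgeSet.ncard

open Classical in
/-- `Δ`, the maximum degree. -/
def maxDeg : ℕ := S.G.maxDegree

/-- `τ(F)`, the set of time stamps at which all edges of `F` are active. -/
def timeOf (F : S.Edges) : Finset ℕ := (Finset.Icc 1 S.tmax).filter fun t => ∀ e ∈ F, t ∈ S.τ e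

open Classical in
/-- `V(F)`, the set of endpoints of the edges of `F`. -/
def verts (F : S.Edges) : Finset (Fin S.n) := Finset.univ.filter fun v => ∃ e ∈ F, v ∈ e

/-- `F` is the edge set of a complete subgraph (the empty edge set included). -/
def IsClique (F : S.Edges) : Prop :=
  (∀ e ∈ F, e ∈ S.G.edgeSet) ∧ ∀ u ∈ S.verts F, ∀ v ∈ S.verts F, u ≠ v → s(u, v) ∈ F

/-- No clique properly containing `K` has the same active time stamp set. -/
def IsClosed (K : S.Edges) : Prop :=
  ∀ K' : S.Edges, S.IsClique K' → K ⊂ K' → S.timeOf K ≠ S.timeOf K'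

/-- `K` is a closed active clique. -/
def ClosedActive (K : S.Edges) : Prop :=
  S.IsClique K ∧ (S.timeOf K).Nonempty ∧ S.IsClosed K

/-- `N`, the number of closed active cliques. -/
def numClosedActive : ℕ := {K : S.Edges | S.ClosedActive K}.ncard

/-! ## The parent-child relation -/

/-- Edges are compared by their smaller endpoint first and by their larger endpoint second. -/
def edgeLT (e e' : Sym2 (Fin S.n)) : Prop :=
  e.inf < e'.inf ∨ (e.inf = e'.inf ∧ e.sup < e'.sup)

/-- `F` is lexicographically smaller than `F'`: the smallest element of the symmetric difference
of `F` and `F'` belongs to `F`. -/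
def LexLT (F F' : S.Edges) : Prop :=
  ∃ e, e ∈ F ∧ e ∉ F' ∧ ∀ e', S.edgeLT e' e → (e' ∈ F ↔ e' ∈ F')

/-- `K'` is the lexicographically smallest among the closed cliques that include `K` and have the
same active time stamp set as `K`. -/
def IsCompletion (K K' : S.Edges) : Prop :=
  (S.IsClique K' ∧ S.IsClosed K' ∧ K ⊆ K' ∧ S.timeOf K' = S.timeOf K) ∧
    ∀ L : S.Edges, S.IsClique L → S.IsClosed L → K ⊆ L → S.timeOf L = S.timeOf K →
      L = K' ∨ S.LexLT K' L

/-- `X(K)`, for a clique `K`. -/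
def X (K : S.Edges) : S.Edges := Classical.epsilon (S.IsCompletion K)

/-- The root `X(∅)` of the family tree. -/
def root : S.Edges := S.X ∅

open Classical in
/-- `F_{≤ i}`: remove the edges incident to vertices of index greater than `i`. -/
def upTo (F : S.Edges) (i : ℕ) : S.Edges := F.filter fun e => ∀ v ∈ e, lbl v ≤ i

/-- `i(K)`: the minimum `i` with `X(K_{≤ i}) = K`. -/
def idx (K : S.Edges) : ℕ := sInf {i : ℕ | S.X (S.upTo K i) = K}

/-- The parent `P(K) = X(K_{≤ i(K) - 1})`; meaningful for closed active `K` other than the root. -/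
def parent (K : S.Edges) : S.Edges := S.X (S.upTo K (S.idx K - 1))

open Classical in
/-- `M(F, v)`: the edges connecting `v` and a vertex of `V(F)`. -/
def star (F : S.Edges) (v : Fin S.n) : S.Edges :=
  Finset.univ.filter fun e => e ∈ S.G.edgeSet ∧ ∃ u ∈ S.verts F, e = s(v, u)

open Classical in
/-- `F ∈ I(K, v)`: `F` is a time maximal subset of `M(K, v)`. -/
def TimeMaximal (K : S.Edges) (v : Fin S.n) (F : S.Edges) : Prop :=
  F ⊆ S.star K v ∧ ∀ F' : S.Edges, F' ⊆ S.star K v → F ⊂ F' →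
    S.timeOf F ∩ S.timeOf K ≠ S.timeOf F' ∩ S.timeOf K

open Classical in
/-- `C(K, F) = X((K_{≤ v} ∩ V(F)) ∪ F)` for a time maximal set `F` of edges incident to `v`. -/
def cand (K : S.Edges) (v : Fin S.n) (F : S.Edges) : S.Edges :=
  S.X ((S.upTo K (lbl v)).filter (fun e => ∀ u ∈ e, u ∈ S.verts F) ∪ F)

/-! ## The algorithm -/

/-- The pairs `(v, F)` over which the loop of `EnumChildren(K)` runs. -/
def IsCandidate (K : S.Edges) (p : Fin S.n × S.Edges) : Prop :=
  S.idx K < lbl p.1 ∧ S.TimeMaximal (S.upTo K (lbl p.1)) p.1 p.2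

/-- The test by which `EnumChildren(K)` decides whether to output `C(K, F)`. -/
def Accepts (K : S.Edges) (p : Fin S.n × S.Edges) : Prop :=
  (S.timeOf (S.cand K p.1 p.2)).Nonempty ∧
    S.parent (S.cand K p.1 p.2) = K ∧ S.idx (S.cand K p.1 p.2) = lbl p.1 ∧
    ∃ e, e ∈ S.upTo K (lbl p.1) ∧ e ∈ S.upTo (S.cand K p.1 p.2) (lbl p.1)

open Classical in
/-- `EnumChildren(K)` may output the list `cs` (the order in which the loop runs through the pairs
`(v, F)` is not prescribed). -/
def EnumChildren (K : S.Edges) (cs : List S.Edges) : Prop :=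
  ∃ ps : List (Fin S.n × S.Edges), ps.Nodup ∧ (∀ p, p ∈ ps ↔ S.IsCandidate K p) ∧
    cs = (ps.filter fun p => decide (S.Accepts K p)).map fun p => S.cand K p.1 p.2

/-- The test in the final loop at the root: `X({e})` is not the root, and `e` is its
lexicographically minimum edge. -/
def AcceptsEdge (e : Sym2 (Fin S.n)) : Prop :=
  S.X {e} ≠ S.root ∧ e ∈ S.X {e} ∧ ∀ e' ∈ S.X {e}, ¬ S.edgeLT e' e

open Classical in
/-- The final loop at the root may produce the list `cs` (the order in which the loop runs
through the edges is not prescribed). -/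
def EdgeChildren (cs : List S.Edges) : Prop :=
  ∃ es : List (Sym2 (Fin S.n)), es.Nodup ∧ (∀ e, e ∈ es ↔ e ∈ S.G.edgeSet) ∧
    cs = (es.filter fun e => decide (S.AcceptsEdge e)).map fun e => S.X {e}

/-- `cs` is a possible list of the arguments of the recursive calls made by the call with
argument `K`. -/
def RecCalls (K : S.Edges) (cs : List S.Edges) : Prop :=
  ∃ as bs, S.EnumChildren K as ∧ cs = as ++ bs ∧
    if K = S.root then S.EdgeChildren bs else bs = []

mutual

/-- A call with argument `K` may terminate having output the list `out`: it outputs `K` and then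
makes its recursive calls one after the other. -/
inductive Call (S : GraphSeq) : S.Edges → List S.Edges → Prop
  | mk (K : S.Edges) (cs out : List S.Edges) :
      S.RecCalls K cs → Calls S cs out → Call S K (K :: out)

/-- Calls with the arguments in a list, one after the other. -/
inductive Calls (S : GraphSeq) : List S.Edges → List S.Edges → Prop
  | nil : Calls S [] []
  | cons (K : S.Edges) (cs out out' : List S.Edges) :
      Call S K out → Calls S cs out' → Calls S (K :: cs) (out ++ out')

end

/-- `Ks` is the output list of a terminating run of `EnumClosedActiveClique`, started at the
root. -/
def EnumClosedActiveClique (Ks : List S.Edges) : Prop := Call S S.root Ks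

end GraphSeq

/-! ## The machine: a structured word RAM

A program uses finitely many registers and finitely many arrays, all of them holding natural
numbers.  There is no recursion and no built-in stack.  The machine is run with arrays of length
`L` and with words that hold the numbers `0, …, W`; a run that would leave these bounds is stuck. -/

namespace RAM

structure State where
  reg : ℕ → ℕ
  mem : ℕ → ℕ → ℕ
  /-- the words written so far on the write-only output tape -/
  out : List ℕ

inductive Exp where
  | lit (k : ℕ)
  | var (x : ℕ)
  | get (a : ℕ) (i : Exp)
  | add (e f : Exp)
  | sub (e f : Exp)

namespace Exp

def eval (σ : State) : Exp → ℕ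
  | lit k => k
  | var x => σ.reg x
  | get a i => σ.mem a (i.eval σ)
  | add e f => e.eval σ + f.eval σ
  | sub e f => e.eval σ - f.eval σ

/-- The number of unit-cost operations needed to evaluate an expression. -/
def size : Exp → ℕ
  | lit _ => 1
  | var _ => 1
  | get _ i => i.size + 1
  | add e f => e.size + f.size + 1
  | sub e f => e.size + f.size + 1

/-- Evaluation stays within the arrays and within the word size. -/
def Fits (L W : ℕ) (σ : State) : Exp → Prop
  | lit k => k ≤ W
  | var x => σ.reg x ≤ W
  | get a i => i.Fits L W σ ∧ i.eval σ < L ∧ σ.mem a (i.eval σ) ≤ W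
  | add e f => e.Fits L W σ ∧ f.Fits L W σ ∧ e.eval σ + f.eval σ ≤ W
  | sub e f => e.Fits L W σ ∧ f.Fits L W σ

def regs : Exp → Finset ℕ
  | lit _ => ∅
  | var x => {x}
  | get _ i => i.regs
  | add e f => e.regs ∪ f.regs
  | sub e f => e.regs ∪ f.regs

def arrays : Exp → Finset ℕ
  | lit _ => ∅
  | var _ => ∅
  | get a i => insert a i.arrays
  | add e f => e.arrays ∪ f.arrays
  | sub e f => e.arrays ∪ f.arrays

end Exp

inductive Cmd where
  | skip
  /-- register `x := e` -/
  | assign (x : ℕ) (e : Exp)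
  /-- array `a[i] := e` -/
  | put (a : ℕ) (i e : Exp)
  /-- append the value of `e` to the output -/
  | emit (e : Exp)
  | seq (c d : Cmd)
  /-- if `e ≠ 0` then `c` else `d` -/
  | ite (e : Exp) (c d : Cmd)
  /-- while `e ≠ 0` do `c` -/
  | loop (e : Exp) (c : Cmd)

namespace Cmd

def regs : Cmd → Finset ℕ
  | skip => ∅
  | assign x e => insert x e.regs
  | put _ i e => i.regs ∪ e.regs
  | emit e => e.regs
  | seq c d => c.regs ∪ d.regs
  | ite e c d => e.regs ∪ c.regs ∪ d.regs
  | loop e c => e.regs ∪ c.regs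

def arrays : Cmd → Finset ℕ
  | skip => ∅
  | assign _ e => e.arrays
  | put a i e => insert a (i.arrays ∪ e.arrays)
  | emit e => e.arrays
  | seq c d => c.arrays ∪ d.arrays
  | ite e c d => e.arrays ∪ c.arrays ∪ d.arrays
  | loop e c => e.arrays ∪ c.arrays

/-- The number of words of memory of a machine that runs `c` with arrays of length `L`. -/
def space (c : Cmd) (L : ℕ) : ℕ := c.arrays.card * L + c.regs.card

end Cmd

/-- `Exec L W c σ σ' t`: with arrays of length `L` and words bounded by `W`, the program `c`
started in `σ` halts in `σ'` after `t` elementary steps. -/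
inductive Exec (L W : ℕ) : Cmd → State → State → ℕ → Prop
  | skip (σ) : Exec L W Cmd.skip σ σ 1
  | assign (σ x e) : e.Fits L W σ →
      Exec L W (Cmd.assign x e) σ
        { σ with reg := Function.update σ.reg x (e.eval σ) } (e.size + 1)
  | put (σ a i e) : i.Fits L W σ → i.eval σ < L → e.Fits L W σ →
      Exec L W (Cmd.put a i e) σ
        { σ with
          mem := Function.update σ.mem a (Function.update (σ.mem a) (i.eval σ) (e.eval σ)) }
        (i.size + e.size + 1)
  | emit (σ e) : e.Fits L W σ →
      Exec L W (Cmd.emit e) σ { σ with out := σ.out ++ [e.eval σ] } (e.size + 1)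
  | seq (σ σ' σ'' c d t t') : Exec L W c σ σ' t → Exec L W d σ' σ'' t' →
      Exec L W (Cmd.seq c d) σ σ'' (t + t')
  | ite_true (σ σ' e c d t) : e.Fits L W σ → e.eval σ ≠ 0 → Exec L W c σ σ' t →
      Exec L W (Cmd.ite e c d) σ σ' (e.size + 1 + t)
  | ite_false (σ σ' e c d t) : e.Fits L W σ → e.eval σ = 0 → Exec L W d σ σ' t →
      Exec L W (Cmd.ite e c d) σ σ' (e.size + 1 + t)
  | loop_true (σ σ' σ'' e c t t') : e.Fits L W σ → e.eval σ ≠ 0 → Exec L W c σ σ' t →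
      Exec L W (Cmd.loop e c) σ' σ'' t' → Exec L W (Cmd.loop e c) σ σ'' (e.size + 1 + t + t')
  | loop_false (σ e c) : e.Fits L W σ → e.eval σ = 0 → Exec L W (Cmd.loop e c) σ σ (e.size + 1)

end RAM

/-! ## Input and output conventions -/

namespace GraphSeq

variable (S : GraphSeq)

/-- The initial machine state `σ` represents the graph sequence `S` (under the interval
assumption) by an edge list and incidence lists, both in some arbitrary order:
* registers `0, 1, 2` hold `|V|`, `|E|` and `tmax`;
* cells `j < |E|` of the arrays `0, 1, 2, 3` hold the two endpoints of the `j`-th edge, and the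
  first and the last time stamp of its interval;
* for the vertex of index `i`, array `4` holds in its cells `i` and `i + 1` the beginning and the
  end of the segment of array `5` that lists the numbers `j` of the edges incident to the vertex;
* everything else is zero, and the output tape is empty. -/
structure Encodes (σ : RAM.State) : Prop where
  reg_n : σ.reg 0 = S.n
  reg_m : σ.reg 1 = S.numEdges
  reg_t : σ.reg 2 = S.tmax
  reg_other : ∀ x, 3 ≤ x → σ.reg x = 0
  edges : ∃ edge : Fin S.numEdges ≃ S.G.edgeSet,
    (∀ j, ∃ u v : Fin S.n, (edge j : Sym2 (Fin S.n)) = s(u, v) ∧ u < v ∧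
      σ.mem 0 j = lbl u ∧ σ.mem 1 j = lbl v ∧
      S.τ (edge j) = Finset.Icc (σ.mem 2 j) (σ.mem 3 j)) ∧
    ∀ v : Fin S.n, σ.mem 4 (lbl v) ≤ σ.mem 4 (lbl v + 1) ∧
      Set.BijOn (σ.mem 5) (Set.Ico (σ.mem 4 (lbl v)) (σ.mem 4 (lbl v + 1)))
        {j | ∃ h : j < S.numEdges, v ∈ (edge ⟨j, h⟩ : Sym2 (Fin S.n))}
  seg_first : σ.mem 4 1 = 0
  seg_last : σ.mem 4 (S.n + 1) = 2 * S.numEdges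
  mem_edge : ∀ a < 4, ∀ j, S.numEdges ≤ j → σ.mem a j = 0
  mem_seg : ∀ i, (i = 0 ∨ S.n + 1 < i) → σ.mem 4 i = 0
  mem_inc : ∀ j, 2 * S.numEdges ≤ j → σ.mem 5 j = 0
  mem_other : ∀ a, 6 ≤ a → ∀ i, σ.mem a i = 0
  out_nil : σ.out = []

open Classical in
/-- The words `w` describe the clique `K`: the endpoints of its edges, edge after edge, each edge
once, and then the end mark `0`. -/
def Describes (w : List ℕ) (K : S.Edges) : Prop :=
  ∃ es : List (Fin S.n × Fin S.n), (es.map fun p => s(p.1, p.2)).Nodup ∧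
    (es.map fun p => s(p.1, p.2)).toFinset = K ∧
    w = (es.flatMap fun p => [lbl p.1, lbl p.2]) ++ [0]

/-- The output `out` consists of descriptions of the cliques in the list `Ks`, in this order. -/
def Prints (out : List ℕ) (Ks : List S.Edges) : Prop :=
  ∃ ws : List (List ℕ), List.Forall₂ S.Describes ws Ks ∧ out = ws.flatten

end GraphSeq

end

namespace GraphSeq

variable {S : GraphSeq}

/-! ## Active times and cliques -/

-- The recursion is a reverse search. Every clique between `A` and `X A` has the completion `X A`
-- (`X_mid`), so a parent has a smaller index than its child (`idx_parent_lt`). Hence the closed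
-- active cliques form a tree with root `X ∅`, and a traversal that finds the children of every node
-- exactly once terminates and lists every clique once (`call_spec`, `exists_call`,
-- `reflTransGen_root`).
--
-- Let `K'` be a child of `K` with index `v` and with an edge below `v`. The set `F` of the edges of
-- `K'` from `v` to smaller vertices recovers `K'` as `C(K, F)` (`cand_lowerStar`). It is time
-- maximal: a larger set with the same times would bring in a vertex below `v` outside `K'` without
-- loss of active times, and the completion would use it to become lexicographically smaller
-- (`mem_verts_of_extends`, `timeMaximal_lowerStar`). Conversely, an accepted pair `(v, F)` has this
-- form (`isKid_of_accepts`), so no child is found twice. The other children belong to the root;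
-- each is the completion of its least edge, and the final loop finds it (`edgeChildren_kids`).
--
-- The machine represents a clique by its vertex set and an interval `[a, b]` of times. Completion
-- becomes greedy closure: in increasing order, add every vertex joined to all present ones by edges
-- active throughout `[a, b]` (`Link.greedy_X`, `Greedy.unique`). `extend` does this in time
-- proportional to the degree sum of the clique, which is at most `R = 2 max(1, min(m, Δ²))`. Since
-- times are intervals, a time maximal set need not be enumerated as a set: its times within `K` are
-- fixed by an edge `f` of latest beginning and an edge `g` of earliest end, and the set consists of
-- all edges from `v` to smaller vertices of `K` that are active throughout the resulting interval.
-- The tie-breaking rule `Canon` selects exactly one pair per child, and the pair is encoded as one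
-- number. A node has at most `R * D` pairs, where `D = max(1, Δ)`, and a pair is tested in time
-- `O(R)`; a search for a child thus costs `O(R²D)`, which is `O(min(Δ⁵, m²Δ))` when there are edges
-- (`findChild_spec`, `square_mul_le`).
--
-- For linear space, a level of the stack holds four numbers: the code at which the search resumes,
-- the index of the child, and the interval of the parent. The parent is recomputed as the closure
-- of the vertices of the child below its index (`pop_spec`). Indices increase along a branch, so
-- the depth is at most `n` (`KidAt.gen`, `KidAt.lt_index`). Each listed clique other than a
-- starting one is paid for by one descent and one return (`explore`). The `O(mR)` spent on the
-- loops over the edges is absorbed, because every edge lies in a closed active clique and such a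
-- clique has at most `R` edges, so `m ≤ N R` (`Link.m_le`). As the loops may run in any order,
-- visiting children by increasing code is a legitimate run (`enumChildren_iff`,
-- `Link.calls_of_kidsOut`).

theorem mem_timeOf {F : S.Edges} {t : ℕ} :
    t ∈ S.timeOf F ↔ (1 ≤ t ∧ t ≤ S.tmax) ∧ ∀ e ∈ F, t ∈ S.τ e := by
  simp [timeOf]

theorem timeOf_anti {F F' : S.Edges} (h : F ⊆ F') : S.timeOf F' ⊆ S.timeOf F := fun t ht => by
  rw [mem_timeOf] at ht ⊢
  exact ⟨ht.1, fun e he => ht.2 e (h he)⟩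

theorem mem_verts {F : S.Edges} {v : Fin S.n} : v ∈ S.verts F ↔ ∃ e ∈ F, v ∈ e := by
  simp [verts]

theorem verts_mono {F F' : S.Edges} (h : F ⊆ F') : S.verts F ⊆ S.verts F' := fun v hv => by
  rw [mem_verts] at hv ⊢
  obtain ⟨e, he, hv⟩ := hv
  exact ⟨e, h he, hv⟩

theorem mem_upTo {F : S.Edges} {i : ℕ} {e : Sym2 (Fin S.n)} :
    e ∈ S.upTo F i ↔ e ∈ F ∧ ∀ v ∈ e, lbl v ≤ i := by
  simp [upTo]

theorem upTo_subset (F : S.Edges) (i : ℕ) : S.upTo F i ⊆ F := fun _ he => (mem_upTo.1 he).1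

theorem upTo_mono (F : S.Edges) {i j : ℕ} (h : i ≤ j) : S.upTo F i ⊆ S.upTo F j := fun e he => by
  rw [mem_upTo] at he ⊢
  exact ⟨he.1, fun v hv => (he.2 v hv).trans h⟩

theorem lbl_pos {n : ℕ} (v : Fin n) : 1 ≤ lbl v := by simp [lbl]

theorem lbl_le {n : ℕ} (v : Fin n) : lbl v ≤ n := v.isLt

theorem lbl_lt_lbl {n : ℕ} {u v : Fin n} : lbl u < lbl v ↔ u < v := by simp [lbl]

theorem lbl_le_lbl {n : ℕ} {u v : Fin n} : lbl u ≤ lbl v ↔ u ≤ v := by simp [lbl]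

theorem lbl_inj {n : ℕ} {u v : Fin n} : lbl u = lbl v ↔ u = v := by simp [lbl, Fin.ext_iff]

theorem exists_lbl {n i : ℕ} (h1 : 1 ≤ i) (h2 : i ≤ n) : ∃ v : Fin n, lbl v = i :=
  ⟨⟨i - 1, by omega⟩, by simp [lbl]; omega⟩

theorem upTo_all (F : S.Edges) : S.upTo F S.n = F := by
  ext e
  rw [mem_upTo]
  exact ⟨fun h => h.1, fun h => ⟨h, fun v _ => lbl_le v⟩⟩

theorem upTo_zero (F : S.Edges) : S.upTo F 0 = ∅ := by
  ext e
  rw [mem_upTo]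
  refine ⟨fun h => ?_, fun h => absurd h (Finset.notMem_empty e)⟩
  induction e with
  | _ a b => exact absurd (h.2 a (by simp)) (by simp [lbl])

theorem isClique_empty : S.IsClique ∅ := by
  constructor
  · simp
  · intro u hu
    simp [mem_verts] at hu

theorem IsClique.ne {K : S.Edges} (hK : S.IsClique K) {u v : Fin S.n} (h : s(u, v) ∈ K) :
    u ≠ v := by
  have := hK.1 _ h
  rw [SimpleGraph.mem_edgeSet] at this
  exact this.ne

theorem left_mem_verts {K : S.Edges} {u v : Fin S.n} (h : s(u, v) ∈ K) : u ∈ S.verts K :=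
  mem_verts.2 ⟨_, h, by simp⟩

theorem right_mem_verts {K : S.Edges} {u v : Fin S.n} (h : s(u, v) ∈ K) : v ∈ S.verts K :=
  mem_verts.2 ⟨_, h, by simp⟩

/-- The edges of a clique with all endpoints satisfying a predicate form a clique. -/
theorem IsClique.of_verts {K L : S.Edges} (hK : S.IsClique K) (p : Fin S.n → Prop)
    (h : ∀ e, e ∈ L ↔ e ∈ K ∧ ∀ v ∈ e, p v) : S.IsClique L := by
  refine ⟨fun e he => hK.1 e ((h e).1 he).1, fun u hu v hv huv => ?_⟩
  rw [mem_verts] at hu hv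
  obtain ⟨e, he, hu⟩ := hu
  obtain ⟨e', he', hv⟩ := hv
  rw [h] at he he' ⊢
  refine ⟨hK.2 u (mem_verts.2 ⟨e, he.1, hu⟩) v (mem_verts.2 ⟨e', he'.1, hv⟩) huv, ?_⟩
  intro w hw
  rcases Sym2.mem_iff.1 hw with rfl | rfl
  · exact he.2 _ hu
  · exact he'.2 _ hv

theorem IsClique.upTo {K : S.Edges} (hK : S.IsClique K) (i : ℕ) : S.IsClique (S.upTo K i) :=
  hK.of_verts (fun v => lbl v ≤ i) fun _ => mem_upTo

/-! ## The lexicographic order -/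

/-- The pair of the smaller and the larger endpoint of an edge. -/
def edgeKey (e : Sym2 (Fin S.n)) : Fin S.n ×ₗ Fin S.n := toLex (e.inf, e.sup)

theorem edgeLT_iff {e e' : Sym2 (Fin S.n)} : S.edgeLT e e' ↔ edgeKey e < edgeKey e' := by
  rw [edgeKey, edgeKey, Prod.Lex.toLex_lt_toLex]
  rfl

theorem edgeKey_inj {e e' : Sym2 (Fin S.n)} (h : edgeKey e = edgeKey e') : e = e' := by
  rw [edgeKey, edgeKey, toLex_inj, Prod.mk.injEq] at h
  exact Sym2.inf_eq_inf_and_sup_eq_sup.1 h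

theorem edgeLT_mk {a b c d : Fin S.n} (h1 : a < b) (h2 : c < d) :
    S.edgeLT s(a, b) s(c, d) ↔ a < c ∨ (a = c ∧ b < d) := by
  rw [edgeLT, Sym2.inf_mk, Sym2.inf_mk, Sym2.sup_mk, Sym2.sup_mk, inf_of_le_left h1.le,
    inf_of_le_left h2.le, sup_of_le_right h1.le, sup_of_le_right h2.le]

theorem LexLT.irrefl (F : S.Edges) : ¬ S.LexLT F F := fun ⟨_, h1, h2, _⟩ => h2 h1

/-- The smaller of the two deciding edges decides the outer comparison, since below it all three
sets agree. The two edges cannot coincide, for the middle set would both contain and omit that edge.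
-/
theorem LexLT.trans {F F' F'' : S.Edges} (h : S.LexLT F F') (h' : S.LexLT F' F'') :
    S.LexLT F F'' := by
  obtain ⟨e, h1, h2, h3⟩ := h
  obtain ⟨e', h1', h2', h3'⟩ := h'
  simp only [edgeLT_iff] at h3 h3'
  rcases lt_trichotomy (edgeKey e) (edgeKey e') with hlt | heq | hlt
  · refine ⟨e, h1, fun hc => h2 ((h3' e hlt).2 hc), fun d hd => ?_⟩
    rw [edgeLT_iff] at hd
    exact (h3 d hd).trans (h3' d (hd.trans hlt))
  · rw [edgeKey_inj heq] at h2
    exact absurd h1' h2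
  · refine ⟨e', (h3 e' hlt).2 h1', h2', fun d hd => ?_⟩
    rw [edgeLT_iff] at hd
    exact (h3 d (hd.trans hlt)).trans (h3' d hd)

open Classical in
theorem LexLT.total {F F' : S.Edges} (h : F ≠ F') : S.LexLT F F' ∨ S.LexLT F' F := by
  have hne : (Finset.univ.filter fun e => ¬ (e ∈ F ↔ e ∈ F')).Nonempty := by
    by_contra hc
    rw [Finset.not_nonempty_iff_eq_empty, Finset.filter_eq_empty_iff] at hc
    exact h (Finset.ext fun e => not_not.1 (hc (Finset.mem_univ e)))
  obtain ⟨e, he, hmin⟩ := Finset.exists_min_image _ (edgeKey (S := S)) hne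
  have hb : ∀ e', S.edgeLT e' e → (e' ∈ F ↔ e' ∈ F') := by
    intro e' hlt
    rw [edgeLT_iff] at hlt
    by_contra hc
    exact absurd (hmin e' (by simpa using hc)) (not_le.2 hlt)
  rw [Finset.mem_filter] at he
  by_cases h1 : e ∈ F
  · exact Or.inl ⟨e, h1, fun h2 => he.2 (by simp [h1, h2]), hb⟩
  · refine Or.inr ⟨e, ?_, h1, fun e' hlt => (hb e' hlt).symm⟩
    by_contra h2
    exact he.2 (by simp [h1, h2])

theorem LexLT.asymm {F F' : S.Edges} (h : S.LexLT F F') : ¬ S.LexLT F' F :=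
  fun h' => LexLT.irrefl _ (h.trans h')

/-! ## Completions -/

/-- A largest clique among those that include `K` and keep its active times is closed. -/
theorem exists_closed {K : S.Edges} (hK : S.IsClique K) :
    ∃ L, S.IsClique L ∧ S.IsClosed L ∧ K ⊆ L ∧ S.timeOf L = S.timeOf K := by
  classical
  obtain ⟨L, hL, hmax⟩ := Finset.exists_max_image
    (Finset.univ.filter fun L : S.Edges => S.IsClique L ∧ K ⊆ L ∧ S.timeOf L = S.timeOf K)
    Finset.card ⟨K, by simp [hK]⟩
  simp only [Finset.mem_filter, Finset.mem_univ, true_and] at hL hmax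
  refine ⟨L, hL.1, fun L' hL' hsub heq => ?_, hL.2.1, hL.2.2⟩
  exact absurd (hmax L' ⟨hL', hL.2.1.trans hsub.1, heq ▸ hL.2.2⟩)
    (not_le.2 (Finset.card_lt_card hsub))

theorem exists_completion {K : S.Edges} (hK : S.IsClique K) : ∃ L, S.IsCompletion K L := by
  have : IsTrans S.Edges S.LexLT := ⟨fun _ _ _ => LexLT.trans⟩
  have : Std.Irrefl S.LexLT := ⟨LexLT.irrefl⟩
  have wf := Finite.wellFounded_of_trans_of_irrefl S.LexLT
  obtain ⟨L, hL, hmin⟩ := wf.has_min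
    {L | S.IsClique L ∧ S.IsClosed L ∧ K ⊆ L ∧ S.timeOf L = S.timeOf K} (exists_closed hK)
  refine ⟨L, hL, fun M h1 h2 h3 h4 => ?_⟩
  by_contra hc
  rw [not_or] at hc
  rcases LexLT.total hc.1 with h | h
  · exact hmin M ⟨h1, h2, h3, h4⟩ h
  · exact hc.2 h

theorem X_isCompletion {K : S.Edges} (hK : S.IsClique K) : S.IsCompletion K (S.X K) :=
  Classical.epsilon_spec (exists_completion hK)

theorem IsCompletion.unique {K L M : S.Edges} (hL : S.IsCompletion K L)
    (hM : S.IsCompletion K M) : L = M := by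
  obtain ⟨⟨a1, a2, a3, a4⟩, a5⟩ := hL
  obtain ⟨⟨b1, b2, b3, b4⟩, b5⟩ := hM
  rcases a5 M b1 b2 b3 b4 with h | h
  · exact h.symm
  · rcases b5 L a1 a2 a3 a4 with h' | h'
    · exact h'
    · exact absurd h' h.asymm

theorem IsCompletion.X_eq {K L : S.Edges} (hK : S.IsClique K) (h : S.IsCompletion K L) :
    S.X K = L :=
  (X_isCompletion hK).unique h

theorem subset_X {K : S.Edges} (hK : S.IsClique K) : K ⊆ S.X K := (X_isCompletion hK).1.2.2.1

theorem timeOf_X {K : S.Edges} (hK : S.IsClique K) : S.timeOf (S.X K) = S.timeOf K :=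
  (X_isCompletion hK).1.2.2.2

theorem isClique_X {K : S.Edges} (hK : S.IsClique K) : S.IsClique (S.X K) := (X_isCompletion hK).1.1

theorem isClosed_X {K : S.Edges} (hK : S.IsClique K) : S.IsClosed (S.X K) :=
  (X_isCompletion hK).1.2.1

theorem closedActive_X {K : S.Edges} (hK : S.IsClique K) (h : (S.timeOf K).Nonempty) :
    S.ClosedActive (S.X K) :=
  ⟨isClique_X hK, by rwa [timeOf_X hK], isClosed_X hK⟩

/-- The inclusions force `A'` to have the times of `A`, so its candidate completions are among those
of `A`. The minimum `X A` of the larger family is still a candidate in the smaller one. Most facts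
about indices and parents come from this. -/
theorem X_mid {A A' : S.Edges} (hA : S.IsClique A) (hA' : S.IsClique A') (h : A ⊆ A')
    (h' : A' ⊆ S.X A) : S.X A' = S.X A := by
  have hX := X_isCompletion hA
  have ht : S.timeOf A' = S.timeOf A :=
    (timeOf_anti h).antisymm (by rw [← timeOf_X hA]; exact timeOf_anti h')
  refine IsCompletion.X_eq hA' ⟨⟨hX.1.1, hX.1.2.1, h', by rw [ht, timeOf_X hA]⟩, ?_⟩
  exact fun L h1 h2 h3 h4 => hX.2 L h1 h2 (h.trans h3) (h4.trans ht)

theorem ClosedActive.X_eq {K : S.Edges} (hK : S.ClosedActive K) : S.X K = K := by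
  refine IsCompletion.X_eq hK.1 ⟨⟨hK.1, hK.2.2, subset_rfl, rfl⟩, fun L h1 _ h3 h4 => ?_⟩
  by_contra hc
  rw [not_or] at hc
  exact hK.2.2 L h1 (h3.ssubset_of_ne fun h => hc.1 h.symm) h4.symm

theorem closedActive_root : S.ClosedActive S.root :=
  closedActive_X isClique_empty ⟨1, by simpa [mem_timeOf] using Nat.succ_le_of_lt S.tmax_pos⟩

/-! ## Indices and parents -/

theorem X_upTo_idx {K : S.Edges} (hK : S.ClosedActive K) : S.X (S.upTo K (S.idx K)) = K :=
  -- The set contains `n`, so the infimum is attained and is not the default value of an empty set.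
  Nat.sInf_mem (s := {i | S.X (S.upTo K i) = K}) ⟨S.n, by
    rw [Set.mem_ofPred_eq, upTo_all, hK.X_eq]⟩

theorem idx_le_of_X {K : S.Edges} {i : ℕ} (h : S.X (S.upTo K i) = K) : S.idx K ≤ i :=
  Nat.sInf_le h

theorem idx_le {K : S.Edges} (hK : S.ClosedActive K) : S.idx K ≤ S.n :=
  idx_le_of_X (by rw [upTo_all, hK.X_eq])

theorem X_upTo_of_le {K : S.Edges} (hK : S.ClosedActive K) {i : ℕ} (h : S.idx K ≤ i) :
    S.X (S.upTo K i) = K := by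
  have h1 := X_upTo_idx hK
  have := X_mid (hK.1.upTo _) (hK.1.upTo i) (upTo_mono K h) (by rw [h1]; exact upTo_subset K i)
  rw [this, h1]

theorem idx_root : S.idx S.root = 0 := by
  have : S.idx S.root ≤ 0 := idx_le_of_X (by rw [upTo_zero]; rfl)
  omega

theorem idx_pos {K : S.Edges} (hK : S.ClosedActive K) (h : K ≠ S.root) : 1 ≤ S.idx K := by
  by_contra hc
  have h0 : S.idx K = 0 := by omega
  have := X_upTo_idx hK
  rw [h0, upTo_zero] at this
  exact h this.symm

theorem closedActive_parent {K : S.Edges} (hK : S.ClosedActive K) :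
    S.ClosedActive (S.parent K) :=
  closedActive_X (hK.1.upTo _) (hK.2.1.mono (timeOf_anti (upTo_subset _ _)))

/-- With `j = i(K) - 1`, the part of `P(K)` up to `j` lies between `K_{≤ j}` and `X(K_{≤ j}) =
P(K)`. By `X_mid` it already generates `P(K)`, so the index of `P(K)` is at most `j`. -/
theorem idx_parent_lt {K : S.Edges} (hK : S.ClosedActive K) (h : K ≠ S.root) :
    S.idx (S.parent K) < S.idx K := by
  have h0 := idx_pos hK h
  have hc := hK.1.upTo (S.idx K - 1)
  have hsub := subset_X hc
  have : S.X (S.upTo (S.parent K) (S.idx K - 1)) = S.parent K := by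
    refine X_mid hc ((isClique_X hc).upTo _) ?_ (upTo_subset _ _)
    intro e he
    exact mem_upTo.2 ⟨hsub he, (mem_upTo.1 he).2⟩
  have := idx_le_of_X this
  omega

end GraphSeq

namespace GraphSeq

variable {S : GraphSeq}

/-! ## Children -/

/-- By minimality of the index, `K_{≤ i(K)}` and `K_{≤ i(K) - 1}` differ; an edge in the difference
has `v` as its larger endpoint. -/
theorem exists_lower_neighbor {K : S.Edges} (hK : S.ClosedActive K) (hr : K ≠ S.root)
    {v : Fin S.n} (hv : lbl v = S.idx K) : ∃ u, u < v ∧ s(u, v) ∈ K := by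
  have h0 := idx_pos hK hr
  have hne : S.upTo K (S.idx K) ≠ S.upTo K (S.idx K - 1) := fun h => by
    have h1 := X_upTo_idx hK
    rw [h] at h1
    have := idx_le_of_X h1
    omega
  have : ∃ e ∈ S.upTo K (S.idx K), e ∉ S.upTo K (S.idx K - 1) := by
    by_contra hc
    push Not at hc
    exact hne (Finset.Subset.antisymm hc (upTo_mono K (by omega)))
  obtain ⟨e, he, hn⟩ := this
  rw [mem_upTo] at he hn
  have : ∃ w ∈ e, ¬ lbl w ≤ S.idx K - 1 := by
    by_contra hc
    push Not at hc
    exact hn ⟨he.1, hc⟩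
  obtain ⟨w, hw, hw'⟩ := this
  have : w = v := by
    rw [← lbl_inj]
    have := he.2 w hw
    omega
  subst this
  obtain ⟨u, rfl⟩ := Sym2.mem_iff_exists.1 hw
  have hne := hK.1.ne he.1
  refine ⟨u, lt_of_le_of_ne (lbl_le_lbl.1 ?_) hne.symm, by rw [Sym2.eq_swap]; exact he.1⟩
  have := he.2 u (by simp)
  omega

theorem exists_idx_vertex {K : S.Edges} (hK : S.ClosedActive K) (hr : K ≠ S.root) :
    ∃ v : Fin S.n, lbl v = S.idx K :=
  exists_lbl (idx_pos hK hr) (idx_le hK)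

theorem mem_upTo_mk {F : S.Edges} {i : ℕ} {a b : Fin S.n} :
    s(a, b) ∈ S.upTo F i ↔ s(a, b) ∈ F ∧ lbl a ≤ i ∧ lbl b ≤ i := by
  rw [mem_upTo]
  simp

/-- Two vertices of `K` below `v` would be joined by an edge of `K_{≤ i(K) - 1}`. So `v` has a
single lower neighbor `u`, and any edge preceding `s(u, v)` would again have two vertices below `v`,
or one different from `u`. -/
theorem upTo_idx_eq_singleton {K : S.Edges} (hK : S.ClosedActive K) (hr : K ≠ S.root)
    (h : S.upTo K (S.idx K - 1) = ∅) :
    ∃ e, S.upTo K (S.idx K) = {e} ∧ ∀ e' ∈ K, ¬ S.edgeLT e' e := by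
  obtain ⟨v, hv⟩ := exists_idx_vertex hK hr
  obtain ⟨u, huv, he⟩ := exists_lower_neighbor hK hr hv
  have hno : ∀ a b, a < v → b < v → s(a, b) ∉ K := fun a b ha hb hab => by
    have : s(a, b) ∈ S.upTo K (S.idx K - 1) := by
      rw [mem_upTo_mk]
      rw [← lbl_lt_lbl] at ha hb
      exact ⟨hab, by omega, by omega⟩
    rw [h] at this
    exact Finset.notMem_empty _ this
  have hno' : ∀ a ∈ S.verts K, a < v → a = u := fun a ha hav => by
    by_contra hne
    exact hno _ _ hav huv (hK.1.2 a ha u (left_mem_verts he) hne)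
  refine ⟨s(u, v), ?_, ?_⟩
  · ext e'
    rw [Finset.mem_singleton]
    constructor
    · intro h'
      induction e' with
      | _ a b =>
        rw [mem_upTo_mk, ← hv, lbl_le_lbl, lbl_le_lbl] at h'
        obtain ⟨h1, h2, h3⟩ := h'
        have hab := hK.1.ne h1
        rcases lt_or_eq_of_le h2 with h2 | h2
        · rcases lt_or_eq_of_le h3 with h3 | h3
          · exact absurd h1 (hno _ _ h2 h3)
          · rw [h3, hno' a (left_mem_verts h1) h2]
        · rw [h2, hno' b (right_mem_verts h1) (lt_of_le_of_ne h3 fun h => hab (h2.trans h.symm)),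
            Sym2.eq_swap]
    · rintro rfl
      rw [mem_upTo_mk, ← hv, lbl_le_lbl, lbl_le_lbl]
      exact ⟨he, huv.le, le_rfl⟩
  · intro e' he' hlt
    induction e' with
    | _ a b =>
      wlog hab : a < b generalizing a b
      · refine this b a (by rwa [Sym2.eq_swap]) (by rwa [Sym2.eq_swap]) ?_
        exact lt_of_le_of_ne (not_lt.1 hab) (hK.1.ne he').symm
      rw [edgeLT_mk hab huv] at hlt
      rcases hlt with h1 | ⟨rfl, h1⟩
      · exact h1.ne (hno' a (left_mem_verts he') (h1.trans huv))
      · exact hno _ _ huv h1 he'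

/-- A clique with the same active times as `K` that extends `K_{≤ i(K)}` has no new vertex of index
at most `i(K)`. -/
theorem mem_verts_of_extends {K Q : S.Edges} (hK : S.ClosedActive K) (hr : K ≠ S.root)
    (hQ : S.IsClique Q) (hsub : S.upTo K (S.idx K) ⊆ Q) (ht : S.timeOf Q = S.timeOf K)
    {u : Fin S.n} (hu : u ∈ S.verts Q) (hui : lbl u ≤ S.idx K) : u ∈ S.verts K := by
  obtain ⟨v, hv⟩ := exists_idx_vertex hK hr
  obtain ⟨x, hxv, hx⟩ := exists_lower_neighbor hK hr hv
  have hc := X_isCompletion (hK.1.upTo (S.idx K))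
  rw [X_upTo_idx hK] at hc
  have hXQ := X_isCompletion hQ
  -- The completion of `Q` is a candidate for the completion of `K_{≤ i(K)}`, which is `K`. Either
  -- it equals `K`, or `K` is lexicographically smaller.
  rcases hc.2 _ hXQ.1.1 hXQ.1.2.1 (hsub.trans hXQ.1.2.2.1)
    (by rw [hXQ.1.2.2.2, ht, hc.1.2.2.2]) with h | ⟨e, he, hne, hb⟩
  · rw [← h]
    exact verts_mono hXQ.1.2.2.1 hu
  · by_contra hnu
    -- Join the least vertex `a` of `K` to the supposed new vertex `u`. This edge lies in `X Q` and
    -- not in `K`. It precedes the first difference `e`, because `e` has an endpoint above `v` while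
    -- `u` is at most `v`.
    obtain ⟨a, ha, hmin⟩ := Finset.exists_min_image (S.verts K) id ⟨x, left_mem_verts hx⟩
    simp only [id] at hmin
    have hav : a < v := (hmin x (left_mem_verts hx)).trans_lt hxv
    have hau : a ≠ u := fun h => hnu (h ▸ ha)
    have hmem : s(a, u) ∈ S.X Q := by
      refine hXQ.1.1.2 a ?_ u (verts_mono hXQ.1.2.2.1 hu) hau
      refine verts_mono (hsub.trans hXQ.1.2.2.1) (left_mem_verts (v := v) ?_)
      rw [mem_upTo_mk, ← hv, lbl_le_lbl, lbl_le_lbl]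
      exact ⟨hK.1.2 a ha v (right_mem_verts hx) hav.ne, hav.le, le_rfl⟩
    have hnm : s(a, u) ∉ K := fun h => hnu (right_mem_verts h)
    refine hnm ((hb _ ?_).2 hmem)
    induction e with
    | _ p q =>
      wlog hpq : p < q generalizing p q
      · rw [Sym2.eq_swap (a := p)] at he hne hb ⊢
        exact this q p he hne hb (lt_of_le_of_ne (not_lt.1 hpq) (hK.1.ne he))
      have hap := hmin p (left_mem_verts he)
      have hvq : v < q := by
        by_contra hc
        refine hne (hXQ.1.2.2.1 (hsub ?_))
        rw [mem_upTo_mk, ← hv, lbl_le_lbl, lbl_le_lbl]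
        exact ⟨he, hpq.le.trans (not_lt.1 hc), not_lt.1 hc⟩
      rw [← hv, lbl_le_lbl] at hui
      rcases lt_or_gt_of_ne hau with h | h
      · rw [edgeLT_mk h hpq]
        rcases lt_or_eq_of_le hap with h' | h'
        · exact Or.inl h'
        · exact Or.inr ⟨h', hui.trans_lt hvq⟩
      · rw [Sym2.eq_swap, edgeLT_mk h hpq]
        exact Or.inl (h.trans_le hap)

open Classical in
/-- The set whose completion is `C(K, F)`. -/
def candBase (K : S.Edges) (v : Fin S.n) (F : S.Edges) : S.Edges :=
  (S.upTo K (lbl v)).filter (fun e => ∀ u ∈ e, u ∈ S.verts F) ∪ F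

theorem cand_eq (K : S.Edges) (v : Fin S.n) (F : S.Edges) :
    S.cand K v F = S.X (candBase K v F) := rfl

theorem mem_candBase {K : S.Edges} {v : Fin S.n} {F : S.Edges} {e : Sym2 (Fin S.n)} :
    e ∈ candBase K v F ↔ (e ∈ S.upTo K (lbl v) ∧ ∀ u ∈ e, u ∈ S.verts F) ∨ e ∈ F := by
  rw [candBase, Finset.mem_union, Finset.mem_filter]

theorem mem_star {F : S.Edges} {v : Fin S.n} {e : Sym2 (Fin S.n)} :
    e ∈ S.star F v ↔ e ∈ S.G.edgeSet ∧ ∃ u ∈ S.verts F, e = s(v, u) := by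
  simp [star]

theorem isClique_candBase {K : S.Edges} (hK : S.IsClique K) {v : Fin S.n} {F : S.Edges}
    (hF : F ⊆ S.star (S.upTo K (lbl v)) v) : S.IsClique (candBase K v F) := by
  have hv : ∀ x ∈ S.verts F, x = v ∨ (s(v, x) ∈ F ∧ x ∈ S.verts (S.upTo K (lbl v))) := by
    intro x hx
    obtain ⟨e, he, hx⟩ := mem_verts.1 hx
    obtain ⟨_, u, hu, rfl⟩ := mem_star.1 (hF he)
    rcases Sym2.mem_iff.1 hx with rfl | rfl
    · exact Or.inl rfl
    · exact Or.inr ⟨he, hu⟩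
  have hsub : ∀ x ∈ S.verts (candBase K v F), x ∈ S.verts F := by
    intro x hx
    obtain ⟨e, he, hx⟩ := mem_verts.1 hx
    rcases mem_candBase.1 he with h | h
    · exact h.2 x hx
    · exact mem_verts.2 ⟨e, h, hx⟩
  constructor
  · intro e he
    rcases mem_candBase.1 he with h | h
    · exact hK.1 e (upTo_subset _ _ h.1)
    · exact (mem_star.1 (hF h)).1
  · intro x hx y hy hxy
    replace hx := hsub x hx
    replace hy := hsub y hy
    rw [mem_candBase]
    rcases hv x hx with rfl | hx'
    · rcases hv y hy with rfl | hy'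
      · exact absurd rfl hxy
      · exact Or.inr hy'.1
    · rcases hv y hy with rfl | hy'
      · rw [Sym2.eq_swap]
        exact Or.inr hx'.1
      · refine Or.inl ⟨(hK.upTo _).2 x hx'.2 y hy'.2 hxy, fun u hu => ?_⟩
        rcases Sym2.mem_iff.1 hu with rfl | rfl
        · exact hx
        · exact hy

/-- `K'` is a child of `K` in the family tree. -/
def IsKid (K K' : S.Edges) : Prop := S.ClosedActive K' ∧ K' ≠ S.root ∧ S.parent K' = K

open Classical in
/-- The edges that join `v` to the vertices of `K` of smaller index. -/
def lowerStar (K : S.Edges) (v : Fin S.n) : S.Edges := (S.upTo K (lbl v)).filter fun e => v ∈ e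

theorem mem_lowerStar {K : S.Edges} {v : Fin S.n} {e : Sym2 (Fin S.n)} :
    e ∈ lowerStar K v ↔ e ∈ S.upTo K (lbl v) ∧ v ∈ e := by
  rw [lowerStar, Finset.mem_filter]

section Kid

variable {K K' : S.Edges} {v : Fin S.n}

theorem upTo_pred_subset_parent (h : S.IsKid K K') : S.upTo K' (S.idx K' - 1) ⊆ K := by
  rw [← h.2.2]
  exact subset_X (h.1.1.upTo _)

theorem timeOf_upTo_pred (h : S.IsKid K K') :
    S.timeOf (S.upTo K' (S.idx K' - 1)) = S.timeOf K := by
  rw [← h.2.2]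
  exact (timeOf_X (h.1.1.upTo _)).symm

theorem timeOf_upTo_idx (h : S.ClosedActive K') : S.timeOf (S.upTo K' (S.idx K')) = S.timeOf K' := by
  have := timeOf_X (h.1.upTo (S.idx K'))
  rw [← this, X_upTo_idx h]

/-- The edges at `v` lie in `F`. The others lie below `v`, hence in the parent, and clique edges
from `F` join their endpoints to `v`, so they survive the restriction to `V(F)`. -/
theorem upTo_subset_candBase (h : S.IsKid K K') (hv : lbl v = S.idx K') {F : S.Edges}
    (hF : lowerStar K' v ⊆ F) : S.upTo K' (S.idx K') ⊆ candBase K v F := by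
  obtain ⟨x, hxv, hx⟩ := exists_lower_neighbor h.1 h.2.1 hv
  intro e he
  rw [mem_candBase]
  by_cases hve : v ∈ e
  · exact Or.inr (hF (mem_lowerStar.2 ⟨by rwa [hv], hve⟩))
  · left
    have he' := mem_upTo.1 he
    have hlt : ∀ w ∈ e, lbl w < lbl v := fun w hw => by
      have h1 := he'.2 w hw
      have h2 : w ≠ v := fun h => hve (h ▸ hw)
      rw [← lbl_inj.ne] at h2
      omega
    have heK : e ∈ K := upTo_pred_subset_parent h (mem_upTo.2 ⟨he'.1, fun w hw => by
      have := hlt w hw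
      omega⟩)
    refine ⟨mem_upTo.2 ⟨heK, fun w hw => (hlt w hw).le⟩, fun w hw => ?_⟩
    refine mem_verts.2 ⟨s(w, v), hF (mem_lowerStar.2 ⟨?_, by simp⟩), by simp⟩
    rw [mem_upTo_mk]
    refine ⟨h.1.1.2 w (mem_verts.2 ⟨e, he'.1, hw⟩) v (right_mem_verts hx) ?_, (hlt w hw).le, le_rfl⟩
    exact fun h => hve (h ▸ hw)

/-- Every lower neighbor of `v` must be a vertex of the parent. This needs an edge of `K'` below
`v`: it yields, for each lower neighbor, an edge at that neighbor which belongs to `K'_{≤ i(K') -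
1}`. -/
theorem lowerStar_subset_star (h : S.IsKid K K') (hv : lbl v = S.idx K')
    (hne : (S.upTo K' (S.idx K' - 1)).Nonempty) :
    lowerStar K' v ⊆ S.star (S.upTo K (lbl v)) v := by
  obtain ⟨d, hd⟩ := hne
  intro e he
  obtain ⟨he, hve⟩ := mem_lowerStar.1 he
  obtain ⟨u, rfl⟩ := Sym2.mem_iff_exists.1 hve
  rw [mem_upTo_mk] at he
  refine mem_star.2 ⟨h.1.1.1 _ he.1, u, ?_, rfl⟩
  have huv := h.1.1.ne he.1
  have hlu : lbl u ≤ S.idx K' - 1 := by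
    rw [← lbl_inj.ne] at huv
    omega
  refine verts_mono (F := S.upTo K' (S.idx K' - 1)) ?_ ?_
  · intro e' he'
    exact mem_upTo.2 ⟨upTo_pred_subset_parent h he', fun w hw => by
      have := (mem_upTo.1 he').2 w hw
      omega⟩
  · induction d with
    | _ a b =>
      by_cases hau : a = u
      · exact hau ▸ left_mem_verts hd
      · rw [mem_upTo_mk] at hd
        refine left_mem_verts (v := a) (mem_upTo_mk.2 ⟨?_, hlu, hd.2.1⟩)
        exact h.1.1.2 u (right_mem_verts he.1) a (left_mem_verts hd.1) (Ne.symm hau)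

/-- A larger set with the same times would give a base with the times of `K'`, extending `K'_{≤ v}`
by the endpoint `u` of a new edge. By `mem_verts_of_extends` this `u` is a vertex of `K'`, so the
edge was not new. -/
theorem timeMaximal_lowerStar (h : S.IsKid K K') (hv : lbl v = S.idx K')
    (hne : (S.upTo K' (S.idx K' - 1)).Nonempty) :
    S.TimeMaximal (S.upTo K (lbl v)) v (lowerStar K' v) := by
  refine ⟨lowerStar_subset_star h hv hne, fun F' hF' hsub heq => ?_⟩
  obtain ⟨e, he, hne'⟩ := Finset.exists_of_ssubset hsub
  have hKc : S.IsClique K := by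
    rw [← h.2.2]
    exact (closedActive_parent h.1).1
  obtain ⟨heE, u, hu, rfl⟩ := mem_star.1 (hF' he)
  have hlu : lbl u ≤ lbl v := by
    obtain ⟨d, hd, hud⟩ := mem_verts.1 hu
    exact (mem_upTo.1 hd).2 u hud
  have hbase := upTo_subset_candBase h hv hsub.1
  have ht : S.timeOf (candBase K v F') = S.timeOf K' := by
    refine Finset.Subset.antisymm ?_ fun t ht => ?_
    · rw [← timeOf_upTo_idx h.1]
      exact timeOf_anti hbase
    · have h1 : t ∈ S.timeOf K := by
        rw [← timeOf_upTo_pred h]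
        exact timeOf_anti (upTo_subset _ _) ht
      have h2 : t ∈ S.timeOf (S.upTo K (lbl v)) := timeOf_anti (upTo_subset _ _) h1
      have h3 : t ∈ S.timeOf (lowerStar K' v) :=
        timeOf_anti (fun e he => upTo_subset _ _ (mem_lowerStar.1 he).1) ht
      have h4 : t ∈ S.timeOf F' :=
        (Finset.mem_inter.1 (heq ▸ Finset.mem_inter.2 ⟨h3, h2⟩)).1
      rw [mem_timeOf] at h1 h4 ⊢
      refine ⟨h1.1, fun e he => ?_⟩
      rcases mem_candBase.1 he with h | h
      · exact h1.2 e (upTo_subset _ _ h.1)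
      · exact h4.2 e h
  have huQ : u ∈ S.verts (candBase K v F') := right_mem_verts (mem_candBase.2 (Or.inr he))
  have huK := mem_verts_of_extends h.1 h.2.1 (isClique_candBase hKc hF') hbase ht huQ (hv ▸ hlu)
  obtain ⟨x, hxv, hx⟩ := exists_lower_neighbor h.1 h.2.1 hv
  refine hne' (mem_lowerStar.2 ⟨mem_upTo_mk.2 ⟨?_, le_rfl, hlu⟩, by simp⟩)
  refine h.1.1.2 v (right_mem_verts hx) u huK ?_
  rw [SimpleGraph.mem_edgeSet] at heE
  exact heE.ne

theorem cand_lowerStar (h : S.IsKid K K') (hv : lbl v = S.idx K') :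
    S.cand K v (lowerStar K' v) = K' := by
  have : candBase K v (lowerStar K' v) = S.upTo K' (S.idx K') := by
    refine Finset.Subset.antisymm (fun e he => ?_) (upTo_subset_candBase h hv subset_rfl)
    have hKc : S.IsClique K := by
      rw [← h.2.2]
      exact (closedActive_parent h.1).1
    rcases mem_candBase.1 he with ⟨h1, h2⟩ | h'
    · rw [← hv]
      have hvK : ∀ u ∈ e, u ∈ S.verts K' := fun u hu =>
        verts_mono (fun e he => upTo_subset _ _ (mem_lowerStar.1 he).1) (h2 u hu)
      refine mem_upTo.2 ⟨?_, (mem_upTo.1 h1).2⟩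
      induction e with
      | _ a b =>
        exact h.1.1.2 a (hvK a (by simp)) b (hvK b (by simp)) (hKc.ne (upTo_subset _ _ h1))
    · rw [← hv]
      exact (mem_lowerStar.1 h').1
  rw [cand_eq, this, X_upTo_idx h.1]

theorem isCandidate_lowerStar (h : S.IsKid K K') (hv : lbl v = S.idx K')
    (hne : (S.upTo K' (S.idx K' - 1)).Nonempty) : S.IsCandidate K (v, lowerStar K' v) := by
  refine ⟨?_, timeMaximal_lowerStar h hv hne⟩
  have := idx_parent_lt h.1 h.2.1
  rw [h.2.2] at this
  simpa [hv] using this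

theorem accepts_lowerStar (h : S.IsKid K K') (hv : lbl v = S.idx K')
    (hne : (S.upTo K' (S.idx K' - 1)).Nonempty) : S.Accepts K (v, lowerStar K' v) := by
  rw [Accepts]
  simp only [cand_lowerStar h hv]
  refine ⟨h.1.2.1, h.2.2, hv.symm, ?_⟩
  obtain ⟨e, he⟩ := hne
  have he' := mem_upTo.1 he
  have hle : ∀ w ∈ e, lbl w ≤ lbl v := fun w hw => by
    have := he'.2 w hw
    omega
  exact ⟨e, mem_upTo.2 ⟨upTo_pred_subset_parent h he, hle⟩, mem_upTo.2 ⟨he'.1, hle⟩⟩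

/-- Besides soundness of the test, this recovers `F` from the accepted clique: `F` lies in the lower
star of `v`, and both have the same times within `K_{≤ v}`, so time maximality makes them equal.
This is why no child is output twice. -/
theorem isKid_of_accepts (hK : S.ClosedActive K) {F : S.Edges} (hc : S.IsCandidate K (v, F))
    (ha : S.Accepts K (v, F)) : S.IsKid K (S.cand K v F) ∧ lbl v = S.idx (S.cand K v F) ∧
      (S.upTo (S.cand K v F) (S.idx (S.cand K v F) - 1)).Nonempty ∧
      F = lowerStar (S.cand K v F) v := by
  obtain ⟨ha1, ha2, ha3, d, hd1, hd2⟩ := ha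
  have hF : F ⊆ S.star (S.upTo K (lbl v)) v := hc.2.1
  have hbc := isClique_candBase hK.1 hF
  simp only at ha1 ha2 ha3 hd1 hd2
  have hCA : S.ClosedActive (S.cand K v F) := by
    rw [cand_eq] at ha1 ⊢
    rw [timeOf_X hbc] at ha1
    exact closedActive_X hbc ha1
  have hsubX : candBase K v F ⊆ S.cand K v F := subset_X hbc
  have htX : S.timeOf (S.cand K v F) = S.timeOf (candBase K v F) := timeOf_X hbc
  generalize S.cand K v F = K' at *
  have hr : K' ≠ S.root := by
    rintro rfl
    rw [idx_root] at ha3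
    simp [lbl] at ha3
  have hkid : S.IsKid K K' := ⟨hCA, hr, ha2⟩
  have hne : (S.upTo K' (S.idx K' - 1)).Nonempty := by
    rw [Finset.nonempty_iff_ne_empty]
    -- Here the common edge demanded by the test matters. If nothing lay below `v`, then `K'_{≤ v}`
    -- would be one edge `d` and `K` the root. As `d` also belongs to `K`, its completion would be
    -- the root, which `K'` is not.
    intro hemp
    obtain ⟨e, he, _⟩ := upTo_idx_eq_singleton hCA hr hemp
    rw [← ha3, he, Finset.mem_singleton] at hd2
    subst hd2
    have h1 : S.X {d} = K' := by rw [← he, X_upTo_idx hCA]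
    have h2 : K = S.root := by rw [← ha2, parent, hemp]; rfl
    have hd : d ∈ S.root := h2 ▸ upTo_subset _ _ hd1
    have h3 : S.X {d} = S.root := by
      refine X_mid isClique_empty ?_ (Finset.empty_subset _)
        (Finset.singleton_subset_iff.2 hd)
      rw [← he]
      exact hCA.1.upTo _
    exact hr (h1.symm.trans h3)
  refine ⟨hkid, ha3.symm, hne, ?_⟩
  by_contra hFne
  have hsub : F ⊆ lowerStar K' v := fun e he => by
    obtain ⟨_, u, hu, rfl⟩ := mem_star.1 (hF he)
    obtain ⟨e', he', hu⟩ := mem_verts.1 hu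
    refine mem_lowerStar.2 ⟨mem_upTo_mk.2 ⟨hsubX (mem_candBase.2 (Or.inr he)), le_rfl, ?_⟩, by simp⟩
    exact (mem_upTo.1 he').2 u hu
  refine hc.2.2 _ (lowerStar_subset_star hkid ha3.symm hne) (hsub.ssubset_of_ne hFne) ?_
  refine Finset.Subset.antisymm (fun t ht => ?_)
    (Finset.inter_subset_inter_right (timeOf_anti hsub))
  rw [Finset.mem_inter] at ht ⊢
  refine ⟨timeOf_anti (fun e he => upTo_subset _ _ (mem_lowerStar.1 he).1) ?_, ht.2⟩
  rw [htX]
  simp only [mem_timeOf] at ht ⊢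
  refine ⟨ht.1.1, fun e he => ?_⟩
  rcases mem_candBase.1 he with h | h
  · exact ht.2.2 e h.1
  · exact ht.1.2 e h

end Kid

theorem _root_.List.exists_map_eq_of_forall {α β : Type*} {P : α → Prop} {f : α → β}
    (l : List β) (h : ∀ b ∈ l, ∃ a, f a = b ∧ P a) : ∃ l', List.map f l' = l ∧ ∀ a ∈ l', P a := by
  induction l with
  | nil => exact ⟨[], rfl, by simp⟩
  | cons b l ih =>
    obtain ⟨l', h1, h2⟩ := ih fun c hc => h c (List.mem_cons_of_mem _ hc)
    obtain ⟨a, h3, h4⟩ := h b (by simp)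
    refine ⟨a :: l', by rw [List.map_cons, h1, h3], ?_⟩
    rintro c hc
    rcases List.mem_cons.1 hc with rfl | hc
    · exact h4
    · exact h2 c hc

open Classical in
/-- `EnumChildren(K)` outputs, in any order and each once, the children `K'` of `K` whose part
below `i(K')` is nonempty. -/
theorem enumChildren_iff {K : S.Edges} (hK : S.ClosedActive K) {cs : List S.Edges} :
    S.EnumChildren K cs ↔ cs.Nodup ∧
      ∀ K', K' ∈ cs ↔ S.IsKid K K' ∧ (S.upTo K' (S.idx K' - 1)).Nonempty := by
  constructor
  · rintro ⟨ps, hnd, hps, rfl⟩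
    constructor
    · refine List.Nodup.map_on ?_ (hnd.filter _)
      rintro ⟨v, F⟩ h1 ⟨v', F'⟩ h2 heq
      rw [List.mem_filter, hps, decide_eq_true_eq] at h1 h2
      obtain ⟨_, a2, _, a4⟩ := isKid_of_accepts hK h1.1 h1.2
      obtain ⟨_, b2, _, b4⟩ := isKid_of_accepts hK h2.1 h2.2
      simp only at heq
      rw [heq] at a2 a4
      have : v = v' := lbl_inj.1 (a2.trans b2.symm)
      subst this
      rw [a4, ← b4]
    · intro K'
      simp only [List.mem_map, List.mem_filter, hps, decide_eq_true_eq]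
      constructor
      · rintro ⟨⟨v, F⟩, ⟨h1, h2⟩, rfl⟩
        obtain ⟨a1, _, a3, _⟩ := isKid_of_accepts hK h1 h2
        exact ⟨a1, a3⟩
      · rintro ⟨h1, h2⟩
        obtain ⟨v, hv⟩ := exists_idx_vertex h1.1 h1.2.1
        exact ⟨(v, lowerStar K' v), ⟨isCandidate_lowerStar h1 hv h2, accepts_lowerStar h1 hv h2⟩,
          cand_lowerStar h1 hv⟩
  · rintro ⟨hnd, hcs⟩
    obtain ⟨ps, rfl, hps⟩ := List.exists_map_eq_of_forall (P := fun p => S.IsCandidate K p ∧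
        S.Accepts K p) (f := fun p => S.cand K p.1 p.2) cs fun K' h => by
      obtain ⟨h1, h2⟩ := (hcs K').1 h
      obtain ⟨v, hv⟩ := exists_idx_vertex h1.1 h1.2.1
      exact ⟨(v, lowerStar K' v), cand_lowerStar h1 hv, isCandidate_lowerStar h1 hv h2,
        accepts_lowerStar h1 hv h2⟩
    have hall : ∀ p, S.IsCandidate K p → S.Accepts K p → p ∈ ps := by
      rintro ⟨v, F⟩ h1 h2
      obtain ⟨a1, a2, a3, a4⟩ := isKid_of_accepts hK h1 h2
      obtain ⟨⟨v', F'⟩, hp, heq⟩ := List.mem_map.1 ((hcs _).2 ⟨a1, a3⟩)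
      obtain ⟨b1, b2, b3, b4⟩ := isKid_of_accepts hK (hps _ hp).1 (hps _ hp).2
      simp only at heq
      rw [heq] at b2 b4
      have : v' = v := lbl_inj.1 (b2.trans a2.symm)
      subst this
      rwa [a4, ← b4]
    -- The rejected candidates go to the end of the loop. They output nothing, so every ordering of
    -- the accepted ones is realized.
    set rest := (Finset.univ.filter fun p : Fin S.n × S.Edges =>
      S.IsCandidate K p ∧ ¬ S.Accepts K p).toList with hrest
    refine ⟨ps ++ rest, ?_, ?_, ?_⟩
    · refine List.Nodup.append hnd.of_map (Finset.nodup_toList _) ?_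
      intro p h1 h2
      rw [hrest, Finset.mem_toList, Finset.mem_filter] at h2
      exact h2.2.2 (hps p h1).2
    · intro p
      rw [List.mem_append, hrest, Finset.mem_toList, Finset.mem_filter]
      constructor
      · rintro (h | h)
        · exact (hps p h).1
        · exact h.2.1
      · intro h
        by_cases ha : S.Accepts K p
        · exact Or.inl (hall p h ha)
        · exact Or.inr ⟨Finset.mem_univ _, h, ha⟩
    · rw [List.filter_append, List.filter_eq_self.2, List.filter_eq_nil_iff.2, List.append_nil]
      · intro p hp
        rw [hrest, Finset.mem_toList, Finset.mem_filter] at hp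
        simpa using hp.2.2
      · intro p hp
        simpa using (hps p hp).2

theorem isClique_singleton {e : Sym2 (Fin S.n)} (he : e ∈ S.G.edgeSet) : S.IsClique {e} := by
  refine ⟨by simpa using he, fun u hu v hv huv => ?_⟩
  simp only [mem_verts, Finset.mem_singleton, exists_eq_left] at hu hv
  rw [Finset.mem_singleton]
  exact ((Sym2.mem_and_mem_iff huv).1 ⟨hu, hv⟩).symm

theorem timeOf_singleton {e : Sym2 (Fin S.n)} (he : e ∈ S.G.edgeSet) : S.timeOf {e} = S.τ e := by
  ext t
  rw [mem_timeOf]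
  simp only [Finset.mem_singleton, forall_eq]
  exact ⟨fun h => h.2, fun h => ⟨by simpa using S.τ_subset e he h, h⟩⟩

theorem closedActive_X_singleton {e : Sym2 (Fin S.n)} (he : e ∈ S.G.edgeSet) :
    S.ClosedActive (S.X {e}) :=
  closedActive_X (isClique_singleton he) (by rw [timeOf_singleton he]; exact S.τ_nonempty e he)

/-- Let `e = s(u, v)` with `u < v`. The edge `e` already generates the clique, so its index is at
most `v`. An edge strictly below the index would have both endpoints below `v`; then it, or the edge
from `u` to its smaller endpoint, would precede `e`. -/
theorem isKid_of_acceptsEdge {e : Sym2 (Fin S.n)} (he : e ∈ S.G.edgeSet)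
    (ha : S.AcceptsEdge e) :
    S.IsKid S.root (S.X {e}) ∧ S.upTo (S.X {e}) (S.idx (S.X {e}) - 1) = ∅ := by
  have hCA := closedActive_X_singleton he
  obtain ⟨hr, hmem, hmin⟩ := ha
  suffices h : S.upTo (S.X {e}) (S.idx (S.X {e}) - 1) = ∅ by
    refine ⟨⟨hCA, hr, ?_⟩, h⟩
    rw [parent, h]
    rfl
  induction e with
  | _ u v =>
    wlog huv : u < v generalizing u v
    · rw [Sym2.eq_swap] at he hCA hr hmem hmin ⊢
      exact this v u he hCA hr hmem hmin (lt_of_le_of_ne (not_lt.1 huv) (hCA.1.ne hmem))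
    have hle : S.idx (S.X {s(u, v)}) ≤ lbl v := by
      refine idx_le_of_X (X_mid (isClique_singleton he) (hCA.1.upTo _) ?_ (upTo_subset _ _))
      rw [Finset.singleton_subset_iff, mem_upTo_mk, lbl_le_lbl, lbl_le_lbl]
      exact ⟨hmem, huv.le, le_rfl⟩
    generalize S.X {s(u, v)} = K at *
    rw [Finset.eq_empty_iff_forall_notMem]
    intro d hd
    induction d with
    | _ a b =>
      wlog hab : a < b generalizing a b
      · refine this b a (by rwa [Sym2.eq_swap]) ?_
        exact lt_of_le_of_ne (not_lt.1 hab) (hCA.1.ne (upTo_subset _ _ hd)).symm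
      rw [mem_upTo_mk] at hd
      have hv := lbl_pos b
      have hbv : b < v := lbl_lt_lbl.1 (by omega)
      have h1 := hmin _ hd.1
      rw [edgeLT_mk hab huv, not_or, not_and] at h1
      rcases lt_or_eq_of_le (not_lt.1 h1.1) with h2 | h2
      · have h3 := hmin _ (hCA.1.2 u (left_mem_verts hmem) a (left_mem_verts hd.1) h2.ne)
        rw [edgeLT_mk h2 huv] at h3
        exact h3 (Or.inr ⟨rfl, hab.trans hbv⟩)
      · exact h1.2 h2.symm hbv

theorem exists_acceptsEdge {K : S.Edges} (hK : S.ClosedActive K) (hr : K ≠ S.root)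
    (h : S.upTo K (S.idx K - 1) = ∅) :
    ∃ e ∈ S.G.edgeSet, S.AcceptsEdge e ∧ S.X {e} = K := by
  obtain ⟨e, he, hmin⟩ := upTo_idx_eq_singleton hK hr h
  have hX : S.X {e} = K := by rw [← he, X_upTo_idx hK]
  have hmem : e ∈ K := by
    have : e ∈ S.upTo K (S.idx K) := by rw [he]; exact Finset.mem_singleton_self e
    exact upTo_subset _ _ this
  refine ⟨e, hK.1.1 e hmem, ?_, hX⟩
  rw [AcceptsEdge, hX]
  exact ⟨hr, hmem, hmin⟩

theorem edgeChildren_kids {cs : List S.Edges} (h : S.EdgeChildren cs) :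
    cs.Nodup ∧ ∀ K', K' ∈ cs ↔ S.IsKid S.root K' ∧ S.upTo K' (S.idx K' - 1) = ∅ := by
  classical
  obtain ⟨es, hnd, hes, rfl⟩ := h
  constructor
  · refine List.Nodup.map_on ?_ (hnd.filter _)
    intro e h1 e' h2 heq
    rw [List.mem_filter, hes, decide_eq_true_eq] at h1 h2
    obtain ⟨_, _, a1, a2⟩ := h1
    obtain ⟨_, _, b1, b2⟩ := h2
    rw [heq] at a1 a2
    have c1 := a2 _ b1
    have c2 := b2 _ a1
    rw [edgeLT_iff] at c1 c2
    exact edgeKey_inj (le_antisymm (not_lt.1 c1) (not_lt.1 c2))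
  · intro K'
    simp only [List.mem_map, List.mem_filter, hes, decide_eq_true_eq]
    constructor
    · rintro ⟨e, ⟨h1, h2⟩, rfl⟩
      exact isKid_of_acceptsEdge h1 h2
    · rintro ⟨⟨h1, h2, _⟩, h3⟩
      obtain ⟨e, he, ha, hX⟩ := exists_acceptsEdge h1 h2 h3
      exact ⟨e, ⟨he, ha⟩, hX⟩

/-- The two loops split the children by whether the part below the index is empty. An empty part
forces the parent to be `X ∅`, so away from the root the second kind does not occur. -/
theorem recCalls_kids {K : S.Edges} (hK : S.ClosedActive K) {cs : List S.Edges}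
    (h : S.RecCalls K cs) : cs.Nodup ∧ ∀ K', K' ∈ cs ↔ S.IsKid K K' := by
  obtain ⟨as, bs, has, rfl, hbs⟩ := h
  rw [enumChildren_iff hK] at has
  split_ifs at hbs with hr
  · subst hr
    have hb := edgeChildren_kids hbs
    constructor
    · refine List.Nodup.append has.1 hb.1 fun K' h1 h2 => ?_
      rw [has.2] at h1
      rw [hb.2] at h2
      exact h1.2.ne_empty h2.2
    · intro K'
      rw [List.mem_append, has.2, hb.2, ← and_or_left, and_iff_left_iff_imp]
      exact fun _ => (Finset.eq_empty_or_nonempty _).symm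
  · subst hbs
    rw [List.append_nil]
    refine ⟨has.1, fun K' => ?_⟩
    rw [has.2, and_iff_left_iff_imp]
    intro hk
    by_contra hc
    rw [Finset.not_nonempty_iff_eq_empty] at hc
    refine hr ?_
    rw [← hk.2.2, parent, hc]
    rfl

open Classical in
theorem exists_recCalls {K : S.Edges} (hK : S.ClosedActive K) : ∃ cs, S.RecCalls K cs := by
  have h1 : ∃ as, S.EnumChildren K as := by
    refine ⟨(Finset.univ.filter fun K' => S.IsKid K K' ∧
      (S.upTo K' (S.idx K' - 1)).Nonempty).toList, ?_⟩
    rw [enumChildren_iff hK]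
    exact ⟨Finset.nodup_toList _, fun K' => by simp⟩
  have h2 : ∃ bs, S.EdgeChildren bs := by
    refine ⟨_, (Finset.univ.filter fun e => e ∈ S.G.edgeSet).toList, Finset.nodup_toList _,
      fun e => by simp, rfl⟩
  obtain ⟨as, has⟩ := h1
  obtain ⟨bs, hbs⟩ := h2
  refine ⟨as ++ if K = S.root then bs else [], as, _, has, rfl, ?_⟩
  split_ifs
  · exact hbs
  · rfl

/-! ## Correctness of the recursion -/

/-- The parent relation on the family tree, from the child to the parent. -/
def ParentStep (K' K : S.Edges) : Prop := S.IsKid K K'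

theorem parentStep_rightUnique : Relator.RightUnique (ParentStep (S := S)) :=
  fun _ _ _ h h' => h.2.2.symm.trans h'.2.2

theorem idx_le_of_reflTransGen {K K' : S.Edges} (h : Relation.ReflTransGen ParentStep K' K) :
    S.idx K ≤ S.idx K' := by
  induction h with
  | refl => exact le_rfl
  | tail _ h ih =>
    have := idx_parent_lt h.1 h.2.1
    rw [h.2.2] at this
    omega

/-- A path from `a` to a different node `b` passes through the parent `K`, whose index is smaller
than that of `b`, although indices do not increase along parent steps. -/
theorem not_reflTransGen_sibling {K a b : S.Edges} (ha : S.IsKid K a) (hb : S.IsKid K b)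
    (hne : a ≠ b) : ¬ Relation.ReflTransGen ParentStep a b := by
  intro h
  rcases h.cases_head with h | ⟨c, hc, h⟩
  · exact hne h
  · have : c = K := parentStep_rightUnique hc ha
    subst this
    have h1 := idx_le_of_reflTransGen h
    have h2 := idx_parent_lt hb.1 hb.2.1
    rw [hb.2.2] at h2
    omega

/-- Simultaneous induction over calls and lists of sibling calls. The outputs of two siblings are
disjoint, since two ancestors of one clique are comparable and siblings are not. -/
theorem call_spec {K : S.Edges} {out : List S.Edges} (h : Call S K out) :
    S.ClosedActive K → out.Nodup ∧ ∀ K', K' ∈ out ↔ Relation.ReflTransGen ParentStep K' K := by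
  refine Call.rec (S := S)
    (motive_1 := fun K out _ => S.ClosedActive K → out.Nodup ∧
      ∀ K', K' ∈ out ↔ Relation.ReflTransGen ParentStep K' K)
    (motive_2 := fun cs out _ => ∀ K, cs.Nodup → (∀ c ∈ cs, S.IsKid K c) → out.Nodup ∧
      ∀ K', K' ∈ out ↔ ∃ c ∈ cs, Relation.ReflTransGen ParentStep K' c) ?_ ?_ ?_ h
  · intro K cs out hrec _ ih hK
    obtain ⟨hnd, hcs⟩ := recCalls_kids hK hrec
    obtain ⟨h1, h2⟩ := ih K hnd fun c hc => (hcs c).1 hc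
    constructor
    · rw [List.nodup_cons]
      refine ⟨fun hc => ?_, h1⟩
      obtain ⟨c, hc, hK'⟩ := (h2 K).1 hc
      have a1 := idx_le_of_reflTransGen hK'
      have a2 := (hcs c).1 hc
      have a3 := idx_parent_lt a2.1 a2.2.1
      rw [a2.2.2] at a3
      omega
    · intro K'
      rw [List.mem_cons, h2, Relation.ReflTransGen.cases_tail_iff]
      refine or_congr ⟨Eq.symm, Eq.symm⟩ ⟨?_, ?_⟩
      · rintro ⟨c, hc, h⟩
        exact ⟨c, h, (hcs c).1 hc⟩
      · rintro ⟨c, h, hc⟩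
        exact ⟨c, (hcs c).2 hc, h⟩
  · intro K _ _
    exact ⟨List.nodup_nil, by simp⟩
  · intro c cs out out' _ _ ih ih' K hnd hcs
    rw [List.nodup_cons] at hnd
    have hc := hcs c (by simp)
    obtain ⟨h1, h2⟩ := ih hc.1
    obtain ⟨h1', h2'⟩ := ih' K hnd.2 fun c hc => hcs c (List.mem_cons_of_mem _ hc)
    constructor
    · refine h1.append h1' fun K' ha hb => ?_
      obtain ⟨d, hd, hKd⟩ := (h2' K').1 hb
      have hKc := (h2 K').1 ha
      have hdk := hcs d (List.mem_cons_of_mem _ hd)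
      have hne : c ≠ d := fun h => hnd.1 (h ▸ hd)
      rcases Relation.ReflTransGen.total_of_right_unique parentStep_rightUnique hKc hKd with h | h
      · exact not_reflTransGen_sibling hc hdk hne h
      · exact not_reflTransGen_sibling hdk hc hne.symm h
    · intro K'
      rw [List.mem_append, h2, h2']
      simp

theorem exists_calls {cs : List S.Edges} (h : ∀ c ∈ cs, ∃ out, Call S c out) :
    ∃ out, Calls S cs out := by
  induction cs with
  | nil => exact ⟨[], Calls.nil⟩
  | cons c cs ih =>
    obtain ⟨out, ho⟩ := h c (by simp)
    obtain ⟨out', ho'⟩ := ih fun c hc => h c (List.mem_cons_of_mem _ hc)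
    exact ⟨_, Calls.cons c cs out out' ho ho'⟩

/-- The recursion terminates because the index strictly increases towards the children and is
bounded by `n`. -/
theorem exists_call (K : S.Edges) (hK : S.ClosedActive K) : ∃ out, Call S K out := by
  induction hk : S.n - S.idx K using Nat.strong_induction_on generalizing K with
  | _ k ih =>
    obtain ⟨cs, hcs⟩ := exists_recCalls hK
    have hkids := (recCalls_kids hK hcs).2
    obtain ⟨out, ho⟩ := exists_calls (cs := cs) fun c hc => by
      have h1 := (hkids c).1 hc
      have h2 := idx_parent_lt h1.1 h1.2.1
      rw [h1.2.2] at h2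
      have h3 := idx_le h1.1
      exact ih _ (by omega) c h1.1 rfl
    exact ⟨_, Call.mk K cs out hcs ho⟩

theorem reflTransGen_root (K : S.Edges) (hK : S.ClosedActive K) :
    Relation.ReflTransGen ParentStep K S.root := by
  induction hk : S.idx K using Nat.strong_induction_on generalizing K with
  | _ k ih =>
    by_cases hr : K = S.root
    · rw [hr]
    · have := idx_parent_lt hK hr
      exact Relation.ReflTransGen.head ⟨hK, hr, rfl⟩
        (ih _ (by omega) _ (closedActive_parent hK) rfl)

theorem closedActive_of_reflTransGen {K K' : S.Edges} (hK : S.ClosedActive K)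
    (h : Relation.ReflTransGen ParentStep K' K) : S.ClosedActive K' := by
  rcases h.cases_head with h | ⟨c, hc, _⟩
  · rwa [h]
  · exact hc.1

theorem enumClosedActiveClique_spec {Ks : List S.Edges} (h : S.EnumClosedActiveClique Ks) :
    Ks.Nodup ∧ ∀ K, K ∈ Ks ↔ S.ClosedActive K := by
  obtain ⟨h1, h2⟩ := call_spec h closedActive_root
  refine ⟨h1, fun K => ?_⟩
  rw [h2]
  exact ⟨closedActive_of_reflTransGen closedActive_root, reflTransGen_root K⟩

theorem length_eq_numClosedActive {Ks : List S.Edges} (h : S.EnumClosedActiveClique Ks) :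
    Ks.length = S.numClosedActive := by
  classical
  obtain ⟨h1, h2⟩ := enumClosedActiveClique_spec h
  have : {K : S.Edges | S.ClosedActive K} = (Ks.toFinset : Set S.Edges) := by
    ext K
    simp [h2]
  rw [numClosedActive, this, Set.ncard_coe_finset, List.toFinset_card_of_nodup h1]

end GraphSeq

namespace RAM

/-! ## Weakest preconditions with running times -/

namespace State

def setR (σ : State) (x v : ℕ) : State := { σ with reg := Function.update σ.reg x v }

def setM (σ : State) (a i v : ℕ) : State :=
  { σ with mem := Function.update σ.mem a (Function.update (σ.mem a) i v) }

def push (σ : State) (v : ℕ) : State := { σ with out := σ.out ++ [v] }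

@[simp] theorem setR_reg (σ : State) (x v y : ℕ) :
    (σ.setR x v).reg y = if y = x then v else σ.reg y := Function.update_apply ..

@[simp] theorem setR_mem (σ : State) (x v : ℕ) : (σ.setR x v).mem = σ.mem := rfl

@[simp] theorem setR_out (σ : State) (x v : ℕ) : (σ.setR x v).out = σ.out := rfl

@[simp] theorem setM_reg (σ : State) (a i v : ℕ) : (σ.setM a i v).reg = σ.reg := rfl

@[simp] theorem setM_mem (σ : State) (a i v b : ℕ) :
    (σ.setM a i v).mem b = if b = a then Function.update (σ.mem a) i v else σ.mem b :=
  Function.update_apply ..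

@[simp] theorem setM_out (σ : State) (a i v : ℕ) : (σ.setM a i v).out = σ.out := rfl

@[simp] theorem push_reg (σ : State) (v : ℕ) : (σ.push v).reg = σ.reg := rfl

@[simp] theorem push_mem (σ : State) (v : ℕ) : (σ.push v).mem = σ.mem := rfl

@[simp] theorem push_out (σ : State) (v : ℕ) : (σ.push v).out = σ.out ++ [v] := rfl

end State

namespace Cmd

/-- `c` may assign register `x`. -/
def modR : Cmd → ℕ → Bool
  | skip, _ => false
  | assign y _, x => y == x
  | put _ _ _, _ => false
  | emit _, _ => false
  | seq c d, x => c.modR x || d.modR x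
  | ite _ c d, x => c.modR x || d.modR x
  | loop _ c, x => c.modR x

/-- `c` may write into array `a`. -/
def modM : Cmd → ℕ → Bool
  | skip, _ => false
  | assign _ _, _ => false
  | put b _ _, a => b == a
  | emit _, _ => false
  | seq c d, a => c.modM a || d.modM a
  | ite _ c d, a => c.modM a || d.modM a
  | loop _ c, a => c.modM a

/-- `c` may write to the output. -/
def emits : Cmd → Bool
  | skip => false
  | assign _ _ => false
  | put _ _ _ => false
  | emit _ => true
  | seq c d => c.emits || d.emits
  | ite _ c d => c.emits || d.emits
  | loop _ c => c.emits

end Cmd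

/-- The parts of the state that `c` does not write are the same in `σ` and `σ'`. -/
structure Frame (c : Cmd) (σ σ' : State) : Prop where
  reg : ∀ x, c.modR x = false → σ'.reg x = σ.reg x
  mem : ∀ a, c.modM a = false → σ'.mem a = σ.mem a
  out : c.emits = false → σ'.out = σ.out

namespace Frame

variable {c d : Cmd} {σ σ' σ'' : State}

theorem refl (c : Cmd) (σ : State) : Frame c σ σ := ⟨fun _ _ => rfl, fun _ _ => rfl, fun _ => rfl⟩

theorem trans (h : Frame c σ σ') (h' : Frame c σ' σ'') : Frame c σ σ'' :=
  ⟨fun x hx => (h'.reg x hx).trans (h.reg x hx), fun a ha => (h'.mem a ha).trans (h.mem a ha),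
    fun ho => (h'.out ho).trans (h.out ho)⟩

theorem weaken (h : Frame c σ σ') (h1 : ∀ x, d.modR x = false → c.modR x = false)
    (h2 : ∀ a, d.modM a = false → c.modM a = false) (h3 : d.emits = false → c.emits = false) :
    Frame d σ σ' :=
  ⟨fun x hx => h.reg x (h1 x hx), fun a ha => h.mem a (h2 a ha), fun ho => h.out (h3 ho)⟩

end Frame

variable {L W : ℕ}

theorem Exec.frame {c : Cmd} {σ σ' : State} {t : ℕ} (h : Exec L W c σ σ' t) : Frame c σ σ' := by
  induction h with
  | skip σ => exact Frame.refl _ _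
  | assign σ x e _ =>
    refine ⟨fun y hy => ?_, fun _ _ => rfl, fun _ => rfl⟩
    simp only [Cmd.modR, beq_eq_false_iff_ne] at hy
    exact Function.update_of_ne hy.symm _ _
  | put σ a i e _ _ _ =>
    refine ⟨fun _ _ => rfl, fun b hb => ?_, fun _ => rfl⟩
    simp only [Cmd.modM, beq_eq_false_iff_ne] at hb
    exact Function.update_of_ne hb.symm _ _
  | emit σ e _ => exact ⟨fun _ _ => rfl, fun _ _ => rfl, fun h => by simp [Cmd.emits] at h⟩
  | seq σ σ' σ'' c d t t' _ _ ih ih' =>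
    refine (ih.weaken ?_ ?_ ?_).trans (ih'.weaken ?_ ?_ ?_) <;>
      simp +contextual [Cmd.modR, Cmd.modM, Cmd.emits]
  | ite_true σ σ' e c d t _ _ _ ih =>
    refine ih.weaken ?_ ?_ ?_ <;> simp +contextual [Cmd.modR, Cmd.modM, Cmd.emits]
  | ite_false σ σ' e c d t _ _ _ ih =>
    refine ih.weaken ?_ ?_ ?_ <;> simp +contextual [Cmd.modR, Cmd.modM, Cmd.emits]
  | loop_true σ σ' σ'' e c t t' _ _ _ _ ih ih' =>
    exact (ih.weaken (d := .loop e c) (fun _ h => h) (fun _ h => h) fun h => h).trans ih'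
  | loop_false σ e c _ _ => exact Frame.refl _ _

/-- `c` started in `σ` halts, and its final state and its running time satisfy `Q`. -/
def Wp (L W : ℕ) (c : Cmd) (σ : State) (Q : State → ℕ → Prop) : Prop :=
  ∃ σ' t, Exec L W c σ σ' t ∧ Q σ' t

namespace Wp

variable {c d : Cmd} {e : Exp} {σ : State} {Q Q' : State → ℕ → Prop}

/-- The frame is handed to the consequent, so that specifications need only mention what changes;
everything else is carried over from the set of written registers and arrays. -/
theorem mono (h : Wp L W c σ Q') (hQ : ∀ σ' t, Frame c σ σ' → Q' σ' t → Q σ' t) :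
    Wp L W c σ Q := by
  obtain ⟨σ', t, hx, hq⟩ := h
  exact ⟨σ', t, hx, hQ σ' t hx.frame hq⟩

theorem skip_iff : Wp L W Cmd.skip σ Q ↔ Q σ 1 := by
  constructor
  · rintro ⟨σ', t, h, hq⟩
    cases h
    exact hq
  · exact fun h => ⟨_, _, Exec.skip σ, h⟩

theorem assign_iff {x : ℕ} :
    Wp L W (Cmd.assign x e) σ Q ↔ e.Fits L W σ ∧ Q (σ.setR x (e.eval σ)) (e.size + 1) := by
  constructor
  · rintro ⟨σ', t, h, hq⟩
    cases h with
    | assign _ _ _ hf => exact ⟨hf, hq⟩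
  · exact fun h => ⟨_, _, Exec.assign σ x e h.1, h.2⟩

theorem put_iff {a : ℕ} {i : Exp} :
    Wp L W (Cmd.put a i e) σ Q ↔ i.Fits L W σ ∧ i.eval σ < L ∧ e.Fits L W σ ∧
      Q (σ.setM a (i.eval σ) (e.eval σ)) (i.size + e.size + 1) := by
  constructor
  · rintro ⟨σ', t, h, hq⟩
    cases h with
    | put _ _ _ _ h1 h2 h3 => exact ⟨h1, h2, h3, hq⟩
  · exact fun h => ⟨_, _, Exec.put σ a i e h.1 h.2.1 h.2.2.1, h.2.2.2⟩

theorem emit_iff :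
    Wp L W (Cmd.emit e) σ Q ↔ e.Fits L W σ ∧ Q (σ.push (e.eval σ)) (e.size + 1) := by
  constructor
  · rintro ⟨σ', t, h, hq⟩
    cases h with
    | emit _ _ hf => exact ⟨hf, hq⟩
  · exact fun h => ⟨_, _, Exec.emit σ e h.1, h.2⟩

theorem seq_iff : Wp L W (Cmd.seq c d) σ Q ↔
    Wp L W c σ fun σ' t => Wp L W d σ' fun σ'' t' => Q σ'' (t + t') := by
  constructor
  · rintro ⟨σ', t, h, hq⟩
    cases h with
    | seq _ σ1 _ _ _ t1 t2 h1 h2 => exact ⟨_, _, h1, _, _, h2, hq⟩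
  · rintro ⟨σ1, t1, h1, σ2, t2, h2, hq⟩
    exact ⟨_, _, Exec.seq _ _ _ _ _ _ _ h1 h2, hq⟩

theorem ite_iff : Wp L W (Cmd.ite e c d) σ Q ↔ e.Fits L W σ ∧
    ((e.eval σ ≠ 0 → Wp L W c σ fun σ' t => Q σ' (e.size + 1 + t)) ∧
      (e.eval σ = 0 → Wp L W d σ fun σ' t => Q σ' (e.size + 1 + t))) := by
  constructor
  · rintro ⟨σ', t, h, hq⟩
    cases h with
    | ite_true _ _ _ _ _ t h1 h2 h3 =>
      exact ⟨h1, fun _ => ⟨_, _, h3, hq⟩, fun h => absurd h h2⟩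
    | ite_false _ _ _ _ _ t h1 h2 h3 =>
      exact ⟨h1, fun h => absurd h2 h, fun _ => ⟨_, _, h3, hq⟩⟩
  · rintro ⟨h1, h2, h3⟩
    by_cases h : e.eval σ = 0
    · obtain ⟨σ', t, hx, hq⟩ := h3 h
      exact ⟨_, _, Exec.ite_false _ _ _ _ _ _ h1 h hx, hq⟩
    · obtain ⟨σ', t, hx, hq⟩ := h2 h
      exact ⟨_, _, Exec.ite_true _ _ _ _ _ _ h1 h hx, hq⟩

/-- Loops with an invariant and a potential that bounds the remaining running time. -/
theorem loop (Inv : State → Prop) (Φ : State → ℕ) (h0 : Inv σ)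
    (hfit : ∀ τ, Frame c σ τ → Inv τ → e.Fits L W τ)
    (hbody : ∀ τ, Frame c σ τ → Inv τ → e.eval τ ≠ 0 →
      Wp L W c τ fun τ' t => Inv τ' ∧ t + e.size + 1 + Φ τ' ≤ Φ τ)
    (hQ : ∀ τ t, Frame c σ τ → Inv τ → e.eval τ = 0 → t + Φ τ ≤ Φ σ + e.size + 1 → Q τ t) :
    Wp L W (Cmd.loop e c) σ Q := by
  have key : ∀ k τ, Φ τ = k → Frame c σ τ → Inv τ → ∃ τ' t, Exec L W (Cmd.loop e c) τ τ' t ∧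
      Frame c σ τ' ∧ Inv τ' ∧ e.eval τ' = 0 ∧ t + Φ τ' ≤ Φ τ + e.size + 1 := by
    intro k
    induction k using Nat.strong_induction_on with
    | _ k ih =>
      intro τ hk hfr hinv
      by_cases he : e.eval τ = 0
      · exact ⟨τ, _, Exec.loop_false τ e c (hfit τ hfr hinv) he, hfr, hinv, he, by omega⟩
      · obtain ⟨τ1, t1, hx1, hinv1, ht1⟩ := hbody τ hfr hinv he
        obtain ⟨τ2, t2, hx2, hfr2, hinv2, he2, ht2⟩ :=
          ih (Φ τ1) (by omega) τ1 rfl (hfr.trans hx1.frame) hinv1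
        exact ⟨τ2, _, Exec.loop_true _ _ _ _ _ _ _ (hfit τ hfr hinv) he hx1 hx2, hfr2, hinv2, he2,
          by omega⟩
  obtain ⟨τ, t, hx, hfr, hinv, he, ht⟩ := key _ σ rfl (Frame.refl c σ) h0
  exact ⟨τ, t, hx, hQ τ t hfr hinv he ht⟩

end Wp

/-- `for p = lo, …, hi - 1 do body`. -/
def forR (p : ℕ) (lo hi : Exp) (body : Cmd) : Cmd :=
  .seq (.assign p lo)
    (.loop (.sub hi (.var p)) (.seq body (.assign p (.add (.var p) (.lit 1)))))

/-- Counting loops, with an invariant and an amortized running time. -/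
theorem Wp.forR {p : ℕ} {lo hi : Exp} {body : Cmd} {σ : State} {Q : State → ℕ → Prop}
    (a b T : ℕ) (Inv : ℕ → State → Prop) (Ψ : ℕ → State → ℕ)
    (hp : body.modR p = false) (hlo : lo.Fits L W σ) (hloe : lo.eval σ = a) (hab : a ≤ b)
    (hb : b + 1 ≤ W)
    (hhi : ∀ τ, Frame (RAM.forR p lo hi body) σ τ → hi.Fits L W τ ∧ hi.eval τ = b)
    (h0 : Inv a (σ.setR p a))
    (hbody : ∀ τ i, a ≤ i → i < b → Frame (RAM.forR p lo hi body) σ τ → τ.reg p = i → Inv i τ →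
      Wp L W body τ fun τ' t => Inv (i + 1) (τ'.setR p (i + 1)) ∧
        t + Ψ (i + 1) (τ'.setR p (i + 1)) ≤ Ψ i τ + T)
    (hQ : ∀ τ t, Frame (RAM.forR p lo hi body) σ τ → Inv b τ →
      t + Ψ b τ ≤ (T + hi.size + 7) * (b - a) + Ψ a (σ.setR p a) + lo.size + hi.size + 4 → Q τ t) :
    Wp L W (RAM.forR p lo hi body) σ Q := by
  rw [RAM.forR, Wp.seq_iff, Wp.assign_iff]
  refine ⟨hlo, ?_⟩
  have hfr : ∀ τ, Frame (.seq body (.assign p (.add (.var p) (.lit 1)))) (σ.setR p (lo.eval σ)) τ →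
      Frame (RAM.forR p lo hi body) σ τ := by
    intro τ h
    refine ⟨fun x hx => ?_, fun a ha => ?_, fun ho => ?_⟩
    · simp only [RAM.forR, Cmd.modR, Bool.or_eq_false_iff, beq_eq_false_iff_ne] at hx
      have := h.reg x (by simp [Cmd.modR, hx])
      rw [this, State.setR_reg, if_neg (Ne.symm hx.1)]
    · have := h.mem a (by simpa [RAM.forR, Cmd.modM] using ha)
      rw [this, State.setR_mem]
    · have := h.out (by simpa [RAM.forR, Cmd.emits] using ho)
      rw [this, State.setR_out]
  rw [hloe] at hfr ⊢
  -- A round costs, beyond the body, four steps for the increment and `hi.size + 3` for evaluating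
  -- the guard; this is the summand `hi.size + 7`.
  refine Wp.loop (fun τ => a ≤ τ.reg p ∧ τ.reg p ≤ b ∧ Inv (τ.reg p) τ)
    (fun τ => (T + hi.size + 7) * (b - τ.reg p) + Ψ (τ.reg p) τ) ⟨by simp, by simpa using hab, by simpa using h0⟩ ?_ ?_ ?_
  · intro τ h1 h2
    have h3 := hhi τ (hfr τ h1)
    exact ⟨h3.1, (by omega : τ.reg p ≤ W)⟩
  · intro τ h1 ⟨h2, h3, h4⟩ h5
    simp only [Exp.eval, (hhi τ (hfr τ h1)).2] at h5
    rw [Wp.seq_iff]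
    refine (hbody τ _ h2 (by omega) (hfr τ h1) rfl h4).mono fun τ' t hf' ⟨h6, h7⟩ => ?_
    have h8 := hf'.reg p hp
    have he : (Exp.add (.var p) (.lit 1)).eval τ' = τ.reg p + 1 := by simp [Exp.eval, h8]
    rw [Wp.assign_iff, he]
    refine ⟨⟨by simp [Exp.Fits, h8]; omega, (by omega : 1 ≤ W), by simp [Exp.eval, h8]; omega⟩, ?_⟩
    have h9 : (τ'.setR p (τ.reg p + 1)).reg p = τ.reg p + 1 := by simp
    rw [h9]
    refine ⟨⟨by omega, by omega, h6⟩, ?_⟩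
    have h10 : b - τ.reg p = (b - (τ.reg p + 1)) + 1 := by omega
    rw [h10, Nat.mul_add]
    simp only [Exp.size]
    omega
  · intro τ t h1 ⟨h2, h3, h4⟩ h5 h6
    simp only [Exp.eval, (hhi τ (hfr τ h1)).2] at h5
    have h7 : τ.reg p = b := by omega
    rw [h7] at h4 h6
    refine hQ τ _ (hfr τ h1) h4 ?_
    simp only [Exp.size, Nat.sub_self, Nat.mul_zero, State.setR_reg, if_true] at h6
    omega

end RAM

/-! ## The arrays of an encoded graph sequence -/

/-- Numbers and arrays of the shape of an encoded graph sequence: `n` vertices, `m` edges, time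
stamps up to `T`, and for the edge of number `j` its endpoints `eu j`, `ev j` and the bounds `lo j`,
`hi j` of its interval; the edges incident to `v` are `inc p` for `st v ≤ p < st (v + 1)`. -/
structure Net where
  n : ℕ
  m : ℕ
  T : ℕ
  eu : ℕ → ℕ
  ev : ℕ → ℕ
  lo : ℕ → ℕ
  hi : ℕ → ℕ
  st : ℕ → ℕ
  inc : ℕ → ℕ

namespace Net

variable (I : Net)

/-- The endpoint other than `v` of the edge of number `j`. -/
def oth (j v : ℕ) : ℕ := I.eu j + I.ev j - v

def deg (v : ℕ) : ℕ := I.st (v + 1) - I.st v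

/-- `u` and `w` are joined by an edge whose interval includes `[a, b]`. -/
def H (a b u w : ℕ) : Prop :=
  ∃ j < I.m, ((I.eu j = u ∧ I.ev j = w) ∨ (I.eu j = w ∧ I.ev j = u)) ∧ I.lo j ≤ a ∧ b ≤ I.hi j

/-- `B` is a set of vertices that are pairwise joined by edges active throughout `[a, b]`. -/
def Cliq (a b : ℕ) (B : Finset ℕ) : Prop :=
  (∀ u ∈ B, 1 ≤ u ∧ u ≤ I.n) ∧ ∀ u ∈ B, ∀ w ∈ B, u ≠ w → I.H a b u w

/-- The arrays represent a graph, the sum of the degrees of the vertices of a clique is at most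
`R`, and the degrees are at most `D`. -/
structure Good (R D : ℕ) : Prop where
  T_pos : 1 ≤ I.T
  R_pos : 1 ≤ R
  D_pos : 1 ≤ D
  edge : ∀ j < I.m, 1 ≤ I.eu j ∧ I.eu j < I.ev j ∧ I.ev j ≤ I.n ∧ 1 ≤ I.lo j ∧
    I.lo j ≤ I.hi j ∧ I.hi j ≤ I.T
  simple : ∀ i < I.m, ∀ j < I.m, I.eu i = I.eu j → I.ev i = I.ev j → i = j
  st_mono : ∀ v, 1 ≤ v → v ≤ I.n → I.st v ≤ I.st (v + 1)
  st_le : ∀ v, 1 ≤ v → v ≤ I.n + 1 → I.st v ≤ 2 * I.m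
  inc_spec : ∀ v p, 1 ≤ v → v ≤ I.n → I.st v ≤ p → p < I.st (v + 1) →
    I.inc p < I.m ∧ (I.eu (I.inc p) = v ∨ I.ev (I.inc p) = v)
  inc_inj : ∀ v p q, 1 ≤ v → v ≤ I.n → I.st v ≤ p → p < I.st (v + 1) → I.st v ≤ q →
    q < I.st (v + 1) → I.inc p = I.inc q → p = q
  inc_surj : ∀ v j, j < I.m → (I.eu j = v ∨ I.ev j = v) →
    ∃ p, I.st v ≤ p ∧ p < I.st (v + 1) ∧ I.inc p = j
  deg_le : ∀ v, 1 ≤ v → v ≤ I.n → I.deg v ≤ D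
  sum_deg_le : ∀ a b B, I.Cliq a b B → ∑ v ∈ B, I.deg v ≤ R

/-- `t` is a time stamp at which all edges within `B` are active iff `tl ≤ t ≤ tr`. -/
def TimeIs (B : Finset ℕ) (tl tr : ℕ) : Prop :=
  ∀ t, (tl ≤ t ∧ t ≤ tr) ↔ (1 ≤ t ∧ t ≤ I.T) ∧
    ∀ j < I.m, I.eu j ∈ B → I.ev j ∈ B → I.lo j ≤ t ∧ t ≤ I.hi j

/-- The edge in cell `p` of the incidence array joins `w` to `z` and is active throughout
`[a, b]`, for some `p` with `st w ≤ p < i`. -/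
def Reach (a b w i z : ℕ) : Prop :=
  ∃ p, I.st w ≤ p ∧ p < i ∧ I.oth (I.inc p) w = z ∧ I.lo (I.inc p) ≤ a ∧ b ≤ I.hi (I.inc p)

open Classical in
/-- The number of neighbors of `z` in `B`. -/
noncomputable def nbrs (a b : ℕ) (B : Finset ℕ) (z : ℕ) : ℕ := (B.filter fun u => I.H a b u z).card

variable {I} {R D : ℕ}

theorem H.symm {a b u w : ℕ} (h : I.H a b u w) : I.H a b w u := by
  obtain ⟨j, hj, h1, h2⟩ := h
  exact ⟨j, hj, h1.symm, h2⟩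

theorem H.mono {a b a' b' u w : ℕ} (h : I.H a b u w) (ha : a ≤ a') (hb : b' ≤ b) :
    I.H a' b' u w := by
  obtain ⟨j, hj, h1, h2, h3⟩ := h
  exact ⟨j, hj, h1, h2.trans ha, hb.trans h3⟩

namespace Good

theorem H_ne (hI : I.Good R D) {a b u w : ℕ} (h : I.H a b u w) : u ≠ w := by
  obtain ⟨j, hj, h1, _⟩ := h
  have := hI.edge j hj
  omega

theorem H_range (hI : I.Good R D) {a b u w : ℕ} (h : I.H a b u w) : (1 ≤ u ∧ u ≤ I.n) ∧ 1 ≤ w ∧ w ≤ I.n := by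
  obtain ⟨j, hj, h1, _⟩ := h
  have := hI.edge j hj
  omega

theorem seg (hI : I.Good R D) {w p : ℕ} (h1 : 1 ≤ w) (h2 : w ≤ I.n) (h3 : I.st w ≤ p) (h4 : p < I.st (w + 1)) :
    I.inc p < I.m ∧ 1 ≤ I.oth (I.inc p) w ∧ I.oth (I.inc p) w ≤ I.n ∧ I.oth (I.inc p) w ≠ w ∧
      ((I.eu (I.inc p) = w ∧ I.ev (I.inc p) = I.oth (I.inc p) w) ∨
        (I.eu (I.inc p) = I.oth (I.inc p) w ∧ I.ev (I.inc p) = w)) := by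
  obtain ⟨h5, h6⟩ := hI.inc_spec w p h1 h2 h3 h4
  have := hI.edge _ h5
  refine ⟨h5, ?_⟩
  unfold oth
  omega

theorem seg_inj (hI : I.Good R D) {w p q : ℕ} (h1 : 1 ≤ w) (h2 : w ≤ I.n) (h3 : I.st w ≤ p)
    (h4 : p < I.st (w + 1)) (h5 : I.st w ≤ q) (h6 : q < I.st (w + 1))
    (h : I.oth (I.inc p) w = I.oth (I.inc q) w) : p = q := by
  obtain ⟨a1, a2, a3, a4, a5⟩ := hI.seg h1 h2 h3 h4
  obtain ⟨b1, b2, b3, b4, b5⟩ := hI.seg h1 h2 h5 h6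
  have e1 := hI.edge _ a1
  have e2 := hI.edge _ b1
  refine hI.inc_inj w p q h1 h2 h3 h4 h5 h6 (hI.simple _ a1 _ b1 ?_ ?_) <;> omega

/-- Every edge between `w` and `z` is found in the segment of `w`. -/
theorem exists_seg (hI : I.Good R D) {j w z : ℕ} (hj : j < I.m)
    (h : (I.eu j = w ∧ I.ev j = z) ∨ (I.eu j = z ∧ I.ev j = w)) :
    ∃ p, I.st w ≤ p ∧ p < I.st (w + 1) ∧ I.inc p = j ∧ I.oth (I.inc p) w = z := by
  obtain ⟨p, h1, h2, h3⟩ := hI.inc_surj w j hj (by omega)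
  refine ⟨p, h1, h2, h3, ?_⟩
  rw [h3, oth]
  omega

theorem H_iff_reach (hI : I.Good R D) {a b w z : ℕ} (h1 : 1 ≤ w) (h2 : w ≤ I.n) :
    I.H a b w z ↔ I.Reach a b w (I.st (w + 1)) z := by
  constructor
  · rintro ⟨j, hj, h, h3, h4⟩
    obtain ⟨p, h5, h6, rfl, h7⟩ := hI.exists_seg hj h
    exact ⟨p, h5, h6, h7, h3, h4⟩
  · rintro ⟨p, h3, h4, h5, h6, h7⟩
    obtain ⟨a1, _, _, _, a5⟩ := hI.seg h1 h2 h3 h4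
    rw [h5] at a5
    exact ⟨_, a1, a5, h6, h7⟩

/-- In a simple graph the positions of one segment have different other endpoints. A scan therefore
raises the counter of any neighbor at most once. -/
theorem not_reach (hI : I.Good R D) {a b w p : ℕ} (h1 : 1 ≤ w) (h2 : w ≤ I.n) (h3 : I.st w ≤ p)
    (h4 : p < I.st (w + 1)) : ¬ I.Reach a b w p (I.oth (I.inc p) w) := by
  rintro ⟨q, h5, h6, h7, _⟩
  have := hI.seg_inj h1 h2 h5 (h6.trans h4) h3 h4 h7
  omega

end Good

theorem reach_succ {a b w p z : ℕ} (h : I.st w ≤ p) : I.Reach a b w (p + 1) z ↔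
    I.Reach a b w p z ∨ (I.oth (I.inc p) w = z ∧ I.lo (I.inc p) ≤ a ∧ b ≤ I.hi (I.inc p)) := by
  constructor
  · rintro ⟨q, h1, h2, h3⟩
    rcases Nat.lt_succ_iff_lt_or_eq.1 h2 with h4 | rfl
    · exact Or.inl ⟨q, h1, h4, h3⟩
    · exact Or.inr h3
  · rintro (⟨q, h1, h2, h3⟩ | h3)
    · exact ⟨q, h1, h2.trans (Nat.lt_succ_self p), h3⟩
    · exact ⟨p, h, Nat.lt_succ_self p, h3⟩

theorem not_reach_start {a b w z : ℕ} : ¬ I.Reach a b w (I.st w) z := by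
  rintro ⟨q, h1, h2, _⟩
  omega

theorem nbrs_le {a b : ℕ} {B : Finset ℕ} {z : ℕ} : I.nbrs a b B z ≤ B.card := by
  classical
  exact Finset.card_filter_le _ _

open Classical in
theorem nbrs_insert {a b w : ℕ} {B : Finset ℕ} (hw : w ∉ B) (z : ℕ) :
    I.nbrs a b (insert w B) z = I.nbrs a b B z + if I.H a b w z then 1 else 0 := by
  unfold nbrs
  rw [Finset.filter_insert]
  split_ifs with h
  · rw [Finset.card_insert_of_notMem fun hc => hw (Finset.mem_filter.1 hc).1]
  · rfl

open Classical in
-- This turns the question whether `z` is joined to the whole clique into one comparison of a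
-- counter with the size of the clique.
theorem nbrs_eq_card_iff {a b : ℕ} {B : Finset ℕ} {z : ℕ} :
    I.nbrs a b B z = B.card ↔ ∀ u ∈ B, I.H a b u z := by
  unfold nbrs
  rw [← Finset.filter_eq_self]
  constructor
  · intro h
    exact Finset.eq_of_subset_of_card_le (Finset.filter_subset _ _) h.ge
  · intro h
    rw [h]

theorem Cliq.insert {a b w : ℕ} {B : Finset ℕ} (hB : I.Cliq a b B) (hw : 1 ≤ w ∧ w ≤ I.n)
    (h : ∀ u ∈ B, I.H a b u w) : I.Cliq a b (insert w B) := by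
  constructor
  · intro u hu
    rcases Finset.mem_insert.1 hu with rfl | hu
    · exact hw
    · exact hB.1 u hu
  · intro u hu x hx hux
    rcases Finset.mem_insert.1 hu with hu | hu <;> rcases Finset.mem_insert.1 hx with hx | hx
    · exact absurd (hu.trans hx.symm) hux
    · exact hu ▸ (h x hx).symm
    · exact hx ▸ h u hu
    · exact hB.2 u hu x hx hux

theorem Cliq.subset {a b : ℕ} {A B : Finset ℕ} (hB : I.Cliq a b B) (h : A ⊆ B) : I.Cliq a b A :=
  ⟨fun u hu => hB.1 u (h hu), fun u hu w hw => hB.2 u (h hu) w (h hw)⟩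

theorem Cliq.mono {a b a' b' : ℕ} {B : Finset ℕ} (hB : I.Cliq a b B) (ha : a ≤ a')
    (hb : b' ≤ b) : I.Cliq a' b' B :=
  ⟨hB.1, fun u hu w hw h => (hB.2 u hu w hw h).mono ha hb⟩

theorem Cliq.card_le {a b : ℕ} {B : Finset ℕ} (hB : I.Cliq a b B) : B.card ≤ I.n := by
  have : B ⊆ Finset.Icc 1 I.n := fun u hu => Finset.mem_Icc.2 (hB.1 u hu)
  simpa using Finset.card_le_card this

theorem Good.deg_pos (hI : I.Good R D) {a b u w : ℕ} (h : I.H a b u w) : 1 ≤ I.deg u := by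
  obtain ⟨j, hj, h1, _⟩ := h
  obtain ⟨p, h2, h3, _⟩ := hI.exists_seg hj h1
  unfold deg
  omega

/-- In a clique with at least two vertices every degree is positive, so the degree sum dominates the
size. -/
theorem Good.card_le (hI : I.Good R D) {a b : ℕ} {B : Finset ℕ} (hB : I.Cliq a b B) :
    B.card ≤ R := by
  rcases Nat.lt_or_ge 1 B.card with h | h
  · refine le_trans ?_ (hI.sum_deg_le a b B hB)
    rw [Finset.card_eq_sum_ones]
    refine Finset.sum_le_sum fun u hu => ?_
    obtain ⟨w, hw, hne⟩ := Finset.exists_mem_ne h u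
    exact hI.deg_pos (hB.2 u hu w hw hne.symm)
  · exact h.trans hI.R_pos

theorem Good.deg_le_R (hI : I.Good R D) {a b : ℕ} {B : Finset ℕ} (hB : I.Cliq a b B) {u : ℕ}
    (hu : u ∈ B) : I.deg u ≤ R :=
  (Finset.single_le_sum (f := I.deg) (fun _ _ => Nat.zero_le _) hu).trans
    (hI.sum_deg_le a b B hB)

variable (I) in
/-- `B` is the clique obtained from `A` by adding, in increasing order, every vertex that is joined
to all vertices present by edges active throughout `[a, b]`. -/
def Greedy (a b : ℕ) (A B : Finset ℕ) : Prop :=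
  A ⊆ B ∧ I.Cliq a b B ∧ ∀ w ∉ B, 1 ≤ w → w ≤ I.n → ∃ z ∈ B, ¬ I.H a b z w ∧ (z ∈ A ∨ z < w)

end Net

-- Machine states holding a network and a current clique

namespace RAM

/-- The parameters of the machine suffice for the network `I`. -/
structure Ctx (I : Net) (L W R D : ℕ) : Prop where
  good : I.Good R D
  L_n : I.n + 2 ≤ L
  L_m : 2 * I.m + 1 ≤ L
  W_le : 4 * (I.m * I.m) + 4 * I.m + 2 * I.n + I.T + 10 ≤ W

/-- The input registers and arrays hold the network `I`. -/
structure Env (I : Net) (σ : State) : Prop where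
  r0 : σ.reg 0 = I.n
  r1 : σ.reg 1 = I.m
  r2 : σ.reg 2 = I.T
  m0 : σ.mem 0 = I.eu
  m1 : σ.mem 1 = I.ev
  m2 : σ.mem 2 = I.lo
  m3 : σ.mem 3 = I.hi
  m4 : σ.mem 4 = I.st
  m5 : σ.mem 5 = I.inc

/-- `c` does not write to the input registers and arrays. -/
def Cmd.safe (c : Cmd) : Bool :=
  !c.modR 0 && !c.modR 1 && !c.modR 2 && !c.modM 0 && !c.modM 1 && !c.modM 2 && !c.modM 3 &&
    !c.modM 4 && !c.modM 5

theorem Env.frame {I : Net} {c : Cmd} {σ σ' : State} (h : Env I σ) (hf : Frame c σ σ')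
    (hs : c.safe = true) : Env I σ' := by
  simp only [Cmd.safe, Bool.and_eq_true, Bool.not_eq_true'] at hs
  obtain ⟨⟨⟨⟨⟨⟨⟨⟨h0, h1⟩, h2⟩, h3⟩, h4⟩, h5⟩, h6⟩, h7⟩, h8⟩ := hs
  exact ⟨(hf.reg 0 h0).trans h.r0, (hf.reg 1 h1).trans h.r1, (hf.reg 2 h2).trans h.r2,
    (hf.mem 0 h3).trans h.m0, (hf.mem 1 h4).trans h.m1, (hf.mem 2 h5).trans h.m2,
    (hf.mem 3 h6).trans h.m3, (hf.mem 4 h7).trans h.m4, (hf.mem 5 h8).trans h.m5⟩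

/-- The first `k` cells of an array list the set `B` without repetitions. -/
def Lists (f : ℕ → ℕ) (k : ℕ) (B : Finset ℕ) : Prop := B.card = k ∧ (Finset.range k).image f = B

/-- The current clique `B` (register 3, array 7), the numbers of neighbors in `B` (array 8), the
membership in `B` (array 9) and the active times of `B` (registers 6 and 7). -/
structure Rep (I : Net) (a b : ℕ) (B : Finset ℕ) (σ : State) : Prop where
  lists : Lists (σ.mem 7) (σ.reg 3) B
  cnt : ∀ z, σ.mem 8 z = I.nbrs a b B z
  mark : ∀ z, σ.mem 9 z = if z ∈ B then 1 else 0
  cliq : I.Cliq a b B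
  time : I.TimeIs B (σ.reg 6) (σ.reg 7)
  le6 : σ.reg 6 ≤ I.T
  le7 : σ.reg 7 ≤ I.T

theorem Lists.mem {f : ℕ → ℕ} {k : ℕ} {B : Finset ℕ} (h : Lists f k B) {i : ℕ} (hi : i < k) :
    f i ∈ B := h.2 ▸ Finset.mem_image_of_mem f (Finset.mem_range.2 hi)

theorem Lists.exists {f : ℕ → ℕ} {k : ℕ} {B : Finset ℕ} (h : Lists f k B) {z : ℕ} (hz : z ∈ B) :
    ∃ i < k, f i = z := by
  rw [← h.2] at hz
  simpa using hz

theorem Lists.injOn {f : ℕ → ℕ} {k : ℕ} {B : Finset ℕ} (h : Lists f k B) :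
    Set.InjOn f (Finset.range k) := by
  rw [← Finset.card_image_iff, h.2, h.1, Finset.card_range]

theorem Lists.insert {f : ℕ → ℕ} {k : ℕ} {B : Finset ℕ} (h : Lists f k B) {w : ℕ} (hw : w ∉ B) :
    Lists (Function.update f k w) (k + 1) (insert w B) := by
  refine ⟨by rw [Finset.card_insert_of_notMem hw, h.1], ?_⟩
  rw [Finset.range_add_one, Finset.image_insert, Function.update_self]
  congr 1
  rw [← h.2]
  refine Finset.image_congr fun i hi => ?_
  have : i < k := by simpa using hi
  exact Function.update_of_ne this.ne _ _

theorem Lists.sum_eq {f : ℕ → ℕ} {k : ℕ} {B : Finset ℕ} (h : Lists f k B) (g : ℕ → ℕ) :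
    ∑ i ∈ Finset.range k, g (f i) = ∑ z ∈ B, g z := by
  rw [← h.2, Finset.sum_image h.injOn]

theorem Lists.congr {f g : ℕ → ℕ} {k : ℕ} {B : Finset ℕ} (h : Lists f k B)
    (hg : ∀ i < k, g i = f i) : Lists g k B :=
  ⟨h.1, by rw [← h.2]; exact Finset.image_congr fun i hi => hg i (by simpa using hi)⟩

/-- The sum of the degrees of the vertices of the current clique. -/
def dsum (I : Net) (σ : State) : ℕ := ∑ i ∈ Finset.range (σ.reg 3), I.deg (σ.mem 7 i)

theorem Rep.dsum_eq {I : Net} {a b : ℕ} {B : Finset ℕ} {σ : State} (h : Rep I a b B σ) :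
    dsum I σ = ∑ z ∈ B, I.deg z := h.lists.sum_eq I.deg

theorem Env.setR {I : Net} {σ : State} (h : Env I σ) {x : ℕ} (v : ℕ) (hx : 3 ≤ x) :
    Env I (σ.setR x v) :=
  ⟨by simpa [show (0 : ℕ) ≠ x by omega] using h.r0, by simpa [show 1 ≠ x by omega] using h.r1,
    by simpa [show 2 ≠ x by omega] using h.r2, h.m0, h.m1, h.m2, h.m3, h.m4, h.m5⟩

theorem Rep.congr {I : Net} {a b : ℕ} {B : Finset ℕ} {σ σ' : State} (h : Rep I a b B σ)
    (h3 : σ'.reg 3 = σ.reg 3) (h6 : σ'.reg 6 = σ.reg 6) (h7 : σ'.reg 7 = σ.reg 7)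
    (m7 : σ'.mem 7 = σ.mem 7) (m8 : σ'.mem 8 = σ.mem 8) (m9 : σ'.mem 9 = σ.mem 9) :
    Rep I a b B σ' :=
  ⟨by rw [h3, m7]; exact h.lists, by rw [m8]; exact h.cnt, by rw [m9]; exact h.mark, h.cliq,
    by rw [h6, h7]; exact h.time, by rw [h6]; exact h.le6, by rw [h7]; exact h.le7⟩

theorem Rep.setR {I : Net} {a b : ℕ} {B : Finset ℕ} {σ : State} (h : Rep I a b B σ) {x : ℕ}
    (v : ℕ) (hx : 8 ≤ x) : Rep I a b B (σ.setR x v) :=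
  h.congr (by simp; omega) (by simp; omega) (by simp; omega) rfl rfl rfl

theorem Rep.frame {I : Net} {a b : ℕ} {B : Finset ℕ} {c : Cmd} {σ σ' : State}
    (h : Rep I a b B σ) (hf : Frame c σ σ') (h3 : c.modR 3 = false) (h6 : c.modR 6 = false)
    (h7 : c.modR 7 = false) (m7 : c.modM 7 = false) (m8 : c.modM 8 = false)
    (m9 : c.modM 9 = false) : Rep I a b B σ' :=
  h.congr (hf.reg 3 h3) (hf.reg 6 h6) (hf.reg 7 h7) (hf.mem 7 m7) (hf.mem 8 m8) (hf.mem 9 m9)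

/-- There is no current clique. -/
structure Clear (I : Net) (σ : State) : Prop where
  r3 : σ.reg 3 = 0
  r6 : σ.reg 6 = 1
  r7 : σ.reg 7 = I.T
  m8 : ∀ z, σ.mem 8 z = 0
  m9 : ∀ z, σ.mem 9 z = 0

/-- The empty clique fits every window `[a, b]`, so a cleared state can start a closure in any
window. -/
theorem Clear.rep {I : Net} {σ : State} (h : Clear I σ) (hT : 1 ≤ I.T) (a b : ℕ) :
    Rep I a b ∅ σ where
  lists := by simp [Lists, h.r3]
  cnt z := by simp [h.m8, Net.nbrs]
  mark z := by simp [h.m9]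
  cliq := by simp [Net.Cliq]
  time t := by simp [h.r6, h.r7]
  le6 := by rw [h.r6]; exact hT
  le7 := by rw [h.r7]

/-- Scan the edges incident to the vertex in register `u`. -/
def forSeg (p u : ℕ) (body : Cmd) : Cmd :=
  forR p (.get 4 (.var u)) (.get 4 (.add (.var u) (.lit 1)))
    (.seq (.assign 10 (.get 5 (.var p)))
      (.seq (.assign 11 (.sub (.add (.get 0 (.var 10)) (.get 1 (.var 10))) (.var u))) body))

/-- The body finds the edge number in register 10 and the other endpoint in register 11. The cost is
linear in the degree of the scanned vertex; as degree sums over a clique are at most `R`, scans of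
all its vertices stay within `O(R)`. -/
theorem Wp.forSeg {I : Net} {L W R D : ℕ} (hC : Ctx I L W R D) {p u : ℕ} {body : Cmd} {σ : State}
    {Q : State → ℕ → Prop} (v T : ℕ) (Inv : ℕ → State → Prop) (hE : Env I σ)
    (hu : σ.reg u = v) (h1 : 1 ≤ v) (h2 : v ≤ I.n)
    (hup : p ≠ u ∧ p ≠ 10 ∧ p ≠ 11 ∧ u ≠ 10 ∧ u ≠ 11)
    (hs : (RAM.forSeg p u body).safe = true)
    (hp : body.modR p = false) (hbu : body.modR u = false)
    (h0 : Inv (I.st v) (σ.setR p (I.st v)))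
    (hbody : ∀ τ i, I.st v ≤ i → i < I.st (v + 1) → Frame (RAM.forSeg p u body) σ τ →
      τ.reg p = i → τ.reg u = v → Env I τ → Inv i τ →
      Wp L W body ((τ.setR 10 (I.inc i)).setR 11 (I.oth (I.inc i) v))
        fun τ' t => Inv (i + 1) (τ'.setR p (i + 1)) ∧ t ≤ T)
    (hQ : ∀ τ t, Frame (RAM.forSeg p u body) σ τ → Env I τ → Inv (I.st (v + 1)) τ →
      t ≤ (T + 24) * I.deg v + 12 → Q τ t) :
    Wp L W (RAM.forSeg p u body) σ Q := by
  have hLn := hC.L_n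
  have hLm := hC.L_m
  have hW := hC.W_le
  have hst := hC.good.st_le (v + 1) (by omega) (by omega)
  have hst' := hC.good.st_le v h1 (by omega)
  have hmod : (RAM.forSeg p u body).modR u = false := by
    simp [RAM.forSeg, RAM.forR, Cmd.modR, hup, hbu, hup.2.2.2.1.symm, hup.2.2.2.2.symm]
  refine Wp.forR (I.st v) (I.st (v + 1)) (T + 12) Inv (fun _ _ => 0)
    (by simp [Cmd.modR, hp, hup.2.1.symm, hup.2.2.1.symm]) ?_ ?_ (hC.good.st_mono v h1 h2) (by omega) ?_ h0 ?_ ?_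
  · simp only [Exp.Fits, Exp.eval, hu, hE.m4]
    omega
  · simp only [Exp.eval, hu, hE.m4]
  · intro τ hf
    have hE' := hE.frame hf hs
    have hu' := (hf.reg u hmod).trans hu
    simp only [Exp.Fits, Exp.eval, hu', hE'.m4, and_true]
    omega
  · intro τ i hi1 hi2 hf hpi hinv
    have hE' := hE.frame hf hs
    have hu' := (hf.reg u hmod).trans hu
    obtain ⟨a1, a2, a3, a4, a5⟩ := hC.good.seg h1 h2 hi1 hi2
    have he := hC.good.edge _ a1
    simp only [Wp.seq_iff, Wp.assign_iff, Exp.Fits, Exp.eval, State.setR_reg, State.setR_mem, hpi,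
      hE'.m5, hE'.m0, hE'.m1, if_true, hu', if_neg hup.2.2.2.1, Exp.size]
    refine ⟨by omega, by omega, ?_⟩
    refine (hbody τ i hi1 hi2 hf hpi hu' hE' hinv).mono fun τ' t _ ⟨b1, b2⟩ => ⟨b1, ?_⟩
    omega
  · intro τ t hf hinv ht
    refine hQ τ t hf (hE.frame hf hs) hinv (ht.trans ?_)
    simp only [Exp.size, Net.deg]
    have : T + 12 + (1 + 1 + 1 + 1) + 7 ≤ T + 24 := by omega
    have := Nat.mul_le_mul_right (I.st (v + 1) - I.st v) this
    omega

end RAM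

-- Adding a vertex to the current clique

namespace RAM

/-- Append the vertex in register 8 to the current clique. -/
def addV : Cmd :=
  .seq (.put 7 (.var 3) (.var 8))
    (.seq (forSeg 9 8
      (.ite (.add (.sub (.get 2 (.var 10)) (.var 4)) (.sub (.var 5) (.get 3 (.var 10)))) .skip
        (.seq (.put 8 (.var 11) (.add (.get 8 (.var 11)) (.lit 1)))
          (.ite (.get 9 (.var 11))
            (.seq (.assign 6 (.add (.var 6) (.sub (.get 2 (.var 10)) (.var 6))))
              (.assign 7 (.sub (.var 7) (.sub (.var 7) (.get 3 (.var 10))))))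
            .skip))))
      (.seq (.put 9 (.var 8) (.lit 1)) (.assign 3 (.add (.var 3) (.lit 1)))))

variable {I : Net} {L W R D : ℕ}

open Classical in
-- One scan of the edges at `w` raises the neighbor counters over edges that span the window, and
-- intersects the current times with those of the edges that lead into `B`. All edges of the
-- enlarged clique that were not inside `B` are met in this scan.
theorem addV_spec (hC : Ctx I L W R D) {σ : State} {a b w : ℕ} {B : Finset ℕ} (hE : Env I σ)
    (ha : σ.reg 4 = a) (hb : σ.reg 5 = b) (haT : a ≤ I.T) (hbT : b ≤ I.T) (hR : Rep I a b B σ)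
    (hw : σ.reg 8 = w) (hw1 : 1 ≤ w ∧ w ≤ I.n) (hwB : w ∉ B) (hH : ∀ u ∈ B, I.H a b u w) :
    Wp L W addV σ fun σ' t => Rep I a b (insert w B) σ' ∧ σ'.mem 7 (σ.reg 3) = w ∧
      t ≤ 60 * I.deg w + 30 := by
  have hLn := hC.L_n
  have hLm := hC.L_m
  have hW := hC.W_le
  have hk : σ.reg 3 ≤ I.n := hR.lists.1 ▸ hR.cliq.card_le
  rw [addV, Wp.seq_iff, Wp.put_iff]
  simp only [Exp.Fits, Exp.eval, hw, Exp.size]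
  refine ⟨by omega, by omega, by omega, ?_⟩
  rw [Wp.seq_iff]
  refine Wp.forSeg hC w 36 (fun i τ => (∀ z, τ.mem 8 z = I.nbrs a b B z +
      if I.Reach a b w i z then 1 else 0) ∧ τ.reg 6 ≤ I.T ∧ τ.reg 7 ≤ I.T ∧
      ∀ t, (τ.reg 6 ≤ t ∧ t ≤ τ.reg 7) ↔ (σ.reg 6 ≤ t ∧ t ≤ σ.reg 7) ∧
        ∀ p, I.st w ≤ p → p < i → I.oth (I.inc p) w ∈ B →
          I.lo (I.inc p) ≤ t ∧ t ≤ I.hi (I.inc p))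
    ⟨hE.r0, hE.r1, hE.r2, hE.m0, hE.m1, hE.m2, hE.m3, hE.m4, hE.m5⟩ hw hw1.1 hw1.2
    (by decide) rfl rfl rfl ?_ ?_ ?_
  · refine ⟨fun z => ?_, by simpa using hR.le6, by simpa using hR.le7, fun t => ?_⟩
    · rw [if_neg Net.not_reach_start]
      simpa using hR.cnt z
    · simp only [State.setR_reg, State.setM_reg]
      refine ⟨fun h => ⟨h, fun p h1 h2 => absurd h2 (by omega)⟩, fun h => h.1⟩
  · intro τ i hi1 hi2 hf hpi hui hEτ ⟨h8, h6, h7, ht⟩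
    obtain ⟨a1, a2, a3, a4, a5⟩ := hC.good.seg hw1.1 hw1.2 hi1 hi2
    have he := hC.good.edge _ a1
    have r4 : τ.reg 4 = a := (hf.reg 4 rfl).trans ha
    have r5 : τ.reg 5 = b := (hf.reg 5 rfl).trans hb
    have m9 : τ.mem 9 = σ.mem 9 := hf.mem 9 rfl
    have hnz := I.nbrs_le (a := a) (b := b) (B := B) (z := I.oth (I.inc i) w)
    have hBn := hR.cliq.card_le
    have c8 := h8 (I.oth (I.inc i) w)
    rw [if_neg (hC.good.not_reach hw1.1 hw1.2 hi1 hi2)] at c8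
    have hpi' : ∀ p, I.st w ≤ p → p < i + 1 → p < i ∨ p = i := fun p _ h => by omega
    have c9 := hR.mark (I.oth (I.inc i) w)
    have c9' : σ.mem 9 (I.oth (I.inc i) w) ≤ 1 := by rw [c9]; split_ifs <;> omega
    simp only [Wp.ite_iff, Wp.seq_iff, Wp.put_iff, Wp.assign_iff, Wp.skip_iff, Exp.Fits, Exp.eval,
      Exp.size, State.setR_reg, State.setR_mem, State.setM_reg, State.setM_mem, r4, r5, hEτ.m2,
      hEτ.m3, m9, if_true, Nat.reduceEqDiff, if_false, ne_eq, c8]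
    refine ⟨by omega, fun hne => ⟨⟨?_, h6, h7, ?_⟩, by omega⟩, fun h0 => ⟨by omega, by omega, by omega, by omega, fun hne => ?_, fun h0' => ?_⟩⟩
    · intro z
      rw [h8 z, Net.reach_succ hi1]
      congr 2
      rw [eq_iff_iff, iff_self_or]
      intro h
      omega
    · intro t
      rw [ht t]
      refine and_congr_right fun _ => ⟨fun h p h1 h2 h3 => ?_, fun h p h1 h2 h3 => h p h1 (by omega) h3⟩
      rcases hpi' p h1 h2 with h4 | rfl
      · exact h p h1 h4 h3
      -- An edge skipped by the scan does not span the window. It cannot lead into `B`: some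
      -- spanning edge does so by hypothesis, and the graph is simple.
      · have : I.H a b (I.oth (I.inc p) w) w := hH _ h3
        obtain ⟨q, q1, q2, q3, q4⟩ := (hC.good.H_iff_reach hw1.1 hw1.2).1 this.symm
        have := hC.good.seg_inj hw1.1 hw1.2 q1 q2 hi1 hi2 q3
        subst this
        omega
    all_goals
      have hreach : ∀ z, (Function.update (τ.mem 8) (I.oth (I.inc i) w)
          (I.nbrs a b B (I.oth (I.inc i) w) + 0 + 1)) z =
          I.nbrs a b B z + if I.Reach a b w (i + 1) z then 1 else 0 := by
        intro z
        rw [Function.update_apply]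
        split_ifs with h1 h2 h2
        · rw [h1]
        · refine absurd ?_ h2
          rw [Net.reach_succ hi1, h1]
          exact Or.inr ⟨rfl, by omega, by omega⟩
        · rw [h8 z, if_pos]
          rw [Net.reach_succ hi1] at h2
          exact h2.resolve_right fun h => h1 h.1.symm
        · rw [h8 z, if_neg]
          exact fun h => h2 ((Net.reach_succ hi1).2 (Or.inl h))
    · have hB : I.oth (I.inc i) w ∈ B := by
        by_contra hc
        rw [if_neg hc] at c9
        exact hne c9
      refine ⟨⟨by omega, by omega⟩, ?_, ⟨hreach, by omega, by omega, fun t => ?_⟩, by omega⟩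
      · omega
      · have := ht t
        constructor
        · intro h
          have h1 := this.1 (by omega)
          refine ⟨h1.1, fun p p1 p2 p3 => ?_⟩
          rcases hpi' p p1 p2 with h4 | rfl
          · exact h1.2 p p1 h4 p3
          · omega
        · intro h
          have h1 := this.2 ⟨h.1, fun p p1 p2 p3 => h.2 p p1 (by omega) p3⟩
          have h2 := h.2 i hi1 (by omega) hB
          omega
    · have hB : I.oth (I.inc i) w ∉ B := by
        intro hc
        rw [if_pos hc, h0'] at c9
        omega
      refine ⟨⟨hreach, h6, h7, fun t => ?_⟩, by omega⟩
      rw [ht t]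
      refine and_congr_right fun _ => ⟨fun h p h1 h2 h3 => ?_, fun h p h1 h2 h3 => h p h1 (by omega) h3⟩
      rcases hpi' p h1 h2 with h4 | rfl
      · exact h p h1 h4 h3
      · exact absurd h3 hB
  · intro τ t hf hEτ ⟨h8, h6, h7, ht⟩ htm
    have r3 : τ.reg 3 = σ.reg 3 := hf.reg 3 rfl
    have r8 : τ.reg 8 = w := (hf.reg 8 rfl).trans hw
    have m7 : τ.mem 7 = Function.update (σ.mem 7) (σ.reg 3) w := by
      rw [hf.mem 7 rfl]
      simp
    have m9 : τ.mem 9 = σ.mem 9 := hf.mem 9 rfl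
    simp only [Wp.seq_iff, Wp.put_iff, Wp.assign_iff, Exp.Fits, Exp.eval, Exp.size, State.setM_reg,
      r3, r8]
    refine ⟨by omega, by omega, by omega, by omega, ⟨?_, ?_, ?_, hR.cliq.insert hw1 hH, ?_, h6, h7⟩, ?_, ?_⟩
    · simp only [State.setR_mem, State.setM_mem, State.setR_reg, if_true, Nat.reduceEqDiff, if_false, m7]
      exact hR.lists.insert hwB
    · intro z
      simp only [State.setR_mem, State.setM_mem, Nat.reduceEqDiff, if_false]
      rw [h8 z, Net.nbrs_insert hwB]
      simp only [hC.good.H_iff_reach hw1.1 hw1.2]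
    · intro z
      simp only [State.setR_mem, State.setM_mem, if_true, m9, Function.update_apply, hR.mark,
        Finset.mem_insert]
      split_ifs <;> simp_all
    · intro t
      simp only [State.setR_reg, State.setM_reg, Nat.reduceEqDiff, if_false]
      rw [ht t, hR.time t, and_assoc]
      refine and_congr_right fun _ => ?_
      constructor
      · rintro ⟨h1, h2⟩ j hj h3 h4
        have := hC.good.edge j hj
        rcases Finset.mem_insert.1 h3 with h3 | h3 <;> rcases Finset.mem_insert.1 h4 with h4 | h4
        · omega
        · obtain ⟨p, p1, p2, rfl, p4⟩ := hC.good.exists_seg hj (Or.inl ⟨h3, rfl⟩)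
          exact h2 p p1 p2 (p4 ▸ h4)
        · obtain ⟨p, p1, p2, rfl, p4⟩ := hC.good.exists_seg hj (Or.inr ⟨rfl, h4⟩)
          exact h2 p p1 p2 (p4 ▸ h3)
        · exact h1 j hj h3 h4
      · refine fun h => ⟨fun j hj h1 h2 => h j hj (Finset.mem_insert_of_mem h1) (Finset.mem_insert_of_mem h2), fun p p1 p2 p3 => ?_⟩
        obtain ⟨a1, a2, a3, a4, a5⟩ := hC.good.seg hw1.1 hw1.2 p1 p2
        rcases a5 with a5 | a5
        · exact h _ a1 (by rw [a5.1]; simp) (by rw [a5.2]; simp [p3])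
        · exact h _ a1 (by rw [a5.1]; simp [p3]) (by rw [a5.2]; simp)
    · simp [m7]
    · omega

end RAM

-- Clearing, copying and filling the current clique

namespace RAM

variable {I : Net} {L W R D : ℕ}

/-- Remove the current clique. -/
def reset : Cmd :=
  .seq (forR 12 (.lit 0) (.var 3)
    (.seq (.assign 15 (.get 7 (.var 12)))
      (.seq (.put 9 (.var 15) (.lit 0)) (forSeg 9 15 (.put 8 (.var 11) (.lit 0))))))
    (.seq (.assign 3 (.lit 0)) (.seq (.assign 6 (.lit 1)) (.assign 7 (.var 2))))

/-- A nonzero counter belongs to a neighbor of a listed vertex, so clearing along the segments of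
these vertices suffices and costs `O(R)`, independently of `n`. The potential is a multiple of the
degree sum of the vertices still to be treated. -/
theorem reset_spec (hC : Ctx I L W R D) {σ : State} {a b : ℕ} {B : Finset ℕ} (hE : Env I σ)
    (hR : Rep I a b B σ) :
    Wp L W reset σ fun σ' t => Clear I σ' ∧ t ≤ 120 * R := by
  have hLn := hC.L_n
  have hLm := hC.L_m
  have hW := hC.W_le
  have hk : σ.reg 3 ≤ I.n := hR.lists.1 ▸ hR.cliq.card_le
  have hkR : σ.reg 3 ≤ R := hR.lists.1 ▸ hC.good.card_le hR.cliq
  have hRp := hC.good.R_pos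
  have hrange : ∀ i < σ.reg 3, 1 ≤ σ.mem 7 i ∧ σ.mem 7 i ≤ I.n := fun i hi =>
    hR.cliq.1 _ (hR.lists.mem hi)
  rw [reset, Wp.seq_iff]
  refine Wp.forR 0 (σ.reg 3) 20 (fun i τ =>
      (∀ z, τ.mem 9 z ≠ 0 → ∃ i', i ≤ i' ∧ i' < σ.reg 3 ∧ σ.mem 7 i' = z) ∧
      ∀ z, τ.mem 8 z ≠ 0 → ∃ i', i ≤ i' ∧ i' < σ.reg 3 ∧ I.H a b (σ.mem 7 i') z)
    (fun i _ => ∑ j ∈ Finset.Ico i (σ.reg 3), 30 * I.deg (σ.mem 7 j)) rfl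
    (Nat.zero_le _) rfl (Nat.zero_le _) (by omega) ?_ ?_ ?_ ?_
  · intro τ hf
    have r3 := hf.reg 3 rfl
    simp only [Exp.Fits, Exp.eval, r3, and_true]
    omega
  · simp only [State.setR_mem]
    constructor
    · intro z hz
      rw [hR.mark] at hz
      obtain ⟨i, hi, h⟩ := hR.lists.exists (by_contra fun hc => hz (if_neg hc))
      exact ⟨i, Nat.zero_le _, hi, h⟩
    · classical
      intro z hz
      rw [hR.cnt] at hz
      obtain ⟨u, hu⟩ := Finset.card_pos.1 (Nat.pos_of_ne_zero hz)
      rw [Finset.mem_filter] at hu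
      obtain ⟨i, hi, h⟩ := hR.lists.exists hu.1
      exact ⟨i, Nat.zero_le _, hi, h ▸ hu.2⟩
  · intro τ i _ hi hf hpi ⟨h9, h8⟩
    have m7 : τ.mem 7 = σ.mem 7 := hf.mem 7 rfl
    have hv := hrange i hi
    have hEτ := hE.frame hf (by decide)
    rw [Wp.seq_iff, Wp.assign_iff, Wp.seq_iff, Wp.put_iff]
    simp only [Exp.Fits, Exp.eval, Exp.size, hpi, m7, State.setR_reg, State.setR_mem, if_true]
    refine ⟨by omega, by omega, by omega, by omega, ?_⟩
    refine Wp.forSeg hC (σ.mem 7 i) 5 (fun p τ' =>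
      (∀ z, τ'.mem 9 z ≠ 0 → ∃ i', i + 1 ≤ i' ∧ i' < σ.reg 3 ∧ σ.mem 7 i' = z) ∧
      ∀ z, τ'.mem 8 z ≠ 0 → (∃ i', i + 1 ≤ i' ∧ i' < σ.reg 3 ∧ I.H a b (σ.mem 7 i') z) ∨
        (I.H a b (σ.mem 7 i) z ∧ ¬ I.Reach a b (σ.mem 7 i) p z))
      ⟨hEτ.r0, hEτ.r1, hEτ.r2, hEτ.m0, hEτ.m1, hEτ.m2, hEτ.m3, hEτ.m4, hEτ.m5⟩ (by simp) hv.1 hv.2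
      (by decide) rfl rfl rfl ?_ ?_ ?_
    · simp only [State.setR_mem, State.setM_mem, if_true, Nat.reduceEqDiff, if_false]
      constructor
      · intro z hz
        rw [Function.update_apply] at hz
        split_ifs at hz with hz'
        · exact absurd rfl hz
        · obtain ⟨i', h1, h2, h3⟩ := h9 z hz
          rcases Nat.eq_or_lt_of_le h1 with rfl | h4
          · exact absurd h3.symm hz'
          · exact ⟨i', h4, h2, h3⟩
      · intro z hz
        obtain ⟨i', h1, h2, h3⟩ := h8 z hz
        rcases Nat.eq_or_lt_of_le h1 with rfl | h4
        · exact Or.inr ⟨h3, Net.not_reach_start⟩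
        · exact Or.inl ⟨i', h4, h2, h3⟩
    · intro τ' p hp1 hp2 hf' _ _ hEτ' ⟨h9', h8'⟩
      obtain ⟨a1, a2, a3, a4, a5⟩ := hC.good.seg hv.1 hv.2 hp1 hp2
      rw [Wp.put_iff]
      simp only [Exp.Fits, Exp.eval, Exp.size, State.setR_reg, State.setR_mem, State.setM_mem,
        if_true, Nat.reduceEqDiff, if_false]
      refine ⟨by omega, by omega, by omega, ⟨h9', fun z hz => ?_⟩, by omega⟩
      rw [Function.update_apply] at hz
      split_ifs at hz with hz'
      · exact absurd rfl hz
      · rcases h8' z hz with h | h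
        · exact Or.inl h
        · refine Or.inr ⟨h.1, fun hc => ?_⟩
          rcases (Net.reach_succ hp1).1 hc with hc | hc
          · exact h.2 hc
          · exact hz' hc.1.symm
    · intro τ' t hf' hEτ' ⟨h9', h8'⟩ ht
      refine ⟨⟨h9', fun z hz => ?_⟩, ?_⟩
      · rcases h8' z hz with h | h
        · exact h
        · exact absurd ((hC.good.H_iff_reach hv.1 hv.2).1 h.1) h.2
      · rw [Finset.sum_eq_sum_Ico_succ_bot hi]
        omega
  · intro τ t hf ⟨h9, h8⟩ ht
    have hEτ := hE.frame hf (by decide)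
    simp only [Wp.seq_iff, Wp.assign_iff, Exp.Fits, Exp.eval, Exp.size, State.setR_reg, hEτ.r2,
      Nat.reduceEqDiff, if_false]
    refine ⟨by omega, by omega, by omega, ⟨by simp, by simp, by simp, fun z => ?_, fun z => ?_⟩, ?_⟩
    · by_contra hc
      obtain ⟨i', h1, h2, _⟩ := h8 z hc
      omega
    · by_contra hc
      obtain ⟨i', h1, h2, _⟩ := h9 z hc
      omega
    · rw [Finset.Ico_self, Finset.sum_empty, ← Finset.range_eq_Ico, ← Finset.mul_sum,
        hR.lists.sum_eq I.deg] at ht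
      have := hC.good.sum_deg_le a b B hR.cliq
      simp only [Exp.size] at ht
      omega

/-- Copy the list in array `src` of the length in register `sl` to array `dst` and register `dl`. -/
def copy (src sl dst dl : ℕ) : Cmd :=
  .seq (forR 12 (.lit 0) (.var sl) (.put dst (.var 12) (.get src (.var 12)))) (.assign dl (.var sl))

theorem copy_spec (hC : Ctx I L W R D) {σ : State} {src sl dst dl a b : ℕ} {B : Finset ℕ}
    (hL : Lists (σ.mem src) (σ.reg sl) B) (hB : I.Cliq a b B) (hsd : src ≠ dst) (hsl : sl ≠ 12) :
    Wp L W (copy src sl dst dl) σ fun σ' t => Lists (σ'.mem dst) (σ'.reg dl) B ∧ t ≤ 30 * R := by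
  have hLn := hC.L_n
  have hW := hC.W_le
  have hk : σ.reg sl ≤ I.n := hL.1 ▸ hB.card_le
  have hkR : σ.reg sl ≤ R := hL.1 ▸ hC.good.card_le hB
  have hRp := hC.good.R_pos
  have hsl' : ∀ τ, Frame (forR 12 (.lit 0) (.var sl) (.put dst (.var 12) (.get src (.var 12)))) σ τ →
      τ.reg sl = σ.reg sl := fun τ hf => hf.reg sl (by simp [forR, Cmd.modR, hsl.symm])
  have hsrc : ∀ τ, Frame (forR 12 (.lit 0) (.var sl) (.put dst (.var 12) (.get src (.var 12)))) σ τ →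
      τ.mem src = σ.mem src := fun τ hf => hf.mem src (by simp [forR, Cmd.modM, hsd.symm])
  rw [copy, Wp.seq_iff]
  refine Wp.forR 0 (σ.reg sl) 5 (fun i τ => ∀ i' < i, τ.mem dst i' = σ.mem src i') (fun _ _ => 0)
    rfl (Nat.zero_le _) rfl (Nat.zero_le _) (by omega) ?_ ?_ ?_ ?_
  · intro τ hf
    simp only [Exp.Fits, Exp.eval, hsl' τ hf, and_true]
    omega
  · intro i hi
    omega
  · intro τ i _ hi hf hpi hinv
    have := hB.1 _ (hL.mem hi)
    rw [Wp.put_iff]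
    simp only [Exp.Fits, Exp.eval, Exp.size, hpi, hsrc τ hf, State.setR_mem, State.setM_mem, if_true]
    refine ⟨by omega, by omega, by omega, fun i' hi' => ?_, by omega⟩
    rcases Nat.lt_succ_iff_lt_or_eq.1 hi' with h | rfl
    · rw [Function.update_of_ne h.ne, hinv i' h]
    · rw [Function.update_self]
  · intro τ t hf hinv ht
    rw [Wp.assign_iff]
    simp only [Exp.Fits, Exp.eval, Exp.size, hsl' τ hf, State.setR_mem, State.setR_reg, if_true] at ht ⊢
    exact ⟨by omega, hL.congr hinv, by omega⟩

/-- Add to the current clique the vertices less than register 18 of the list in array `src` of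
length in register `sl` that are joined to all vertices of the current clique. -/
def fill (src sl : ℕ) : Cmd :=
  forR 12 (.lit 0) (.var sl)
    (.seq (.assign 8 (.get src (.var 12)))
      (.ite (.sub (.var 18) (.var 8))
        (.ite (.sub (.var 3) (.get 8 (.var 8))) .skip addV) .skip))

open Classical in
/-- The vertices of `K` less than `v` that are joined to all vertices of `B`. -/
noncomputable def fillSet (I : Net) (a b v : ℕ) (B K : Finset ℕ) : Finset ℕ :=
  K.filter fun z => z < v ∧ ∀ u ∈ B, I.H a b u z

theorem mem_fillSet {a b v z : ℕ} {B K : Finset ℕ} :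
    z ∈ fillSet I a b v B K ↔ z ∈ K ∧ z < v ∧ ∀ u ∈ B, I.H a b u z := by
  classical
  simp [fillSet]

/-- The vertices of `K` below `v` are pairwise joined within the window, so a vertex is joined to
the growing clique as soon as it is joined to `B`. The result thus does not depend on the order of
the list. Each addition is paid for by the growth of the degree sum, which never exceeds `R`. -/
theorem fill_spec (hC : Ctx I L W R D) {σ : State} {src sl a b a' b' v : ℕ}
    {B K : Finset ℕ} (hE : Env I σ) (hL : Lists (σ.mem src) (σ.reg sl) K) (hK : I.Cliq a' b' K)
    (hKv : ∀ u ∈ K, ∀ w ∈ K, u < v → w < v → u ≠ w → I.H a b u w) (ha : σ.reg 4 = a)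
    (hb : σ.reg 5 = b) (haT : a ≤ I.T) (hbT : b ≤ I.T) (hR : Rep I a b B σ) (hv : σ.reg 18 = v)
    (hvn : v ≤ I.n + 1) (hdis : ∀ z ∈ K, z < v → z ∉ B) (hsrc : addV.modM src = false)
    (hsl : (fill src sl).modR sl = false) :
    Wp L W (fill src sl) σ fun σ' t => Rep I a b (B ∪ fillSet I a b v B K) σ' ∧ t ≤ 200 * R := by
  have hLn := hC.L_n
  have hW := hC.W_le
  have hk : σ.reg sl ≤ I.n := hL.1 ▸ hK.card_le
  have hkR : σ.reg sl ≤ R := hL.1 ▸ hC.good.card_le hK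
  have hRp := hC.good.R_pos
  have hf7 : ∀ x, (fill src sl).modR x = (fill 0 sl).modR x := fun x => rfl
  have fr : ∀ {τ}, Frame (fill src sl) σ τ → ∀ x, (fill 0 0).modR x = false → τ.reg x = σ.reg x :=
    fun hf x hx => hf.reg x hx
  have hmsrc : (fill src sl).modM src = false := by
    simpa [fill, forR, Cmd.modM] using hsrc
  unfold fill
  refine Wp.forR 0 (σ.reg sl) 60
    (fun i τ => Rep I a b (B ∪ fillSet I a b v B ((Finset.range i).image (σ.mem src))) τ)
    (fun _ τ => 60 * (R - dsum I τ)) rfl (Nat.zero_le _) rfl (Nat.zero_le _) (by omega) ?_ ?_ ?_ ?_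
  · intro τ hf
    simp only [Exp.Fits, Exp.eval, hf.reg sl hsl, and_true]
    omega
  · have : fillSet I a b v B ∅ = ∅ := by simp [fillSet]
    rw [Finset.range_zero, Finset.image_empty, this, Finset.union_empty]
    exact hR.setR _ (by norm_num)
  · intro τ i _ hi hf hpi hinv
    set Bi := B ∪ fillSet I a b v B ((Finset.range i).image (σ.mem src)) with hBi
    have hms := hf.mem src hmsrc
    -- Which cells `fill` writes does not depend on its arguments, so one instance settles the
    -- matter.
    have hEτ := hE.frame hf (by exact (rfl : (fill 6 3).safe = true))
    have hz := hK.1 _ (hL.mem hi)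
    set z := σ.mem src i with hzd
    have r4 : τ.reg 4 = a := (fr hf 4 rfl).trans ha
    have r5 : τ.reg 5 = b := (fr hf 5 rfl).trans hb
    have r18 : τ.reg 18 = v := (fr hf 18 rfl).trans hv
    have r3 : τ.reg 3 ≤ I.n := hinv.lists.1 ▸ hinv.cliq.card_le
    have hnb := I.nbrs_le (a := a) (b := b) (B := Bi) (z := z)
    have hBn := hinv.lists.1
    have himg : (Finset.range (i + 1)).image (σ.mem src) =
        insert z ((Finset.range i).image (σ.mem src)) := by
      rw [Finset.range_add_one, Finset.image_insert]
    have hzi : z ∉ (Finset.range i).image (σ.mem src) := by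
      intro hc
      obtain ⟨i', h1, h2⟩ := Finset.mem_image.1 hc
      have h3 := Finset.mem_range.1 h1
      have := hL.injOn (by simp; omega) (by simpa using hi) h2
      omega
    have hskip : (¬ (z < v ∧ ∀ u ∈ B, I.H a b u z)) →
        B ∪ fillSet I a b v B ((Finset.range (i + 1)).image (σ.mem src)) = Bi := by
      intro h
      rw [hBi, himg]
      congr 1
      ext x
      rw [mem_fillSet, mem_fillSet, Finset.mem_insert]
      refine ⟨fun hx => ⟨hx.1.resolve_left ?_, hx.2⟩, fun hx => ⟨Or.inr hx.1, hx.2⟩⟩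
      rintro rfl
      exact h hx.2
    have hrep8 : Rep I a b Bi (τ.setR 8 z) := hinv.setR _ le_rfl
    have hds : dsum I ((τ.setR 8 z).setR 12 (i + 1)) = dsum I τ := by simp [dsum]
    simp only [Wp.ite_iff, Wp.seq_iff, Wp.assign_iff, Wp.skip_iff, Exp.Fits, Exp.eval, Exp.size,
      State.setR_reg, State.setR_mem, hpi, hms, r18, if_true, Nat.reduceEqDiff, if_false]
    rw [← hzd, hinv.cnt z]
    refine ⟨by omega, by omega, fun h1 => ⟨by omega, fun h2 => ?_, fun h2 => ?_⟩, fun h1 => ?_⟩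
    · rw [hskip, hds]
      · exact ⟨hrep8.setR _ (by norm_num), by omega⟩
      · rintro ⟨h3, h4⟩
        have : I.nbrs a b Bi z = Bi.card := by
          rw [Net.nbrs_eq_card_iff]
          intro u hu
          rcases Finset.mem_union.1 hu with hu | hu
          · exact h4 u hu
          · refine hKv u ?_ z (hL.mem hi) (mem_fillSet.1 hu).2.1 h3 ?_
            · rw [mem_fillSet] at hu
              obtain ⟨i', h5, rfl⟩ := Finset.mem_image.1 hu.1
              exact hL.mem ((Finset.mem_range.1 h5).trans hi)
            · rintro rfl
              exact hzi (mem_fillSet.1 hu).1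
        omega
    · have hall : ∀ u ∈ Bi, I.H a b u z := by
        rw [← Net.nbrs_eq_card_iff]
        omega
      have hzB : z ∉ Bi := by
        intro hc
        rcases Finset.mem_union.1 hc with hc | hc
        · exact hdis z (hL.mem hi) (by omega) hc
        · exact hzi (mem_fillSet.1 hc).1
      refine (addV_spec hC (σ := τ.setR 8 z) (hEτ.setR _ (by norm_num)) (by simp [r4])
        (by simp [r5]) haT hbT hrep8 (by simp) hz hzB hall).mono ?_
      intro τ' t hf' ⟨h5, _, h6⟩
      have heq : B ∪ fillSet I a b v B ((Finset.range (i + 1)).image (σ.mem src)) =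
          insert z Bi := by
        rw [hBi, himg, ← Finset.union_insert]
        congr 1
        ext x
        simp only [mem_fillSet, Finset.mem_insert]
        constructor
        · rintro ⟨rfl | h7, h8⟩
          · exact Or.inl rfl
          · exact Or.inr ⟨h7, h8⟩
        · rintro (rfl | h7)
          · exact ⟨Or.inl rfl, by omega, fun u hu => hall u (Finset.mem_union_left _ hu)⟩
          · exact ⟨Or.inr h7.1, h7.2⟩
      rw [heq]
      have hds' : dsum I (τ'.setR 12 (i + 1)) = dsum I τ' := by simp [dsum]
      have hsum := hC.good.sum_deg_le a b _ h5.cliq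
      refine ⟨h5.setR _ (by norm_num), ?_⟩
      rw [hds', h5.dsum_eq, hinv.dsum_eq]
      rw [Finset.sum_insert hzB] at hsum ⊢
      omega
    · rw [hskip (by omega), hds]
      exact ⟨hrep8.setR _ (by norm_num), by omega⟩
  · intro τ t hf hinv ht
    rw [hL.2] at hinv
    refine ⟨hinv, ?_⟩
    simp only [Exp.size] at ht
    omega

end RAM

-- Greedy closure

namespace RAM

variable {I : Net} {L W R D : ℕ}

/-- Extend the current clique greedily; register 17 receives the least vertex added. -/
def extend : Cmd :=
  .seq (.assign 17 (.add (.var 0) (.lit 1)))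
    (.seq (.assign 16 (.lit 1))
      (.loop (.var 16)
        (.seq (.assign 15 (.get 7 (.sub (.var 3) (.lit 1))))
          (.seq (.assign 14 (.add (.var 0) (.lit 1)))
            (.seq (forSeg 9 15
              (.ite (.sub (.var 3) (.get 8 (.var 11))) .skip
                (.ite (.sub (.var 14) (.var 11)) (.assign 14 (.var 11)) .skip)))
              (.ite (.sub (.add (.var 0) (.lit 1)) (.var 14))
                (.seq (.assign 8 (.var 14))
                  (.seq (.assign 17 (.sub (.var 17) (.sub (.var 17) (.var 14)))) addV))
                (.assign 16 (.lit 0))))))))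

/-- The degree of the vertex added last. -/
def lastDeg (I : Net) (σ : State) : ℕ := I.deg (σ.mem 7 (σ.reg 3 - 1))

/-- The invariant of `extend`: every vertex outside of `B'` is joined to all of `B'`, or separated
from it by a smaller vertex or a vertex of `B`. -/
structure Ext (I : Net) (a b : ℕ) (B B' : Finset ℕ) (σ : State) : Prop where
  env : Env I σ
  rep : Rep I a b B' σ
  sub : B ⊆ B'
  r16 : σ.reg 16 ≤ 1
  r17 : σ.reg 17 ≤ I.n + 1
  min : ∀ v ≤ I.n + 1, v ≤ σ.reg 17 ↔ ∀ z ∈ B' \ B, v ≤ z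
  sep : ∀ w ∉ B', 1 ≤ w → w ≤ I.n →
    (∀ u ∈ B', I.H a b u w) ∨ ∃ z ∈ B', ¬ I.H a b z w ∧ (z ∈ B ∨ z < w)
  halt : σ.reg 16 = 0 → ∀ w, ¬ ∀ u ∈ B', I.H a b u w

/-- A common neighbor of the clique is in particular a neighbor of the vertex added last, so
scanning that segment finds the least candidate `w`. A candidate lost by adding `w` is not joined to
`w` and exceeds it, so `w` is the smaller separating vertex that `Greedy` requires. Register 17 is
`n + 1` if nothing is added. -/
theorem extend_spec (hC : Ctx I L W R D) {σ : State} {a b : ℕ} {B : Finset ℕ} (hE : Env I σ)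
    (ha : σ.reg 4 = a) (hb : σ.reg 5 = b) (haT : a ≤ I.T) (hbT : b ≤ I.T) (hR : Rep I a b B σ)
    (hne : B.Nonempty) :
    Wp L W extend σ fun σ' t => ∃ B', I.Greedy a b B B' ∧ Rep I a b B' σ' ∧
      σ'.reg 17 ≤ I.n + 1 ∧ (∀ v ≤ I.n + 1, v ≤ σ'.reg 17 ↔ ∀ z ∈ B' \ B, v ≤ z) ∧
      t ≤ 500 * R := by
  have hLn := hC.L_n
  have hW := hC.W_le
  have hRp := hC.good.R_pos
  rw [extend, Wp.seq_iff, Wp.assign_iff, Wp.seq_iff, Wp.assign_iff]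
  simp only [Exp.Fits, Exp.eval, Exp.size, hE.r0]
  refine ⟨by omega, by omega, ?_⟩
  have fr : ∀ {c : Cmd} {τ : State},
      Frame c ((σ.setR 17 (I.n + 1)).setR 16 1) τ → c.modR 4 = false → c.modR 5 = false →
      τ.reg 4 = a ∧ τ.reg 5 = b := fun hf h4 h5 =>
    ⟨by rw [hf.reg 4 h4]; simpa using ha, by rw [hf.reg 5 h5]; simpa using hb⟩
  -- The scan is paid for by the degree of the last vertex, the addition by the growth of the degree
  -- sum. The factor `reg 16` makes the potential vanish at the stop and so pays for the final
  -- unsuccessful scan.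
  refine Wp.loop (fun τ => ∃ B', Ext I a b B B' τ)
    (fun τ => τ.reg 16 * (150 + 60 * lastDeg I τ + 250 * (R - dsum I τ))) ?_ ?_ ?_ ?_
  · refine ⟨B, (hE.setR _ (by norm_num)).setR _ (by norm_num),
      (hR.setR _ (by norm_num)).setR _ (by norm_num), subset_rfl, by simp, by simp, ?_, ?_, ?_⟩
    · intro v hv
      simpa using hv
    · intro w hw _ _
      by_cases h : ∀ u ∈ B, I.H a b u w
      · exact Or.inl h
      · push Not at h
        obtain ⟨z, h1, h2⟩ := h
        exact Or.inr ⟨z, h1, h2, Or.inl h1⟩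
    · intro h
      simp at h
  · rintro τ hf ⟨B', hB'⟩
    exact (hB'.r16.trans (by omega) : τ.reg 16 ≤ W)
  · rintro τ hf ⟨B', hB'⟩ hg
    have r16 : τ.reg 16 = 1 := by
      have := hB'.r16
      simp only [Exp.eval] at hg
      omega
    obtain ⟨r4, r5⟩ := fr hf rfl rfl
    have r3 : τ.reg 3 ≤ I.n := hB'.rep.lists.1 ▸ hB'.rep.cliq.card_le
    have r3p : 1 ≤ τ.reg 3 := by
      rw [← hB'.rep.lists.1]
      exact Finset.card_pos.2 (hne.mono hB'.sub)
    have hu := hB'.rep.lists.mem (i := τ.reg 3 - 1) (by omega)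
    have hlast : lastDeg I τ = I.deg (τ.mem 7 (τ.reg 3 - 1)) := rfl
    set u := τ.mem 7 (τ.reg 3 - 1) with hud
    have hun := hB'.rep.cliq.1 u hu
    rw [Wp.seq_iff, Wp.assign_iff, Wp.seq_iff, Wp.assign_iff, Wp.seq_iff]
    simp only [Exp.Fits, Exp.eval, Exp.size, State.setR_reg, hB'.env.r0, ← hud, Nat.reduceEqDiff,
      if_false]
    refine ⟨by omega, by omega, ?_⟩
    refine Wp.forSeg hC u 20 (fun i τ' => τ'.reg 14 ≤ I.n + 1 ∧
        (τ'.reg 14 = I.n + 1 ∨ ∀ x ∈ B', I.H a b x (τ'.reg 14)) ∧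
        ∀ p, I.st u ≤ p → p < i → (∀ x ∈ B', I.H a b x (I.oth (I.inc p) u)) →
          τ'.reg 14 ≤ I.oth (I.inc p) u)
      ((hB'.env.setR _ (by norm_num)).setR _ (by norm_num)) (by simp) hun.1 hun.2 (by decide)
      rfl rfl rfl ?_ ?_ ?_
    · simp only [State.setR_reg, Nat.reduceEqDiff, if_false, if_true]
      exact ⟨le_rfl, Or.inl trivial, fun p h1 h2 => absurd h2 (by omega)⟩
    · intro τ' i hi1 hi2 hf' _ _ hEτ' ⟨h1, h2, h3⟩
      obtain ⟨a1, a2, a3, a4, a5⟩ := hC.good.seg hun.1 hun.2 hi1 hi2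
      have m8 : τ'.mem 8 = τ.mem 8 := hf'.mem 8 rfl
      have q3 : τ'.reg 3 = τ.reg 3 := by rw [hf'.reg 3 rfl]; simp
      have hnb := I.nbrs_le (a := a) (b := b) (B := B') (z := I.oth (I.inc i) u)
      have hcard := hB'.rep.lists.1
      have hiff := I.nbrs_eq_card_iff (a := a) (b := b) (B := B') (z := I.oth (I.inc i) u)
      have hpi' : ∀ p, p < i + 1 → p < i ∨ p = i := fun p h => by omega
      simp only [Wp.ite_iff, Wp.assign_iff, Wp.skip_iff, Exp.Fits, Exp.eval, Exp.size,
        State.setR_reg, State.setR_mem, m8, q3, Nat.reduceEqDiff, if_false, if_true,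
        hB'.rep.cnt]
      refine ⟨by omega, fun h4 => ⟨⟨h1, h2, fun p h5 h6 h7 => ?_⟩, by omega⟩, fun h4 => ⟨by omega, fun h5 => ⟨by omega, ⟨by omega, Or.inr (hiff.1 (by omega)), fun p h6 h7 h8 => ?_⟩, by omega⟩, fun h5 => ⟨⟨h1, h2, fun p h6 h7 h8 => ?_⟩, by omega⟩⟩⟩
      · rcases hpi' p h6 with h8 | rfl
        · exact h3 p h5 h8 h7
        · have := hiff.2 h7
          omega
      · rcases hpi' p h7 with h9 | rfl
        · have := h3 p h6 h9 h8
          omega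
        · exact le_rfl
      · rcases hpi' p h7 with h9 | rfl
        · exact h3 p h6 h9 h8
        · omega
    · intro τ' t hf' hEτ' ⟨h1, h2, h3⟩ ht
      have q16 : τ'.reg 16 = 1 := by rw [hf'.reg 16 rfl]; simpa using r16
      have q17 : τ'.reg 17 = τ.reg 17 := by rw [hf'.reg 17 rfl]; simp
      have q4 : τ'.reg 4 = a := by rw [hf'.reg 4 rfl]; simpa using r4
      have q5 : τ'.reg 5 = b := by rw [hf'.reg 5 rfl]; simpa using r5
      have hrep : Rep I a b B' τ' :=
        ((hB'.rep.setR _ (by norm_num)).setR _ (by norm_num)).frame hf' rfl rfl rfl rfl rfl rfl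
      have hsum := hC.good.sum_deg_le a b B' hB'.rep.cliq
      have hds : dsum I τ = ∑ z ∈ B', I.deg z := hB'.rep.dsum_eq
      have h17 := hB'.r17
      have hmin : ∀ w, (∀ x ∈ B', I.H a b x w) → τ'.reg 14 ≤ w := by
        intro w hw
        obtain ⟨p, p1, p2, p3, p4⟩ := (hC.good.H_iff_reach hun.1 hun.2).1 (hw u hu)
        have := h3 p p1 p2 (p3 ▸ hw)
        omega
      rw [Wp.ite_iff, Wp.seq_iff, Wp.assign_iff, Wp.seq_iff, Wp.assign_iff, Wp.assign_iff]
      simp only [Exp.Fits, Exp.eval, Exp.size, State.setR_reg, hEτ'.r0, q17, Nat.reduceEqDiff,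
        if_false, r16, hlast, hds]
      refine ⟨by omega, fun h4 => ⟨by omega, by omega, ?_⟩, fun h4 => ⟨by omega, ?_, ?_⟩⟩
      · have hcand := h2.resolve_left (by omega)
        set w := τ'.reg 14 with hwd
        have hwH := hC.good.H_range (hcand u hu)
        -- The new vertex has positive degree; this pays for the constant part of the round.
        have hdw : 1 ≤ I.deg w := hC.good.deg_pos (hcand u hu).symm
        have hwB : w ∉ B' := fun hc => hC.good.H_ne (hcand w hc) rfl
        refine (addV_spec hC (w := w) (a := a) (b := b) (B := B')
          (σ := (τ'.setR 8 w).setR 17 (τ.reg 17 - (τ.reg 17 - w)))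
          ((hEτ'.setR _ (by norm_num)).setR _ (by norm_num)) (by simp [q4]) (by simp [q5]) haT hbT
          ((hrep.setR _ (by norm_num)).setR _ (by norm_num)) (by simp) hwH.2 hwB hcand).mono ?_
        intro τ'' t'' hf'' ⟨h5, h5', h6⟩
        have s16 : τ''.reg 16 = 1 := by rw [hf''.reg 16 rfl]; simpa using q16
        have s17 : τ''.reg 17 = τ.reg 17 - (τ.reg 17 - w) := by rw [hf''.reg 17 rfl]; simp
        have s3 : τ''.reg 3 = τ.reg 3 + 1 := by
          rw [← h5.lists.1, Finset.card_insert_of_notMem hwB, hB'.rep.lists.1]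
        have hsum' := hC.good.sum_deg_le a b _ h5.cliq
        have q3 : τ'.reg 3 = τ.reg 3 := by rw [hf'.reg 3 rfl]; simp
        have hlast' : lastDeg I τ'' = I.deg w := by
          simp only [State.setR_reg, Nat.reduceEqDiff, if_false, q3] at h5'
          rw [lastDeg, s3, Nat.add_sub_cancel, h5']
        refine ⟨⟨insert w B', ?_, h5, hB'.sub.trans (Finset.subset_insert _ _), by omega, by omega,
          ?_, ?_, by omega⟩, ?_⟩
        · exact ((hEτ'.setR _ (by norm_num)).setR _ (by norm_num)).frame hf'' (by decide)
        · intro v hv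
          rw [s17]
          have := hB'.min v hv
          have hwsub : w ∉ B := fun hc => hwB (hB'.sub hc)
          rw [Finset.insert_sdiff_of_notMem _ hwsub, Finset.forall_mem_insert, ← this]
          omega
        · intro x hx hx1 hx2
          rw [Finset.mem_insert, not_or] at hx
          rcases hB'.sep x hx.2 hx1 hx2 with h7 | ⟨z, h7, h8, h9⟩
          · by_cases h8 : I.H a b w x
            · refine Or.inl fun y hy => ?_
              rcases Finset.mem_insert.1 hy with rfl | hy
              · exact h8
              · exact h7 y hy
            · have := hmin x h7
              exact Or.inr ⟨w, Finset.mem_insert_self _ _, h8, Or.inr (by omega)⟩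
          · exact Or.inr ⟨z, Finset.mem_insert_of_mem h7, h8, h9⟩
        · rw [s16, hlast', h5.dsum_eq]
          rw [Finset.sum_insert hwB] at hsum' ⊢
          omega
      · refine ⟨B', hEτ'.setR _ (by norm_num), hrep.setR _ (by norm_num), hB'.sub, by simp, ?_, ?_, hB'.sep, ?_⟩
        · simpa [q17] using h17
        · intro v hv
          simpa [q17] using hB'.min v hv
        · intro _ w hw
          have := hmin w hw
          have := hC.good.H_range (hw u hu)
          omega
      · simp only [if_true, Nat.zero_mul]
        omega
  · rintro τ t hf ⟨B', hB'⟩ hg ht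
    refine ⟨B', ⟨hB'.sub, hB'.rep.cliq, fun w hw h1 h2 => ?_⟩, hB'.rep, hB'.r17, hB'.min, ?_⟩
    · rcases hB'.sep w hw h1 h2 with h | h
      · exact absurd h (hB'.halt hg w)
      · exact h
    · have h16 : ((σ.setR 17 (I.n + 1)).setR 16 1).reg 16 = 1 := by simp
      have hl : lastDeg I ((σ.setR 17 (I.n + 1)).setR 16 1) ≤ R := by
        refine hC.good.deg_le_R hR.cliq ?_
        have : 1 ≤ σ.reg 3 := by
          rw [← hR.lists.1]
          exact Finset.card_pos.2 hne
        simpa using hR.lists.mem (i := σ.reg 3 - 1) (by omega)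
      rw [h16] at ht
      simp only [Exp.size] at ht
      omega

end RAM

-- Uniqueness of closures, and the conditions for a child

namespace Net

variable {I : Net} {R D : ℕ}

/-- At the least vertex `w` on which the closures differ, the closure that omits `w` has a
separating vertex in `A` or below `w`. That vertex also lies in the other closure, which contains
`w` and is a clique. -/
theorem Greedy.unique {a b : ℕ} {A B B' : Finset ℕ} (h : I.Greedy a b A B)
    (h' : I.Greedy a b A B') : B = B' := by
  by_contra hne
  have hsd : (B \ B' ∪ B' \ B).Nonempty := by
    rw [Finset.nonempty_iff_ne_empty]
    intro hc
    rw [Finset.union_eq_empty, Finset.sdiff_eq_empty_iff_subset, Finset.sdiff_eq_empty_iff_subset]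
      at hc
    exact hne (hc.1.antisymm hc.2)
  obtain ⟨w, hw, hmin⟩ := Finset.exists_min_image _ id hsd
  have key : ∀ {C C' : Finset ℕ}, I.Greedy a b A C → I.Greedy a b A C' → w ∈ C' → w ∉ C →
      (∀ z, z < w → z ∈ C → z ∈ C') → False := by
    intro C C' h h' h1 h2 h3
    obtain ⟨z, hz, hz1, hz2⟩ := h.2.2 w h2 (h'.2.1.1 w h1).1 (h'.2.1.1 w h1).2
    have hz' : z ∈ C' := hz2.elim (fun hA => h'.1 hA) fun hlt => h3 z hlt hz
    exact hz1 (h'.2.1.2 z hz' w h1 fun hc => h2 (hc ▸ hz))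
  have hagree : ∀ z, z < w → (z ∈ B ↔ z ∈ B') := by
    intro z hz
    by_contra hc
    refine absurd (hmin z ?_) (not_le.2 hz)
    rw [Finset.mem_union, Finset.mem_sdiff, Finset.mem_sdiff]
    tauto
  rw [Finset.mem_union, Finset.mem_sdiff, Finset.mem_sdiff] at hw
  rcases hw with hw | hw
  · exact key h' h hw.1 hw.2 fun z hz h => (hagree z hz).2 h
  · exact key h h' hw.1 hw.2 fun z hz h => (hagree z hz).1 h

theorem TimeIs.unique {A : Finset ℕ} {a b a' b' : ℕ} (h : I.TimeIs A a b) (h' : I.TimeIs A a' b')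
    (hab : a ≤ b) : a' = a ∧ b' = b := by
  have key : ∀ t, (a ≤ t ∧ t ≤ b) ↔ (a' ≤ t ∧ t ≤ b') := fun t => (h t).trans (h' t).symm
  have k1 := (key a).1 ⟨le_rfl, hab⟩
  have k2 := (key b).1 ⟨hab, le_rfl⟩
  have k3 := (key a').2 ⟨le_rfl, by omega⟩
  have k4 := (key b').2 ⟨by omega, le_rfl⟩
  omega

variable (I) in
/-- Among the edges that join `v` to the vertices considered, `f` (with other endpoint `x`) has the
latest beginning, `g` (with other endpoint `y`) has the earliest end, and ties are resolved in
favor of smaller endpoints, as far as the edge `e` (with other endpoint `z`) is concerned. -/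
def Canon (f x g y e z : ℕ) : Prop :=
  (I.lo e < I.lo f ∨ (I.lo e = I.lo f ∧ x ≤ z)) ∧ (I.hi g < I.hi e ∨ (I.hi e = I.hi g ∧ y ≤ z))

variable (I) in
/-- The neighbors of `v` in `K` through edges active throughout `[a, b]` that are less than `v`. -/
noncomputable def lower (a b v : ℕ) (K : Finset ℕ) : Finset ℕ := RAM.fillSet I a b v {v} K

theorem mem_lower {a b v z : ℕ} {K : Finset ℕ} :
    z ∈ I.lower a b v K ↔ z ∈ K ∧ z < v ∧ I.H a b v z := by
  simp [lower, RAM.mem_fillSet]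

variable (I) in
/-- The first half of the test of a candidate. -/
structure ViaLow (K : Finset ℕ) (x f y g v a b : ℕ) (K' : Finset ℕ) : Prop where
  card : 2 ≤ (I.lower a b v K).card
  x_mem : x ∈ I.lower a b v K
  y_mem : y ∈ I.lower a b v K
  canon : ∀ p, I.st v ≤ p → p < I.st (v + 1) → I.oth (I.inc p) v ∈ I.lower a b v K →
    I.Canon f x g y (I.inc p) (I.oth (I.inc p) v)
  low : ∀ z ∈ K', z < v → z ∈ I.lower a b v K

variable (I) in
/-- The second half of the test of a candidate. -/
structure ViaUp (α β : ℕ) (K : Finset ℕ) (v : ℕ) (A : Finset ℕ) : Prop where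
  time : I.TimeIs A α β
  greedy : I.Greedy α β A K
  notMem : v ∉ K

variable (I) in
/-- `K'`, with active times `[a, b]` and index `v`, is the child of `K`, with active times
`[α, β]`, that is found by means of the edges `f = xv` and `g = yv`. -/
structure Via (α β : ℕ) (K : Finset ℕ) (x f y g v a b : ℕ) (K' : Finset ℕ) : Prop where
  a_eq : a = max α (I.lo f)
  b_eq : b = min β (I.hi g)
  le : a ≤ b
  greedy : I.Greedy a b (insert v (I.lower a b v K)) K'
  toLow : I.ViaLow K x f y g v a b K'
  toUp : I.ViaUp α β K v (I.lower a b v K)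

end Net

-- Testing a candidate

namespace RAM

variable {I : Net} {L W R D : ℕ}

/-- Clear the flag in register 28 if `e` vanishes. -/
def chk (e : Exp) : Cmd := .ite e .skip (.assign 28 (.lit 0))

/-- Clear the flag in register 28 unless `e` vanishes. -/
def chkZ (e : Exp) : Cmd := .ite e (.assign 28 (.lit 0)) .skip

theorem State.setR_self (σ : State) (x : ℕ) : σ.setR x (σ.reg x) = σ := by
  simp [State.setR]

theorem Wp.chk {e : Exp} {σ : State} {Q : State → ℕ → Prop} (he : e.Fits L W σ)
    (hQ : ∀ t, t ≤ e.size + 3 → Q (σ.setR 28 (if e.eval σ = 0 then 0 else σ.reg 28)) t) :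
    Wp L W (RAM.chk e) σ Q := by
  rw [RAM.chk, Wp.ite_iff, Wp.skip_iff, Wp.assign_iff]
  refine ⟨he, fun h => ?_, fun h => ⟨Nat.zero_le _, ?_⟩⟩
  · have := hQ (e.size + 1 + 1) (by omega)
    rwa [if_neg h, State.setR_self] at this
  · have := hQ (e.size + 1 + ((Exp.lit 0).size + 1)) (by simp [Exp.size])
    rwa [if_pos h] at this

theorem Wp.chkZ {e : Exp} {σ : State} {Q : State → ℕ → Prop} (he : e.Fits L W σ)
    (hQ : ∀ t, t ≤ e.size + 3 → Q (σ.setR 28 (if e.eval σ = 0 then σ.reg 28 else 0)) t) :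
    Wp L W (RAM.chkZ e) σ Q := by
  rw [RAM.chkZ, Wp.ite_iff, Wp.skip_iff, Wp.assign_iff]
  refine ⟨he, fun h => ⟨Nat.zero_le _, ?_⟩, fun h => ?_⟩
  · have := hQ (e.size + 1 + ((Exp.lit 0).size + 1)) (by simp [Exp.size])
    rwa [if_neg h] at this
  · have := hQ (e.size + 1 + 1) (by omega)
    rwa [if_pos h, State.setR_self] at this

/-- Check the edge in register 10 against the edges in registers 24 and 26. -/
def canonBody : Cmd :=
  .ite (.get 9 (.var 11))
    (.seq
      (.ite (.sub (.get 2 (.var 10)) (.get 2 (.var 24))) (.assign 28 (.lit 0))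
        (.ite (.sub (.get 2 (.var 24)) (.get 2 (.var 10))) .skip
          (chkZ (.sub (.var 23) (.var 11)))))
      (.ite (.sub (.get 3 (.var 26)) (.get 3 (.var 10))) (.assign 28 (.lit 0))
        (.ite (.sub (.get 3 (.var 10)) (.get 3 (.var 26))) .skip
          (chkZ (.sub (.var 27) (.var 11))))))
    .skip

/-- Build the candidate determined by the vertices in registers 23, 18, 27 and the edges in
registers 24, 26, and list it in array 11. -/
def testLow : Cmd :=
  .seq (.assign 4 (.var 37)) <| .seq (.assign 5 (.var 38)) <| .seq (.assign 8 (.var 18)) <|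
  .seq addV <| .seq (fill 10 19) <| .seq (.assign 28 (.lit 1)) <|
  .seq (chk (.sub (.var 3) (.lit 2))) <| .seq (chk (.get 9 (.var 23))) <|
  .seq (chk (.get 9 (.var 27))) <| .seq (forSeg 9 18 canonBody) <| .seq extend <|
  .seq (chkZ (.sub (.var 18) (.var 17))) <| .seq (copy 7 3 11 22) reset

theorem Cliq_singleton {a b v : ℕ} (hv : 1 ≤ v ∧ v ≤ I.n) : I.Cliq a b {v} := by
  constructor
  · simpa using hv
  · intro u hu w hw h
    rw [Finset.mem_singleton] at hu hw
    exact absurd (hu.trans hw.symm) h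

/-- The list in array 10, of the length in register 19, is the clique `K`, whose active times
`[α, β]` are in registers 20 and 21. -/
structure Node (I : Net) (α β : ℕ) (K : Finset ℕ) (σ : State) : Prop where
  lists : Lists (σ.mem 10) (σ.reg 19) K
  cliq : I.Cliq α β K
  max : ∀ w ∉ K, 1 ≤ w → w ≤ I.n → ∃ z ∈ K, ¬ I.H α β z w
  time : I.TimeIs K α β
  le : α ≤ β
  leT : β ≤ I.T
  r20 : σ.reg 20 = α
  r21 : σ.reg 21 = β

theorem Node.congr {α β : ℕ} {K : Finset ℕ} {σ σ' : State} (h : Node I α β K σ)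
    (h1 : σ'.mem 10 = σ.mem 10) (h2 : σ'.reg 19 = σ.reg 19) (h3 : σ'.reg 20 = σ.reg 20)
    (h4 : σ'.reg 21 = σ.reg 21) : Node I α β K σ' :=
  ⟨by rw [h1, h2]; exact h.lists, h.cliq, h.max, h.time, h.le, h.leT, h3.trans h.r20,
    h4.trans h.r21⟩

theorem Node.frame {α β : ℕ} {K : Finset ℕ} {c : Cmd} {σ σ' : State} (h : Node I α β K σ)
    (hf : Frame c σ σ') (h1 : c.modM 10 = false) (h2 : c.modR 19 = false)
    (h3 : c.modR 20 = false) (h4 : c.modR 21 = false) : Node I α β K σ' :=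
  h.congr (hf.mem 10 h1) (hf.reg 19 h2) (hf.reg 20 h3) (hf.reg 21 h4)

theorem Node.setR {α β : ℕ} {K : Finset ℕ} {σ : State} (h : Node I α β K σ) {x : ℕ} (v : ℕ)
    (h1 : x ≠ 19) (h2 : x ≠ 20) (h3 : x ≠ 21) : Node I α β K (σ.setR x v) :=
  h.congr rfl (by simp [h1.symm]) (by simp [h2.symm]) (by simp [h3.symm])

theorem canonBody_spec (hC : Ctx I L W R D) {τ : State} {f g x y e z : ℕ} {B : Finset ℕ}
    {P : Prop} (hE : Env I τ) (hm : ∀ z, τ.mem 9 z = if z ∈ B then 1 else 0) (r10 : τ.reg 10 = e)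
    (r11 : τ.reg 11 = z) (r24 : τ.reg 24 = f) (r26 : τ.reg 26 = g) (r23 : τ.reg 23 = x)
    (r27 : τ.reg 27 = y) (hf : f < I.m) (hg : g < I.m) (he : e < I.m) (hx : x ≤ I.n)
    (hy : y ≤ I.n) (hz : z ≤ I.n) (h28 : τ.reg 28 ≤ 1 ∧ (τ.reg 28 = 1 ↔ P)) :
    Wp L W canonBody τ fun τ' t =>
      (τ'.reg 28 ≤ 1 ∧ (τ'.reg 28 = 1 ↔ P ∧ (z ∈ B → I.Canon f x g y e z))) ∧ t ≤ 40 := by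
  have hLn := hC.L_n
  have hLm := hC.L_m
  have hW := hC.W_le
  -- The property is replaced by the value of the flag, so that only arithmetic remains.
  obtain rfl : P = (τ.reg 28 = 1) := propext h28.2.symm
  have ef := hC.good.edge f hf
  have eg := hC.good.edge g hg
  have ee := hC.good.edge e he
  have h9 : τ.mem 9 z ≤ 1 := by rw [hm]; split_ifs <;> omega
  simp only [canonBody, chkZ, Wp.ite_iff, Wp.seq_iff, Wp.assign_iff, Wp.skip_iff, Exp.Fits,
    Exp.eval, Exp.size, State.setR_reg, State.setR_mem, r10, r11, r24, r26, r23, r27, hE.m2, hE.m3,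
    Nat.reduceEqDiff, if_false, if_true, Net.Canon]
  refine ⟨by omega, fun h1 => ?_, fun h1 => ?_⟩
  · have hzB : z ∈ B := by
      by_contra hc
      rw [hm, if_neg hc] at h1
      exact h1 rfl
    simp only [hzB, true_imp_iff]
    repeat' (first | apply And.intro | intro _)
    all_goals first | omega | (rw [false_iff]; omega)
  · have hzB : z ∉ B := by
      intro hc
      rw [hm, if_pos hc] at h1
      omega
    exact ⟨⟨h28.1, by simpa [hzB] using h28.2⟩, by omega⟩

end RAM

namespace RAM

variable {I : Net} {L W R D : ℕ}

theorem Clear.setR {σ : State} (h : Clear I σ) {x : ℕ} (v : ℕ) (h3 : x ≠ 3) (h6 : x ≠ 6)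
    (h7 : x ≠ 7) : Clear I (σ.setR x v) :=
  ⟨by simpa [h3.symm] using h.r3, by simpa [h6.symm] using h.r6, by simpa [h7.symm] using h.r7,
    h.m8, h.m9⟩

/-- Starting from `v`, filling with the vertices of `K` below `v` produces `lower`, and `extend` its
closure together with `v`. The closure is stored even when the flag is cleared; this allows
`test_spec` to refute every other candidate by uniqueness. -/
theorem testLow_spec (hC : Ctx I L W R D) {σ : State} {α β a b v x f y g : ℕ} {K : Finset ℕ}
    (hE : Env I σ) (hcl : Clear I σ) (hN : Node I α β K σ) (hαa : α ≤ a) (hbβ : b ≤ β)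
    (haT : a ≤ I.T) (hbT : b ≤ I.T) (r37 : σ.reg 37 = a) (r38 : σ.reg 38 = b) (r18 : σ.reg 18 = v)
    (hv : 1 ≤ v ∧ v ≤ I.n) (r23 : σ.reg 23 = x) (r24 : σ.reg 24 = f) (r26 : σ.reg 26 = g)
    (r27 : σ.reg 27 = y) (hf : f < I.m) (hg : g < I.m) (hx : x ≤ I.n) (hy : y ≤ I.n) (hxv : x ≠ v)
    (hyv : y ≠ v) :
    Wp L W testLow σ fun σ' t => Clear I σ' ∧ σ'.reg 28 ≤ 1 ∧ (∃ K',
      I.Greedy a b (insert v (I.lower a b v K)) K' ∧ Lists (σ'.mem 11) (σ'.reg 22) K' ∧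
      (σ'.reg 28 = 1 ↔ I.ViaLow K x f y g v a b K')) ∧ t ≤ 2000 * R := by
  have hLn := hC.L_n
  have hW := hC.W_le
  have hRp := hC.good.R_pos
  have hT := hC.good.T_pos
  have hdv : I.deg v ≤ R := hC.good.deg_le_R (Cliq_singleton (a := a) (b := b) hv) (by simp)
  rw [testLow, Wp.seq_iff, Wp.assign_iff, Wp.seq_iff, Wp.assign_iff, Wp.seq_iff, Wp.assign_iff,
    Wp.seq_iff]
  simp only [Exp.Fits, Exp.eval, Exp.size, State.setR_reg, Nat.reduceEqDiff, if_false, r37, r38,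
    r18]
  refine ⟨by omega, by omega, by omega, ?_⟩
  have hE1 : Env I (((σ.setR 4 a).setR 5 b).setR 8 v) :=
    ((hE.setR _ (by norm_num)).setR _ (by norm_num)).setR _ (by norm_num)
  have hcl1 : Clear I (((σ.setR 4 a).setR 5 b).setR 8 v) :=
    ((hcl.setR _ (by norm_num) (by norm_num) (by norm_num)).setR _ (by norm_num) (by norm_num)
      (by norm_num)).setR _ (by norm_num) (by norm_num) (by norm_num)
  have hN1 : Node I α β K (((σ.setR 4 a).setR 5 b).setR 8 v) :=
    hN.congr rfl (by simp) (by simp) (by simp)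
  refine (addV_spec hC hE1 (a := a) (b := b) (w := v) (by simp) (by simp) haT hbT
    (hcl1.rep hT a b) (by simp) hv (by simp) (by simp)).mono ?_
  intro τ2 t2 hf2 ⟨hr2, _, ht2⟩
  have hE2 := hE1.frame hf2 (by decide)
  have hN2 := hN1.frame hf2 rfl rfl rfl rfl
  have q4 : τ2.reg 4 = a := by rw [hf2.reg 4 rfl]; simp
  have q5 : τ2.reg 5 = b := by rw [hf2.reg 5 rfl]; simp
  have q18 : τ2.reg 18 = v := by rw [hf2.reg 18 rfl]; simpa using r18
  rw [Wp.seq_iff]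
  have hKab : I.Cliq a b K := hN.cliq.mono hαa hbβ
  refine (fill_spec hC (src := 10) (sl := 19) (a := a) (b := b) (v := v) (B := insert v ∅) hE2 hN2.lists
    hN2.cliq (fun u hu w hw _ _ h => hKab.2 u hu w hw h) q4 q5 haT hbT hr2 q18 (by omega)
    (fun z _ h => by simp; omega) rfl rfl).mono ?_
  intro τ3 t3 hf3 ⟨hr3, ht3⟩
  have hE3 := hE2.frame hf3 (by decide)
  have hset : insert v ∅ ∪ fillSet I a b v (insert v ∅) K = insert v (I.lower a b v K) := by
    rw [Finset.insert_eq, Finset.insert_eq, Finset.union_empty]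
    rfl
  rw [hset] at hr3
  set A := I.lower a b v K with hA
  have hvA : v ∉ A := fun h => by
    have := (Net.mem_lower.1 h).2.1
    omega
  have q3 : τ3.reg 3 = A.card + 1 := by
    rw [← hr3.lists.1, Finset.card_insert_of_notMem hvA]
  have hk : τ3.reg 3 ≤ I.n := hr3.lists.1 ▸ hr3.cliq.card_le
  have mk01 : ∀ z, τ3.mem 9 z ≤ 1 := fun z => by rw [hr3.mark]; split_ifs <;> omega
  have mkA : ∀ z, z ≠ v → (τ3.mem 9 z = 0 ↔ z ∉ A) := fun z hz => by
    rw [hr3.mark]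
    simp [hz]
  have s23 : τ3.reg 23 = x := by rw [hf3.reg 23 rfl, hf2.reg 23 rfl]; simpa using r23
  have s24 : τ3.reg 24 = f := by rw [hf3.reg 24 rfl, hf2.reg 24 rfl]; simpa using r24
  have s26 : τ3.reg 26 = g := by rw [hf3.reg 26 rfl, hf2.reg 26 rfl]; simpa using r26
  have s27 : τ3.reg 27 = y := by rw [hf3.reg 27 rfl, hf2.reg 27 rfl]; simpa using r27
  have s18 : τ3.reg 18 = v := by rw [hf3.reg 18 rfl, q18]
  have s4 : τ3.reg 4 = a := by rw [hf3.reg 4 rfl, q4]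
  have s5 : τ3.reg 5 = b := by rw [hf3.reg 5 rfl, q5]
  rw [Wp.seq_iff, Wp.assign_iff]
  refine ⟨(by omega : 1 ≤ W), ?_⟩
  rw [Wp.seq_iff]
  -- Register 3 also counts `v`, so a positive difference with `2` says that at least two lower
  -- vertices are present.
  refine Wp.chk (by simp only [Exp.Fits, State.setR_reg, Nat.reduceEqDiff, if_false]; omega) fun c1 hc1 => ?_
  rw [Wp.seq_iff]
  refine Wp.chk (by simp [Exp.Fits, Exp.eval, s23]; have := mk01 x; omega) fun c2 hc2 => ?_
  rw [Wp.seq_iff]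
  refine Wp.chk (by simp [Exp.Fits, Exp.eval, s27]; have := mk01 y; omega) fun c3 hc3 => ?_
  simp only [Exp.eval, Exp.size, State.setR_reg, State.setR_mem, Nat.reduceEqDiff, if_false,
    if_true, s23, s27, q3] at hc1 hc2 hc3 ⊢
  set τ4 := (((τ3.setR 28 1).setR 28 (if A.card + 1 - 2 = 0 then 0 else 1)).setR 28
    (if τ3.mem 9 x = 0 then 0 else if A.card + 1 - 2 = 0 then 0 else 1)).setR 28
    (if τ3.mem 9 y = 0 then 0 else if τ3.mem 9 x = 0 then 0 else
      if A.card + 1 - 2 = 0 then 0 else 1) with hτ4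
  have hE4 : Env I τ4 := (((hE3.setR _ (by norm_num)).setR _ (by norm_num)).setR _
    (by norm_num)).setR _ (by norm_num)
  have hr4 : Rep I a b (insert v A) τ4 := (((hr3.setR _ (by norm_num)).setR _
    (by norm_num)).setR _ (by norm_num)).setR _ (by norm_num)
  have h28 : τ4.reg 28 ≤ 1 ∧ (τ4.reg 28 = 1 ↔ 2 ≤ A.card ∧ x ∈ A ∧ y ∈ A) := by
    have e1 := mkA x hxv
    have e2 := mkA y hyv
    rw [hτ4, State.setR_reg, if_pos rfl]
    by_cases h1 : x ∈ A <;> by_cases h2 : y ∈ A <;> simp only [h1, h2, not_true, not_false_iff,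
      iff_true, iff_false] at e1 e2 <;> simp [e1, e2, h1, h2] <;> split_ifs <;> (simp; omega)
  have p23 : τ4.reg 23 = x := by simp [hτ4, s23]
  have p24 : τ4.reg 24 = f := by simp [hτ4, s24]
  have p26 : τ4.reg 26 = g := by simp [hτ4, s26]
  have p27 : τ4.reg 27 = y := by simp [hτ4, s27]
  have p18 : τ4.reg 18 = v := by simp [hτ4, s18]
  have p4 : τ4.reg 4 = a := by simp [hτ4, s4]
  have p5 : τ4.reg 5 = b := by simp [hτ4, s5]
  clear_value τ4
  rw [Wp.seq_iff]
  refine Wp.forSeg hC v 50 (fun i τ => τ.reg 28 ≤ 1 ∧ (τ.reg 28 = 1 ↔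
      (2 ≤ A.card ∧ x ∈ A ∧ y ∈ A) ∧ ∀ p, I.st v ≤ p → p < i → I.oth (I.inc p) v ∈ A →
        I.Canon f x g y (I.inc p) (I.oth (I.inc p) v))) hE4 p18 hv.1 hv.2 (by decide) rfl rfl
      rfl ?_ ?_ ?_
  · simp only [State.setR_reg, Nat.reduceEqDiff, if_false]
    rw [h28.2]
    refine ⟨h28.1, fun h => ⟨h, fun p h1 h2 => by omega⟩, fun h => h.1⟩
  · intro τ i hi1 hi2 hf' _ _ hEτ hinv
    obtain ⟨a1, a2, a3, a4, a5⟩ := hC.good.seg hv.1 hv.2 hi1 hi2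
    refine (canonBody_spec hC (f := f) (g := g) (x := x) (y := y) (B := insert v A)
      (τ := (τ.setR 10 (I.inc i)).setR 11 (I.oth (I.inc i) v))
      ((hEτ.setR _ (by norm_num)).setR _ (by norm_num))
      (by intro z; rw [State.setR_mem, State.setR_mem, hf'.mem 9 rfl]; exact hr4.mark z)
      (by simp) (by simp) (by simp [hf'.reg 24 rfl, p24]) (by simp [hf'.reg 26 rfl, p26])
      (by simp [hf'.reg 23 rfl, p23]) (by simp [hf'.reg 27 rfl, p27]) hf hg a1 hx hy a3
      (by simpa using hinv)).mono ?_
    intro τ' t _ ⟨⟨h1, h2⟩, h3⟩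
    simp only [State.setR_reg, Nat.reduceEqDiff, if_false]
    refine ⟨⟨h1, h2.trans ?_⟩, by omega⟩
    rw [and_assoc]
    refine and_congr_right fun _ => ?_
    rw [Finset.mem_insert, or_iff_right a4]
    constructor
    · rintro ⟨h4, h5⟩ p p1 p2 p3
      rcases Nat.lt_succ_iff_lt_or_eq.1 p2 with p2 | rfl
      · exact h4 p p1 p2 p3
      · exact h5 p3
    · exact fun h => ⟨fun p p1 p2 p3 => h p p1 (by omega) p3, fun h4 => h i hi1 (by omega) h4⟩
  · intro τ5 t5 hf5 hE5 h28' ht5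
    have hr5 := hr4.frame hf5 rfl rfl rfl rfl rfl rfl
    rw [Wp.seq_iff]
    refine (extend_spec hC (a := a) (b := b) (B := insert v A) hE5 (by rw [hf5.reg 4 rfl, p4])
      (by rw [hf5.reg 5 rfl, p5]) haT hbT hr5 (Finset.insert_nonempty _ _)).mono ?_
    intro τ6 t6 hf6 ⟨K', hg6, hr6, hmn, hmin, ht6⟩
    have hE6 := hE5.frame hf6 (by decide)
    have u18 : τ6.reg 18 = v := by rw [hf6.reg 18 rfl, hf5.reg 18 rfl, p18]
    have u28 : τ6.reg 28 = τ5.reg 28 := hf6.reg 28 rfl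
    rw [Wp.seq_iff]
    refine Wp.chkZ (by simp only [Exp.Fits, u18]; omega) fun c4 hc4 => ?_
    rw [Wp.seq_iff]
    refine (copy_spec hC (src := 7) (sl := 3) (dst := 11) (dl := 22) (B := K')
      (by simpa using hr6.lists) hg6.2.1 (by norm_num) (by norm_num)).mono ?_
    intro τ8 t8 hf8 ⟨hl8, ht8⟩
    have hE8 := (hE6.setR (x := 28) (if Exp.eval τ6 (.sub (.var 18) (.var 17)) = 0 then τ6.reg 28
      else 0) (by norm_num)).frame hf8 (by decide)
    have hr8 := (hr6.setR (x := 28) (if Exp.eval τ6 (.sub (.var 18) (.var 17)) = 0 then τ6.reg 28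
      else 0) (by norm_num)).frame hf8 rfl rfl rfl rfl rfl rfl
    refine (reset_spec hC hE8 hr8).mono ?_
    intro τ9 t9 hf9 ⟨hcl9, ht9⟩
    have v28 : τ9.reg 28 = if v - τ6.reg 17 = 0 then τ5.reg 28 else 0 := by
      rw [hf9.reg 28 rfl, hf8.reg 28 rfl]
      simp [Exp.eval, u18, u28]
    -- Register 17 is the least vertex that the extension has added; it is at least `v` exactly if
    -- no vertex below `v` is new.
    have hlow : v ≤ τ6.reg 17 ↔ ∀ z ∈ K', z < v → z ∈ A := by
      rw [hmin v (by omega)]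
      constructor
      · intro h z hz hzv
        by_contra hc
        have := h z (Finset.mem_sdiff.2 ⟨hz, by rw [Finset.mem_insert, not_or]; exact ⟨hzv.ne, hc⟩⟩)
        omega
      · intro h z hz
        rw [Finset.mem_sdiff, Finset.mem_insert, not_or] at hz
        by_contra hc
        exact hz.2.2 (h z hz.1 (by omega))
    refine ⟨hcl9, ?_, ⟨K', hg6, ?_, ?_⟩, ?_⟩
    · rw [v28]
      split_ifs
      · exact h28'.1
      · omega
    · rw [hf9.mem 11 rfl, hf9.reg 22 rfl]
      exact hl8
    · rw [v28]
      have hiff : (if v - τ6.reg 17 = 0 then τ5.reg 28 else 0) = 1 ↔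
          τ5.reg 28 = 1 ∧ v ≤ τ6.reg 17 := by
        by_cases h : v ≤ τ6.reg 17
        · rw [if_pos (Nat.sub_eq_zero_of_le h)]
          exact ⟨fun h' => ⟨h', h⟩, And.left⟩
        · rw [if_neg (by omega)]
          simp [h]
      rw [hiff, h28'.2, hlow]
      exact ⟨fun ⟨⟨⟨h1, h2, h3⟩, h4⟩, h5⟩ => ⟨h1, h2, h3, h4, h5⟩,
        fun ⟨h1, h2, h3, h4, h5⟩ => ⟨⟨⟨h1, h2, h3⟩, h4⟩, h5⟩⟩
    · simp only [Exp.size] at hc4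
      omega

end RAM

namespace RAM

variable {I : Net} {L W R D : ℕ}

/-- Check that the clique in array 10 is the closure, within its active times, of the vertices
listed in array 11 that are less than the vertex in register 18. -/
def testUp : Cmd :=
  .seq (.assign 4 (.var 20)) <| .seq (.assign 5 (.var 21)) <| .seq (fill 11 22) <|
  .seq (chkZ (.sub (.var 20) (.var 6))) <| .seq (chkZ (.sub (.var 6) (.var 20))) <|
  .seq (chkZ (.sub (.var 21) (.var 7))) <| .seq (chkZ (.sub (.var 7) (.var 21))) <| .seq extend <|
  .seq (forR 12 (.lit 0) (.var 19) (chk (.get 9 (.get 10 (.var 12))))) <|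
  .seq (chkZ (.get 9 (.var 18))) reset

/-- The parent of the candidate is recomputed: its vertices below `v` are closed again, now in the
window of `K`, and the result is compared with `K` in both times and vertices. -/
theorem testUp_spec (hC : Ctx I L W R D) {σ : State} {α β a b v : ℕ} {A K K' : Finset ℕ}
    (hE : Env I σ) (hcl : Clear I σ) (hN : Node I α β K σ) (r18 : σ.reg 18 = v)
    (hv : 1 ≤ v ∧ v ≤ I.n) (r28 : σ.reg 28 = 1) (hL : Lists (σ.mem 11) (σ.reg 22) K')
    (hK' : I.Cliq a b K') (hA : ∀ z, z ∈ A ↔ z ∈ K' ∧ z < v) (hAK : A ⊆ K) (hne : A.Nonempty) :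
    Wp L W testUp σ fun σ' t => Clear I σ' ∧ σ'.reg 28 ≤ 1 ∧
      (σ'.reg 28 = 1 ↔ I.ViaUp α β K v A) ∧ t ≤ 2000 * R := by
  have hLn := hC.L_n
  have hW := hC.W_le
  have hRp := hC.good.R_pos
  have hT := hC.good.T_pos
  have hαβ := hN.le
  have hβT := hN.leT
  rw [testUp, Wp.seq_iff, Wp.assign_iff, Wp.seq_iff, Wp.assign_iff, Wp.seq_iff]
  simp only [Exp.Fits, Exp.eval, Exp.size, State.setR_reg, Nat.reduceEqDiff, if_false, hN.r20,
    hN.r21]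
  refine ⟨by omega, by omega, ?_⟩
  have hE1 : Env I ((σ.setR 4 α).setR 5 β) := (hE.setR _ (by norm_num)).setR _ (by norm_num)
  have hcl1 : Clear I ((σ.setR 4 α).setR 5 β) :=
    (hcl.setR _ (by norm_num) (by norm_num) (by norm_num)).setR _ (by norm_num) (by norm_num)
      (by norm_num)
  refine (fill_spec hC (src := 11) (sl := 22) (a := α) (b := β) (v := v) (B := ∅) (K := K') hE1
    (by simpa using hL) hK' (fun u hu w hw h1 h2 h => hN.cliq.2 u (hAK ((hA u).2 ⟨hu, h1⟩)) w
      (hAK ((hA w).2 ⟨hw, h2⟩)) h) (by simp) (by simp) (by omega) (by omega) (hcl1.rep hT α β)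
    (by simpa using r18) (by omega) (by simp) rfl rfl).mono ?_
  intro τ2 t2 hf2 ⟨hr2, ht2⟩
  have hset : ∅ ∪ fillSet I α β v ∅ K' = A := by
    ext z
    simp [mem_fillSet, hA]
  rw [hset] at hr2
  have hE2 := hE1.frame hf2 (by decide)
  have q20 : τ2.reg 20 = α := by rw [hf2.reg 20 rfl]; simpa using hN.r20
  have q21 : τ2.reg 21 = β := by rw [hf2.reg 21 rfl]; simpa using hN.r21
  have q18 : τ2.reg 18 = v := by rw [hf2.reg 18 rfl]; simpa using r18
  have q28 : τ2.reg 28 = 1 := by rw [hf2.reg 28 rfl]; simpa using r28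
  have q4 : τ2.reg 4 = α := by rw [hf2.reg 4 rfl]; simp
  have q5 : τ2.reg 5 = β := by rw [hf2.reg 5 rfl]; simp
  have hN2 : Node I α β K τ2 :=
    (hN.congr (σ' := (σ.setR 4 α).setR 5 β) rfl (by simp) (by simp) (by simp)).frame hf2 rfl rfl
      rfl rfl
  have q6 := hr2.le6
  have q7 := hr2.le7
  rw [Wp.seq_iff]
  -- Subtraction is truncated, so each of the two equations between end points needs two checks.
  refine Wp.chkZ (by simp only [Exp.Fits]; omega) fun c1 hc1 => ?_
  rw [Wp.seq_iff]
  refine Wp.chkZ (by simp only [Exp.Fits, State.setR_reg, Nat.reduceEqDiff, if_false]; omega)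
    fun c2 hc2 => ?_
  rw [Wp.seq_iff]
  refine Wp.chkZ (by simp only [Exp.Fits, State.setR_reg, Nat.reduceEqDiff, if_false]; omega)
    fun c3 hc3 => ?_
  rw [Wp.seq_iff]
  refine Wp.chkZ (by simp only [Exp.Fits, State.setR_reg, Nat.reduceEqDiff, if_false]; omega)
    fun c4 hc4 => ?_
  simp only [Exp.eval, Exp.size, State.setR_reg, Nat.reduceEqDiff, if_false, if_true, q20, q21,
    q28] at hc1 hc2 hc3 hc4 ⊢
  generalize hτ4 : State.setR _ 28 (if τ2.reg 7 - β = 0 then _ else 0) = τ4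
  have hE4 : Env I τ4 := hτ4 ▸ (((hE2.setR _ (by norm_num)).setR _ (by norm_num)).setR _
    (by norm_num)).setR _ (by norm_num)
  have hr4 : Rep I α β A τ4 := hτ4 ▸ (((hr2.setR _ (by norm_num)).setR _
    (by norm_num)).setR _ (by norm_num)).setR _ (by norm_num)
  have hN4 : Node I α β K τ4 := hN2.congr (by simp [← hτ4]) (by simp [← hτ4]) (by simp [← hτ4])
    (by simp [← hτ4])
  have h28 : τ4.reg 28 ≤ 1 ∧ (τ4.reg 28 = 1 ↔ I.TimeIs A α β) := by
    have h1 : I.TimeIs A α β ↔ τ2.reg 6 = α ∧ τ2.reg 7 = β :=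
      ⟨fun h => h.unique hr2.time hαβ, fun h => h.1 ▸ h.2 ▸ hr2.time⟩
    rw [h1, ← hτ4, State.setR_reg, if_pos rfl]
    split_ifs <;> exact ⟨by omega, fun h => by first | omega | exact absurd h (by decide),
      fun h => by omega⟩
  have p18 : τ4.reg 18 = v := by simp [← hτ4, q18]
  have p4 : τ4.reg 4 = α := by simp [← hτ4, q4]
  have p5 : τ4.reg 5 = β := by simp [← hτ4, q5]
  clear hτ4
  rw [Wp.seq_iff]
  refine (extend_spec hC hE4 p4 p5 (by omega) (by omega) hr4 hne).mono ?_
  intro τ5 t5 hf5 ⟨B, hg, hr5, _, _, ht5⟩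
  have hE5 := hE4.frame hf5 (by decide)
  have hN5 := hN4.frame hf5 rfl rfl rfl rfl
  have u18 : τ5.reg 18 = v := by rw [hf5.reg 18 rfl, p18]
  have u28 : τ5.reg 28 = τ4.reg 28 := hf5.reg 28 rfl
  have hkn : τ5.reg 19 ≤ I.n := hN5.lists.1 ▸ hN5.cliq.card_le
  have hkR : τ5.reg 19 ≤ R := hN5.lists.1 ▸ hC.good.card_le hN5.cliq
  have mk01 : ∀ z, τ5.mem 9 z ≤ 1 := fun z => by rw [hr5.mark]; split_ifs <;> omega
  have mk0 : ∀ z, τ5.mem 9 z = 0 ↔ z ∉ B := fun z => by rw [hr5.mark]; simp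
  rw [Wp.seq_iff]
  refine Wp.forR 0 (τ5.reg 19) 7 (fun i τ => τ.reg 28 ≤ 1 ∧ (τ.reg 28 = 1 ↔ I.TimeIs A α β ∧
    ∀ i' < i, τ5.mem 10 i' ∈ B)) (fun _ _ => 0) rfl (Nat.zero_le _) rfl (Nat.zero_le _) (by omega)
    ?_ ?_ ?_ ?_
  · intro τ hf
    have := hf.reg 19 rfl
    simp only [Exp.Fits, Exp.eval, this, and_true]
    omega
  · simpa [u28] using h28
  · intro τ i _ hi hf hr12 hinv
    have m10 : τ.mem 10 = τ5.mem 10 := hf.mem 10 rfl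
    have m9 : τ.mem 9 = τ5.mem 9 := hf.mem 9 rfl
    have hz := hN5.cliq.1 _ (hN5.lists.mem hi)
    have hz1 := mk01 (τ5.mem 10 i)
    have hz0 := mk0 (τ5.mem 10 i)
    refine Wp.chk (by simp only [Exp.Fits, Exp.eval, hr12, m10, m9]; omega) fun t ht => ?_
    simp only [Exp.eval, Exp.size, State.setR_reg, Nat.reduceEqDiff, if_false, if_true, m10, m9,
      hr12] at ht ⊢
    refine ⟨⟨?_, ?_⟩, by omega⟩
    · split_ifs
      · omega
      · exact hinv.1
    · have hsucc : (∀ i' < i + 1, τ5.mem 10 i' ∈ B) ↔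
          (∀ i' < i, τ5.mem 10 i' ∈ B) ∧ τ5.mem 10 i ∈ B := by
        constructor
        · exact fun h => ⟨fun i' hi' => h i' (by omega), h i (by omega)⟩
        · rintro ⟨h, h'⟩ i' hi'
          rcases Nat.lt_succ_iff_lt_or_eq.1 hi' with h1 | rfl
          · exact h i' h1
          · exact h'
      rw [hsucc, ← and_assoc, ← hinv.2]
      split_ifs with h
      · simp [hz0.1 h]
      · simp [not_not.1 (fun hc => h (hz0.2 hc))]
  · intro τ6 t6 hf6 hinv6 ht6
    have hE6 := hE5.frame hf6 (by decide)
    have hr6 := hr5.frame hf6 rfl rfl rfl rfl rfl rfl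
    have w18 : τ6.reg 18 = v := by rw [hf6.reg 18 rfl, u18]
    have m9 : τ6.mem 9 = τ5.mem 9 := hf6.mem 9 rfl
    have hv1 := mk01 v
    have hv0 := mk0 v
    -- Testing `K ⊆ B` is enough: `K` is maximal in this window and `B` is a clique there, so
    -- inclusion gives equality.
    have hBK : (∀ i' < τ5.reg 19, τ5.mem 10 i' ∈ B) ↔ I.Greedy α β A K := by
      constructor
      · intro h
        have hKB : K ⊆ B := fun z hz => by
          obtain ⟨i, hi, rfl⟩ := hN5.lists.exists hz
          exact h i hi
        have : B ⊆ K := by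
          intro w hw
          by_contra hc
          obtain ⟨z, hz, hzw⟩ := hN.max w hc (hg.2.1.1 w hw).1 (hg.2.1.1 w hw).2
          exact hzw (hg.2.1.2 z (hKB hz) w hw fun h => hc (h ▸ hz))
        rwa [hKB.antisymm this]
      · intro h i hi
        rw [hg.unique h]
        exact hN5.lists.mem hi
    rw [hBK] at hinv6
    rw [Wp.seq_iff]
    refine Wp.chkZ (by simp only [Exp.Fits, Exp.eval, w18, m9]; omega) fun c7 hc7 => ?_
    refine (reset_spec hC (hE6.setR _ (by norm_num)) (hr6.setR _ (by norm_num))).mono ?_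
    intro τ8 t8 hf8 ⟨hcl8, ht8⟩
    have x28 : τ8.reg 28 = if τ5.mem 9 v = 0 then τ6.reg 28 else 0 := by
      rw [hf8.reg 28 rfl]
      simp [Exp.eval, w18, m9]
    have hVia : I.ViaUp α β K v A ↔ (I.TimeIs A α β ∧ I.Greedy α β A K) ∧ v ∉ B := by
      constructor
      · exact fun h => ⟨⟨h.time, h.greedy⟩, by rw [hg.unique h.greedy]; exact h.notMem⟩
      · rintro ⟨⟨h1, h2⟩, h3⟩
        exact ⟨h1, h2, by rw [← hg.unique h2]; exact h3⟩
    refine ⟨hcl8, ?_, ?_, ?_⟩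
    · rw [x28]
      split_ifs
      · exact hinv6.1
      · omega
    · rw [x28, hVia, ← hinv6.2, ← hv0]
      split_ifs with h
      · simp [h]
      · simp [h]
    · simp only [Exp.size] at hc7 ht6
      omega

end RAM

namespace RAM

variable {I : Net} {L W R D : ℕ}

/-- Test the candidate determined by the vertices in registers 23, 18, 27 and the edges in
registers 24, 26. -/
def test : Cmd :=
  .seq (.assign 28 (.lit 0)) <|
  .seq (.assign 37 (.add (.var 20) (.sub (.get 2 (.var 24)) (.var 20)))) <|
  .seq (.assign 38 (.sub (.var 21) (.sub (.var 21) (.get 3 (.var 26))))) <|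
  .ite (.sub (.add (.var 38) (.lit 1)) (.var 37)) (.seq testLow (.ite (.var 28) testUp .skip)) .skip

/-- A cleared flag excludes all `a`, `b` and `K'` at once: the window is determined by the edges `f`
and `g`, and the clique is then determined as a greedy closure. -/
theorem test_spec (hC : Ctx I L W R D) {σ : State} {α β v x f y g : ℕ} {K : Finset ℕ}
    (hE : Env I σ) (hcl : Clear I σ) (hN : Node I α β K σ) (r18 : σ.reg 18 = v)
    (hv : 1 ≤ v ∧ v ≤ I.n) (r23 : σ.reg 23 = x) (r24 : σ.reg 24 = f) (r26 : σ.reg 26 = g)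
    (r27 : σ.reg 27 = y) (hf : f < I.m) (hg : g < I.m) (hx : x ≤ I.n) (hy : y ≤ I.n) (hxv : x ≠ v)
    (hyv : y ≠ v) :
    Wp L W test σ fun σ' t => Clear I σ' ∧ σ'.reg 28 ≤ 1 ∧
      (σ'.reg 28 = 1 → ∃ K', I.Via α β K x f y g v (σ'.reg 37) (σ'.reg 38) K' ∧
        Lists (σ'.mem 11) (σ'.reg 22) K') ∧
      (σ'.reg 28 = 0 → ∀ a b K', ¬ I.Via α β K x f y g v a b K') ∧ t ≤ 5000 * R := by
  have hLn := hC.L_n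
  have hLm := hC.L_m
  have hW := hC.W_le
  have hRp := hC.good.R_pos
  have hβT := hN.leT
  have hαβ := hN.le
  have ef := hC.good.edge f hf
  have eg := hC.good.edge g hg
  simp only [test, Wp.seq_iff, Wp.assign_iff, Wp.ite_iff (c := .seq testLow _), Exp.Fits, Exp.eval,
    Exp.size, State.setR_reg, State.setR_mem, Nat.reduceEqDiff, if_false, if_true, r24, r26,
    hN.r20, hN.r21, hE.m2, hE.m3, Wp.skip_iff]
  -- The machine expresses maximum and minimum by truncated subtraction.
  have ha : α + (I.lo f - α) = max α (I.lo f) := by omega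
  have hb : β - (β - I.hi g) = min β (I.hi g) := by omega
  refine ⟨by omega, by omega, by omega, by omega, fun hle => ?_, fun hle => ?_⟩
  · rw [ha, hb] at hle ⊢
    have h1 := Nat.le_max_left α (I.lo f)
    have h2 := Nat.min_le_left β (I.hi g)
    generalize hma : max α (I.lo f) = a at *
    generalize hmb : min β (I.hi g) = b at *
    have hE1 : Env I (((σ.setR 28 0).setR 37 a).setR 38 b) :=
      ((hE.setR _ (by norm_num)).setR _ (by norm_num)).setR _ (by norm_num)
    have hN1 : Node I α β K (((σ.setR 28 0).setR 37 a).setR 38 b) :=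
      hN.congr rfl (by simp) (by simp) (by simp)
    have hcl1 : Clear I (((σ.setR 28 0).setR 37 a).setR 38 b) :=
      ((hcl.setR _ (by norm_num) (by norm_num) (by norm_num)).setR _ (by norm_num) (by norm_num)
        (by norm_num)).setR _ (by norm_num) (by norm_num) (by norm_num)
    refine (testLow_spec hC hE1 hcl1 hN1 h1 h2 (by omega) (by omega) (by simp) (by simp)
      (by simpa using r18) hv (by simpa using r23) (by simpa using r24) (by simpa using r26)
      (by simpa using r27) hf hg hx hy hxv hyv).mono ?_
    intro τ1 t1 hf1 ⟨hcl2, h28, ⟨K', hg', hl', hiff⟩, ht1⟩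
    have hE2 := hE1.frame hf1 (by decide)
    have hN2 := hN1.frame hf1 rfl rfl rfl rfl
    have q18 : τ1.reg 18 = v := by rw [hf1.reg 18 rfl]; simpa using r18
    have q37 : τ1.reg 37 = a := by rw [hf1.reg 37 rfl]; simp
    have q38 : τ1.reg 38 = b := by rw [hf1.reg 38 rfl]; simp
    refine (Wp.ite_iff (c := testUp)).2 ⟨(by omega : τ1.reg 28 ≤ W), fun h => ?_, fun h => ?_⟩
    · have hlow := hiff.1 (by simp only [Exp.eval] at h; omega)
      refine (testUp_spec hC (A := I.lower a b v K) hE2 hcl2 hN2 q18 hv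
        (by simp only [Exp.eval] at h; omega) hl' hg'.2.1
        (fun z => ⟨fun hz => ⟨hg'.1 (Finset.mem_insert_of_mem hz), (Net.mem_lower.1 hz).2.1⟩,
          fun hz => hlow.low z hz.1 hz.2⟩) (fun z hz => (Net.mem_lower.1 hz).1)
        ⟨x, hlow.x_mem⟩).mono ?_
      intro τ2 t2 hf2 ⟨hcl3, h28', hiff', ht2⟩
      refine ⟨hcl3, h28', fun h1 => ⟨K', ?_, ?_⟩, fun h0 a' b' K'' hVia => ?_, ?_⟩
      · rw [hf2.reg 37 rfl, hf2.reg 38 rfl, q37, q38]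
        exact ⟨hma.symm, hmb.symm, by omega, hg', hlow, hiff'.1 h1⟩
      · rw [hf2.mem 11 rfl, hf2.reg 22 rfl]
        exact hl'
      · have := hiff'.2 (by
          have := hVia.toUp
          rwa [hVia.a_eq, hVia.b_eq, hma, hmb] at this)
        omega
      · simp only [Exp.size]
        omega
    · rw [Wp.skip_iff]
      simp only [Exp.eval] at h
      refine ⟨hcl2, h28, fun h1 => absurd h1 (by omega), fun _ a' b' K'' hVia => ?_, ?_⟩
      · have hlow := hVia.toLow
        have hgr := hVia.greedy
        rw [hVia.a_eq, hVia.b_eq, hma, hmb] at hlow hgr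
        rw [← hg'.unique hgr] at hlow
        have := hiff.2 hlow
        omega
      · simp only [Exp.size]
        omega
  · refine ⟨(((hcl.setR _ (by norm_num) (by norm_num) (by norm_num)).setR _ (by norm_num)
      (by norm_num) (by norm_num)).setR _ (by norm_num) (by norm_num) (by norm_num)), by omega,
      fun h => absurd h (by decide), fun _ a b K' hVia => ?_, by omega⟩
    have h1 := hVia.le
    have h2 := hVia.a_eq
    have h3 := hVia.b_eq
    rw [ha, hb, ← h2, ← h3] at hle
    omega

end RAM

-- Codes of children

namespace Net

variable {I : Net} {R D : ℕ}

variable (I) in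
/-- `K'`, with active times `[a, b]` and index `v`, is a child of `K`, with active times `[α, β]`,
and `c` is the code of the pair of incidences by which it is found. -/
def KidAt (α β : ℕ) (K : Finset ℕ) (c v a b : ℕ) (K' : Finset ℕ) : Prop :=
  ∃ x ∈ K, ∃ p q, I.st x ≤ p ∧ p < I.st (x + 1) ∧ v = I.oth (I.inc p) x ∧ I.st v ≤ q ∧
    q < I.st (v + 1) ∧ c = p * (2 * I.m) + q ∧
    I.Via α β K x (I.inc p) (I.oth (I.inc q) v) (I.inc q) v a b K'

theorem Good.st_le_st (hI : I.Good R D) {v w : ℕ} (hv : 1 ≤ v) (hvw : v ≤ w) (hw : w ≤ I.n + 1) :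
    I.st v ≤ I.st w := by
  induction w, hvw using Nat.le_induction with
  | base => exact le_rfl
  | succ w h ih => exact (ih (by omega)).trans (hI.st_mono w (by omega) (by omega))

/-- The segments of different vertices are disjoint, so a position in the incidence array determines
its vertex. Hence a pair of positions encodes `x`, `v` and both edges. -/
theorem Good.seg_unique (hI : I.Good R D) {v w p : ℕ} (hv : 1 ≤ v ∧ v ≤ I.n) (hw : 1 ≤ w ∧ w ≤ I.n)
    (h1 : I.st v ≤ p) (h2 : p < I.st (v + 1)) (h3 : I.st w ≤ p) (h4 : p < I.st (w + 1)) : v = w := by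
  rcases lt_trichotomy v w with h | h | h
  · have := hI.st_le_st (v := v + 1) (w := w) (by omega) (by omega) (by omega)
    omega
  · exact h
  · have := hI.st_le_st (v := w + 1) (w := v) (by omega) (by omega) (by omega)
    omega

theorem Good.seg_lt (hI : I.Good R D) {v p : ℕ} (hv : 1 ≤ v ∧ v ≤ I.n) (h : p < I.st (v + 1)) :
    p < 2 * I.m := h.trans_le (hI.st_le _ (by omega) (by omega))

theorem code_inj {k p q p' q' : ℕ} (hq : q < k) (hq' : q' < k) (h : p * k + q = p' * k + q') :
    p = p' ∧ q = q' := by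
  have h1 : p = p' := by
    have := congrArg (· / k) h
    simpa [Nat.add_div_of_dvd_right, Nat.div_eq_of_lt hq, Nat.div_eq_of_lt hq',
      Nat.mul_div_cancel _ (by omega : 0 < k)] using this
  subst h1
  exact ⟨rfl, by omega⟩

theorem code_lt {k p q : ℕ} (hp : p < k) (hq : q < k) : p * k + q < k * k := by
  have := Nat.mul_le_mul_right k hp
  rw [Nat.succ_mul] at this
  omega

theorem KidAt.lt (hI : I.Good R D) {α β c v a b : ℕ} {K K' : Finset ℕ} (hK : I.Cliq α β K)
    (h : I.KidAt α β K c v a b K') : c < 2 * I.m * (2 * I.m) := by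
  obtain ⟨x, hx, p, q, h1, h2, h3, h4, h5, rfl, h6⟩ := h
  obtain ⟨_, a1, a2, _⟩ := hI.seg (hK.1 x hx).1 (hK.1 x hx).2 h1 h2
  exact code_lt (hI.seg_lt (hK.1 x hx) h2) (hI.seg_lt (h3 ▸ ⟨a1, a2⟩) h5)

/-- The two digits of the code give the two incidences, these give `x`, `v` and the edges `f` and
`g`, hence the window, and in it the closure is unique. -/
theorem KidAt.unique (hI : I.Good R D) {α β c v a b v' a' b' : ℕ} {K K' K'' : Finset ℕ}
    (hK : I.Cliq α β K) (h : I.KidAt α β K c v a b K') (h' : I.KidAt α β K c v' a' b' K'') :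
    K'' = K' := by
  obtain ⟨x, hx, p, q, h1, h2, rfl, h4, h5, rfl, h6⟩ := h
  obtain ⟨x', hx', p', q', h1', h2', rfl, h4', h5', h7, h6'⟩ := h'
  obtain ⟨_, a1, a2, _⟩ := hI.seg (hK.1 x hx).1 (hK.1 x hx).2 h1 h2
  obtain ⟨_, b1, b2, _⟩ := hI.seg (hK.1 x' hx').1 (hK.1 x' hx').2 h1' h2'
  obtain ⟨rfl, rfl⟩ := code_inj (hI.seg_lt ⟨a1, a2⟩ h5) (hI.seg_lt ⟨b1, b2⟩ h5') h7
  obtain rfl := hI.seg_unique (hK.1 x hx) (hK.1 x' hx') h1 h2 h1' h2'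
  have e1 := h6.a_eq
  have e2 := h6.b_eq
  rw [← h6'.a_eq] at e1
  rw [← h6'.b_eq] at e2
  subst e1 e2
  exact h6'.greedy.unique h6.greedy

end Net

-- The search for the child of least code

namespace RAM

variable {I : Net} {L W R D : ℕ}

/-- Test the candidate given by the incidences in registers 33 and 34, if its code is at least
the one in register 30 and less than the one in register 31, and record it if it is a child. -/
def visit : Cmd :=
  .seq (.assign 26 (.var 10)) <| .seq (.assign 27 (.var 11)) <|
  .seq (.assign 32 (.add (.get 6 (.var 33)) (.var 34))) <|
  .ite (.sub (.var 30) (.var 32)) .skip <| .ite (.sub (.var 31) (.var 32))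
    (.seq test <| .ite (.var 28)
      (.seq (copy 11 22 12 39) <| .seq (.assign 31 (.var 32)) <| .seq (.assign 36 (.var 18)) <|
        .seq (.assign 46 (.var 37)) (.assign 47 (.var 38)))
      .skip)
    .skip

/-- Find the child of least code, this code being at least the one in register 30. -/
def findChild : Cmd :=
  .seq (.assign 31 (.var 42)) <| forR 35 (.lit 0) (.var 19) <|
    .seq (.assign 23 (.get 10 (.var 35))) <| forSeg 33 23 <|
      .seq (.assign 24 (.var 10)) <| .seq (.assign 18 (.var 11)) <| forSeg 34 18 visit

/-- Registers 31, 36, 46, 47 and array 12 describe the child of least code among those whose code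
is in `P` and at least `last`. -/
structure Best (I : Net) (α β : ℕ) (K : Finset ℕ) (last : ℕ) (P : ℕ → Prop) (σ : State) : Prop where
  least : ∀ c, P c → last ≤ c → c < σ.reg 31 → ∀ v a b K', ¬ I.KidAt α β K c v a b K'
  kid : σ.reg 31 = 2 * I.m * (2 * I.m) ∨ (last ≤ σ.reg 31 ∧ ∃ K',
    I.KidAt α β K (σ.reg 31) (σ.reg 36) (σ.reg 46) (σ.reg 47) K' ∧
      Lists (σ.mem 12) (σ.reg 39) K')

theorem Best.congr {α β last : ℕ} {K : Finset ℕ} {P Q : ℕ → Prop} {σ σ' : State}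
    (h : Best I α β K last P σ) (hQ : ∀ c, Q c → P c) (h1 : σ'.reg 31 = σ.reg 31)
    (h2 : σ'.reg 36 = σ.reg 36) (h3 : σ'.reg 46 = σ.reg 46) (h4 : σ'.reg 47 = σ.reg 47)
    (h5 : σ'.reg 39 = σ.reg 39) (h6 : σ'.mem 12 = σ.mem 12) : Best I α β K last Q σ' :=
  ⟨by rw [h1]; exact fun c hc => h.least c (hQ c hc), by rw [h1, h2, h3, h4, h5, h6]; exact h.kid⟩

theorem visit_spec (hC : Ctx I L W R D) {σ : State} {α β x p q v last : ℕ} {K : Finset ℕ}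
    {P : ℕ → Prop} (hE : Env I σ) (hcl : Clear I σ) (hN : Node I α β K σ)
    (hmul : ∀ p < 2 * I.m, σ.mem 6 p = p * (2 * I.m)) (hx : x ∈ K) (hp1 : I.st x ≤ p)
    (hp2 : p < I.st (x + 1)) (hv : v = I.oth (I.inc p) x) (hq1 : I.st v ≤ q)
    (hq2 : q < I.st (v + 1)) (r33 : σ.reg 33 = p) (r34 : σ.reg 34 = q) (r23 : σ.reg 23 = x)
    (r24 : σ.reg 24 = I.inc p) (r18 : σ.reg 18 = v) (r10 : σ.reg 10 = I.inc q)
    (r11 : σ.reg 11 = I.oth (I.inc q) v) (r30 : σ.reg 30 = last)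
    (hlast : last ≤ 2 * I.m * (2 * I.m)) (hB : Best I α β K last P σ) :
    Wp L W visit σ fun σ' t => (Clear I σ' ∧
      Best I α β K last (fun c => P c ∨ c = p * (2 * I.m) + q) σ') ∧ t ≤ 5100 * R := by
  have hLn := hC.L_n
  have hLm := hC.L_m
  have hW := hC.W_le
  have hRp := hC.good.R_pos
  have hxn := hN.cliq.1 x hx
  obtain ⟨a1, a2, a3, a4, a5⟩ := hC.good.seg hxn.1 hxn.2 hp1 hp2
  rw [← hv] at a2 a3 a4
  obtain ⟨b1, b2, b3, b4, b5⟩ := hC.good.seg a2 a3 hq1 hq2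
  have hpm := hC.good.seg_lt hxn hp2
  have hqm := hC.good.seg_lt ⟨a2, a3⟩ hq2
  have hcode := Net.code_lt hpm hqm
  have hsq : 2 * I.m * (2 * I.m) = 4 * (I.m * I.m) := by ring
  have h31 : σ.reg 31 ≤ 2 * I.m * (2 * I.m) := by
    rcases hB.kid with h | ⟨_, K', h, _⟩
    · exact h.le
    · exact (h.lt hC.good hN.cliq).le
  have hcode' : p * (2 * I.m) ≤ p * (2 * I.m) + q := Nat.le_add_right _ _
  generalize hc : p * (2 * I.m) + q = code at *
  -- Any child with this code is found by this very pair of incidences, so the outcome of a single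
  -- test settles the code.
  have hnew : ∀ v' a' b' K', I.KidAt α β K code v' a' b' K' →
      I.Via α β K x (I.inc p) (I.oth (I.inc q) v) (I.inc q) v a' b' K' := by
    rintro v' a' b' K' ⟨x', hx', p', q', h1, h2, rfl, h4, h5, h6, h7⟩
    obtain ⟨_, c2, c3, _⟩ := hC.good.seg (hN.cliq.1 x' hx').1 (hN.cliq.1 x' hx').2 h1 h2
    obtain ⟨rfl, rfl⟩ := Net.code_inj hqm (hC.good.seg_lt ⟨c2, c3⟩ h5) (hc.trans h6)
    obtain rfl := hC.good.seg_unique hxn (hN.cliq.1 x' hx') hp1 hp2 h1 h2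
    rwa [hv]
  have hm6 := hmul p hpm
  simp only [visit, Wp.seq_iff (d := .seq _ (.seq _ (.ite _ _ _))),
    Wp.seq_iff (d := .seq _ (.ite _ _ _)), Wp.seq_iff (d := .ite (.sub (.var 30) (.var 32)) _ _),
    Wp.ite_iff (e := .sub _ _), Wp.assign_iff, Wp.skip_iff, Exp.Fits, Exp.eval, Exp.size,
    State.setR_reg, State.setR_mem, Nat.reduceEqDiff, if_false, if_true, r10, r11, r33, r34, r30,
    hm6, hc]
  have hbase : ∀ (Q : ℕ → Prop) y1 y2 y3, Best I α β K last Q σ →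
      Best I α β K last Q (((σ.setR 26 y1).setR 27 y2).setR 32 y3) :=
    fun Q y1 y2 y3 h => h.congr (fun _ h => h) (by simp) (by simp) (by simp) (by simp) (by simp) rfl
  have hcl1 : ∀ y1 y2 y3, Clear I (((σ.setR 26 y1).setR 27 y2).setR 32 y3) := fun y1 y2 y3 =>
    ((hcl.setR _ (by norm_num) (by norm_num) (by norm_num)).setR _ (by norm_num) (by norm_num)
      (by norm_num)).setR _ (by norm_num) (by norm_num) (by norm_num)
  refine ⟨by omega, by omega, by omega, by omega, fun h1 => ⟨⟨hcl1 _ _ _, hbase _ _ _ _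
    ⟨fun c hc' h2 => hc'.elim (fun h => hB.least c h h2) (by omega), hB.kid⟩⟩, by omega⟩,
    fun h1 => ⟨by omega, fun h2 => ?_, fun h2 => ⟨⟨hcl1 _ _ _, hbase _ _ _ _
    ⟨fun c hc' h2 h3 => hc'.elim (fun h => hB.least c h h2 h3) (by omega), hB.kid⟩⟩, by omega⟩⟩⟩
  rw [Wp.seq_iff]
  have hE1 : Env I (((σ.setR 26 (I.inc q)).setR 27 (I.oth (I.inc q) v)).setR 32 code) :=
    ((hE.setR _ (by norm_num)).setR _ (by norm_num)).setR _ (by norm_num)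
  refine (test_spec hC hE1 (hcl1 _ _ _) (hN.congr rfl (by simp) (by simp) (by simp))
    (by simpa using r18) ⟨a2, a3⟩ (by simpa using r23) (by simpa using r24) (by simp) (by simp) a1
    b1 hxn.2 b3 (fun h => a4 h.symm) b4).mono ?_
  intro τ1 t1 hf1 ⟨hcl2, h28, hyes, hno, ht1⟩
  have hE2 := hE1.frame hf1 (by decide)
  have q31 : τ1.reg 31 = σ.reg 31 := by rw [hf1.reg 31 rfl]; simp
  have q32 : τ1.reg 32 = code := by rw [hf1.reg 32 rfl]; simp
  have q18 : τ1.reg 18 = v := by rw [hf1.reg 18 rfl]; simpa using r18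
  rw [Wp.ite_iff, Wp.skip_iff]
  refine ⟨(by omega : τ1.reg 28 ≤ W), fun h3 => ?_, fun h3 => ?_⟩
  · obtain ⟨K', hVia, hl⟩ := hyes (by simp only [Exp.eval] at h3; omega)
    have hT : τ1.reg 38 ≤ I.T := by
      have := hVia.b_eq
      have := hN.leT
      omega
    have hab := hVia.le
    rw [Wp.seq_iff]
    refine (copy_spec hC hl hVia.greedy.2.1 (by norm_num) (by norm_num)).mono ?_
    intro τ2 t2 hf2 ⟨hl2, ht2⟩
    have s32 : τ2.reg 32 = code := by rw [hf2.reg 32 rfl, q32]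
    have s18 : τ2.reg 18 = v := by rw [hf2.reg 18 rfl, q18]
    have s37 : τ2.reg 37 = τ1.reg 37 := hf2.reg 37 rfl
    have s38 : τ2.reg 38 = τ1.reg 38 := hf2.reg 38 rfl
    simp only [Wp.seq_iff, Wp.assign_iff, Exp.Fits, Exp.eval, Exp.size, State.setR_reg,
      Nat.reduceEqDiff, if_false, s32, s18, s37, s38]
    refine ⟨by omega, by omega, by omega, by omega, ⟨?_, ?_⟩, by omega⟩
    · refine ⟨?_, ?_, ?_, ?_, ?_⟩
      · simpa [hf2.reg 3 rfl] using hcl2.r3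
      · simpa [hf2.reg 6 rfl] using hcl2.r6
      · simpa [hf2.reg 7 rfl] using hcl2.r7
      · simpa [hf2.mem 8 rfl] using hcl2.m8
      · simpa [hf2.mem 9 rfl] using hcl2.m9
    · constructor
      · simp only [State.setR_reg, Nat.reduceEqDiff, if_false, if_true]
        exact fun c hc' h4 h5 => hc'.elim (fun h => hB.least c h h4 (by omega)) (by omega)
      · simp only [State.setR_reg, Nat.reduceEqDiff, if_false, if_true]
        exact Or.inr ⟨by omega, K', ⟨x, hx, p, q, hp1, hp2, hv, hq1, hq2, hc.symm, hVia⟩, hl2⟩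
  · refine ⟨⟨hcl2, ?_⟩, ?_⟩
    · constructor
      · rw [q31]
        intro c hc' h4 h5
        rcases hc' with h | rfl
        · exact hB.least c h h4 h5
        · exact fun v' a' b' K' hk => hno h3 a' b' K' (hnew v' a' b' K' hk)
      · rw [hf1.reg 31 rfl, hf1.reg 36 rfl, hf1.reg 46 rfl, hf1.reg 47 rfl, hf1.reg 39 rfl,
          hf1.mem 12 rfl]
        simpa using hB.kid
    · simp only [Exp.size]
      omega

end RAM

namespace RAM

variable {I : Net} {L W R D : ℕ}

theorem visitAll_spec (hC : Ctx I L W R D) {σ : State} {α β x p v last : ℕ} {K : Finset ℕ}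
    {P : ℕ → Prop} (hE : Env I σ) (hcl : Clear I σ) (hN : Node I α β K σ)
    (hmul : ∀ p < 2 * I.m, σ.mem 6 p = p * (2 * I.m)) (hx : x ∈ K) (hp1 : I.st x ≤ p)
    (hp2 : p < I.st (x + 1)) (hv : v = I.oth (I.inc p) x) (r33 : σ.reg 33 = p)
    (r23 : σ.reg 23 = x) (r24 : σ.reg 24 = I.inc p) (r18 : σ.reg 18 = v) (r30 : σ.reg 30 = last)
    (hlast : last ≤ 2 * I.m * (2 * I.m)) (hB : Best I α β K last P σ) :
    Wp L W (forSeg 34 18 visit) σ fun σ' t => (Clear I σ' ∧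
      Best I α β K last (fun c => P c ∨ ∃ q, I.st v ≤ q ∧ q < I.st (v + 1) ∧
        c = p * (2 * I.m) + q) σ') ∧ t ≤ 5124 * (R * D) + 12 := by
  have hRp := hC.good.R_pos
  have hxn := hN.cliq.1 x hx
  obtain ⟨a1, a2, a3, a4, a5⟩ := hC.good.seg hxn.1 hxn.2 hp1 hp2
  rw [← hv] at a2 a3 a4
  refine Wp.forSeg hC v (5100 * R) (fun i τ => Clear I τ ∧ Best I α β K last
    (fun c => P c ∨ ∃ q, I.st v ≤ q ∧ q < i ∧ c = p * (2 * I.m) + q) τ) hE r18 a2 a3 (by decide)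
    rfl rfl rfl ?_ ?_ ?_
  · refine ⟨hcl.setR _ (by norm_num) (by norm_num) (by norm_num), hB.congr ?_ (by simp) (by simp)
      (by simp) (by simp) (by simp) rfl⟩
    rintro c (h | ⟨q, h1, h2, _⟩)
    · exact h
    · omega
  · intro τ i hi1 hi2 hf r34 _ hEτ ⟨hclτ, hBτ⟩
    refine (visit_spec hC (α := α) (β := β) (x := x) (p := p) (q := i) (v := v) (last := last)
      (K := K) ((hEτ.setR _ (by norm_num)).setR _ (by norm_num))
      ((hclτ.setR _ (by norm_num) (by norm_num) (by norm_num)).setR _ (by norm_num) (by norm_num)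
        (by norm_num)) ((hN.frame hf rfl rfl rfl rfl).congr rfl (by simp) (by simp) (by simp))
      (by simpa [hf.mem 6 rfl] using hmul) hx hp1 hp2 hv hi1 hi2
      (by simpa [hf.reg 33 rfl] using r33) (by simpa using r34)
      (by simpa [hf.reg 23 rfl] using r23) (by simpa [hf.reg 24 rfl] using r24)
      (by simpa [hf.reg 18 rfl] using r18) (by simp) (by simp)
      (by simpa [hf.reg 30 rfl] using r30) hlast
      (hBτ.congr (fun _ h => h) (by simp) (by simp) (by simp) (by simp) (by simp) rfl)).mono ?_
    intro τ' t _ ⟨⟨h1, h2⟩, h3⟩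
    refine ⟨⟨h1.setR _ (by norm_num) (by norm_num) (by norm_num), h2.congr ?_ (by simp) (by simp)
      (by simp) (by simp) (by simp) rfl⟩, h3⟩
    rintro c (h | ⟨q, h4, h5, h6⟩)
    · exact Or.inl (Or.inl h)
    · rcases Nat.lt_succ_iff_lt_or_eq.1 h5 with h7 | rfl
      · exact Or.inl (Or.inr ⟨q, h4, h7, h6⟩)
      · exact Or.inr h6
  · intro τ t hf _ hinv ht
    refine ⟨hinv, ht.trans ?_⟩
    have h1 := Nat.mul_le_mul (show 5100 * R + 24 ≤ 5124 * R by omega) (hC.good.deg_le v a2 a3)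
    rw [Nat.mul_assoc] at h1
    omega

theorem visitVertex_spec (hC : Ctx I L W R D) {σ : State} {α β x last : ℕ} {K : Finset ℕ}
    {P : ℕ → Prop} (hE : Env I σ) (hcl : Clear I σ) (hN : Node I α β K σ)
    (hmul : ∀ p < 2 * I.m, σ.mem 6 p = p * (2 * I.m)) (hx : x ∈ K) (r23 : σ.reg 23 = x)
    (r30 : σ.reg 30 = last) (hlast : last ≤ 2 * I.m * (2 * I.m)) (hB : Best I α β K last P σ) :
    Wp L W (forSeg 33 23 (.seq (.assign 24 (.var 10)) <| .seq (.assign 18 (.var 11)) <|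
      forSeg 34 18 visit)) σ fun σ' t => (Clear I σ' ∧
      Best I α β K last (fun c => P c ∨ ∃ p q, I.st x ≤ p ∧ p < I.st (x + 1) ∧
        I.st (I.oth (I.inc p) x) ≤ q ∧ q < I.st (I.oth (I.inc p) x + 1) ∧
        c = p * (2 * I.m) + q) σ') ∧ t ≤ (5124 * (R * D) + 40) * I.deg x + 12 := by
  have hLn := hC.L_n
  have hW := hC.W_le
  have hxn := hN.cliq.1 x hx
  refine Wp.forSeg hC x (5124 * (R * D) + 16) (fun i τ => Clear I τ ∧ Best I α β K last
    (fun c => P c ∨ ∃ p q, I.st x ≤ p ∧ p < i ∧ I.st (I.oth (I.inc p) x) ≤ q ∧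
      q < I.st (I.oth (I.inc p) x + 1) ∧ c = p * (2 * I.m) + q) τ) hE r23 hxn.1 hxn.2 (by decide)
    rfl rfl rfl ?_ ?_ ?_
  · refine ⟨hcl.setR _ (by norm_num) (by norm_num) (by norm_num), hB.congr ?_ (by simp) (by simp)
      (by simp) (by simp) (by simp) rfl⟩
    rintro c (h | ⟨p, q, h1, h2, _⟩)
    · exact h
    · omega
  · intro τ i hi1 hi2 hf r33 _ hEτ ⟨hclτ, hBτ⟩
    obtain ⟨a1, a2, a3, a4, a5⟩ := hC.good.seg hxn.1 hxn.2 hi1 hi2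
    simp only [Wp.seq_iff, Wp.assign_iff, Exp.Fits, Exp.eval, Exp.size, State.setR_reg,
      Nat.reduceEqDiff, if_false, if_true]
    refine ⟨by omega, by omega, ?_⟩
    generalize hτ' : ((((τ.setR 10 (I.inc i)).setR 11 (I.oth (I.inc i) x)).setR 24
      (I.inc i)).setR 18 (I.oth (I.inc i) x)) = τ'
    have hm : τ'.mem = τ.mem := by rw [← hτ']; rfl
    have hr : ∀ y, y ≠ 10 → y ≠ 11 → y ≠ 24 → y ≠ 18 → τ'.reg y = τ.reg y := by
      intro y h1 h2 h3 h4
      simp [← hτ', h1, h2, h3, h4]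
    refine (visitAll_spec hC (α := α) (β := β) (x := x) (p := i) (last := last) (K := K)
      (σ := τ') (hτ' ▸ (((hEτ.setR _ (by norm_num)).setR _ (by norm_num)).setR _
        (by norm_num)).setR _ (by norm_num))
      (hτ' ▸ (((hclτ.setR _ (by norm_num) (by norm_num) (by norm_num)).setR _ (by norm_num)
        (by norm_num) (by norm_num)).setR _ (by norm_num) (by norm_num) (by norm_num)).setR _
        (by norm_num) (by norm_num) (by norm_num))
      ((hN.frame hf rfl rfl rfl rfl).congr (by rw [hm]) (hr _ (by decide) (by decide) (by decide)
        (by decide)) (hr _ (by decide) (by decide) (by decide) (by decide)) (hr _ (by decide)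
        (by decide) (by decide) (by decide))) (by simpa [hm, hf.mem 6 rfl] using hmul) hx hi1 hi2
      rfl ((hr _ (by decide) (by decide) (by decide) (by decide)).trans r33)
      ((hr _ (by decide) (by decide) (by decide) (by decide)).trans ((hf.reg 23 rfl).trans r23))
      (by simp [← hτ']) (by simp [← hτ'])
      ((hr _ (by decide) (by decide) (by decide) (by decide)).trans ((hf.reg 30 rfl).trans r30))
      hlast (hBτ.congr (fun _ h => h) (hr _ (by decide) (by decide) (by decide) (by decide))
        (hr _ (by decide) (by decide) (by decide) (by decide))
        (hr _ (by decide) (by decide) (by decide) (by decide))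
        (hr _ (by decide) (by decide) (by decide) (by decide))
        (hr _ (by decide) (by decide) (by decide) (by decide)) (by rw [hm]))).mono ?_
    intro τ'' t _ ⟨⟨h1, h2⟩, h3⟩
    refine ⟨⟨h1.setR _ (by norm_num) (by norm_num) (by norm_num), h2.congr ?_ (by simp) (by simp)
      (by simp) (by simp) (by simp) rfl⟩, by omega⟩
    rintro c (h | ⟨p, q, h4, h5, h6⟩)
    · exact Or.inl (Or.inl h)
    · rcases Nat.lt_succ_iff_lt_or_eq.1 h5 with h7 | rfl
      · exact Or.inl (Or.inr ⟨p, q, h4, h7, h6⟩)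
      · exact Or.inr ⟨q, h6⟩
  · intro τ t hf _ hinv ht
    exact ⟨hinv, by omega⟩

/-- The pairs of incidences number at most the degree sum of `K` times the maximum degree, that is
`R * D`, and each is tested in `O(R)`. Searching for the least code from `last` on replaces a stored
list of children: one number suffices to resume the loop. -/
theorem findChild_spec (hC : Ctx I L W R D) {σ : State} {α β last : ℕ} {K : Finset ℕ}
    (hE : Env I σ) (hcl : Clear I σ) (hN : Node I α β K σ)
    (hmul : ∀ p < 2 * I.m, σ.mem 6 p = p * (2 * I.m)) (r30 : σ.reg 30 = last)
    (r42 : σ.reg 42 = 2 * I.m * (2 * I.m)) (hlast : last ≤ 2 * I.m * (2 * I.m)) :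
    Wp L W findChild σ fun σ' t => Clear I σ' ∧ Best I α β K last (fun _ => True) σ' ∧
      t ≤ 5300 * (R * R * D) := by
  have hLn := hC.L_n
  have hLm := hC.L_m
  have hW := hC.W_le
  have hRp := hC.good.R_pos
  have hDp := hC.good.D_pos
  have hk : σ.reg 19 ≤ I.n := hN.lists.1 ▸ hN.cliq.card_le
  have hkR : σ.reg 19 ≤ R := hN.lists.1 ▸ hC.good.card_le hN.cliq
  have hsq : 2 * I.m * (2 * I.m) = 4 * (I.m * I.m) := by ring
  generalize hA : 5124 * (R * D) + 12 = A
  rw [findChild, Wp.seq_iff, Wp.assign_iff]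
  simp only [Exp.Fits, Exp.eval, Exp.size, r42]
  refine ⟨by omega, ?_⟩
  refine Wp.forR 0 (σ.reg 19) 20 (fun i τ => Clear I τ ∧ Best I α β K last
      (fun c => ∃ i' < i, ∃ p q, I.st (σ.mem 10 i') ≤ p ∧ p < I.st (σ.mem 10 i' + 1) ∧
        I.st (I.oth (I.inc p) (σ.mem 10 i')) ≤ q ∧
        q < I.st (I.oth (I.inc p) (σ.mem 10 i') + 1) ∧ c = p * (2 * I.m) + q) τ)
    (fun i _ => (A + 28) * ∑ j ∈ Finset.Ico i (σ.reg 19), I.deg (σ.mem 10 j)) rfl (Nat.zero_le _)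
    rfl (Nat.zero_le _) (by omega) ?_ ?_ ?_ ?_
  · intro τ hf
    have := hf.reg 19 rfl
    simp only [Exp.Fits, Exp.eval, this]
    simp
    omega
  · refine ⟨(hcl.setR _ (by norm_num) (by norm_num) (by norm_num)).setR _ (by norm_num)
      (by norm_num) (by norm_num), ⟨?_, Or.inl (by simp)⟩⟩
    rintro c ⟨i', hi', _⟩
    omega
  · intro τ i _ hi hf r35 ⟨hclτ, hB⟩
    have hE' := (hE.setR (x := 31) (2 * I.m * (2 * I.m)) (by norm_num)).frame hf (by decide)
    have hN' := (hN.setR (x := 31) (2 * I.m * (2 * I.m)) (by norm_num) (by norm_num)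
      (by norm_num)).frame hf rfl rfl rfl rfl
    have m10 : τ.mem 10 = σ.mem 10 := hf.mem 10 rfl
    have m6 : τ.mem 6 = σ.mem 6 := hf.mem 6 rfl
    have s30 : τ.reg 30 = last := by rw [hf.reg 30 rfl]; simpa using r30
    have hx := hN.lists.mem hi
    have hxn := hN.cliq.1 _ hx
    rw [Wp.seq_iff, Wp.assign_iff]
    simp only [Exp.Fits, Exp.eval, Exp.size, r35, m10]
    refine ⟨by omega, ?_⟩
    have hsum := Finset.sum_eq_sum_Ico_succ_bot hi fun j => I.deg (σ.mem 10 j)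
    refine (visitVertex_spec hC (hE'.setR _ (by norm_num))
      (hclτ.setR _ (by norm_num) (by norm_num) (by norm_num))
      (hN'.setR _ (by norm_num) (by norm_num) (by norm_num)) (by simpa [m6] using hmul) hx (by simp)
      (by simpa using s30) hlast (hB.congr (fun _ h => h) (by simp) (by simp) (by simp) (by simp)
      (by simp) rfl)).mono ?_
    intro τ' t _ ⟨⟨h1, h2⟩, h3⟩
    refine ⟨⟨h1.setR _ (by norm_num) (by norm_num) (by norm_num), h2.congr ?_ (by simp) (by simp)
      (by simp) (by simp) (by simp) rfl⟩, ?_⟩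
    · rintro c ⟨i', hi', h⟩
      rcases Nat.lt_succ_iff_lt_or_eq.1 hi' with h7 | rfl
      · exact Or.inl ⟨i', h7, h⟩
      · exact Or.inr h
    · rw [hsum, Nat.mul_add]
      have : 5124 * (R * D) + 40 = A + 28 := by omega
      rw [this] at h3
      omega
  · intro τ t hf ⟨hclτ, hB⟩ ht
    refine ⟨hclτ, ⟨fun c _ h1 h2 v a b K' hk => hB.least c ?_ h1 h2 v a b K' hk, hB.kid⟩, ?_⟩
    · obtain ⟨x, hx, p, q, h3, h4, rfl, h5, h6, h7, _⟩ := hk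
      obtain ⟨i, hi, rfl⟩ := hN.lists.exists hx
      exact ⟨i, hi, p, q, h3, h4, h5, h6, h7⟩
    · have hsum : ∑ j ∈ Finset.Ico 0 (σ.reg 19), I.deg (σ.mem 10 j) ≤ R := by
        rw [← Finset.range_eq_Ico, hN.lists.sum_eq]
        exact hC.good.sum_deg_le α β K hN.cliq
      have h1 := Nat.mul_le_mul_left (A + 28) hsum
      have h2 : (A + 28) * R = 5124 * (R * R * D) + 40 * R := by
        rw [← hA]
        ring
      have h3 : R ≤ R * R * D := by
        rw [Nat.mul_assoc]
        exact Nat.le_mul_of_pos_right R (Nat.mul_pos hRp hDp)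
      simp only [Exp.size] at ht
      omega

end RAM

/-- The words `w` list the edges of the complete graph on `K`, and then an end mark. -/
def Words (K : Finset ℕ) (w : List ℕ) : Prop :=
  ∃ es : List (ℕ × ℕ), (es.map fun p => s(p.1, p.2)).Nodup ∧
    (∀ e, e ∈ (es.map fun p => s(p.1, p.2)) ↔ ¬ e.IsDiag ∧ ∀ v ∈ e, v ∈ K) ∧
    w = (es.flatMap fun p => [p.1, p.2]) ++ [0]

-- Output of a clique

namespace RAM

variable {I : Net} {L W R D : ℕ}

/-- Write the clique in array 10 to the output. -/
def emitK : Cmd :=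
  .seq (forR 12 (.lit 0) (.var 19) <| forR 13 (.add (.var 12) (.lit 1)) (.var 19) <|
    .seq (.emit (.get 10 (.var 12))) (.emit (.get 10 (.var 13)))) (.emit (.lit 0))

theorem sym2_eq_iff_of_injOn {f : ℕ → ℕ} {k : ℕ} (hf : Set.InjOn f (Finset.range k)) {i j i' j' : ℕ}
    (h1 : i < j) (h2 : j < k) (h3 : i' < j') (h4 : j' < k) (h : s(f i, f j) = s(f i', f j')) :
    i = i' ∧ j = j' := by
  have hi : ∀ {a b}, a < k → b < k → f a = f b → a = b := fun ha hb hab =>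
    hf (by simpa using ha) (by simpa using hb) hab
  rcases Sym2.eq_iff.1 h with ⟨h5, h6⟩ | ⟨h5, h6⟩
  · exact ⟨hi (h1.trans h2) (h3.trans h4) h5, hi h2 h4 h6⟩
  · have := hi (h1.trans h2) h4 h5
    have := hi h2 (h3.trans h4) h6
    omega

/-- The list of `K` has at most `R` entries without repetitions, so the pairs of positions `i < j`
give each edge once, in time `O(R²)`. -/
theorem emitK_spec (hC : Ctx I L W R D) {σ : State} {α β : ℕ} {K : Finset ℕ}
    (hN : Node I α β K σ) :
    Wp L W emitK σ fun σ' t => (∃ w, Words K w ∧ σ'.out = σ.out ++ w) ∧ t ≤ 50 * (R * R) := by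
  have hLn := hC.L_n
  have hW := hC.W_le
  have hRp := hC.good.R_pos
  have hk : σ.reg 19 ≤ I.n := hN.lists.1 ▸ hN.cliq.card_le
  have hkR : σ.reg 19 ≤ R := hN.lists.1 ▸ hC.good.card_le hN.cliq
  have hinj := hN.lists.injOn
  have hmem : ∀ i < σ.reg 19, 1 ≤ σ.mem 10 i ∧ σ.mem 10 i ≤ I.n := fun i hi =>
    hN.cliq.1 _ (hN.lists.mem hi)
  set k := σ.reg 19 with hkd
  set f := σ.mem 10 with hfd
  let Out (S : Sym2 ℕ → Prop) (τ : State) : Prop := ∃ es : List (ℕ × ℕ),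
    (es.map fun p => s(p.1, p.2)).Nodup ∧ (∀ e, e ∈ (es.map fun p => s(p.1, p.2)) ↔ S e) ∧
    τ.out = σ.out ++ es.flatMap fun p => [p.1, p.2]
  rw [emitK, Wp.seq_iff]
  refine Wp.forR 0 k (14 * R + 10) (fun i τ => Out (fun e => ∃ i' j', i' < i ∧ i' < j' ∧ j' < k ∧
    e = s(f i', f j')) τ) (fun _ _ => 0) rfl (Nat.zero_le _) rfl (Nat.zero_le _) (by omega) ?_ ?_
    ?_ ?_
  · intro τ hf
    have := hf.reg 19 rfl
    simp only [Exp.Fits, Exp.eval, this, ← hkd, and_true]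
    omega
  · exact ⟨[], by simp, by simp, by simp⟩
  · intro τ i _ hi hf r12 hO
    have m10 : τ.mem 10 = f := hf.mem 10 rfl
    have r19 : τ.reg 19 = k := hf.reg 19 rfl
    refine Wp.forR (i + 1) k 6 (fun j τ' => Out (fun e => (∃ i' j', i' < i ∧ i' < j' ∧ j' < k ∧
      e = s(f i', f j')) ∨ ∃ j', i < j' ∧ j' < j ∧ e = s(f i, f j')) τ') (fun _ _ => 0) rfl ?_ ?_
      (by omega) (by omega) ?_ ?_ ?_ ?_
    · simp only [Exp.Fits, Exp.eval, r12]
      omega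
    · simp only [Exp.eval, r12]
    · intro τ' hf'
      have := hf'.reg 19 rfl
      simp only [Exp.Fits, Exp.eval, this, r19, and_true]
      omega
    · obtain ⟨es, h1, h2, h3⟩ := hO
      refine ⟨es, h1, fun e => ?_, h3⟩
      refine (h2 e).trans (or_iff_left ?_).symm
      rintro ⟨j', h4, h5, _⟩
      omega
    · rintro τ' j hj1 hj2 hf' r13 ⟨es, h1, h2, h3⟩
      have m10' : τ'.mem 10 = f := (hf'.mem 10 rfl).trans m10
      have r12' : τ'.reg 12 = i := (hf'.reg 12 rfl).trans r12
      have hi1 := hmem i (by omega)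
      have hj1 := hmem j (by omega)
      simp only [Wp.seq_iff, Wp.emit_iff, Exp.Fits, Exp.eval, Exp.size, State.push_reg,
        State.push_mem, m10', r12', r13, add_zero, zero_add]
      refine ⟨by omega, by omega, ⟨es ++ [(f i, f j)], ?_, ?_, ?_⟩, by omega⟩
      · rw [List.map_append, List.nodup_append]
        refine ⟨h1, by simp, ?_⟩
        intro e he e' he' hee
        simp only [List.map_cons, List.map_nil, List.mem_singleton] at he'
        rw [h2, hee, he'] at he
        rcases he with ⟨i', j', h4, h5, h6, h7⟩ | ⟨j', h4, h5, h6⟩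
        · have := sym2_eq_iff_of_injOn hinj (by omega) hj2 h5 h6 h7
          omega
        · have := sym2_eq_iff_of_injOn hinj (by omega) hj2 h4 (by omega) h6
          omega
      · intro e
        rw [List.map_append, List.mem_append, h2]
        simp only [List.map_cons, List.map_nil, List.mem_singleton, or_assoc]
        refine or_congr_right ?_
        constructor
        · rintro (⟨j', h4, h5, h6⟩ | h4)
          · exact ⟨j', h4, by omega, h6⟩
          · exact ⟨j, by omega, by omega, h4⟩
        · rintro ⟨j', h4, h5, h6⟩
          rcases Nat.lt_succ_iff_lt_or_eq.1 h5 with h7 | rfl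
          · exact Or.inl ⟨j', h4, h7, h6⟩
          · exact Or.inr h6
      · simp [h3]
    · rintro τ' t hf' ⟨es, h1, h2, h3⟩ ht
      refine ⟨⟨es, h1, fun e => ?_, h3⟩, ?_⟩
      · rw [h2]
        constructor
        · rintro (⟨i', j', h4, h5, h6, h7⟩ | ⟨j', h4, h5, h6⟩)
          · exact ⟨i', j', by omega, h5, h6, h7⟩
          · exact ⟨i, j', by omega, h4, h5, h6⟩
        · rintro ⟨i', j', h4, h5, h6, h7⟩
          rcases Nat.lt_succ_iff_lt_or_eq.1 h4 with h8 | rfl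
          · exact Or.inl ⟨i', j', h8, h5, h6, h7⟩
          · exact Or.inr ⟨j', h5, h6, h7⟩
      · simp only [Exp.size] at ht
        omega
  · rintro τ t hf ⟨es, h1, h2, h3⟩ ht
    rw [Wp.emit_iff]
    refine ⟨Nat.zero_le _, ⟨_, ⟨es, h1, fun e => ?_, rfl⟩, ?_⟩, ?_⟩
    · rw [h2]
      induction e using Sym2.ind with
      | _ u w =>
        simp only [Sym2.mk_isDiag_iff, Sym2.mem_iff, forall_eq_or_imp, forall_eq]
        constructor
        · rintro ⟨i, j, h4, h5, h6, h7⟩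
          have hij : f i ≠ f j := fun h => by
            have := hinj (by simp; omega) (by simpa using h6) h
            omega
          rcases Sym2.eq_iff.1 h7 with ⟨rfl, rfl⟩ | ⟨rfl, rfl⟩
          · exact ⟨hij, hN.lists.mem h4, hN.lists.mem h6⟩
          · exact ⟨hij.symm, hN.lists.mem h6, hN.lists.mem h4⟩
        · rintro ⟨h4, h5, h6⟩
          obtain ⟨i, hi, rfl⟩ := hN.lists.exists h5
          obtain ⟨j, hj, rfl⟩ := hN.lists.exists h6
          rcases lt_trichotomy i j with h | rfl | h
          · exact ⟨i, j, hi, h, hj, rfl⟩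
          · exact absurd rfl h4
          · exact ⟨j, i, hj, h, hi, Sym2.eq_swap⟩
    · simp [Exp.eval, h3]
    · have h4 : (14 * R + 10 + (Exp.var 19).size + 7) * (k - 0) ≤ (32 * R) * R := by
        refine Nat.mul_le_mul ?_ (by omega)
        simp only [Exp.size]
        omega
      have h5 : 32 * R * R = 32 * (R * R) := Nat.mul_assoc _ _ _
      have h6 : 1 ≤ R * R := Nat.mul_pos hRp hRp
      simp only [Exp.size] at ht h4 ⊢
      omega

end RAM

-- The family tree in terms of vertex sets and windows

namespace Net

variable {I : Net} {R D : ℕ}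

variable (I) in
/-- `K` is a maximal set of vertices that are pairwise joined by edges active throughout `[α, β]`,
and `[α, β]` is the set of active times of `K`. -/
structure Sat (α β : ℕ) (K : Finset ℕ) : Prop where
  cliq : I.Cliq α β K
  max : ∀ w ∉ K, 1 ≤ w → w ≤ I.n → ∃ z ∈ K, ¬ I.H α β z w
  time : I.TimeIs K α β
  le : α ≤ β
  leT : β ≤ I.T

variable (I) in
/-- `K` is not the closure, within its active times, of a nonempty set of vertices less than `i`. -/
def Gen (i α β : ℕ) (K : Finset ℕ) : Prop :=
  ∀ A : Finset ℕ, A.Nonempty → I.TimeIs A α β → I.Greedy α β A K → ∃ z ∈ A, i ≤ z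

variable (I) in
/-- The exploration of the children of `K` of codes at least `c`, and of their descendants, lists
the cliques in `out`. -/
inductive KidsOut : ℕ → ℕ → Finset ℕ → ℕ → List (Finset ℕ) → Prop
  | nil (α β K c) : (∀ c', c ≤ c' → ∀ v a b K', ¬ I.KidAt α β K c' v a b K') →
      KidsOut α β K c []
  | cons (α β K c c' v a b K' out out') : c ≤ c' → I.KidAt α β K c' v a b K' →
      (∀ c'', c ≤ c'' → c'' < c' → ∀ v a b K', ¬ I.KidAt α β K c'' v a b K') →
      KidsOut a b K' 0 out → KidsOut α β K (c' + 1) out' →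
      KidsOut α β K c (K' :: (out ++ out'))

theorem Greedy.max {a b : ℕ} {A B : Finset ℕ} (h : I.Greedy a b A B) :
    ∀ w ∉ B, 1 ≤ w → w ≤ I.n → ∃ z ∈ B, ¬ I.H a b z w := fun w hw h1 h2 => by
  obtain ⟨z, hz, hz', _⟩ := h.2.2 w hw h1 h2
  exact ⟨z, hz, hz'⟩

/-- An edge of a network is determined by its endpoints. -/
theorem Good.edge_unique (hI : I.Good R D) {i j : ℕ} (hi : i < I.m) (hj : j < I.m)
    (h : (I.eu i = I.eu j ∧ I.ev i = I.ev j) ∨ (I.eu i = I.ev j ∧ I.ev i = I.eu j)) : i = j := by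
  have := hI.edge i hi
  have := hI.edge j hj
  refine hI.simple i hi j hj ?_ ?_ <;> omega

theorem Cliq.edge (hI : I.Good R D) {a b j : ℕ} {B : Finset ℕ} (h : I.Cliq a b B) (hj : j < I.m)
    (hu : I.eu j ∈ B) (hv : I.ev j ∈ B) : I.lo j ≤ a ∧ b ≤ I.hi j := by
  have := hI.edge j hj
  obtain ⟨i, hi, h1, h2, h3⟩ := h.2 _ hu _ hv (by omega)
  obtain rfl := hI.edge_unique hi hj h1
  exact ⟨h2, h3⟩

theorem TimeIs.bounds {a b : ℕ} {B : Finset ℕ} (h : I.TimeIs B a b) (hab : a ≤ b) :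
    1 ≤ a ∧ b ≤ I.T := by
  have h1 := ((h a).1 ⟨le_rfl, hab⟩).1
  have h2 := ((h b).1 ⟨hab, le_rfl⟩).1
  omega

theorem TimeIs.anti {a b a' b' : ℕ} {A B : Finset ℕ} (h : I.TimeIs A a b) (h' : I.TimeIs B a' b')
    (hAB : A ⊆ B) (hab : a' ≤ b') : a ≤ a' ∧ b' ≤ b := by
  have key : ∀ t, a' ≤ t ∧ t ≤ b' → a ≤ t ∧ t ≤ b := fun t ht =>
    (h t).2 ⟨((h' t).1 ht).1, fun j hj h1 h2 => ((h' t).1 ht).2 j hj (hAB h1) (hAB h2)⟩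
  exact ⟨(key a' ⟨le_rfl, hab⟩).1, (key b' ⟨hab, le_rfl⟩).2⟩

/-- What `KidAt` says about the vertices. -/
theorem KidAt.via {α β c v a b : ℕ} {K K' : Finset ℕ} (h : I.KidAt α β K c v a b K') :
    ∃ x p y q, I.Via α β K x (I.inc p) y (I.inc q) v a b K' ∧ x ∈ K ∧ I.st x ≤ p ∧
      p < I.st (x + 1) ∧ v = I.oth (I.inc p) x ∧ I.st v ≤ q ∧ q < I.st (v + 1) ∧
      y = I.oth (I.inc q) v := by
  obtain ⟨x, hx, p, q, h1, h2, h3, h4, h5, _, h6⟩ := h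
  exact ⟨x, p, _, q, h6, hx, h1, h2, h3, h4, h5, rfl⟩

theorem KidAt.toUp {α β c v a b : ℕ} {K K' : Finset ℕ} (h : I.KidAt α β K c v a b K') :
    I.ViaUp α β K v (I.lower a b v K) := by
  obtain ⟨_, _, _, _, h, _⟩ := h.via
  exact h.toUp

theorem KidAt.lower_eq {α β c v a b : ℕ} {K K' : Finset ℕ} (h : I.KidAt α β K c v a b K') (z : ℕ) :
    z ∈ I.lower a b v K ↔ z ∈ K' ∧ z < v := by
  obtain ⟨_, _, _, _, h, _⟩ := h.via
  exact ⟨fun hz => ⟨h.greedy.1 (Finset.mem_insert_of_mem hz), (mem_lower.1 hz).2.1⟩,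
    fun hz => h.toLow.low z hz.1 hz.2⟩

theorem KidAt.lower_nonempty {α β c v a b : ℕ} {K K' : Finset ℕ}
    (h : I.KidAt α β K c v a b K') : (I.lower a b v K).Nonempty := by
  obtain ⟨x, _, _, _, h, _⟩ := h.via
  exact ⟨x, h.toLow.x_mem⟩

theorem KidAt.le {α β c v a b : ℕ} {K K' : Finset ℕ} (h : I.KidAt α β K c v a b K') :
    α ≤ a ∧ a ≤ b ∧ b ≤ β := by
  obtain ⟨x, _, _, _, h, _⟩ := h.via
  have h1 := h.a_eq
  have h2 := h.b_eq
  have h3 := h.le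
  omega

theorem KidAt.v_mem {α β c v a b : ℕ} {K K' : Finset ℕ} (h : I.KidAt α β K c v a b K') :
    v ∈ K' := by
  obtain ⟨x, _, _, _, h, _⟩ := h.via
  exact h.greedy.1 (Finset.mem_insert_self _ _)

/-- All edges within `K'` span `[a, b]`. Conversely, the lower vertices confine the times to `[α,
β]`, and the edges `f` and `g` at `v` cut this down to `[a, b]`. -/
theorem KidAt.timeIs (hI : I.Good R D) {α β c v a b : ℕ} {K K' B : Finset ℕ} (hK : I.Sat α β K)
    (h : I.KidAt α β K c v a b K') (h1 : insert v (I.lower a b v K) ⊆ B) (h2 : B ⊆ K') :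
    I.TimeIs B a b := by
  have hle := h.le
  have hb := hK.time.bounds hK.le
  obtain ⟨x, p, y, q, hV, hx, p1, p2, hv, q1, q2, hy⟩ := h.via
  have hxn := hK.cliq.1 x hx
  obtain ⟨a1, a2, a3, a4, a5⟩ := hI.seg hxn.1 hxn.2 p1 p2
  rw [← hv] at a2 a3 a4 a5
  obtain ⟨b1, b2, b3, b4, b5⟩ := hI.seg a2 a3 q1 q2
  rw [← hy] at b5
  have hxB := h1 (Finset.mem_insert_of_mem hV.toLow.x_mem)
  have hyB := h1 (Finset.mem_insert_of_mem hV.toLow.y_mem)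
  have hvB := h1 (Finset.mem_insert_self _ _)
  intro t
  constructor
  · intro ht
    refine ⟨by omega, fun j hj hu hv' => ?_⟩
    have := hV.greedy.2.1.edge hI hj (h2 hu) (h2 hv')
    omega
  · rintro ⟨ht, hall⟩
    have e1 : α ≤ t ∧ t ≤ β := (hV.toUp.time t).2 ⟨ht, fun j hj hu hv' =>
      hall j hj (h1 (Finset.mem_insert_of_mem hu)) (h1 (Finset.mem_insert_of_mem hv'))⟩
    have e2 : I.lo (I.inc p) ≤ t ∧ t ≤ I.hi (I.inc p) := by
      refine hall _ a1 ?_ ?_ <;> rcases a5 with ⟨h3, h4⟩ | ⟨h3, h4⟩ <;>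
        first | (rw [h3]; assumption) | (rw [h4]; assumption)
    have e3 : I.lo (I.inc q) ≤ t ∧ t ≤ I.hi (I.inc q) := by
      refine hall _ b1 ?_ ?_ <;> rcases b5 with ⟨h3, h4⟩ | ⟨h3, h4⟩ <;>
        first | (rw [h3]; assumption) | (rw [h4]; assumption)
    have h3 := hV.a_eq
    have h4 := hV.b_eq
    omega

/-- Children are again maximal in their own windows, so the invariant of a node is inherited along
the search. -/
theorem KidAt.sat (hI : I.Good R D) {α β c v a b : ℕ} {K K' : Finset ℕ} (hK : I.Sat α β K)
    (h : I.KidAt α β K c v a b K') : I.Sat a b K' := by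
  have hle := h.le
  have hb := hK.leT
  obtain ⟨_, _, _, _, hV, _⟩ := h.via
  exact ⟨hV.greedy.2.1, hV.greedy.max, h.timeIs hI hK hV.greedy.1 subset_rfl, by omega, by omega⟩

/-- If vertices below `v` generated `K'` with the times of `K'`, the windows of `K` and `K'` would
coincide, and both would be closures of the lower vertices. By uniqueness they would be equal,
although `v` lies only in `K'`. This is the lower bound for the index, in a form that the search can
carry along. -/
theorem KidAt.gen {α β c v a b : ℕ} {K K' : Finset ℕ} (hK : I.Sat α β K)
    (h : I.KidAt α β K c v a b K') : I.Gen v a b K' := by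
  intro A hne hA hg
  by_contra! hlt
  have hle := h.le
  have hsub : A ⊆ I.lower a b v K := fun z hz => (h.lower_eq z).2 ⟨hg.1 hz, hlt z hz⟩
  have hUp := h.toUp
  have h1 := hA.anti hUp.time hsub hK.le
  obtain ⟨rfl, rfl⟩ : a = α ∧ b = β := by omega
  have hg' : I.Greedy a b A K := by
    refine ⟨hsub.trans hUp.greedy.1, hUp.greedy.2.1, fun w hw h1 h2 => ?_⟩
    have hKK : I.Greedy a b (I.lower a b v K) K' := by
      refine ⟨fun z hz => ((h.lower_eq z).1 hz).1, hg.2.1, fun w hw h1 h2 => ?_⟩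
      obtain ⟨z, hz, hz1, hz2⟩ := hg.2.2 w hw h1 h2
      exact ⟨z, hz, hz1, hz2.imp_left fun h => hsub h⟩
    have := hUp.greedy.unique hKK
    exact absurd (this ▸ h.v_mem) hUp.notMem
  exact hUp.notMem (hg'.unique hg ▸ h.v_mem)

/-- The lower vertices of the child generate `K`, so one of them is at least `i`; all of them are
below `v`. Hence indices grow strictly along a branch, which bounds the height of the stack. -/
theorem KidAt.lt_index {i α β c v a b : ℕ} {K K' : Finset ℕ} (hG : I.Gen i α β K)
    (h : I.KidAt α β K c v a b K') : i < v := by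
  have hUp := h.toUp
  obtain ⟨z, hz, hiz⟩ := hG _ h.lower_nonempty hUp.time hUp.greedy
  have := ((h.lower_eq z).1 hz).2
  omega

theorem KidAt.v_le {α β c v a b : ℕ} {K K' : Finset ℕ} (h : I.KidAt α β K c v a b K') :
    1 ≤ v ∧ v ≤ I.n := by
  obtain ⟨_, _, _, _, hV, _⟩ := h.via
  exact hV.greedy.2.1.1 v h.v_mem

end Net

-- The stack of the search

namespace RAM

variable {I : Net} {L W R D : ℕ}

/-- Descend to the child described by registers 31, 36, 46, 47 and array 12. -/
def push : Cmd :=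
  .seq (.put 13 (.var 40) (.add (.var 31) (.lit 1))) <| .seq (.put 14 (.var 40) (.var 36)) <|
  .seq (.put 15 (.var 40) (.var 20)) <| .seq (.put 16 (.var 40) (.var 21)) <|
  .seq (.assign 40 (.add (.var 40) (.lit 1))) <| .seq (copy 12 39 10 19) <|
  .seq (.assign 20 (.var 46)) <| .seq (.assign 21 (.var 47)) <| .seq (.assign 30 (.lit 0)) emitK

/-- Return to the parent, which is computed anew. -/
def pop : Cmd :=
  .seq (.assign 40 (.sub (.var 40) (.lit 1))) <| .seq (copy 10 19 11 22) <|
  .seq (.assign 20 (.get 15 (.var 40))) <| .seq (.assign 21 (.get 16 (.var 40))) <|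
  .seq (.assign 18 (.get 14 (.var 40))) <| .seq (.assign 4 (.var 20)) <|
  .seq (.assign 5 (.var 21)) <| .seq (fill 11 22) <| .seq extend <| .seq (copy 7 3 10 19) <|
  .seq reset (.assign 30 (.get 13 (.var 40)))

/-- One step of the depth-first search. -/
def step : Cmd :=
  .seq findChild <| .ite (.sub (.var 42) (.var 31)) push <| .ite (.var 40) pop (.assign 41 (.lit 0))

/-- The depth-first search is at the node `K`, at depth `d`, and the children of codes less than
`c` have been explored. -/
structure At (I : Net) (α β : ℕ) (K : Finset ℕ) (d c : ℕ) (σ : State) : Prop where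
  env : Env I σ
  clear : Clear I σ
  node : Node I α β K σ
  mul : ∀ p < 2 * I.m, σ.mem 6 p = p * (2 * I.m)
  r30 : σ.reg 30 = c
  r40 : σ.reg 40 = d
  r41 : σ.reg 41 = 1
  r42 : σ.reg 42 = 2 * I.m * (2 * I.m)

/-- The stacks agree below depth `d`. -/
def SameStack (d : ℕ) (σ σ' : State) : Prop :=
  ∀ i < d, σ'.mem 13 i = σ.mem 13 i ∧ σ'.mem 14 i = σ.mem 14 i ∧ σ'.mem 15 i = σ.mem 15 i ∧
    σ'.mem 16 i = σ.mem 16 i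

theorem Node.sat {α β : ℕ} {K : Finset ℕ} {σ : State} (h : Node I α β K σ) : I.Sat α β K :=
  ⟨h.cliq, h.max, h.time, h.le, h.leT⟩

/-- `K` has no children of codes at least `c`. -/
def _root_.Net.Done (I : Net) (α β : ℕ) (K : Finset ℕ) (c : ℕ) : Prop :=
  ∀ c', c ≤ c' → ∀ v a b K', ¬ I.KidAt α β K c' v a b K'

/-- The level left behind records the code `c' + 1` at which its loop resumes, the index of the
child and the interval of the parent, but no clique; the stack therefore takes linear space. -/
theorem push_spec (hC : Ctx I L W R D) {σ : State} {α β c d c' v a b : ℕ} {K K' : Finset ℕ}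
    (hσ : At I α β K d c σ) (hd : d < I.n) (hkid : I.KidAt α β K c' v a b K')
    (r31 : σ.reg 31 = c') (r36 : σ.reg 36 = v) (r46 : σ.reg 46 = a) (r47 : σ.reg 47 = b)
    (hl : Lists (σ.mem 12) (σ.reg 39) K') :
    Wp L W push σ fun σ' t => At I a b K' (d + 1) 0 σ' ∧ SameStack d σ σ' ∧
      (σ'.mem 13 d = c' + 1 ∧ σ'.mem 14 d = v ∧ σ'.mem 15 d = α ∧ σ'.mem 16 d = β) ∧
      (∃ w, Words K' w ∧ σ'.out = σ.out ++ w) ∧ t ≤ 120 * (R * R) := by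
  have hLn := hC.L_n
  have hW := hC.W_le
  have hRp := hC.good.R_pos
  have hsq : 2 * I.m * (2 * I.m) = 4 * (I.m * I.m) := by ring
  have hc' := hkid.lt hC.good hσ.node.cliq
  have hs := hkid.sat hC.good hσ.node.sat
  have hle := hkid.le
  have hβ := hσ.node.leT
  have hvn := hkid.v_le
  have hRR : R ≤ R * R := Nat.le_mul_of_pos_left R hRp
  simp only [push, Wp.seq_iff (c := .put _ _ _), Wp.seq_iff (c := .assign 40 _), Wp.put_iff,
    Wp.assign_iff, Exp.Fits, Exp.eval, Exp.size, State.setM_reg, hσ.r40, r31, r36, hσ.node.r20,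
    hσ.node.r21]
  refine ⟨by omega, by omega, by omega, by omega, by omega, by omega, by omega, by omega, by omega,
    by omega, by omega, by omega, by omega, ?_⟩
  generalize hτ : ((((σ.setM 13 d (c' + 1)).setM 14 d v).setM 15 d α).setM 16 d β).setR 40
    (d + 1) = τ
  have hr : ∀ x, x ≠ 40 → τ.reg x = σ.reg x := fun x hx => by simp [← hτ, hx]
  have hm : ∀ x, x ≠ 13 → x ≠ 14 → x ≠ 15 → x ≠ 16 → τ.mem x = σ.mem x :=
    fun x h1 h2 h3 h4 => by simp [← hτ, h1, h2, h3, h4]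
  have r40 : τ.reg 40 = d + 1 := by simp [← hτ]
  have hstack : SameStack d σ τ := by
    intro i hi
    simp [← hτ, Function.update_of_ne hi.ne]
  have hcell : τ.mem 13 d = c' + 1 ∧ τ.mem 14 d = v ∧ τ.mem 15 d = α ∧ τ.mem 16 d = β := by
    simp [← hτ]
  have ho : τ.out = σ.out := by simp [← hτ]
  have hE : Env I τ := ⟨(hr _ (by decide)).trans hσ.env.r0, (hr _ (by decide)).trans hσ.env.r1,
    (hr _ (by decide)).trans hσ.env.r2, by rw [hm _ (by decide) (by decide) (by decide) (by decide)]; exact hσ.env.m0,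
    by rw [hm _ (by decide) (by decide) (by decide) (by decide)]; exact hσ.env.m1,
    by rw [hm _ (by decide) (by decide) (by decide) (by decide)]; exact hσ.env.m2,
    by rw [hm _ (by decide) (by decide) (by decide) (by decide)]; exact hσ.env.m3,
    by rw [hm _ (by decide) (by decide) (by decide) (by decide)]; exact hσ.env.m4,
    by rw [hm _ (by decide) (by decide) (by decide) (by decide)]; exact hσ.env.m5⟩
  clear hτ
  rw [Wp.seq_iff]
  refine (copy_spec hC (src := 12) (sl := 39) (dst := 10) (dl := 19) (σ := τ) (B := K')
    (by rw [hm _ (by decide) (by decide) (by decide) (by decide), hr _ (by decide)]; exact hl)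
    hs.cliq (by decide) (by decide)).mono ?_
  intro τ1 t1 hf1 ⟨hl1, ht1⟩
  have q46 : τ1.reg 46 = a := by rw [hf1.reg 46 rfl, hr _ (by decide), r46]
  have q47 : τ1.reg 47 = b := by rw [hf1.reg 47 rfl, hr _ (by decide), r47]
  simp only [Wp.seq_iff (d := .seq _ (.seq _ emitK)), Wp.seq_iff (d := .seq _ emitK),
    Wp.seq_iff (d := emitK), Wp.assign_iff, Exp.Fits, Exp.eval, Exp.size, State.setR_reg, q46,
    Nat.reduceEqDiff, if_false, q47]
  refine ⟨by omega, by omega, by omega, ?_⟩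
  have hE1 := ((((hE.frame hf1 (by decide)).setR (x := 20) a (by decide)).setR (x := 21) b
    (by decide)).setR (x := 30) 0 (by decide))
  have hN : Node I a b K' (((τ1.setR 20 a).setR 21 b).setR 30 0) :=
    ⟨by simpa using hl1, hs.cliq, hs.max, hs.time, hs.le, hs.leT, by simp, by simp⟩
  refine (emitK_spec hC hN).mono ?_
  intro τ2 t2 hf2 ⟨⟨w, hw, ho2⟩, ht2⟩
  refine ⟨⟨hE1.frame hf2 (by decide), ?_, hN.frame hf2 rfl rfl rfl rfl, ?_, ?_, ?_, ?_, ?_⟩, ?_, ?_,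
    ⟨w, hw, ?_⟩, by omega⟩
  · have := hσ.clear
    refine ⟨?_, ?_, ?_, ?_, ?_⟩
    · rw [hf2.reg 3 rfl]
      simpa [hf1.reg 3 rfl, hr 3 (by decide)] using this.r3
    · rw [hf2.reg 6 rfl]
      simpa [hf1.reg 6 rfl, hr 6 (by decide)] using this.r6
    · rw [hf2.reg 7 rfl]
      simpa [hf1.reg 7 rfl, hr 7 (by decide)] using this.r7
    · rw [hf2.mem 8 rfl]
      simpa [hf1.mem 8 rfl, hm 8 (by decide)] using this.m8
    · rw [hf2.mem 9 rfl]
      simpa [hf1.mem 9 rfl, hm 9 (by decide)] using this.m9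
  · rw [hf2.mem 6 rfl]
    simpa [hf1.mem 6 rfl, hm 6 (by decide)] using hσ.mul
  · rw [hf2.reg 30 rfl]
    simp
  · rw [hf2.reg 40 rfl]
    simpa [hf1.reg 40 rfl] using r40
  · rw [hf2.reg 41 rfl]
    simpa [hf1.reg 41 rfl, hr 41 (by decide)] using hσ.r41
  · rw [hf2.reg 42 rfl]
    simpa [hf1.reg 42 rfl, hr 42 (by decide)] using hσ.r42
  · intro i hi
    rw [hf2.mem 13 rfl, hf2.mem 14 rfl, hf2.mem 15 rfl, hf2.mem 16 rfl]
    simpa [hf1.mem 13 rfl, hf1.mem 14 rfl, hf1.mem 15 rfl, hf1.mem 16 rfl] using hstack i hi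
  · rw [hf2.mem 13 rfl, hf2.mem 14 rfl, hf2.mem 15 rfl, hf2.mem 16 rfl]
    simpa [hf1.mem 13 rfl, hf1.mem 14 rfl, hf1.mem 15 rfl, hf1.mem 16 rfl] using hcell
  · rw [ho2]
    simp [hf1.out rfl, ho]

/-- The parent is not stored. It is the closure, in its own window, of the vertices of the child
below the index `v`, and the stack supplies just this window and `v`. -/
theorem pop_spec (hC : Ctx I L W R D) {σ : State} {α β c d c' v a b : ℕ} {A K K' : Finset ℕ}
    (hσ : At I a b K' (d + 1) c σ) (hd : d < I.n) (hK : I.Sat α β K) (hg : I.Greedy α β A K)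
    (hA : ∀ z, z ∈ A ↔ z ∈ K' ∧ z < v) (hne : A.Nonempty) (hv : v ≤ I.n)
    (hc' : c' ≤ 2 * I.m * (2 * I.m)) (h13 : σ.mem 13 d = c')
    (h14 : σ.mem 14 d = v) (h15 : σ.mem 15 d = α) (h16 : σ.mem 16 d = β) :
    Wp L W pop σ fun σ' t => At I α β K d c' σ' ∧ SameStack (d + 1) σ σ' ∧ σ'.out = σ.out ∧
      t ≤ 1000 * R := by
  have hLn := hC.L_n
  have hW := hC.W_le
  have hRp := hC.good.R_pos
  have hsq : 2 * I.m * (2 * I.m) = 4 * (I.m * I.m) := by ring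
  have hβ := hK.leT
  have hle := hK.le
  have hk : σ.reg 19 ≤ I.n := hσ.node.lists.1 ▸ hσ.node.cliq.card_le
  simp only [pop, Wp.seq_iff (c := .assign 40 _), Wp.assign_iff (x := 40), Exp.Fits, Exp.eval,
    Exp.size, hσ.r40]
  refine ⟨by omega, ?_⟩
  rw [Wp.seq_iff]
  have e40 : d + 1 - 1 = d := rfl
  rw [e40]
  refine (copy_spec hC (src := 10) (sl := 19) (dst := 11) (dl := 22) (σ := σ.setR 40 d) (B := K')
    (by simpa using hσ.node.lists) hσ.node.cliq (by decide) (by decide)).mono ?_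
  intro τ1 t1 hf1 ⟨hl1, ht1⟩
  have q40 : τ1.reg 40 = d := by rw [hf1.reg 40 rfl]; simp
  have m13 : τ1.mem 13 = σ.mem 13 := hf1.mem 13 rfl
  have m14 : τ1.mem 14 = σ.mem 14 := hf1.mem 14 rfl
  have m15 : τ1.mem 15 = σ.mem 15 := hf1.mem 15 rfl
  have m16 : τ1.mem 16 = σ.mem 16 := hf1.mem 16 rfl
  simp only [Wp.seq_iff (c := .assign _ _), Wp.assign_iff (x := 20), Wp.assign_iff (x := 21),
    Wp.assign_iff (x := 18), Wp.assign_iff (x := 4), Wp.assign_iff (x := 5), Exp.Fits, Exp.eval,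
    Exp.size, State.setR_reg, State.setR_mem, q40, m14, m15, m16, h14, h15, h16, Nat.reduceEqDiff,
    if_false, if_true]
  refine ⟨by omega, by omega, by omega, by omega, by omega, ?_⟩
  generalize hτ : ((((τ1.setR 20 α).setR 21 β).setR 18 v).setR 4 α).setR 5 β = τ
  have hE1 := (hσ.env.setR (x := 40) d (by decide)).frame hf1 (by decide)
  have hE2 : Env I τ := hτ ▸ ((((hE1.setR _ (by decide)).setR _ (by decide)).setR _
    (by decide)).setR _ (by decide)).setR _ (by decide)
  have hr : ∀ x, x ≠ 20 → x ≠ 21 → x ≠ 18 → x ≠ 4 → x ≠ 5 → τ.reg x = τ1.reg x :=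
    fun x h1 h2 h3 h4 h5 => by simp [← hτ, h1, h2, h3, h4, h5]
  have hm : τ.mem = τ1.mem := by rw [← hτ]; rfl
  have ho : τ.out = σ.out := by rw [← hτ]; exact hf1.out rfl
  have hcl : Clear I τ := by
    have := hσ.clear
    refine ⟨?_, ?_, ?_, ?_, ?_⟩
    · rw [hr 3 (by decide) (by decide) (by decide) (by decide) (by decide), hf1.reg 3 rfl]
      simpa using this.r3
    · rw [hr 6 (by decide) (by decide) (by decide) (by decide) (by decide), hf1.reg 6 rfl]
      simpa using this.r6
    · rw [hr 7 (by decide) (by decide) (by decide) (by decide) (by decide), hf1.reg 7 rfl]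
      simpa using this.r7
    · rw [hm, hf1.mem 8 rfl]
      exact this.m8
    · rw [hm, hf1.mem 9 rfl]
      exact this.m9
  have p20 : τ.reg 20 = α := by simp [← hτ]
  have p21 : τ.reg 21 = β := by simp [← hτ]
  have p18 : τ.reg 18 = v := by simp [← hτ]
  have p4 : τ.reg 4 = α := by simp [← hτ]
  have p5 : τ.reg 5 = β := by simp [← hτ]
  clear hτ
  have hAK : ∀ z ∈ K', z < v → z ∈ K := fun z hz hzv => hg.1 ((hA z).2 ⟨hz, hzv⟩)
  rw [Wp.seq_iff]
  refine (fill_spec hC (src := 11) (sl := 22) (a := α) (b := β) (v := v) (B := ∅) (K := K')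
    hE2 (by rw [hm, hr 22 (by decide) (by decide) (by decide) (by decide) (by decide)]; exact hl1)
    hσ.node.cliq (fun u hu w hw h1 h2 h => hK.cliq.2 u (hAK u hu h1) w (hAK w hw h2) h) p4 p5
    (by omega) (by omega) (hcl.rep hC.good.T_pos α β) p18 (by omega) (by simp) rfl rfl).mono ?_
  intro τ2 t2 hf2 ⟨hr2, ht2⟩
  have hset : ∅ ∪ fillSet I α β v ∅ K' = A := by
    ext z
    simp [mem_fillSet, hA]
  rw [hset] at hr2
  have hE3 := hE2.frame hf2 (by decide)
  rw [Wp.seq_iff]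
  refine (extend_spec hC (a := α) (b := β) hE3 (by rw [hf2.reg 4 rfl, p4])
    (by rw [hf2.reg 5 rfl, p5]) (by omega) (by omega) hr2 hne).mono ?_
  intro τ3 t3 hf3 ⟨B, hgB, hr3, _, _, ht3⟩
  obtain rfl := hg.unique hgB
  have hE4 := hE3.frame hf3 (by decide)
  rw [Wp.seq_iff]
  refine (copy_spec hC (src := 7) (sl := 3) (dst := 10) (dl := 19) hr3.lists hK.cliq (by decide)
    (by decide)).mono ?_
  intro τ4 t4 hf4 ⟨hl4, ht4⟩
  have hE5 := hE4.frame hf4 (by decide)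
  rw [Wp.seq_iff]
  refine (reset_spec hC hE5 (hr3.frame hf4 rfl rfl rfl rfl rfl rfl)).mono ?_
  intro τ5 t5 hf5 ⟨hcl5, ht5⟩
  have hE6 := hE5.frame hf5 (by decide)
  have u40 : τ5.reg 40 = d := by
    rw [hf5.reg 40 rfl, hf4.reg 40 rfl, hf3.reg 40 rfl, hf2.reg 40 rfl,
      hr 40 (by decide) (by decide) (by decide) (by decide) (by decide), q40]
  have n13 : τ5.mem 13 = σ.mem 13 := by
    rw [hf5.mem 13 rfl, hf4.mem 13 rfl, hf3.mem 13 rfl, hf2.mem 13 rfl, hm, m13]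
  have n14 : τ5.mem 14 = σ.mem 14 := by
    rw [hf5.mem 14 rfl, hf4.mem 14 rfl, hf3.mem 14 rfl, hf2.mem 14 rfl, hm, m14]
  have n15 : τ5.mem 15 = σ.mem 15 := by
    rw [hf5.mem 15 rfl, hf4.mem 15 rfl, hf3.mem 15 rfl, hf2.mem 15 rfl, hm, m15]
  have n16 : τ5.mem 16 = σ.mem 16 := by
    rw [hf5.mem 16 rfl, hf4.mem 16 rfl, hf3.mem 16 rfl, hf2.mem 16 rfl, hm, m16]
  rw [Wp.assign_iff]
  simp only [Exp.Fits, Exp.eval, Exp.size, u40, n13, h13]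
  refine ⟨by omega, ⟨hE6.setR _ (by decide), hcl5.setR _ (by decide) (by decide) (by decide),
    ⟨?_, hK.cliq, hK.max, hK.time, hK.le, hK.leT, ?_, ?_⟩, ?_, by simp, by simpa using u40, ?_, ?_⟩,
    ?_, ?_, by omega⟩
  · rw [State.setR_mem, State.setR_reg, if_neg (by decide), hf5.mem 10 rfl, hf5.reg 19 rfl]
    exact hl4
  · simp [hf5.reg 20 rfl, hf4.reg 20 rfl, hf3.reg 20 rfl, hf2.reg 20 rfl, p20]
  · simp [hf5.reg 21 rfl, hf4.reg 21 rfl, hf3.reg 21 rfl, hf2.reg 21 rfl, p21]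
  · rw [State.setR_mem, hf5.mem 6 rfl, hf4.mem 6 rfl, hf3.mem 6 rfl, hf2.mem 6 rfl, hm,
      hf1.mem 6 rfl]
    exact hσ.mul
  · rw [State.setR_reg, if_neg (by decide), hf5.reg 41 rfl, hf4.reg 41 rfl, hf3.reg 41 rfl,
      hf2.reg 41 rfl, hr 41 (by decide) (by decide) (by decide) (by decide) (by decide),
      hf1.reg 41 rfl]
    simpa using hσ.r41
  · rw [State.setR_reg, if_neg (by decide), hf5.reg 42 rfl, hf4.reg 42 rfl, hf3.reg 42 rfl,
      hf2.reg 42 rfl, hr 42 (by decide) (by decide) (by decide) (by decide) (by decide),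
      hf1.reg 42 rfl]
    simpa using hσ.r42
  · intro i _
    simp [n13, n14, n15, n16]
  · rw [State.setR_out, hf5.out rfl, hf4.out rfl, hf3.out rfl, hf2.out rfl, ho]

end RAM

/-- The words `w` describe the cliques in the list `out`. -/
def Printed (out : List (Finset ℕ)) (w : List ℕ) : Prop :=
  ∃ ws : List (List ℕ), List.Forall₂ (fun w K => Words K w) ws out ∧ w = ws.flatten

theorem Printed.nil : Printed [] [] := ⟨[], List.Forall₂.nil, rfl⟩

theorem Printed.append {l l' : List (Finset ℕ)} {w w' : List ℕ} (h : Printed l w)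
    (h' : Printed l' w') : Printed (l ++ l') (w ++ w') := by
  obtain ⟨ws, h1, rfl⟩ := h
  obtain ⟨ws', h2, rfl⟩ := h'
  exact ⟨ws ++ ws', List.rel_append h1 h2, by simp⟩

theorem Printed.singleton {K : Finset ℕ} {w : List ℕ} (h : Words K w) : Printed [K] w :=
  ⟨[w], List.Forall₂.cons h List.Forall₂.nil, by simp⟩

-- Rounds of the depth-first search

namespace RAM

variable {I : Net} {L W R D : ℕ}

/-- `k` rounds of the loop `while e ≠ 0 do c`, each taking time at most `T`, lead from one state
to the other. -/
inductive Iter (L W : ℕ) (e : Exp) (c : Cmd) (T : ℕ) : State → ℕ → State → Prop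
  | refl (σ) : Iter L W e c T σ 0 σ
  | head (σ σ' σ'' k t) : e.Fits L W σ → e.eval σ ≠ 0 → Exec L W c σ σ' t → t ≤ T →
      Iter L W e c T σ' k σ'' → Iter L W e c T σ (k + 1) σ''

theorem Iter.trans {e : Exp} {c : Cmd} {T k k' : ℕ} {σ σ' σ'' : State}
    (h : Iter L W e c T σ k σ') (h' : Iter L W e c T σ' k' σ'') :
    Iter L W e c T σ (k + k') σ'' := by
  induction h with
  | refl σ => simpa using h'
  | head σ σ1 σ2 k t h1 h2 h3 h4 _ ih =>
    rw [Nat.add_right_comm]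
    exact Iter.head _ _ _ _ _ h1 h2 h3 h4 (ih h')

theorem Iter.exec {e : Exp} {c : Cmd} {T k : ℕ} {σ σ' : State} (h : Iter L W e c T σ k σ')
    (hf : e.Fits L W σ') (he : e.eval σ' = 0) :
    ∃ t, Exec L W (.loop e c) σ σ' t ∧ t ≤ k * (T + e.size + 1) + e.size + 1 := by
  induction h with
  | refl σ => exact ⟨_, Exec.loop_false σ e c hf he, by omega⟩
  | head σ σ1 σ2 k t h1 h2 h3 h4 _ ih =>
    obtain ⟨t', h5, h6⟩ := ih hf he
    exact ⟨_, Exec.loop_true _ _ _ _ _ _ _ h1 h2 h3 h5, by rw [Nat.succ_mul]; omega⟩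

theorem At.findChild (hC : Ctx I L W R D) {σ : State} {α β d c : ℕ} {K : Finset ℕ}
    (hσ : At I α β K d c σ) (hc : c ≤ 2 * I.m * (2 * I.m)) :
    Wp L W findChild σ fun σ' t => At I α β K d c σ' ∧ Best I α β K c (fun _ => True) σ' ∧
      SameStack d σ σ' ∧ σ'.mem 13 = σ.mem 13 ∧ σ'.mem 14 = σ.mem 14 ∧ σ'.mem 15 = σ.mem 15 ∧
      σ'.mem 16 = σ.mem 16 ∧ σ'.out = σ.out ∧ t ≤ 5300 * (R * R * D) := by
  refine (findChild_spec hC hσ.env hσ.clear hσ.node hσ.mul hσ.r30 hσ.r42 hc).mono ?_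
  intro τ t hf ⟨h1, h2, h3⟩
  refine ⟨⟨hσ.env.frame hf (by decide), h1, hσ.node.frame hf rfl rfl rfl rfl, ?_,
    (hf.reg 30 rfl).trans hσ.r30, (hf.reg 40 rfl).trans hσ.r40, (hf.reg 41 rfl).trans hσ.r41,
    (hf.reg 42 rfl).trans hσ.r42⟩, h2, ?_, hf.mem 13 rfl, hf.mem 14 rfl, hf.mem 15 rfl,
    hf.mem 16 rfl, hf.out rfl, h3⟩
  · rw [hf.mem 6 rfl]
    exact hσ.mul
  · intro i _
    rw [hf.mem 13 rfl, hf.mem 14 rfl, hf.mem 15 rfl, hf.mem 16 rfl]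
    simp

theorem Best.done {α β c : ℕ} {K : Finset ℕ} {σ : State}
    (h : Best I α β K c (fun _ => True) σ) (hI : I.Good R D) (hK : I.Cliq α β K)
    (h31 : σ.reg 31 = 2 * I.m * (2 * I.m)) : I.Done α β K c := fun c' hc v a b K' hk =>
  h.least c' trivial hc (h31 ▸ hk.lt hI hK) v a b K' hk

/-- A bound on the running time of `step`. -/
abbrev stepTime (R D : ℕ) : ℕ := 7000 * (R * R * D)

theorem Ctx.mul_le (hC : Ctx I L W R D) : R ≤ R * R * D ∧ R * R ≤ R * R * D ∧ 1 ≤ R * R * D := by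
  have h1 := hC.good.R_pos
  have h2 := hC.good.D_pos
  have h3 : R * R ≤ R * R * D := Nat.le_mul_of_pos_right _ h2
  have h4 : R ≤ R * R := Nat.le_mul_of_pos_left R h1
  omega

theorem step_push (hC : Ctx I L W R D) {σ : State} {α β d c : ℕ} {K : Finset ℕ}
    (hσ : At I α β K d c σ) (hd : d < I.n) (hc : c ≤ 2 * I.m * (2 * I.m))
    (hkid : ¬ I.Done α β K c) :
    Wp L W step σ fun σ' t => (∃ c' v a b K', c ≤ c' ∧ I.KidAt α β K c' v a b K' ∧
      (∀ c'', c ≤ c'' → c'' < c' → ∀ v a b K', ¬ I.KidAt α β K c'' v a b K') ∧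
      At I a b K' (d + 1) 0 σ' ∧
      (σ'.mem 13 d = c' + 1 ∧ σ'.mem 14 d = v ∧ σ'.mem 15 d = α ∧ σ'.mem 16 d = β) ∧
      ∃ w, Words K' w ∧ σ'.out = σ.out ++ w) ∧ SameStack d σ σ' ∧ t ≤ stepTime R D := by
  have hW := hC.W_le
  have hsq : 2 * I.m * (2 * I.m) = 4 * (I.m * I.m) := by ring
  have hmul := hC.mul_le
  rw [step, Wp.seq_iff]
  refine (hσ.findChild hC hc).mono ?_
  intro τ t _ ⟨hA, hB, hS, _, _, _, _, ho, ht⟩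
  obtain ⟨hc', K', hk, hl⟩ := hB.kid.resolve_left fun h =>
    hkid (hB.done hC.good hσ.node.cliq h)
  have hlt := hk.lt hC.good hσ.node.cliq
  rw [Wp.ite_iff]
  simp only [Exp.Fits, Exp.eval, Exp.size, hA.r42]
  refine ⟨by omega, fun _ => ?_, fun h => by omega⟩
  refine (push_spec hC hA hd hk rfl rfl rfl rfl hl).mono ?_
  intro τ' t' _ ⟨h1, h2, h3, ⟨w, h4, h5⟩, h6⟩
  refine ⟨⟨_, _, _, _, K', hc', hk, fun c'' h7 h8 => hB.least c'' trivial h7 h8, h1, h3, w, h4,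
    by rw [h5, ho]⟩, ?_, by simp only [stepTime]; omega⟩
  intro i hi
  obtain ⟨a1, a2, a3, a4⟩ := hS i hi
  obtain ⟨b1, b2, b3, b4⟩ := h2 i hi
  exact ⟨b1.trans a1, b2.trans a2, b3.trans a3, b4.trans a4⟩

theorem step_pop (hC : Ctx I L W R D) {σ : State} {α β c d c' v a b : ℕ} {A K K' : Finset ℕ}
    (hσ : At I a b K' (d + 1) c σ) (hc : c ≤ 2 * I.m * (2 * I.m)) (hkid : I.Done a b K' c)
    (hd : d < I.n) (hK : I.Sat α β K) (hg : I.Greedy α β A K)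
    (hA : ∀ z, z ∈ A ↔ z ∈ K' ∧ z < v) (hne : A.Nonempty) (hv : v ≤ I.n)
    (hc' : c' ≤ 2 * I.m * (2 * I.m)) (h13 : σ.mem 13 d = c')
    (h14 : σ.mem 14 d = v) (h15 : σ.mem 15 d = α) (h16 : σ.mem 16 d = β) :
    Wp L W step σ fun σ' t => At I α β K d c' σ' ∧ SameStack d σ σ' ∧ σ'.out = σ.out ∧
      t ≤ stepTime R D := by
  have hW := hC.W_le
  have hsq : 2 * I.m * (2 * I.m) = 4 * (I.m * I.m) := by ring
  have hmul := hC.mul_le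
  rw [step, Wp.seq_iff]
  refine (hσ.findChild hC hc).mono ?_
  intro τ t _ ⟨hA', hB, hS, m13, m14, m15, m16, ho, ht⟩
  have h31 : τ.reg 31 = 2 * I.m * (2 * I.m) := hB.kid.resolve_right fun ⟨h1, K'', h2, _⟩ =>
    hkid _ h1 _ _ _ _ h2
  rw [Wp.ite_iff]
  simp only [Exp.Fits, Exp.eval, Exp.size, hA'.r42, h31]
  refine ⟨by omega, fun h => by omega, fun _ => ?_⟩
  rw [Wp.ite_iff]
  simp only [Exp.Fits, Exp.eval, Exp.size, hA'.r40]
  refine ⟨by omega, fun _ => ?_, fun h => by omega⟩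
  refine (pop_spec hC hA' hd hK hg hA hne hv hc' (by rw [m13, h13]) (by rw [m14, h14])
    (by rw [m15, h15]) (by rw [m16, h16])).mono ?_
  intro τ' t' _ ⟨h1, h2, h3, h4⟩
  refine ⟨h1, ?_, h3.trans ho, by simp only [stepTime]; omega⟩
  intro i hi
  obtain ⟨a1, a2, a3, a4⟩ := hS i (by omega)
  obtain ⟨b1, b2, b3, b4⟩ := h2 i (by omega)
  exact ⟨b1.trans a1, b2.trans a2, b3.trans a3, b4.trans a4⟩

theorem step_stop (hC : Ctx I L W R D) {σ : State} {α β c : ℕ} {K : Finset ℕ}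
    (hσ : At I α β K 0 c σ) (hc : c ≤ 2 * I.m * (2 * I.m)) (hkid : I.Done α β K c) :
    Wp L W step σ fun σ' t => Env I σ' ∧ Clear I σ' ∧ σ'.reg 41 = 0 ∧ σ'.out = σ.out ∧
      t ≤ stepTime R D := by
  have hW := hC.W_le
  have hsq : 2 * I.m * (2 * I.m) = 4 * (I.m * I.m) := by ring
  have hmul := hC.mul_le
  rw [step, Wp.seq_iff]
  refine (hσ.findChild hC hc).mono ?_
  intro τ t _ ⟨hA', hB, hS, _, _, _, _, ho, ht⟩
  have h31 : τ.reg 31 = 2 * I.m * (2 * I.m) := hB.kid.resolve_right fun ⟨h1, K'', h2, _⟩ =>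
    hkid _ h1 _ _ _ _ h2
  simp only [Wp.ite_iff, Wp.assign_iff, Exp.Fits, Exp.eval, Exp.size, hA'.r42, h31, hA'.r40]
  refine ⟨by omega, fun h => by omega, fun _ => ⟨by omega, fun h => absurd rfl h, fun _ =>
    ⟨by omega, hA'.env.setR _ (by decide), hA'.clear.setR _ (by decide) (by decide) (by decide),
      by simp, ho, by simp only [stepTime]; omega⟩⟩⟩

theorem SameStack.refl (d : ℕ) (σ : State) : SameStack d σ σ := fun _ _ => by simp

theorem SameStack.trans {d d' : ℕ} {σ σ' σ'' : State} (h : SameStack d σ σ')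
    (h' : SameStack d' σ' σ'') (hd : d ≤ d') : SameStack d σ σ'' := fun i hi => by
  obtain ⟨a1, a2, a3, a4⟩ := h i hi
  obtain ⟨b1, b2, b3, b4⟩ := h' i (by omega)
  exact ⟨b1.trans a1, b2.trans a2, b3.trans a3, b4.trans a4⟩

/-- The depth-first search explores all descendants through children of codes at least `c`. -/
theorem explore (hC : Ctx I L W R D) (k j : ℕ) : ∀ (i d c α β : ℕ) (K : Finset ℕ) (σ : State),
    I.n - i = k → 2 * I.m * (2 * I.m) - c = j → At I α β K d c σ → I.Gen i α β K → d ≤ i →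
    c ≤ 2 * I.m * (2 * I.m) → ∃ out c' σ' w, I.KidsOut α β K c out ∧
      Iter L W (.var 41) step (stepTime R D) σ (2 * out.length) σ' ∧ At I α β K d c' σ' ∧
      I.Done α β K c' ∧ c' ≤ 2 * I.m * (2 * I.m) ∧ SameStack d σ σ' ∧ Printed out w ∧
      σ'.out = σ.out ++ w := by
  have hW := hC.W_le
  -- The outer induction is on the distance of the index bound from `n` and serves the descent to a
  -- child; the inner one is on the number of codes left at the same node.
  induction k using Nat.strong_induction_on generalizing j with
  | _ k ihk =>
    induction j using Nat.strong_induction_on with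
    | _ j ihj =>
      intro i d c α β K σ hk hj hσ hG hd hc
      by_cases hdone : I.Done α β K c
      · exact ⟨[], c, σ, [], .nil _ _ _ _ hdone, .refl _, hσ, hdone, hc, .refl _ _, .nil,
          by simp⟩
      -- The depth is at most the index bound, and a further child has a larger index that is at
      -- most `n`; so the stack does not overflow.
      have hdn : d < I.n := by
        rw [Net.Done] at hdone
        push Not at hdone
        obtain ⟨c', _, v, a, b, K', hkid⟩ := hdone
        have := hkid.lt_index hG
        have := hkid.v_le
        omega
      obtain ⟨σ1, t1, hx1, ⟨c1, v, a, b, K', hc1, hkid, hleast, hA1, ⟨s13, s14, s15, s16⟩, w1, hw1,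
        ho1⟩, hS1, ht1⟩ := step_push hC hσ hdn hc hdone
      have hlt := hkid.lt hC.good hσ.node.cliq
      have hiv := hkid.lt_index hG
      have hvn := hkid.v_le
      obtain ⟨out2, c2, σ2, w2, hout2, hit2, hA2, hdone2, hc2, hS2, hw2, ho2⟩ :=
        ihk (I.n - v) (by omega) _ v (d + 1) 0 a b K' σ1 rfl rfl hA1 (hkid.gen hσ.node.sat)
          (by omega) (Nat.zero_le _)
      obtain ⟨p13, p14, p15, p16⟩ := hS2 d (Nat.lt_succ_self d)
      have hUp := hkid.toUp
      obtain ⟨σ3, t3, hx3, hA3, hS3, ho3, ht3⟩ := step_pop hC (c' := c1 + 1) hA2 hc2 hdone2 hdn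
        hσ.node.sat hUp.greedy hkid.lower_eq hkid.lower_nonempty hvn.2 (by omega) (p13.trans s13)
        (p14.trans s14) (p15.trans s15) (p16.trans s16)
      obtain ⟨out4, c4, σ4, w4, hout4, hit4, hA4, hdone4, hc4, hS4, hw4, ho4⟩ :=
        ihj (2 * I.m * (2 * I.m) - (c1 + 1)) (by omega) i d (c1 + 1) α β K σ3 hk rfl hA3 hG hd
          (by omega)
      refine ⟨K' :: (out2 ++ out4), c4, σ4, w1 ++ (w2 ++ w4), .cons _ _ _ _ _ _ _ _ _ _ _ hc1 hkid hleast hout2 hout4, ?_,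
        hA4, hdone4, hc4, (hS1.trans hS2 (by omega)).trans (hS3.trans hS4 le_rfl) le_rfl,
        (Printed.singleton hw1).append (hw2.append hw4), ?_⟩
      · have hg1 : (Exp.var 41).eval σ ≠ 0 := by simp [Exp.eval, hσ.r41]
        have hf1 : (Exp.var 41).Fits L W σ := by simp only [Exp.Fits, hσ.r41]; omega
        have hg2 : (Exp.var 41).eval σ2 ≠ 0 := by simp [Exp.eval, hA2.r41]
        have hf2 : (Exp.var 41).Fits L W σ2 := by simp only [Exp.Fits, hA2.r41]; omega
        -- One round descends to `K'` and one returns from it; hence twice as many rounds as listed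
        -- cliques.
        have := Iter.head _ _ _ _ _ hf1 hg1 hx1 ht1
          (hit2.trans (Iter.head _ _ _ _ _ hf2 hg2 hx3 ht3 hit4))
        convert this using 1
        simp only [List.length_cons, List.length_append]
        omega
      · rw [ho4, ho3, ho2, ho1]
        simp

/-- List the clique in array 10 and its descendants. -/
def dfs : Cmd :=
  .seq (.assign 30 (.lit 0)) <| .seq (.assign 40 (.lit 0)) <| .seq (.assign 41 (.lit 1)) <|
  .seq emitK (.loop (.var 41) step)

/-- The search takes `2 * out.length + 1` rounds, the last of which finds no further child at depth
zero and stops. The remaining slack pays for writing the starting clique. -/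
theorem dfs_spec (hC : Ctx I L W R D) {σ : State} {α β : ℕ} {K : Finset ℕ} (hE : Env I σ)
    (hcl : Clear I σ) (hN : Node I α β K σ) (hmul : ∀ p < 2 * I.m, σ.mem 6 p = p * (2 * I.m))
    (r42 : σ.reg 42 = 2 * I.m * (2 * I.m)) :
    Wp L W dfs σ fun σ' t => Env I σ' ∧ Clear I σ' ∧ (∃ out w, I.KidsOut α β K 0 out ∧
      Printed (K :: out) w ∧ σ'.out = σ.out ++ w ∧
      t ≤ 2 * (out.length + 1) * (8000 * (R * R * D))) := by
  have hW := hC.W_le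
  have hml := hC.mul_le
  simp only [dfs, Wp.seq_iff (c := .assign _ _), Wp.assign_iff, Exp.Fits, Exp.eval, Exp.size]
  refine ⟨by omega, by omega, by omega, ?_⟩
  generalize hτ : ((σ.setR 30 0).setR 40 0).setR 41 1 = τ
  have hr : ∀ x, x ≠ 30 → x ≠ 40 → x ≠ 41 → τ.reg x = σ.reg x :=
    fun x h1 h2 h3 => by simp [← hτ, h1, h2, h3]
  have hm : τ.mem = σ.mem := by rw [← hτ]; rfl
  have ho : τ.out = σ.out := by rw [← hτ]; rfl
  have hA : At I α β K 0 0 τ := ⟨hτ ▸ ((hE.setR _ (by decide)).setR _ (by decide)).setR _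
    (by decide), hτ ▸ ((hcl.setR _ (by decide) (by decide) (by decide)).setR _ (by decide)
    (by decide) (by decide)).setR _ (by decide) (by decide) (by decide),
    hN.congr (by rw [hm]) (hr _ (by decide) (by decide) (by decide))
      (hr _ (by decide) (by decide) (by decide)) (hr _ (by decide) (by decide) (by decide)),
    by rw [hm]; exact hmul, by simp [← hτ], by simp [← hτ], by simp [← hτ],
    (hr _ (by decide) (by decide) (by decide)).trans r42⟩
  clear hτ
  rw [Wp.seq_iff]
  refine (emitK_spec hC hA.node).mono ?_
  intro τ1 t1 hf1 ⟨⟨w1, hw1, ho1⟩, ht1⟩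
  have hA1 : At I α β K 0 0 τ1 := by
    have hc := hA.clear
    refine ⟨hA.env.frame hf1 (by decide), ⟨(hf1.reg 3 rfl).trans hc.r3, (hf1.reg 6 rfl).trans hc.r6,
      (hf1.reg 7 rfl).trans hc.r7, by rw [hf1.mem 8 rfl]; exact hc.m8,
      by rw [hf1.mem 9 rfl]; exact hc.m9⟩, hA.node.frame hf1 rfl rfl rfl rfl,
      by rw [hf1.mem 6 rfl]; exact hA.mul, (hf1.reg 30 rfl).trans hA.r30,
      (hf1.reg 40 rfl).trans hA.r40, (hf1.reg 41 rfl).trans hA.r41, (hf1.reg 42 rfl).trans hA.r42⟩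
  obtain ⟨out, c', σ2, w2, hout, hit, hA2, hdone, hc', _, hw2, ho2⟩ :=
    -- With the bound `0` the condition on the index is vacuous, so any starting clique is
    -- admissible.
    explore hC _ _ 0 0 0 α β K τ1 rfl rfl hA1 (fun A hA _ _ => hA.imp fun z hz => ⟨hz, Nat.zero_le z⟩)
      le_rfl (Nat.zero_le _)
  obtain ⟨σ3, t3, hx3, hE3, hcl3, r41, ho3, ht3⟩ := step_stop hC hA2 hc' hdone
  obtain ⟨t, hx, ht⟩ := (hit.trans (Iter.head _ _ _ _ _
    (by simp only [Exp.Fits, hA2.r41]; omega : (Exp.var 41).Fits L W σ2)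
    (by simp [Exp.eval, hA2.r41]) hx3 ht3 (.refl _))).exec
    (by simp only [Exp.Fits, r41]; omega : (Exp.var 41).Fits L W σ3) (by simpa [Exp.eval] using r41)
  refine ⟨σ3, t, hx, hE3, hcl3, out, w1 ++ w2, hout, (Printed.singleton hw1).append hw2, ?_, ?_⟩
  · rw [ho3, ho2, ho1, ho]
    simp
  · simp only [Exp.size, stepTime, zero_add] at ht
    have h1 : (2 * out.length + 1) * (7000 * (R * R * D) + 1 + 1) ≤
        (2 * out.length + 1) * (7002 * (R * R * D)) := Nat.mul_le_mul_left _ (by omega)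
    have h2 : 2 * (out.length + 1) * (8000 * (R * R * D)) =
        (2 * out.length + 1) * (7002 * (R * R * D)) + (2 * out.length + 1) * (998 * (R * R * D)) +
          8000 * (R * R * D) := by ring
    omega

end RAM

-- Starting the search from edges

namespace Net

variable {I : Net} {R D : ℕ}

variable (I) in
/-- The exploration starts at `K` on account of the edge of number `j`: the clique `K` is the
closure of this edge, and the edge is the least edge of `K`. -/
structure Start (j : ℕ) (K : Finset ℕ) : Prop where
  greedy : I.Greedy (I.lo j) (I.hi j) {I.eu j, I.ev j} K
  least : ∀ z ∈ K \ {I.eu j, I.ev j}, I.ev j ≤ z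

variable (I) in
/-- What is listed on account of the edges of numbers less than `k`, the edge of number `jm`
excepted. -/
inductive EdgesOut (jm : ℕ) : ℕ → List (Finset ℕ) → Prop
  | zero : EdgesOut jm 0 []
  | skip (k out) : EdgesOut jm k out → (k = jm ∨ ∀ K, ¬ I.Start k K) → EdgesOut jm (k + 1) out
  | take (k out K out') : EdgesOut jm k out → k ≠ jm → I.Start k K →
      I.KidsOut (I.lo k) (I.hi k) K 0 out' → EdgesOut jm (k + 1) (out ++ K :: out')

variable (I) in
/-- The edge of number `j` is active at all times. -/
def Full (j : ℕ) : Prop := I.lo j ≤ 1 ∧ I.T ≤ I.hi j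

variable (I) in
/-- The edge of number `i` precedes the edge of number `j`. -/
def Before (i j : ℕ) : Prop := I.eu i < I.eu j ∨ (I.eu i = I.eu j ∧ I.ev i < I.ev j)

variable (I) in
/-- Among the edges of numbers less than `k` that are active at all times, `j` is the number of the
first one; it is `m` if there are none. -/
def FirstFull (k j : ℕ) : Prop :=
  (j = I.m ∧ ∀ i < k, ¬ I.Full i) ∨
    (j < I.m ∧ I.Full j ∧ ∀ i < k, I.Full i → ¬ I.Before i j)

/-- The edge itself confines the times of its closure to its own interval, and all edges of the
closure span that interval. -/
theorem sat_of_edge (hI : I.Good R D) {j : ℕ} {K : Finset ℕ} (hj : j < I.m)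
    (h : I.Greedy (I.lo j) (I.hi j) {I.eu j, I.ev j} K) : I.Sat (I.lo j) (I.hi j) K := by
  have he := hI.edge j hj
  refine ⟨h.2.1, h.max, fun t => ⟨fun ht => ⟨by omega, fun i hi hu hv => ?_⟩, fun ht => ?_⟩,
    he.2.2.2.2.1, he.2.2.2.2.2⟩
  · have := h.2.1.edge hI hi hu hv
    omega
  · exact ht.2 j hj (h.1 (by simp)) (h.1 (by simp))

end Net

-- The main program

namespace RAM

variable {I : Net} {L W R D : ℕ}

/-- Put the closure of the edge in register 48 into array 10. -/
def genEdge : Cmd :=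
  .seq (.assign 4 (.get 2 (.var 48))) <| .seq (.assign 5 (.get 3 (.var 48))) <|
  .seq (.assign 8 (.get 0 (.var 48))) <| .seq addV <| .seq (.assign 8 (.get 1 (.var 48))) <|
  .seq addV <| .seq extend <| .seq (copy 7 3 10 19) <| .seq (.assign 20 (.var 4)) <|
  .seq (.assign 21 (.var 5)) reset

/-- Fill the multiplication table, and put the number of codes into register 42. -/
def mulTable : Cmd :=
  .seq (.assign 43 (.lit 0)) <|
  .seq (forR 45 (.lit 0) (.add (.var 1) (.var 1)) <| .seq (.put 6 (.var 45) (.var 43)) <|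
    .assign 43 (.add (.var 43) (.add (.var 1) (.var 1)))) <| .assign 42 (.var 43)

/-- Find the first edge that is active at all times. -/
def firstFull : Cmd :=
  .seq (.assign 44 (.var 1)) <| forR 45 (.lit 0) (.var 1) <|
    .ite (.add (.sub (.get 2 (.var 45)) (.lit 1)) (.sub (.var 2) (.get 3 (.var 45)))) .skip <|
    .ite (.sub (.var 1) (.var 44))
      (.ite (.sub (.get 0 (.var 44)) (.get 0 (.var 45))) (.assign 44 (.var 45)) <|
        .ite (.sub (.get 0 (.var 45)) (.get 0 (.var 44))) .skip <|
        .ite (.sub (.get 1 (.var 44)) (.get 1 (.var 45))) (.assign 44 (.var 45)) .skip)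
      (.assign 44 (.var 45))

/-- The whole algorithm. -/
def main : Cmd :=
  .seq mulTable <| .seq (.assign 6 (.lit 1)) <| .seq (.assign 7 (.var 2)) <| .seq firstFull <|
  .seq (.ite (.sub (.var 1) (.var 44)) (.seq (.assign 48 (.var 44)) <| .seq genEdge dfs)
    (.emit (.lit 0))) <|
  forR 45 (.lit 0) (.var 1) <|
    .ite (.add (.sub (.var 45) (.var 44)) (.sub (.var 44) (.var 45)))
      (.seq (.assign 48 (.var 45)) <| .seq genEdge <|
        .ite (.sub (.get 1 (.var 48)) (.var 17)) .skip dfs)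
      .skip

/-- The comparison of the larger endpoint with register 17 is the machine's test that the edge is
the least edge of its closure; `Link.exists_start_iff` justifies it. -/
theorem genEdge_spec (hC : Ctx I L W R D) {σ : State} {j : ℕ} (hE : Env I σ) (hcl : Clear I σ)
    (hj : j < I.m) (r48 : σ.reg 48 = j) :
    Wp L W genEdge σ fun σ' t => Env I σ' ∧ Clear I σ' ∧ (∃ K,
      I.Greedy (I.lo j) (I.hi j) {I.eu j, I.ev j} K ∧ Node I (I.lo j) (I.hi j) K σ' ∧
      σ'.reg 17 ≤ I.n + 1 ∧
      (I.ev j ≤ σ'.reg 17 ↔ ∀ z ∈ K \ {I.eu j, I.ev j}, I.ev j ≤ z)) ∧ t ≤ 2000 * R := by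
  classical
  have hLn := hC.L_n
  have hLm := hC.L_m
  have hW := hC.W_le
  have hRp := hC.good.R_pos
  have he := hC.good.edge j hj
  have hH : I.H (I.lo j) (I.hi j) (I.eu j) (I.ev j) := ⟨j, hj, Or.inl ⟨rfl, rfl⟩, le_rfl, le_rfl⟩
  have hdeg : ∀ u, 1 ≤ u ∧ u ≤ I.n → I.deg u ≤ R := fun u hu =>
    hC.good.deg_le_R (Cliq_singleton (a := 1) (b := 1) hu) (by simp)
  have hdu := hdeg (I.eu j) (by omega)
  have hdv := hdeg (I.ev j) (by omega)
  simp only [genEdge, Wp.seq_iff (c := .assign 4 _), Wp.seq_iff (c := .assign 5 _),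
    Wp.seq_iff (c := .assign 8 (.get 0 _)), Wp.assign_iff (x := 4), Wp.assign_iff (x := 5),
    Wp.assign_iff (x := 8) (e := .get 0 _), Exp.Fits, Exp.eval, Exp.size, State.setR_reg,
    State.setR_mem, r48, hE.m0, hE.m2, hE.m3, Nat.reduceEqDiff, if_false]
  refine ⟨by omega, by omega, by omega, ?_⟩
  rw [Wp.seq_iff]
  have hE1 := ((hE.setR (x := 4) (I.lo j) (by decide)).setR (x := 5) (I.hi j) (by decide)).setR
    (x := 8) (I.eu j) (by decide)
  have hcl1 := ((hcl.setR (x := 4) (I.lo j) (by decide) (by decide) (by decide)).setR (x := 5)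
    (I.hi j) (by decide) (by decide) (by decide)).setR (x := 8) (I.eu j) (by decide) (by decide)
    (by decide)
  refine (addV_spec hC hE1 (a := I.lo j) (b := I.hi j) (w := I.eu j) (by simp) (by simp) (by omega)
    (by omega) (hcl1.rep hC.good.T_pos _ _) (by simp) (by omega) (by simp) (by simp)).mono ?_
  intro τ2 t2 hf2 ⟨hr2, _, ht2⟩
  have hE2 := hE1.frame hf2 (by decide)
  have q4 : τ2.reg 4 = I.lo j := by rw [hf2.reg 4 rfl]; simp
  have q5 : τ2.reg 5 = I.hi j := by rw [hf2.reg 5 rfl]; simp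
  have q48 : τ2.reg 48 = j := by rw [hf2.reg 48 rfl]; simpa using r48
  rw [Wp.seq_iff, Wp.assign_iff]
  simp only [Exp.Fits, Exp.eval, Exp.size, q48, hE2.m1]
  refine ⟨by omega, ?_⟩
  rw [Wp.seq_iff]
  refine (addV_spec hC (hE2.setR (x := 8) (I.ev j) (by decide)) (a := I.lo j) (b := I.hi j)
    (w := I.ev j) (by simpa using q4) (by simpa using q5) (by omega)
    (by omega) (hr2.setR _ (by decide)) (by simp) (by omega) (by simp; omega)
    (by simpa using hH)).mono ?_
  intro τ3 t3 hf3 ⟨hr3, _, ht3⟩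
  have hset : insert (I.ev j) (insert (I.eu j) ∅) = ({I.eu j, I.ev j} : Finset ℕ) := by
    ext z
    simp [or_comm]
  rw [hset] at hr3
  have hE3 := (hE2.setR (x := 8) (I.ev j) (by decide)).frame hf3 (by decide)
  have s4 : τ3.reg 4 = I.lo j := by rw [hf3.reg 4 rfl]; simpa using q4
  have s5 : τ3.reg 5 = I.hi j := by rw [hf3.reg 5 rfl]; simpa using q5
  rw [Wp.seq_iff]
  refine (extend_spec hC hE3 s4 s5 (by omega) (by omega) hr3 (by simp)).mono ?_
  intro τ4 t4 hf4 ⟨K, hg, hr4, hmn, hmin, ht4⟩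
  have hE4 := hE3.frame hf4 (by decide)
  have hs := Net.sat_of_edge hC.good hj hg
  rw [Wp.seq_iff]
  refine (copy_spec hC (src := 7) (sl := 3) (dst := 10) (dl := 19) hr4.lists hg.2.1 (by decide)
    (by decide)).mono ?_
  intro τ5 t5 hf5 ⟨hl5, ht5⟩
  have hE5 := hE4.frame hf5 (by decide)
  have u4 : τ5.reg 4 = I.lo j := by rw [hf5.reg 4 rfl, hf4.reg 4 rfl, s4]
  have u5 : τ5.reg 5 = I.hi j := by rw [hf5.reg 5 rfl, hf4.reg 5 rfl, s5]
  simp only [Wp.seq_iff, Wp.assign_iff, Exp.Fits, Exp.eval, Exp.size, State.setR_reg, u4, u5,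
    Nat.reduceEqDiff, if_false]
  refine ⟨by omega, by omega, ?_⟩
  have hE6 := (hE5.setR (x := 20) (I.lo j) (by decide)).setR (x := 21) (I.hi j) (by decide)
  refine (reset_spec hC hE6 (((hr4.frame hf5 rfl rfl rfl rfl rfl rfl).setR _ (by decide)).setR _
    (by decide))).mono ?_
  intro τ7 t7 hf7 ⟨hcl7, ht7⟩
  have v17 : τ7.reg 17 = τ4.reg 17 := by
    rw [hf7.reg 17 rfl]
    simp [hf5.reg 17 rfl]
  refine ⟨hE6.frame hf7 (by decide), hcl7, ⟨K, hg, ⟨?_, hs.cliq, hs.max, hs.time, hs.le, hs.leT, ?_,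
    ?_⟩, by omega, ?_⟩, by omega⟩
  · rw [hf7.mem 10 rfl, hf7.reg 19 rfl]
    simpa using hl5
  · rw [hf7.reg 20 rfl]
    simp
  · rw [hf7.reg 21 rfl]
    simp
  · rw [v17]
    exact hmin _ (by omega)

/-- The machine cannot multiply, so the multiples of `2m` needed for codes are tabulated by repeated
addition. The final sum exceeds every code and later stands for the absence of a child. -/
theorem mulTable_spec (hC : Ctx I L W R D) {σ : State} (hE : Env I σ) :
    Wp L W mulTable σ fun σ' t => Env I σ' ∧ (∀ p < 2 * I.m, σ'.mem 6 p = p * (2 * I.m)) ∧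
      σ'.reg 42 = 2 * I.m * (2 * I.m) ∧ t ≤ 40 * I.m + 20 := by
  have hLm := hC.L_m
  have hW := hC.W_le
  have hsq : 2 * I.m * (2 * I.m) = 4 * (I.m * I.m) := by ring
  simp only [mulTable, Wp.seq_iff (c := .assign 43 _), Wp.assign_iff (x := 43) (e := .lit 0),
    Exp.Fits, Exp.eval, Exp.size]
  refine ⟨by omega, ?_⟩
  rw [Wp.seq_iff]
  refine Wp.forR 0 (2 * I.m) 9 (fun i τ => τ.reg 43 = i * (2 * I.m) ∧
    ∀ p < i, τ.mem 6 p = p * (2 * I.m)) (fun _ _ => 0) rfl (Nat.zero_le _) rfl (Nat.zero_le _)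
    (by omega) ?_ ?_ ?_ ?_
  · intro τ hf
    have := (hE.setR (x := 43) 0 (by decide)).frame hf (by decide)
    simp only [Exp.Fits, Exp.eval, this.r1]
    omega
  · simp
  · intro τ i _ hi hf r45 ⟨h1, h2⟩
    have hE' := (hE.setR (x := 43) 0 (by decide)).frame hf (by decide)
    have h3 : (i + 1) * (2 * I.m) = i * (2 * I.m) + 2 * I.m := by ring
    have h4 := Nat.mul_le_mul_right (2 * I.m) (show i + 1 ≤ 2 * I.m by omega)
    simp only [Wp.seq_iff, Wp.put_iff, Wp.assign_iff, Exp.Fits, Exp.eval, Exp.size,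
      State.setM_reg, r45, h1, hE'.r1]
    refine ⟨by omega, by omega, by omega, by omega, ⟨by simp; omega, fun p hp => ?_⟩, by omega⟩
    rcases Nat.lt_succ_iff_lt_or_eq.1 hp with h5 | rfl
    · simpa [Function.update_of_ne h5.ne] using h2 p h5
    · simp
  · intro τ t hf ⟨h1, h2⟩ ht
    have hE' := (hE.setR (x := 43) 0 (by decide)).frame hf (by decide)
    simp only [Wp.assign_iff, Exp.Fits, Exp.eval, Exp.size, h1]
    simp only [Exp.size] at ht
    exact ⟨by omega, hE'.setR _ (by decide), h2, by simp, by omega⟩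

theorem firstFull_spec (hC : Ctx I L W R D) {σ : State} (hE : Env I σ) :
    Wp L W firstFull σ fun σ' t => Env I σ' ∧ I.FirstFull I.m (σ'.reg 44) ∧
      t ≤ 60 * I.m + 20 := by
  have hLn := hC.L_n
  have hLm := hC.L_m
  have hW := hC.W_le
  rw [firstFull, Wp.seq_iff, Wp.assign_iff]
  simp only [Exp.Fits, Exp.eval, Exp.size, hE.r1]
  refine ⟨by omega, ?_⟩
  refine Wp.forR 0 I.m 40 (fun i τ => I.FirstFull i (τ.reg 44)) (fun _ _ => 0) rfl (Nat.zero_le _)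
    rfl (Nat.zero_le _) (by omega) ?_ ?_ ?_ ?_
  · intro τ hf
    have := (hE.setR (x := 44) I.m (by decide)).frame hf (by decide)
    simp only [Exp.Fits, Exp.eval, this.r1, and_true]
    omega
  · exact Or.inl ⟨by simp, fun i hi => absurd hi (by omega)⟩
  · intro τ i _ hi hf r45 hinv
    have hE' := (hE.setR (x := 44) I.m (by decide)).frame hf (by decide)
    have he := hC.good.edge i hi
    have hsucc : ∀ {P : ℕ → Prop}, (∀ i' < i, P i') → P i → ∀ i' < i + 1, P i' := by
      intro P h1 h2 i' hi'
      rcases Nat.lt_succ_iff_lt_or_eq.1 hi' with h3 | rfl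
      · exact h1 i' h3
      · exact h2
    simp only [Wp.ite_iff, Wp.assign_iff, Wp.skip_iff, Exp.Fits, Exp.eval, Exp.size,
      State.setR_reg, r45, hE'.r1, hE'.r2, hE'.m0, hE'.m1, hE'.m2, hE'.m3, Nat.reduceEqDiff,
      if_false, if_true]
    have h44 : τ.reg 44 ≤ I.m := by
      rcases hinv with h | h <;> omega
    refine ⟨by omega, fun h1 => ⟨?_, by omega⟩, fun h1 => ?_⟩
    · have hnf : ¬ I.Full i := fun h => by
        have := h.1
        have := h.2
        omega
      rcases hinv with ⟨h2, h3⟩ | ⟨h2, h3, h4⟩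
      · exact Or.inl ⟨h2, hsucc h3 hnf⟩
      · exact Or.inr ⟨h2, h3, hsucc h4 fun h => absurd h hnf⟩
    · have hfi : I.Full i := ⟨by omega, by omega⟩
      have hirr : ¬ I.Before i i := by
        unfold Net.Before
        omega
      refine ⟨by omega, fun h2 => ?_, fun h2 => ⟨by omega, ?_, by omega⟩⟩
      · obtain ⟨h3, h4, h5⟩ := hinv.resolve_left fun h => by omega
        have hej := hC.good.edge _ h3
        refine ⟨by omega, fun h6 => ⟨by omega, ?_, by omega⟩, fun h6 => ⟨by omega, fun h7 =>
          ⟨?_, by omega⟩, fun h7 => ⟨by omega, fun h8 => ⟨by omega, ?_, by omega⟩, fun h8 =>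
          ⟨?_, by omega⟩⟩⟩⟩
        · refine Or.inr ⟨hi, hfi, hsucc (fun i' hi' hf' hb => h5 i' hi' hf' ?_) fun _ => hirr⟩
          unfold Net.Before at hb ⊢
          omega
        · refine Or.inr ⟨h3, h4, hsucc h5 fun _ hb => ?_⟩
          unfold Net.Before at hb
          omega
        · refine Or.inr ⟨hi, hfi, hsucc (fun i' hi' hf' hb => h5 i' hi' hf' ?_) fun _ => hirr⟩
          unfold Net.Before at hb ⊢
          omega
        · refine Or.inr ⟨h3, h4, hsucc h5 fun _ hb => ?_⟩
          unfold Net.Before at hb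
          omega
      · obtain ⟨h3, h4⟩ := hinv.resolve_right fun h => by omega
        exact Or.inr ⟨hi, hfi, hsucc (fun i' hi' hf' => absurd hf' (h4 i' hi')) fun _ => hirr⟩
  · intro τ t hf hinv ht
    refine ⟨(hE.setR (x := 44) I.m (by decide)).frame hf (by decide), hinv, ?_⟩
    simp only [Exp.size] at ht
    omega

end RAM

namespace Net

variable (I : Net)

/-- The list of cliques that the program produces. -/
def RunOut (out : List (Finset ℕ)) : Prop :=
  ∃ jm, I.FirstFull I.m jm ∧ ∃ out0 out1, out = out0 ++ out1 ∧ I.EdgesOut jm I.m out1 ∧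
    ((jm = I.m ∧ out0 = [∅]) ∨ (jm < I.m ∧ ∃ K out', I.Greedy (I.lo jm) (I.hi jm)
      {I.eu jm, I.ev jm} K ∧ I.KidsOut (I.lo jm) (I.hi jm) K 0 out' ∧ out0 = K :: out'))

end Net

namespace RAM

variable {I : Net} {L W R D : ℕ}

/-- Counting loops, with an invariant that refers to the time spent in the body. -/
theorem Wp.forR_time {p : ℕ} {lo hi : Exp} {body : Cmd} {σ : State} {Q : State → ℕ → Prop}
    (a b : ℕ) (Inv : ℕ → State → ℕ → Prop)
    (hp : body.modR p = false) (hlo : lo.Fits L W σ) (hloe : lo.eval σ = a) (hab : a ≤ b)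
    (hb : b + 1 ≤ W)
    (hhi : ∀ τ, Frame (RAM.forR p lo hi body) σ τ → hi.Fits L W τ ∧ hi.eval τ = b)
    (h0 : Inv a (σ.setR p a) 0)
    (hbody : ∀ τ i s, a ≤ i → i < b → Frame (RAM.forR p lo hi body) σ τ → τ.reg p = i → Inv i τ s →
      Wp L W body τ fun τ' t => Inv (i + 1) (τ'.setR p (i + 1)) (s + t))
    (hQ : ∀ τ t s, Frame (RAM.forR p lo hi body) σ τ → Inv b τ s →
      t ≤ s + (hi.size + 7) * (b - a) + lo.size + hi.size + 4 → Q τ t) :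
    Wp L W (RAM.forR p lo hi body) σ Q := by
  have hfr0 : Frame (RAM.forR p lo hi body) σ (σ.setR p a) := by
    refine ⟨fun x hx => ?_, fun _ _ => rfl, fun _ => rfl⟩
    simp only [RAM.forR, Cmd.modR, Bool.or_eq_false_iff, beq_eq_false_iff_ne] at hx
    simp [Ne.symm hx.1]
  have hweak : ∀ {τ τ'}, Frame (.seq body (.assign p (.add (.var p) (.lit 1)))) τ τ' →
      Frame (RAM.forR p lo hi body) τ τ' := fun h => h.weaken
    (by simp +contextual [RAM.forR, Cmd.modR]) (by simp +contextual [RAM.forR, Cmd.modM])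
    (by simp +contextual [RAM.forR, Cmd.emits])
  have key : ∀ k τ s, b - τ.reg p = k → a ≤ τ.reg p → τ.reg p ≤ b →
      Frame (RAM.forR p lo hi body) σ τ → Inv (τ.reg p) τ s → ∃ τ' t s', Exec L W
        (.loop (.sub hi (.var p)) (.seq body (.assign p (.add (.var p) (.lit 1))))) τ τ' t ∧
        Frame (RAM.forR p lo hi body) σ τ' ∧ Inv b τ' s' ∧
        t + s ≤ s' + (hi.size + 7) * k + hi.size + 3 := by
    intro k
    induction k with
    | zero =>
      intro τ s hk h1 h2 hf hinv
      obtain ⟨h3, h4⟩ := hhi τ hf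
      have h5 : τ.reg p = b := by omega
      refine ⟨τ, _, s, Exec.loop_false τ _ _ ⟨h3, (by omega : τ.reg p ≤ W)⟩ ?_, hf, h5 ▸ hinv, ?_⟩
      · simp only [Exp.eval, h4]
        omega
      · simp only [Exp.size]
        omega
    | succ k ih =>
      intro τ s hk h1 h2 hf hinv
      obtain ⟨h3, h4⟩ := hhi τ hf
      obtain ⟨τ1, t1, hx1, hinv1⟩ := hbody τ _ s h1 (by omega) hf rfl hinv
      have h8 := hx1.frame.reg p hp
      have he : (Exp.add (.var p) (.lit 1)).eval τ1 = τ.reg p + 1 := by simp [Exp.eval, h8]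
      have hx2 : Exec L W (.seq body (.assign p (.add (.var p) (.lit 1)))) τ
          (τ1.setR p (τ.reg p + 1)) (t1 + 4) := by
        have := Exec.assign (L := L) (W := W) τ1 p (.add (.var p) (.lit 1))
          ⟨(by omega : τ1.reg p ≤ W), (by omega : 1 ≤ W), (by simp only [Exp.eval]; omega)⟩
        rw [he] at this
        exact Exec.seq _ _ _ _ _ _ _ hx1 this
      have h9 : (τ1.setR p (τ.reg p + 1)).reg p = τ.reg p + 1 := by simp
      obtain ⟨τ3, t3, s3, hx3, hf3, hinv3, ht3⟩ := ih (τ1.setR p (τ.reg p + 1)) (s + t1) (by omega)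
        (by omega) (by omega) (hf.trans (hweak hx2.frame)) (by rw [h9]; exact hinv1)
      refine ⟨τ3, _, s3, Exec.loop_true _ _ _ _ _ _ _ ⟨h3, (by omega : τ.reg p ≤ W)⟩ ?_ hx2 hx3,
        hf3, hinv3, ?_⟩
      · simp only [Exp.eval, h4]
        omega
      · rw [Nat.mul_succ]
        simp only [Exp.size]
        omega
  obtain ⟨τ, t, s, hx, hf, hinv, ht⟩ := key (b - a) (σ.setR p a) 0 (by simp) (by simp) (by simpa)
    hfr0 (by simpa using h0)
  rw [RAM.forR, Wp.seq_iff, Wp.assign_iff, hloe]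
  exact ⟨hlo, τ, t, hx, hQ τ _ s hf hinv (by omega)⟩

/-- The first summand of the bound accounts for preprocessing and the closures of the edges, each
`O(R)`; the second charges `O(R²D)` to every clique listed. -/
theorem main_spec (hC : Ctx I L W R D) {σ : State} (hE : Env I σ) (r3 : σ.reg 3 = 0)
    (m8 : ∀ z, σ.mem 8 z = 0) (m9 : ∀ z, σ.mem 9 z = 0) (ho : σ.out = []) :
    Wp L W main σ fun σ' t => ∃ out, I.RunOut out ∧ Printed out σ'.out ∧
      t ≤ 6000 * ((I.m + 1) * R) + 16000 * (out.length * (R * R * D)) := by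
  have hLn := hC.L_n
  have hLm := hC.L_m
  have hW := hC.W_le
  have hRp := hC.good.R_pos
  have hml := hC.mul_le
  have hTp := hC.good.T_pos
  generalize hX : R * R * D = X at *
  rw [main, Wp.seq_iff]
  refine (mulTable_spec hC hE).mono ?_
  intro τ1 t1 hf1 ⟨hE1, hmul, r42, ht1⟩
  simp only [Wp.seq_iff (c := .assign 6 _), Wp.seq_iff (c := .assign 7 _), Wp.assign_iff (x := 6),
    Wp.assign_iff (x := 7), Exp.Fits, Exp.eval, Exp.size, State.setR_reg, hE1.r2,
    Nat.reduceEqDiff, if_false]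
  refine ⟨by omega, by omega, ?_⟩
  have hE2 := (hE1.setR (x := 6) 1 (by decide)).setR (x := 7) I.T (by decide)
  rw [Wp.seq_iff]
  refine (firstFull_spec hC hE2).mono ?_
  intro τ3 t3 hf3 ⟨hE3, hff, ht3⟩
  have hcl3 : Clear I τ3 := by
    refine ⟨?_, ?_, ?_, ?_, ?_⟩
    · rw [hf3.reg 3 rfl]
      simpa [hf1.reg 3 rfl] using r3
    · rw [hf3.reg 6 rfl]
      simp
    · rw [hf3.reg 7 rfl]
      simp
    · rw [hf3.mem 8 rfl]
      simpa [hf1.mem 8 rfl] using m8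
    · rw [hf3.mem 9 rfl]
      simpa [hf1.mem 9 rfl] using m9
  have hmul3 : ∀ p < 2 * I.m, τ3.mem 6 p = p * (2 * I.m) := by
    rw [hf3.mem 6 rfl]
    exact hmul
  have r42' : τ3.reg 42 = 2 * I.m * (2 * I.m) := by
    rw [hf3.reg 42 rfl]
    simpa using r42
  have ho3 : τ3.out = [] := by
    rw [hf3.out rfl]
    simpa [hf1.out rfl] using ho
  generalize hjm : τ3.reg 44 = jm at hff
  have hjmle : jm ≤ I.m := by
    rcases hff with h | h <;> omega
  rw [Wp.seq_iff]
  -- If some edge is active at all times, the root is the closure of the first such edge. Otherwise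
  -- the root is empty, and only an end mark is written.
  have hroot : Wp L W (.ite (.sub (.var 1) (.var 44)) (.seq (.assign 48 (.var 44)) <|
      .seq genEdge dfs) (.emit (.lit 0))) τ3 fun τ t => (Env I τ ∧ Clear I τ) ∧
      ∃ out0, ((jm = I.m ∧ out0 = [∅]) ∨ (jm < I.m ∧ ∃ K out', I.Greedy (I.lo jm) (I.hi jm)
        {I.eu jm, I.ev jm} K ∧ I.KidsOut (I.lo jm) (I.hi jm) K 0 out' ∧ out0 = K :: out')) ∧
        Printed out0 τ.out ∧ t ≤ 2100 * R + 16000 * (out0.length * X) := by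
    rw [Wp.ite_iff]
    simp only [Exp.Fits, Exp.eval, Exp.size, hE3.r1, hjm]
    refine ⟨by omega, fun hlt => ?_, fun hge => ?_⟩
    · rw [Wp.seq_iff, Wp.assign_iff]
      simp only [Exp.Fits, Exp.eval, Exp.size, hjm]
      refine ⟨by omega, ?_⟩
      rw [Wp.seq_iff]
      refine (genEdge_spec hC (hE3.setR _ (by decide)) (hcl3.setR _ (by decide) (by decide)
        (by decide)) (j := jm) (by omega) (by simp)).mono ?_
      intro τ4 t4 hf4 ⟨hE4, hcl4, ⟨K, hg, hN, _⟩, ht4⟩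
      refine (dfs_spec hC hE4 hcl4 hN (by rw [hf4.mem 6 rfl]; exact hmul3)
        (by rw [hf4.reg 42 rfl]; simpa using r42')).mono ?_
      intro τ5 t5 _ ⟨hE5, hcl5, out, w, hout, hw, ho5, ht5⟩
      rw [hX] at ht5
      refine ⟨⟨hE5, hcl5⟩, K :: out, Or.inr ⟨by omega, K, out, hg, hout, rfl⟩, ?_, ?_⟩
      · rw [ho5, hf4.out rfl, State.setR_out, ho3]
        simpa using hw
      · have : 2 * (out.length + 1) * (8000 * X) = 16000 * ((K :: out).length * X) := by
          rw [List.length_cons]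
          ring
        omega
    · rw [Wp.emit_iff]
      refine ⟨by simp [Exp.Fits], ⟨⟨hE3.r0, hE3.r1, hE3.r2, hE3.m0, hE3.m1, hE3.m2, hE3.m3, hE3.m4,
        hE3.m5⟩, ⟨hcl3.r3, hcl3.r6, hcl3.r7, hcl3.m8, hcl3.m9⟩⟩, [∅], Or.inl ⟨by omega, rfl⟩, ?_, ?_⟩
      · rw [State.push_out, ho3]
        refine Printed.singleton ⟨[], by simp, fun e => ?_, by simp [Exp.eval]⟩
        induction e using Sym2.ind with
        | _ u v =>
          simp only [List.map_nil, List.not_mem_nil, Finset.notMem_empty, false_iff, not_and]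
          exact fun _ h => h u (Sym2.mem_mk_left u v)
      · simp only [Exp.size]
        omega
  refine hroot.mono ?_
  intro τ5 t5 hf5 ⟨⟨hE5, hcl5⟩, out0, hout0, hw0, ht5⟩
  have hmul5 : τ5.mem 6 = τ3.mem 6 := hf5.mem 6 rfl
  have r42'' : τ5.reg 42 = τ3.reg 42 := hf5.reg 42 rfl
  have r44 : τ5.reg 44 = jm := (hf5.reg 44 rfl).trans hjm
  refine Wp.forR_time 0 I.m (fun i τ s => (Env I τ ∧ Clear I τ) ∧ ∃ out1 w, I.EdgesOut jm i out1 ∧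
    Printed out1 w ∧ τ.out = τ5.out ++ w ∧ s ≤ 2100 * (i * R) + 16000 * (out1.length * X)) rfl
    (Nat.zero_le _) rfl (Nat.zero_le _) (by omega) ?_ ?_ ?_ ?_
  · intro τ hf
    have := hE5.frame hf (by decide)
    simp only [Exp.Fits, Exp.eval, this.r1, and_true]
    omega
  · exact ⟨⟨hE5.setR _ (by decide), hcl5.setR _ (by decide) (by decide) (by decide)⟩, [], [],
      .zero, .nil, by simp, Nat.zero_le _⟩
  · rintro τ i s _ hi hf r45 ⟨⟨hEτ, hclτ⟩, out1, w, hout1, hw1, ho1, hs⟩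
    have q44 : τ.reg 44 = jm := (hf.reg 44 rfl).trans r44
    have hiR : (i + 1) * R = i * R + R := by ring
    rw [hiR]
    simp only [Wp.ite_iff (c := .seq (.assign 48 (.var 45)) _), Wp.skip_iff, Exp.Fits, Exp.eval,
      Exp.size, r45, q44]
    refine ⟨by omega, fun hne => ?_, fun heq => ?_⟩
    · rw [Wp.seq_iff, Wp.assign_iff]
      simp only [Exp.Fits, Exp.eval, Exp.size, r45]
      refine ⟨by omega, ?_⟩
      rw [Wp.seq_iff]
      refine (genEdge_spec hC (hEτ.setR _ (by decide)) (hclτ.setR _ (by decide) (by decide)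
        (by decide)) hi (by simp)).mono ?_
      intro τ6 t6 hf6 ⟨hE6, hcl6, ⟨K, hg, hN, h17, hmin⟩, ht6⟩
      have he := hC.good.edge i hi
      have q48 : τ6.reg 48 = i := by rw [hf6.reg 48 rfl]; simp
      have ho6 : τ6.out = τ.out := hf6.out rfl
      rw [Wp.ite_iff, Wp.skip_iff]
      simp only [Exp.Fits, Exp.eval, Exp.size, q48, hE6.m1]
      refine ⟨by omega, fun hgt => ?_, fun hle => ?_⟩
      · refine ⟨⟨hE6.setR _ (by decide), hcl6.setR _ (by decide) (by decide) (by decide)⟩, out1, w,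
          .skip _ _ hout1 (Or.inr fun K' hK' => ?_), hw1, by simp [ho6, ho1], by omega⟩
        have := hmin.2 (hK'.greedy.unique hg ▸ hK'.least)
        omega
      · refine (dfs_spec hC hE6 hcl6 hN (by
          rw [hf6.mem 6 rfl, State.setR_mem, hf.mem 6 rfl, hmul5]; exact hmul3) (by
          rw [hf6.reg 42 rfl]; simpa [hf.reg 42 rfl, r42''] using r42')).mono ?_
        intro τ7 t7 hf7 ⟨hE7, hcl7, out, w', hout, hw', ho7, ht7⟩
        rw [hX] at ht7
        refine ⟨⟨hE7.setR _ (by decide), hcl7.setR _ (by decide) (by decide) (by decide)⟩,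
          out1 ++ K :: out, w ++ w', .take _ _ _ _ hout1 (by omega) ⟨hg, hmin.1 (by omega)⟩ hout,
          hw1.append hw', ?_, ?_⟩
        · simp [ho7, ho6, ho1]
        · have : 16000 * ((out1 ++ K :: out).length * X) =
              16000 * (out1.length * X) + 2 * (out.length + 1) * (8000 * X) := by
            rw [List.length_append, List.length_cons]
            ring
          omega
    · exact ⟨⟨hEτ.setR _ (by decide), hclτ.setR _ (by decide) (by decide) (by decide)⟩, out1, w,
        .skip _ _ hout1 (Or.inl (by omega)), hw1, by simpa using ho1, by omega⟩
  · rintro τ t s hf ⟨_, out1, w, hout1, hw1, ho1, hs⟩ ht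
    refine ⟨out0 ++ out1, ⟨jm, hff, out0, out1, rfl, hout1, hout0⟩, ?_, ?_⟩
    · rw [ho1]
      exact hw0.append hw1
    · have h1 : 16000 * ((out0 ++ out1).length * X) =
          16000 * (out0.length * X) + 16000 * (out1.length * X) := by
        rw [List.length_append]
        ring
      have h2 : (I.m + 1) * R = I.m * R + R := by ring
      have h3 : I.m ≤ I.m * R := Nat.le_mul_of_pos_right _ hRp
      simp only [Exp.size] at ht
      omega

end RAM

-- Translation between edge sets and vertex sets

namespace GraphSeq

variable {S : GraphSeq}

open Classical in
/-- The edge set of the complete graph on the vertices with indices in `B`. -/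
def cl (S : GraphSeq) (B : Finset ℕ) : S.Edges :=
  Finset.univ.filter fun x => ¬ x.IsDiag ∧ ∀ v ∈ x, lbl v ∈ B

/-- The indices of the endpoints of the edges of `K`. -/
def vs (K : S.Edges) : Finset ℕ := (S.verts K).image lbl

theorem mem_cl {B : Finset ℕ} {x : Sym2 (Fin S.n)} :
    x ∈ S.cl B ↔ ¬ x.IsDiag ∧ ∀ v ∈ x, lbl v ∈ B := by
  simp [cl]

theorem mk_mem_cl {B : Finset ℕ} {u v : Fin S.n} :
    s(u, v) ∈ S.cl B ↔ u ≠ v ∧ lbl u ∈ B ∧ lbl v ∈ B := by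
  simp [mem_cl]

theorem cl_mono {A B : Finset ℕ} (h : A ⊆ B) : S.cl A ⊆ S.cl B := fun x hx => by
  rw [mem_cl] at hx ⊢
  exact ⟨hx.1, fun v hv => h (hx.2 v hv)⟩

theorem mem_vs {K : S.Edges} {i : ℕ} : i ∈ S.vs K ↔ ∃ v ∈ S.verts K, lbl v = i := by
  simp [vs]

theorem lbl_mem_vs {K : S.Edges} {v : Fin S.n} : lbl v ∈ S.vs K ↔ v ∈ S.verts K := by
  rw [mem_vs]
  exact ⟨fun ⟨u, hu, h⟩ => lbl_inj.1 h ▸ hu, fun h => ⟨v, h, rfl⟩⟩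

theorem vs_range {K : S.Edges} {i : ℕ} (h : i ∈ S.vs K) : 1 ≤ i ∧ i ≤ S.n := by
  obtain ⟨v, _, rfl⟩ := mem_vs.1 h
  exact ⟨lbl_pos v, lbl_le v⟩

theorem vs_mono {K L : S.Edges} (h : K ⊆ L) : S.vs K ⊆ S.vs L := Finset.image_subset_image (verts_mono h)

theorem cl_vs {K : S.Edges} (hK : S.IsClique K) : S.cl (S.vs K) = K := by
  ext x
  induction x using Sym2.ind with
  | _ u v =>
    rw [mk_mem_cl, lbl_mem_vs, lbl_mem_vs]
    exact ⟨fun h => hK.2 u h.2.1 v h.2.2 h.1,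
      fun h => ⟨hK.ne h, left_mem_verts h, right_mem_verts h⟩⟩

/-- An edge set does not show an isolated vertex; this is why sets of at least two vertices are
required here and below. -/
theorem vs_cl {B : Finset ℕ} (hB : ∀ u ∈ B, 1 ≤ u ∧ u ≤ S.n) (h2 : 2 ≤ B.card) :
    S.vs (S.cl B) = B := by
  ext i
  rw [mem_vs]
  constructor
  · rintro ⟨v, hv, rfl⟩
    obtain ⟨x, hx, hvx⟩ := mem_verts.1 hv
    exact (mem_cl.1 hx).2 v hvx
  · intro hi
    obtain ⟨j, hj, hne⟩ := Finset.exists_mem_ne h2 i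
    obtain ⟨u, rfl⟩ := exists_lbl (hB i hi).1 (hB i hi).2
    obtain ⟨w, rfl⟩ := exists_lbl (hB j hj).1 (hB j hj).2
    exact ⟨u, left_mem_verts (v := w) (mk_mem_cl.2 ⟨fun h => hne (by rw [h]), hi, hj⟩), rfl⟩

theorem cl_inj {A B : Finset ℕ} (hA : ∀ u ∈ A, 1 ≤ u ∧ u ≤ S.n) (hB : ∀ u ∈ B, 1 ≤ u ∧ u ≤ S.n)
    (hA2 : 2 ≤ A.card) (hB2 : 2 ≤ B.card) (h : S.cl A = S.cl B) : A = B := by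
  rw [← vs_cl hA hA2, ← vs_cl hB hB2, h]

theorem two_le_card_vs {K : S.Edges} (hK : S.IsClique K) (hne : K.Nonempty) :
    2 ≤ (S.vs K).card := by
  obtain ⟨x, hx⟩ := hne
  induction x using Sym2.ind with
  | _ u v =>
    exact Finset.one_lt_card.2 ⟨lbl u, lbl_mem_vs.2 (left_mem_verts hx), lbl v,
      lbl_mem_vs.2 (right_mem_verts hx), fun h => hK.ne hx (lbl_inj.1 h)⟩

theorem isClique_cl {B : Finset ℕ} (h : ∀ x ∈ S.cl B, x ∈ S.G.edgeSet) : S.IsClique (S.cl B) := by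
  refine ⟨h, fun u hu v hv hne => ?_⟩
  obtain ⟨x, hx, hux⟩ := mem_verts.1 hu
  obtain ⟨y, hy, hvy⟩ := mem_verts.1 hv
  exact mk_mem_cl.2 ⟨hne, (mem_cl.1 hx).2 u hux, (mem_cl.1 hy).2 v hvy⟩

theorem cl_nonempty {B : Finset ℕ} (hB : ∀ u ∈ B, 1 ≤ u ∧ u ≤ S.n) (h2 : 2 ≤ B.card) :
    (S.cl B).Nonempty := by
  obtain ⟨i, hi⟩ := Finset.card_pos.1 (show 0 < B.card by omega)
  rw [← vs_cl hB h2] at hi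
  obtain ⟨v, hv, _⟩ := mem_vs.1 hi
  obtain ⟨x, hx, _⟩ := mem_verts.1 hv
  exact ⟨x, hx⟩

/-- Two cliques are compared lexicographically by the least vertex in which they differ. -/
theorem lexLT_cl {A B C : Finset ℕ} {w : ℕ} (hB : ∀ u ∈ B, 1 ≤ u ∧ u ≤ S.n) (hA : 2 ≤ A.card)
    (hAB : A ⊆ B) (hw : w ∈ B) (hwC : w ∉ C) (h : ∀ z < w, z ∈ B ↔ z ∈ C) :
    S.LexLT (S.cl B) (S.cl C) := by
  have hne : (B.erase w).Nonempty := by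
    rw [← Finset.card_pos, Finset.card_erase_of_mem hw]
    have := Finset.card_le_card hAB
    omega
  -- The first difference of the edge sets is the edge from `w` to the least other vertex `z` of
  -- `B`. An earlier edge either has an endpoint that excludes it from both sets, or has both
  -- endpoints below `w`, where `B` and `C` agree.
  obtain ⟨z, hz, hzmin⟩ := Finset.exists_min_image _ id hne
  rw [Finset.mem_erase] at hz
  have hmin : ∀ y ∈ B, y ≠ w → z ≤ y := fun y hy hyw => hzmin y (Finset.mem_erase.2 ⟨hyw, hy⟩)
  obtain ⟨v, rfl⟩ := exists_lbl (hB w hw).1 (hB w hw).2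
  obtain ⟨u, rfl⟩ := exists_lbl (hB z hz.2).1 (hB z hz.2).2
  have huv : u ≠ v := fun hc => hz.1 (by rw [hc])
  refine ⟨s(u, v), mk_mem_cl.2 ⟨huv, hz.2, hw⟩, fun hc => hwC (mk_mem_cl.1 hc).2.2, ?_⟩
  intro e' he'
  induction e' using Sym2.ind with
  | _ a b =>
    wlog hab : a ≤ b generalizing a b
    · rw [Sym2.eq_swap] at he' ⊢
      exact this b a he' (le_of_not_ge hab)
    rcases hab.eq_or_lt with rfl | hab
    · simp [mk_mem_cl]
    rw [mk_mem_cl, mk_mem_cl]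
    rcases lt_or_gt_of_ne huv with hlt | hlt
    · rw [edgeLT_mk hab hlt] at he'
      rcases he' with h1 | ⟨rfl, h1⟩
      · have e1 : lbl a ∉ B := fun hc => by
          have := hmin _ hc fun h => by
            have := lbl_inj.1 h
            omega
          rw [lbl_le_lbl] at this
          omega
        have e2 : lbl a ∉ C := fun hc => e1 ((h _ (lbl_lt_lbl.2 (h1.trans hlt))).2 hc)
        tauto
      · rw [h _ (lbl_lt_lbl.2 hlt), h _ (lbl_lt_lbl.2 h1)]
    · rw [Sym2.eq_swap (a := u), edgeLT_mk hab hlt] at he'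
      rcases he' with h1 | ⟨rfl, h1⟩
      · have e1 : lbl a ∉ B := fun hc => by
          have := hmin _ hc fun h => by
            have := lbl_inj.1 h
            omega
          rw [lbl_le_lbl] at this
          omega
        have e2 : lbl a ∉ C := fun hc => e1 ((h _ (lbl_lt_lbl.2 h1)).2 hc)
        tauto
      · have e1 : lbl b ∉ B := fun hc => by
          have := hmin _ hc fun h => by
            have := lbl_inj.1 h
            omega
          rw [lbl_le_lbl] at this
          omega
        tauto

/-- The numbers and arrays of `I` represent the graph sequence, the edge of number `j` being
`e j`. -/
structure Link (S : GraphSeq) (I : Net) (e : ℕ → Sym2 (Fin S.n)) (R D : ℕ) : Prop where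
  good : I.Good R D
  n_eq : I.n = S.n
  T_eq : I.T = S.tmax
  e_mk : ∀ j < I.m, ∃ u v : Fin S.n, u < v ∧ e j = s(u, v) ∧ I.eu j = lbl u ∧ I.ev j = lbl v
  e_mem : ∀ j < I.m, e j ∈ S.G.edgeSet
  e_surj : ∀ x ∈ S.G.edgeSet, ∃ j < I.m, e j = x
  e_time : ∀ j < I.m, S.τ (e j) = Finset.Icc (I.lo j) (I.hi j)

namespace Link

variable {I : Net} {e : ℕ → Sym2 (Fin S.n)} {R D : ℕ}

theorem e_inj (h : S.Link I e R D) {i j : ℕ} (hi : i < I.m) (hj : j < I.m) (hij : e i = e j) :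
    i = j := by
  obtain ⟨u, v, huv, h1, h2, h3⟩ := h.e_mk i hi
  obtain ⟨u', v', huv', h1', h2', h3'⟩ := h.e_mk j hj
  refine h.good.edge_unique hi hj ?_
  rw [h1, h1', Sym2.eq_iff] at hij
  rcases hij with ⟨rfl, rfl⟩ | ⟨rfl, rfl⟩
  · exact Or.inl ⟨by rw [h2, h2'], by rw [h3, h3']⟩
  · exact Or.inr ⟨by rw [h2, h3'], by rw [h3, h2']⟩

theorem e_eq_iff (h : S.Link I e R D) {j : ℕ} (hj : j < I.m) {u v : Fin S.n} :
    e j = s(u, v) ↔ (I.eu j = lbl u ∧ I.ev j = lbl v) ∨ (I.eu j = lbl v ∧ I.ev j = lbl u) := by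
  obtain ⟨a, b, _, h1, h2, h3⟩ := h.e_mk j hj
  rw [h1, h2, h3, Sym2.eq_iff, lbl_inj, lbl_inj, lbl_inj, lbl_inj]

theorem H_iff (h : S.Link I e R D) {a b : ℕ} {u v : Fin S.n} (hab : a ≤ b) :
    I.H a b (lbl u) (lbl v) ↔ s(u, v) ∈ S.G.edgeSet ∧ Finset.Icc a b ⊆ S.τ s(u, v) := by
  constructor
  · rintro ⟨j, hj, h1, h2, h3⟩
    rw [← (h.e_eq_iff hj).2 h1, h.e_time j hj]
    exact ⟨h.e_mem j hj, Finset.Icc_subset_Icc h2 h3⟩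
  · rintro ⟨h1, h2⟩
    obtain ⟨j, hj, h3⟩ := h.e_surj _ h1
    rw [← h3, h.e_time j hj, Finset.Icc_subset_Icc_iff hab] at h2
    exact ⟨j, hj, (h.e_eq_iff hj).1 h3, h2⟩

theorem cliq_iff (h : S.Link I e R D) {a b : ℕ} {B : Finset ℕ} (hab : a ≤ b) :
    I.Cliq a b B ↔ (∀ u ∈ B, 1 ≤ u ∧ u ≤ S.n) ∧
      ∀ x ∈ S.cl B, x ∈ S.G.edgeSet ∧ Finset.Icc a b ⊆ S.τ x := by
  rw [Net.Cliq, h.n_eq]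
  refine and_congr_right fun hB => ⟨fun h1 x hx => ?_, fun h1 i hi j hj hne => ?_⟩
  · induction x using Sym2.ind with
    | _ u v =>
      rw [mk_mem_cl] at hx
      exact (h.H_iff hab).1 (h1 _ hx.2.1 _ hx.2.2 fun hc => hx.1 (lbl_inj.1 hc))
  · obtain ⟨u, rfl⟩ := exists_lbl (hB i hi).1 (hB i hi).2
    obtain ⟨v, rfl⟩ := exists_lbl (hB j hj).1 (hB j hj).2
    exact (h.H_iff hab).2 (h1 _ (mk_mem_cl.2 ⟨fun hc => hne (by rw [hc]), hi, hj⟩))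

theorem isClique_cl (h : S.Link I e R D) {a b : ℕ} {B : Finset ℕ} (hab : a ≤ b)
    (hB : I.Cliq a b B) : S.IsClique (S.cl B) :=
  GraphSeq.isClique_cl fun x hx => (((h.cliq_iff hab).1 hB).2 x hx).1

theorem range (h : S.Link I e R D) {a b : ℕ} {B : Finset ℕ} (hB : I.Cliq a b B) :
    ∀ u ∈ B, 1 ≤ u ∧ u ≤ S.n := h.n_eq ▸ hB.1

theorem timeIs_iff (h : S.Link I e R D) {a b : ℕ} {B : Finset ℕ}
    (hB : ∀ x ∈ S.cl B, x ∈ S.G.edgeSet) :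
    I.TimeIs B a b ↔ Finset.Icc a b = S.timeOf (S.cl B) := by
  rw [Net.TimeIs, Finset.ext_iff]
  refine forall_congr' fun t => ?_
  rw [Finset.mem_Icc, mem_timeOf, h.T_eq]
  refine iff_congr Iff.rfl (and_congr_right fun _ => ⟨fun h1 x hx => ?_, fun h1 j hj hu hv => ?_⟩)
  · obtain ⟨j, hj, rfl⟩ := h.e_surj x (hB x hx)
    obtain ⟨u, v, huv, h2, h3, h4⟩ := h.e_mk j hj
    rw [h2, mk_mem_cl] at hx
    rw [h.e_time j hj, Finset.mem_Icc]
    exact h1 j hj (h3 ▸ hx.2.1) (h4 ▸ hx.2.2)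
  · obtain ⟨u, v, huv, h2, h3, h4⟩ := h.e_mk j hj
    rw [← Finset.mem_Icc, ← h.e_time j hj]
    refine h1 _ ?_
    rw [h2, mk_mem_cl]
    exact ⟨huv.ne, h3 ▸ hu, h4 ▸ hv⟩

theorem timeOf_eq (h : S.Link I e R D) {a b : ℕ} {B : Finset ℕ} (hab : a ≤ b)
    (hB : I.Cliq a b B) (ht : I.TimeIs B a b) : S.timeOf (S.cl B) = Finset.Icc a b :=
  ((h.timeIs_iff fun x hx => (((h.cliq_iff hab).1 hB).2 x hx).1).1 ht).symm

/-- The cliques whose times include `[a, b]`. -/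
theorem cliq_vs (h : S.Link I e R D) {a b : ℕ} {K : S.Edges} (hab : a ≤ b) (hK : S.IsClique K)
    (ht : Finset.Icc a b ⊆ S.timeOf K) : I.Cliq a b (S.vs K) := by
  rw [h.cliq_iff hab, cl_vs hK]
  exact ⟨fun u hu => vs_range hu, fun x hx => ⟨hK.1 x hx, fun t h1 => (mem_timeOf.1 (ht h1)).2 x hx⟩⟩

/-- Suppose that a missing vertex `w` were joined to `A` and to all smaller vertices of the
completion. Keeping only these vertices and adding `w` gives a clique with the same times, whose own
completion is lexicographically smaller than the supposed minimum. -/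
theorem greedy_X (h : S.Link I e R D) {a b : ℕ} {A : Finset ℕ} (hab : a ≤ b) (hA : I.Cliq a b A)
    (h2 : 2 ≤ A.card) (ht : I.TimeIs A a b) : I.Greedy a b A (S.vs (S.X (S.cl A))) := by
  have hcl := h.isClique_cl hab hA
  have htA := h.timeOf_eq hab hA ht
  have hX := X_isCompletion hcl
  set B := S.vs (S.X (S.cl A)) with hBd
  have hBcl : S.cl B = S.X (S.cl A) := cl_vs (isClique_X hcl)
  have hAB : A ⊆ B := by
    rw [← vs_cl (h.range hA) h2]
    exact vs_mono (subset_X hcl)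
  have hB : I.Cliq a b B := h.cliq_vs hab (isClique_X hcl) (by rw [timeOf_X hcl, htA])
  refine ⟨hAB, hB, fun w hw h1 h3 => ?_⟩
  by_contra! hc
  -- Only the vertices of `A` and those below `w` are kept; larger vertices need not be joined to
  -- `w` and do not affect the comparison.
  set B2 := insert w (B.filter fun z => z ∈ A ∨ z < w) with hB2d
  have hmem2 : ∀ z, z ∈ B2 ↔ z = w ∨ (z ∈ B ∧ (z ∈ A ∨ z < w)) := by simp [hB2d]
  have hB2 : I.Cliq a b B2 := (hB.subset (Finset.filter_subset _ _)).insert ⟨h1, h3⟩ fun u hu => by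
    rw [Finset.mem_filter] at hu
    by_contra hn
    obtain ⟨h5, h6⟩ := hc u hu.1 hn
    exact hu.2.elim h5 (by omega)
  have hAB2 : A ⊆ B2 := fun z hz => (hmem2 z).2 (Or.inr ⟨hAB hz, Or.inl hz⟩)
  have hcl2 := h.isClique_cl hab hB2
  have ht2 : S.timeOf (S.cl B2) = S.timeOf (S.cl A) := by
    refine (timeOf_anti (cl_mono hAB2)).antisymm ?_
    rw [htA]
    intro t htt
    refine mem_timeOf.2 ⟨(mem_timeOf.1 (htA ▸ htt : t ∈ S.timeOf (S.cl A))).1, fun x hx =>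
      (((h.cliq_iff hab).1 hB2).2 x hx).2 htt⟩
  set B3 := S.vs (S.X (S.cl B2)) with hB3d
  have hB3cl : S.cl B3 = S.X (S.cl B2) := cl_vs (isClique_X hcl2)
  have hB23 : B2 ⊆ B3 := by
    rw [← vs_cl (h.range hB2) (h2.trans (Finset.card_le_card hAB2))]
    exact vs_mono (subset_X hcl2)
  have hw3 : w ∈ B3 := hB23 ((hmem2 w).2 (Or.inl rfl))
  obtain ⟨w', hw', hmin⟩ := Finset.exists_min_image (B3 \ B) id ⟨w, Finset.mem_sdiff.2 ⟨hw3, hw⟩⟩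
  rw [Finset.mem_sdiff] at hw'
  have hw'w : w' ≤ w := hmin w (Finset.mem_sdiff.2 ⟨hw3, hw⟩)
  -- Below `w'` nothing is new, by minimality of `w'`, and nothing is lost, since `w' ≤ w` and `B2`
  -- keeps the vertices of `B` below `w`.
  have hlex : S.LexLT (S.cl B3) (S.cl B) := by
    refine lexLT_cl (fun u hu => vs_range hu) h2 (hAB2.trans hB23) hw'.1 hw'.2 fun z hz => ⟨fun h4 => ?_, fun h4 => ?_⟩
    · by_contra h5
      have : w' ≤ z := hmin z (Finset.mem_sdiff.2 ⟨h4, h5⟩)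
      omega
    · exact hB23 ((hmem2 z).2 (Or.inr ⟨h4, Or.inr (by omega)⟩))
  rw [hB3cl, hBcl] at hlex
  rcases hX.2 (S.X (S.cl B2)) (isClique_X hcl2) (isClosed_X hcl2)
    ((cl_mono hAB2).trans (subset_X hcl2)) ((timeOf_X hcl2).trans ht2) with h4 | h4
  · exact LexLT.irrefl _ (h4 ▸ hlex)
  · exact hlex.asymm h4

/-- By uniqueness of closures, any greedily computed clique is the completion; this identifies the
cliques of the machine with those of the algorithm. -/
theorem X_cl (h : S.Link I e R D) {a b : ℕ} {A B : Finset ℕ} (hab : a ≤ b) (h2 : 2 ≤ A.card)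
    (ht : I.TimeIs A a b) (hg : I.Greedy a b A B) : S.X (S.cl A) = S.cl B := by
  have hA := hg.2.1.subset hg.1
  rw [← (h.greedy_X hab hA h2 ht).unique hg, cl_vs (isClique_X (h.isClique_cl hab hA))]

/-- Maximal cliques, within their active times, are closed. -/
theorem closedActive (h : S.Link I e R D) {a b : ℕ} {K : Finset ℕ} (hK : I.Sat a b K)
    (h2 : 2 ≤ K.card) : S.ClosedActive (S.cl K) := by
  have hcl := h.isClique_cl hK.le hK.cliq
  have ht := h.timeOf_eq hK.le hK.cliq hK.time
  refine ⟨hcl, ?_, fun K' hK' hss htt => ?_⟩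
  · rw [ht]
    exact ⟨a, Finset.mem_Icc.2 ⟨le_rfl, hK.le⟩⟩
  · have hc := h.cliq_vs hK.le hK' (by rw [← htt, ht])
    have hsub := vs_mono hss.1
    rw [vs_cl (h.range hK.cliq) h2] at hsub
    refine hss.2 ?_
    rw [← cl_vs hK']
    refine cl_mono fun w hw => ?_
    by_contra hwK
    obtain ⟨z, hz, hzw⟩ := hK.max w hwK (hc.1 w hw).1 (hc.1 w hw).2
    exact hzw (hc.2 z (hsub hz) w hw fun hh => hwK (hh ▸ hz))

end Link

end GraphSeq

-- Every child has exactly one code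

namespace Net

variable {I : Net} {R D : ℕ}

/-- The codes of the children of a clique are unique. -/
theorem KidAt.code_unique (hI : I.Good R D) {α β c c' v a b : ℕ} {K K' : Finset ℕ}
    (hK : I.Cliq α β K) (h : I.KidAt α β K c v a b K') (h' : I.KidAt α β K c' v a b K') :
    c = c' := by
  have hv := h.v_le
  obtain ⟨x, hx, p, q, p1, p2, p3, q1, q2, rfl, hV⟩ := h
  obtain ⟨x', hx', p', q', p1', p2', p3', q1', q2', rfl, hV'⟩ := h'
  -- Each of the two choices is canonical with respect to the edges of the other. Both comparisons
  -- together force equal end points of intervals and then, by the tie-breaking rule, equal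
  -- vertices.
  have key : ∀ {x p y g x' p' y' g'}, x ∈ K → I.st x ≤ p → p < I.st (x + 1) → v = I.oth (I.inc p) x →
      I.ViaLow K x (I.inc p) y g v a b K' → I.ViaLow K x' (I.inc p') y' g' v a b K' →
      I.Canon (I.inc p') x' g' y' (I.inc p) x := by
    intro x p y g x' p' y' g' hx p1 p2 p3 hV hV'
    obtain ⟨a1, _, _, _, a5⟩ := hI.seg (hK.1 x hx).1 (hK.1 x hx).2 p1 p2
    rw [← p3] at a5
    obtain ⟨r, r1, r2, r3, r4⟩ := hI.exists_seg a1 a5.symm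
    have := hV'.canon r r1 r2 (r4 ▸ hV.x_mem)
    rwa [r4, r3] at this
  have k1 := (key hx p1 p2 p3 hV.toLow hV'.toLow).1
  have k2 := (key hx' p1' p2' p3' hV'.toLow hV.toLow).1
  have k3 := (hV'.toLow.canon q q1 q2 hV.toLow.y_mem).2
  have k4 := (hV.toLow.canon q' q1' q2' hV'.toLow.y_mem).2
  obtain rfl : x = x' := by omega
  obtain rfl : p = p' := hI.seg_inj (hK.1 x hx).1 (hK.1 x hx).2 p1 p2 p1' p2' (p3 ▸ p3')
  obtain rfl : q = q' := hI.seg_inj hv.1 hv.2 q1 q2 q1' q2' (by omega)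
  rfl

/-- As `f` take an edge from `v` into the lower part with latest beginning, as `g` one with earliest
end, preferring smaller endpoints in ties. All other edges at `v` contain the interval between these
bounds, so `f` and `g` alone cut `[α, β]` down to `[a, b]`. -/
theorem exists_kidAt (hI : I.Good R D) {α β v a b : ℕ} {K K' : Finset ℕ} (hab : a ≤ b)
    (h2 : 2 ≤ (K'.filter (· < v)).card) (hv : v ∈ K')
    (tA : I.TimeIs (K'.filter (· < v)) α β) (gA : I.Greedy α β (K'.filter (· < v)) K)
    (hvK : v ∉ K) (tB : I.TimeIs (insert v (K'.filter (· < v))) a b)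
    (gB : I.Greedy a b (insert v (K'.filter (· < v))) K') : ∃ c, I.KidAt α β K c v a b K' := by
  set A := K'.filter (· < v) with hAd
  have hmemA : ∀ z, z ∈ A ↔ z ∈ K' ∧ z < v := fun z => by rw [hAd, Finset.mem_filter]
  have hvn := gB.2.1.1 v hv
  have hle := tA.anti tB (Finset.subset_insert _ _) hab
  -- A vertex of `K` below `v` that is joined to `v` cannot be missing from `K'`: greediness would
  -- separate it from `v` or from a vertex of `A`, but it is joined to all of these.
  have hlow : I.lower a b v K = A := by
    ext z
    rw [mem_lower, hmemA]
    constructor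
    · rintro ⟨h3, h4, h5⟩
      refine ⟨?_, h4⟩
      by_contra hz
      obtain ⟨u, hu, h6, h7⟩ := gB.2.2 z hz (gA.2.1.1 z h3).1 (gA.2.1.1 z h3).2
      by_cases huv : u = v
      · exact h6 (huv ▸ h5)
      · have huA : u ∈ A := by
          rcases h7 with h7 | h7
          · exact (Finset.mem_insert.1 h7).resolve_left huv
          · exact (hmemA u).2 ⟨hu, h7.trans h4⟩
        exact h6 ((gA.2.1.2 u (gA.1 huA) z h3 fun hh => hz (hh ▸ hu)).mono hle.1 hle.2)
    · rintro ⟨h3, h4⟩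
      exact ⟨gA.1 ((hmemA z).2 ⟨h3, h4⟩), h4, gB.2.1.2 v hv z h3 (by omega)⟩
  have hseg : ∀ z ∈ A, ∃ p, I.st v ≤ p ∧ p < I.st (v + 1) ∧ I.oth (I.inc p) v = z := by
    intro z hz
    have hz' := (hmemA z).1 hz
    obtain ⟨j, hj, h3, _⟩ := gB.2.1.2 v hv z hz'.1 (by omega)
    obtain ⟨p, p1, p2, _, p4⟩ := hI.exists_seg hj h3
    exact ⟨p, p1, p2, p4⟩
  set P := (Finset.Ico (I.st v) (I.st (v + 1))).filter fun p => I.oth (I.inc p) v ∈ A with hP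
  have hmemP : ∀ p, p ∈ P ↔ (I.st v ≤ p ∧ p < I.st (v + 1)) ∧ I.oth (I.inc p) v ∈ A := fun p => by
    rw [hP, Finset.mem_filter, Finset.mem_Ico]
  have hPne : P.Nonempty := by
    obtain ⟨z, hz⟩ := Finset.card_pos.1 (show 0 < A.card by omega)
    obtain ⟨p, p1, p2, rfl⟩ := hseg z hz
    exact ⟨p, (hmemP p).2 ⟨⟨p1, p2⟩, hz⟩⟩
  -- The maximum is taken over beginnings, so the endpoint is put into the order dual to prefer
  -- smaller ones.
  obtain ⟨r, hr, hrmax⟩ := Finset.exists_max_image P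
    (fun p => toLex (I.lo (I.inc p), OrderDual.toDual (I.oth (I.inc p) v))) hPne
  obtain ⟨q, hq, hqmin⟩ := Finset.exists_min_image P
    (fun p => toLex (I.hi (I.inc p), I.oth (I.inc p) v)) hPne
  simp only [Prod.Lex.toLex_le_toLex, OrderDual.toDual_le_toDual] at hrmax hqmin
  obtain ⟨⟨r1, r2⟩, hrA⟩ := (hmemP r).1 hr
  obtain ⟨⟨q1, q2⟩, hqA⟩ := (hmemP q).1 hq
  obtain ⟨a1, a2, a3, a4, a5⟩ := hI.seg hvn.1 hvn.2 r1 r2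
  obtain ⟨b1, b2, b3, b4, b5⟩ := hI.seg hvn.1 hvn.2 q1 q2
  set x := I.oth (I.inc r) v with hx
  set y := I.oth (I.inc q) v with hy
  -- The code refers to `f` by its position in the segment of `x`, whereas `r` is its position in
  -- the segment of `v`.
  obtain ⟨p, p1, p2, p3, p4⟩ := hI.exists_seg a1 a5.symm
  have hvA : v ∉ A := fun hc => by
    have := (hmemA v).1 hc
    omega
  have ht : I.TimeIs (insert v A) (max α (I.lo (I.inc r))) (min β (I.hi (I.inc q))) := by
    intro t
    constructor
    · intro ht
      have hAt := (tA t).1 (by omega)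
      refine ⟨hAt.1, fun j hj hu hw => ?_⟩
      have hej := hI.edge j hj
      have hs : ∀ z ∈ A, ((I.eu j = v ∧ I.ev j = z) ∨ (I.eu j = z ∧ I.ev j = v)) →
          I.lo j ≤ t ∧ t ≤ I.hi j := by
        intro z hz h3
        obtain ⟨s, s1, s2, s3, s4⟩ := hI.exists_seg hj h3
        have hsP := (hmemP s).2 ⟨⟨s1, s2⟩, s4 ▸ hz⟩
        have h4 := hrmax s hsP
        have h5 := hqmin s hsP
        rw [s3] at h4 h5
        omega
      rcases Finset.mem_insert.1 hu with h3 | h3 <;> rcases Finset.mem_insert.1 hw with h4 | h4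
      · omega
      · exact hs _ h4 (Or.inl ⟨h3, rfl⟩)
      · exact hs _ h3 (Or.inr ⟨rfl, h4⟩)
      · exact hAt.2 j hj h3 h4
    · rintro ⟨h3, h4⟩
      have h5 := (tA t).2 ⟨h3, fun j hj hu hw =>
        h4 j hj (Finset.mem_insert_of_mem hu) (Finset.mem_insert_of_mem hw)⟩
      have hin : ∀ z ∈ A, ∀ j, j < I.m → ((I.eu j = v ∧ I.ev j = z) ∨ (I.eu j = z ∧ I.ev j = v)) →
          I.lo j ≤ t ∧ t ≤ I.hi j := by
        rintro z hz j hj (⟨h6, h7⟩ | ⟨h6, h7⟩)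
        · exact h4 j hj (h6 ▸ Finset.mem_insert_self _ _) (h7 ▸ Finset.mem_insert_of_mem hz)
        · exact h4 j hj (h6 ▸ Finset.mem_insert_of_mem hz) (h7 ▸ Finset.mem_insert_self _ _)
      have h6 := hin x hrA _ a1 a5
      have h7 := hin y hqA _ b1 b5
      omega
  obtain ⟨e1, e2⟩ := tB.unique ht hab
  refine ⟨p * (2 * I.m) + q, x, gA.1 hrA, p, q, p1, p2, p4.symm, q1, q2, rfl, ?_⟩
  rw [p3]
  refine ⟨e1.symm, e2.symm, hab, hlow.symm ▸ gB, ⟨hlow.symm ▸ h2, hlow.symm ▸ hrA, hlow.symm ▸ hqA, ?_, ?_⟩,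
    hlow.symm ▸ ⟨tA, gA, hvK⟩⟩
  · intro s s1 s2 hs
    rw [hlow] at hs
    have hsP := (hmemP s).2 ⟨⟨s1, s2⟩, hs⟩
    have h4 := hrmax s hsP
    have h5 := hqmin s hsP
    unfold Canon
    omega
  · intro z hz hzv
    rw [hlow]
    exact (hmemA z).2 ⟨hz, hzv⟩

end Net

-- The coded children are the children in the family tree

namespace GraphSeq

variable {S : GraphSeq}

theorem upTo_cl (B : Finset ℕ) (i : ℕ) : S.upTo (S.cl B) i = S.cl (B.filter (· ≤ i)) := by
  ext x
  rw [mem_upTo, mem_cl, mem_cl, and_assoc, ← forall₂_and]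
  simp only [Finset.mem_filter]

namespace Link

variable {I : Net} {e : ℕ → Sym2 (Fin S.n)} {R D : ℕ}

/-- Intervals are closed under intersection. For inactive sets the interval on the right is empty.
-/
theorem exists_timeOf_eq (h : S.Link I e R D) {F : S.Edges} (hF : ∀ x ∈ F, x ∈ S.G.edgeSet) :
    ∃ a b, S.timeOf F = Finset.Icc a b := by
  classical
  induction F using Finset.induction_on with
  | empty => exact ⟨1, S.tmax, by ext t; simp [mem_timeOf]⟩
  | insert x F _ ih =>
    obtain ⟨a, b, hab⟩ := ih fun y hy => hF y (Finset.mem_insert_of_mem hy)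
    obtain ⟨j, hj, rfl⟩ := h.e_surj x (hF x (Finset.mem_insert_self _ _))
    refine ⟨max a (I.lo j), min b (I.hi j), ?_⟩
    ext t
    have h1 := Finset.ext_iff.1 hab t
    have h2 := Finset.ext_iff.1 (h.e_time j hj) t
    rw [Finset.mem_Icc, mem_timeOf] at h1
    rw [Finset.mem_Icc] at h2
    rw [mem_timeOf, Finset.forall_mem_insert, h2, Finset.mem_Icc, sup_le_iff, le_inf_iff]
    tauto

/-- The two closures in `Via` say that the part of `K'` below `v` generates `K` and that the part up
to `v` generates `K'`. -/
theorem isKid (h : S.Link I e R D) {α β c v a b : ℕ} {K K' : Finset ℕ} (hK : I.Sat α β K)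
    (hk : I.KidAt α β K c v a b K') : 2 ≤ K'.card ∧ S.IsKid (S.cl K) (S.cl K') ∧ S.idx (S.cl K') = v ∧
      (S.upTo (S.cl K') (S.idx (S.cl K') - 1)).Nonempty := by
  have hK' := hk.sat h.good hK
  obtain ⟨_, _, _, _, hV, _⟩ := hk.via
  have hv := hk.v_le
  have hlow2 := hV.toLow.card
  have hsub : I.lower a b v K ⊆ K' := fun z hz => ((hk.lower_eq z).1 hz).1
  have h2 : 2 ≤ K'.card := hlow2.trans (Finset.card_le_card hsub)
  have hK2 : 2 ≤ K.card := hlow2.trans (Finset.card_le_card hV.toUp.greedy.1)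
  have hCA := h.closedActive hK' h2
  have e1 : S.upTo (S.cl K') (v - 1) = S.cl (I.lower a b v K) := by
    rw [upTo_cl]
    congr 1
    ext z
    rw [hk.lower_eq, Finset.mem_filter]
    exact and_congr_right fun _ => by omega
  have e2 : S.upTo (S.cl K') v = S.cl (insert v (I.lower a b v K)) := by
    rw [upTo_cl]
    congr 1
    ext z
    rw [Finset.mem_insert, hk.lower_eq, Finset.mem_filter]
    constructor
    · intro h3
      by_cases h4 : z = v
      · exact Or.inl h4
      · exact Or.inr ⟨h3.1, by omega⟩
    · rintro (rfl | h3)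
      · exact ⟨hk.v_mem, le_rfl⟩
      · exact ⟨h3.1, h3.2.le⟩
  have x1 : S.X (S.upTo (S.cl K') (v - 1)) = S.cl K := by
    rw [e1]
    exact h.X_cl hK.le hlow2 hV.toUp.time hV.toUp.greedy
  have x2 : S.X (S.upTo (S.cl K') v) = S.cl K' := by
    rw [e2]
    refine h.X_cl hK'.le ?_ (hk.timeIs h.good hK subset_rfl ?_) hV.greedy
    · exact hlow2.trans (Finset.card_le_card (Finset.subset_insert _ _))
    · exact hV.greedy.1
  -- Were the index smaller than `v`, the part below `v` would generate both `K` and `K'`, and `v`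
  -- would lie in `K`.
  have hidx : S.idx (S.cl K') = v := by
    refine le_antisymm (idx_le_of_X x2) ?_
    by_contra hlt
    have := X_upTo_of_le hCA (i := v - 1) (by omega)
    rw [x1] at this
    exact hV.toUp.notMem (cl_inj (h.range hK.cliq) (h.range hK'.cliq) hK2 h2 this ▸ hk.v_mem)
  refine ⟨h2, ⟨hCA, fun hr => ?_, ?_⟩, hidx, ?_⟩
  · rw [hr, idx_root] at hidx
    omega
  · rw [parent, hidx, x1]
  · rw [hidx, e1]
    exact cl_nonempty (fun u hu => h.range hK'.cliq u (hsub hu)) hlow2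

/-- Let `A` be the set of vertices of `K'` below its index; an edge below the index provides two of
them. The completions of `A` and of `A` together with the index vertex are `K` and `K'`. Both are
greedy closures with the right times, which is what `Net.exists_kidAt` requires. -/
theorem exists_kidAt (h : S.Link I e R D) {α β : ℕ} {K : Finset ℕ} (hK : I.Sat α β K)
    (h2 : 2 ≤ K.card) {K' : S.Edges} (hk : S.IsKid (S.cl K) K')
    (hne : (S.upTo K' (S.idx K' - 1)).Nonempty) :
    ∃ c v a b B, I.KidAt α β K c v a b B ∧ S.cl B = K' := by
  obtain ⟨hCA, hr, hp⟩ := hk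
  obtain ⟨v, hv⟩ := exists_idx_vertex hCA hr
  obtain ⟨u, hu, huv⟩ := exists_lower_neighbor hCA hr hv
  have hv1 := lbl_pos v
  have hcl : S.cl (S.vs K') = K' := cl_vs hCA.1
  set A := (S.vs K').filter (· < lbl v) with hA
  have hvm : lbl v ∈ S.vs K' := lbl_mem_vs.2 (right_mem_verts huv)
  have e1 : S.upTo K' (S.idx K' - 1) = S.cl A := by
    rw [← hv]
    conv_lhs => rw [← hcl]
    rw [upTo_cl, hA]
    congr 1
    ext z
    rw [Finset.mem_filter, Finset.mem_filter]
    exact and_congr_right fun _ => by omega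
  have e2 : S.upTo K' (S.idx K') = S.cl (insert (lbl v) A) := by
    rw [← hv]
    conv_lhs => rw [← hcl]
    rw [upTo_cl, hA]
    congr 1
    ext z
    rw [Finset.mem_insert, Finset.mem_filter, Finset.mem_filter]
    constructor
    · intro h3
      by_cases h4 : z = lbl v
      · exact Or.inl h4
      · exact Or.inr ⟨h3.1, by omega⟩
    · rintro (rfl | h3)
      · exact ⟨hvm, le_rfl⟩
      · exact ⟨h3.1, h3.2.le⟩
  have hAr : ∀ z ∈ A, 1 ≤ z ∧ z ≤ S.n := fun z hz => vs_range (Finset.mem_filter.1 hz).1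
  have hAc := hCA.1.upTo (S.idx K' - 1)
  have hBc := hCA.1.upTo (S.idx K')
  have hA2 : 2 ≤ A.card := by
    refine (two_le_card_vs hAc hne).trans (Finset.card_le_card ?_)
    rw [e1]
    intro i hi
    obtain ⟨w, hw, rfl⟩ := mem_vs.1 hi
    obtain ⟨x, hx, hwx⟩ := mem_verts.1 hw
    exact (mem_cl.1 hx).2 w hwx
  have hp' : S.X (S.cl A) = S.cl K := by rw [← e1]; exact hp
  have hX' : S.X (S.cl (insert (lbl v) A)) = K' := by rw [← e2]; exact X_upTo_idx hCA
  rw [e1] at hAc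
  rw [e2] at hBc
  have htA : S.timeOf (S.cl A) = Finset.Icc α β := by
    rw [← timeOf_X hAc, hp', h.timeOf_eq hK.le hK.cliq hK.time]
  obtain ⟨a, b, hab⟩ := h.exists_timeOf_eq hCA.1.1
  have hle : a ≤ b := Finset.nonempty_Icc.1 (hab ▸ hCA.2.1)
  have htB : S.timeOf (S.cl (insert (lbl v) A)) = Finset.Icc a b := by
    rw [← timeOf_X hBc, hX', hab]
  have hB2 : 2 ≤ (insert (lbl v) A).card :=
    hA2.trans (Finset.card_le_card (Finset.subset_insert _ _))
  have hBr : ∀ z ∈ insert (lbl v) A, 1 ≤ z ∧ z ≤ S.n := by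
    intro z hz
    rcases Finset.mem_insert.1 hz with rfl | hz
    · exact vs_range hvm
    · exact hAr z hz
  have tA := (h.timeIs_iff hAc.1).2 htA.symm
  have tB := (h.timeIs_iff hBc.1).2 htB.symm
  have cA : I.Cliq α β A := by
    have := h.cliq_vs hK.le hAc htA.ge
    rwa [vs_cl hAr hA2] at this
  have cB : I.Cliq a b (insert (lbl v) A) := by
    have := h.cliq_vs hle hBc htB.ge
    rwa [vs_cl hBr hB2] at this
  have gA := h.greedy_X hK.le cA hA2 tA
  rw [hp', vs_cl (h.range hK.cliq) h2] at gA
  have gB := h.greedy_X hle cB hB2 tB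
  rw [hX'] at gB
  -- If `v` belonged to `K`, then `K'_{≤ v}` would lie between `A` and its completion, so `K'` would
  -- equal its own parent, against the decrease of the index.
  have hvK : lbl v ∉ K := by
    intro hc
    have hs : S.cl (insert (lbl v) A) ⊆ S.X (S.cl A) := by
      rw [hp']
      exact cl_mono (Finset.insert_subset hc gA.1)
    have := X_mid hAc hBc (cl_mono (Finset.subset_insert _ _)) hs
    rw [hX', hp', ← hp] at this
    have hlt := idx_parent_lt hCA hr
    rw [← this] at hlt
    exact lt_irrefl _ hlt
  obtain ⟨c, hc⟩ := I.exists_kidAt h.good hle hA2 hvm tA gA hvK tB gB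
  exact ⟨c, _, _, _, _, hc, hcl⟩

theorem kidAt_inj (h : S.Link I e R D) {α β c v a b c' v' a' b' : ℕ} {K B B' : Finset ℕ}
    (hK : I.Sat α β K) (hB : I.KidAt α β K c v a b B)
    (hB' : I.KidAt α β K c' v' a' b' B') (heq : S.cl B = S.cl B') : c = c' := by
  obtain ⟨h2, _, rfl, _⟩ := h.isKid hK hB
  obtain ⟨h2', _, rfl, _⟩ := h.isKid hK hB'
  have s := hB.sat h.good hK
  have s' := hB'.sat h.good hK
  obtain rfl := cl_inj (h.range s.cliq) (h.range s'.cliq) h2 h2' heq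
  obtain ⟨rfl, rfl⟩ := s.time.unique s'.time s.le
  exact hB.code_unique h.good hK.cliq hB'

theorem enumChildren (h : S.Link I e R D) {α β : ℕ} {K : Finset ℕ} (hK : I.Sat α β K)
    (h2 : 2 ≤ K.card) {cs : List S.Edges} (hnd : cs.Nodup)
    (hcs : ∀ K', K' ∈ cs ↔ ∃ c v a b B, I.KidAt α β K c v a b B ∧ S.cl B = K') :
    S.EnumChildren (S.cl K) cs := by
  rw [enumChildren_iff (h.closedActive hK h2)]
  refine ⟨hnd, fun K' => (hcs K').trans ⟨?_, fun hk => h.exists_kidAt hK h2 hk.1 hk.2⟩⟩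
  rintro ⟨c, v, a, b, B, hB, rfl⟩
  exact ⟨(h.isKid hK hB).2.1, (h.isKid hK hB).2.2.2⟩

/-- The codes order the children. The exploration from code `c` is the sequence of calls on the
children of code at least `c`; uniqueness of codes keeps the list of arguments free of repetitions,
and the case `c = 0` is the full loop of `EnumChildren`. -/
theorem calls_of_kidsOut (h : S.Link I e R D) {α β c : ℕ} {K : Finset ℕ}
    {out : List (Finset ℕ)} (ho : I.KidsOut α β K c out) (hK : I.Sat α β K) (h2 : 2 ≤ K.card) :
    ∃ cs, Calls S cs (out.map S.cl) ∧ cs.Nodup ∧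
      ∀ K', K' ∈ cs ↔ ∃ c', c ≤ c' ∧ ∃ v a b B, I.KidAt α β K c' v a b B ∧ S.cl B = K' := by
  induction ho with
  | nil α β K c hno =>
    refine ⟨[], Calls.nil, List.nodup_nil, fun K' => ⟨fun hc => absurd hc (by simp), ?_⟩⟩
    rintro ⟨c', hc, v, a, b, B, hB, _⟩
    exact absurd hB (hno c' hc v a b B)
  | cons α β K c c' v a b K' out out' hcc hk hno _ _ ih ih' =>
    obtain ⟨h2', hkid, _, _⟩ := h.isKid hK hk
    have hK' := hk.sat h.good hK
    obtain ⟨cs1, call1, nd1, mem1⟩ := ih hK' h2'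
    obtain ⟨cs, calls, nd, mem⟩ := ih' hK h2
    refine ⟨S.cl K' :: cs, ?_, ?_, ?_⟩
    · rw [List.map_cons, List.map_append, ← List.cons_append]
      refine Calls.cons _ _ _ _ (Call.mk _ cs1 _ ⟨cs1, [], ?_, (List.append_nil _).symm, ?_⟩ call1) calls
      · exact h.enumChildren hK' h2' nd1 (by simpa using mem1)
      · rw [if_neg hkid.2.1]
    · refine List.nodup_cons.2 ⟨fun hc => ?_, nd⟩
      obtain ⟨c2, hc2, v2, a2, b2, B, hB, hBe⟩ := (mem _).1 hc
      have := h.kidAt_inj hK hB hk hBe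
      omega
    · intro K2
      rw [List.mem_cons, mem]
      constructor
      · rintro (rfl | ⟨c2, hc2, hB⟩)
        · exact ⟨c', hcc, v, a, b, K', hk, rfl⟩
        · exact ⟨c2, by omega, hB⟩
      · rintro ⟨c2, hc2, v2, a2, b2, B, hB, rfl⟩
        rcases lt_trichotomy c2 c' with hlt | rfl | hlt
        · exact absurd hB (hno c2 hc2 hlt _ _ _ _)
        · exact Or.inl (by rw [hk.unique h.good hK.cliq hB])
        · exact Or.inr ⟨c2, hlt, v2, a2, b2, B, hB, rfl⟩

/-- The exploration of the children of a clique is a loop over the list found by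
`EnumChildren`. -/
theorem exists_enumChildren (h : S.Link I e R D) {α β : ℕ} {K : Finset ℕ}
    {out : List (Finset ℕ)} (ho : I.KidsOut α β K 0 out) (hK : I.Sat α β K) (h2 : 2 ≤ K.card) :
    ∃ cs, Calls S cs (out.map S.cl) ∧ S.EnumChildren (S.cl K) cs := by
  obtain ⟨cs, h3, h4, h5⟩ := h.calls_of_kidsOut ho hK h2
  exact ⟨cs, h3, h.enumChildren hK h2 h4 (by simpa using h5)⟩

theorem call_of_kidsOut (h : S.Link I e R D) {α β : ℕ} {K : Finset ℕ}
    {out : List (Finset ℕ)} (ho : I.KidsOut α β K 0 out) (hK : I.Sat α β K) (h2 : 2 ≤ K.card)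
    (hr : S.cl K ≠ S.root) : Call S (S.cl K) (S.cl K :: out.map S.cl) := by
  obtain ⟨cs, h3, h4⟩ := h.exists_enumChildren ho hK h2
  exact Call.mk _ cs _ ⟨cs, [], h4, (List.append_nil _).symm, by rw [if_neg hr]⟩ h3

end Link

end GraphSeq

-- The run of the program is a run of the algorithm

namespace GraphSeq

variable {S : GraphSeq}

theorem Calls.append {cs cs' out out' : List S.Edges} (h : Calls S cs out)
    (h' : Calls S cs' out') : Calls S (cs ++ cs') (out ++ out') := by
  induction cs generalizing out with
  | nil =>
    cases h
    exact h'
  | cons K cs ih =>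
    cases h with
    | cons _ _ o1 o2 h1 h2 =>
      rw [List.append_assoc]
      exact Calls.cons _ _ _ _ h1 (ih h2)

theorem describes_of_words {K : Finset ℕ} {w : List ℕ} (hK : ∀ u ∈ K, 1 ≤ u ∧ u ≤ S.n)
    (h : Words K w) : S.Describes w (S.cl K) := by
  classical
  obtain ⟨es, hnd, hmem, rfl⟩ := h
  have hinj : Function.Injective (lbl : Fin S.n → ℕ) := fun u v h => lbl_inj.1 h
  obtain ⟨es', rfl, -⟩ := List.exists_map_eq_of_forall (P := fun _ => True)
    (f := fun p : Fin S.n × Fin S.n => (lbl p.1, lbl p.2)) es fun p hp => by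
      have h1 := ((hmem _).1 (List.mem_map_of_mem hp)).2
      obtain ⟨h2, h3⟩ := hK p.1 (h1 _ (by simp))
      obtain ⟨h4, h5⟩ := hK p.2 (h1 _ (by simp))
      obtain ⟨u, hu⟩ := exists_lbl h2 h3
      obtain ⟨v, hv⟩ := exists_lbl h4 h5
      exact ⟨(u, v), by rw [hu, hv], trivial⟩
  have hmap : (es'.map fun p => ((lbl p.1, lbl p.2) : ℕ × ℕ)).map (fun p => s(p.1, p.2)) =
      (es'.map fun p => s(p.1, p.2)).map (Sym2.map lbl) := by
    simp only [List.map_map]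
    rfl
  rw [hmap] at hnd
  refine ⟨es', hnd.of_map _, ?_, by rw [List.flatMap_map]⟩
  ext x
  rw [List.mem_toFinset, ← List.mem_map_of_injective (Sym2.map.injective hinj), ← hmap, hmem, mem_cl]
  induction x using Sym2.ind with
  | _ u v => simp [lbl_inj]

theorem prints_of_printed {out : List (Finset ℕ)} {w : List ℕ}
    (hK : ∀ K ∈ out, ∀ u ∈ K, 1 ≤ u ∧ u ≤ S.n) (h : Printed out w) : S.Prints w (out.map S.cl) := by
  obtain ⟨ws, h1, rfl⟩ := h
  refine ⟨ws, ?_, rfl⟩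
  rw [List.forall₂_map_right_iff]
  induction h1 with
  | nil => exact List.Forall₂.nil
  | cons h2 _ ih =>
    exact List.Forall₂.cons (describes_of_words (hK _ List.mem_cons_self) h2)
      (ih fun K hK' => hK K (List.mem_cons_of_mem _ hK'))

namespace Link

variable {I : Net} {e : ℕ → Sym2 (Fin S.n)} {R D : ℕ}

theorem range_of_kidsOut (h : S.Link I e R D) {α β c : ℕ} {K : Finset ℕ}
    {out : List (Finset ℕ)} (ho : I.KidsOut α β K c out) (hK : I.Sat α β K) :
    ∀ B ∈ out, ∀ u ∈ B, 1 ≤ u ∧ u ≤ S.n := by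
  induction ho with
  | nil => simp
  | cons α β K c c' v a b K' out out' hcc hk hno _ _ ih ih' =>
    have hK' := hk.sat h.good hK
    intro B hB
    rw [List.mem_cons, List.mem_append] at hB
    rcases hB with rfl | hB | hB
    · exact h.range hK'.cliq
    · exact ih hK' B hB
    · exact ih' hK B hB

theorem cl_pair (h : S.Link I e R D) {j : ℕ} (hj : j < I.m) : S.cl {I.eu j, I.ev j} = {e j} := by
  obtain ⟨u, v, huv, h1, h2, h3⟩ := h.e_mk j hj
  rw [h1, h2, h3]
  ext x
  induction x using Sym2.ind with
  | _ a b =>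
    simp only [mk_mem_cl, Finset.mem_insert, Finset.mem_singleton, lbl_inj, Sym2.eq_iff]
    constructor
    · rintro ⟨h1, rfl | rfl, rfl | rfl⟩ <;> simp_all
    · rintro (⟨rfl, rfl⟩ | ⟨rfl, rfl⟩)
      · exact ⟨huv.ne, Or.inl rfl, Or.inr rfl⟩
      · exact ⟨huv.ne', Or.inr rfl, Or.inl rfl⟩

theorem card_pair (h : S.Link I e R D) {j : ℕ} (hj : j < I.m) :
    2 ≤ ({I.eu j, I.ev j} : Finset ℕ).card := by
  have := h.good.edge j hj
  rw [Finset.card_pair (by omega)]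

theorem timeIs_pair (h : S.Link I e R D) {j : ℕ} (hj : j < I.m) :
    I.TimeIs {I.eu j, I.ev j} (I.lo j) (I.hi j) := by
  have hm := h.e_mem j hj
  rw [h.timeIs_iff (by rw [h.cl_pair hj]; simpa using hm), h.cl_pair hj, timeOf_singleton hm,
    h.e_time j hj]

theorem lo_le_hi (h : S.Link I e R D) {j : ℕ} (hj : j < I.m) : I.lo j ≤ I.hi j :=
  (h.good.edge j hj).2.2.2.2.1

theorem greedy_edge (h : S.Link I e R D) {j : ℕ} (hj : j < I.m) :
    I.Greedy (I.lo j) (I.hi j) {I.eu j, I.ev j} (S.vs (S.X {e j})) := by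
  have hm := h.e_mem j hj
  have hc : I.Cliq (I.lo j) (I.hi j) {I.eu j, I.ev j} := by
    rw [h.cliq_iff (h.lo_le_hi hj), h.cl_pair hj]
    have := h.good.edge j hj
    have hn := h.n_eq
    constructor
    · intro u hu
      rw [Finset.mem_insert, Finset.mem_singleton] at hu
      omega
    · simp only [Finset.mem_singleton, forall_eq]
      exact ⟨hm, (h.e_time j hj).ge⟩
  have := h.greedy_X (h.lo_le_hi hj) hc (h.card_pair hj) (h.timeIs_pair hj)
  rwa [h.cl_pair hj] at this

theorem X_edge (h : S.Link I e R D) {j : ℕ} (hj : j < I.m) {K : Finset ℕ}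
    (hg : I.Greedy (I.lo j) (I.hi j) {I.eu j, I.ev j} K) : S.X {e j} = S.cl K := by
  rw [← h.cl_pair hj]
  exact h.X_cl (h.lo_le_hi hj) (h.card_pair hj) (h.timeIs_pair hj) hg

theorem edgeLT_iff (h : S.Link I e R D) {i j : ℕ} (hi : i < I.m) (hj : j < I.m) :
    S.edgeLT (e i) (e j) ↔ I.Before i j := by
  obtain ⟨u, v, huv, h1, h2, h3⟩ := h.e_mk i hi
  obtain ⟨u', v', huv', h1', h2', h3'⟩ := h.e_mk j hj
  rw [h1, h1', edgeLT_mk huv huv', Net.Before, h2, h2', h3, h3', lbl_lt_lbl, lbl_lt_lbl, lbl_inj]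

theorem eq_of_not_before (h : S.Link I e R D) {i j : ℕ} (hi : i < I.m) (hj : j < I.m)
    (h1 : ¬ I.Before i j) (h2 : ¬ I.Before j i) : i = j := by
  unfold Net.Before at h1 h2
  exact h.good.edge_unique hi hj (by omega)

/-- A vertex of the closure below the larger endpoint, other than the smaller endpoint, gives an
edge to the smaller endpoint that precedes the given edge. Conversely, an earlier edge has such a
vertex. -/
theorem exists_start_iff (h : S.Link I e R D) {j : ℕ} (hj : j < I.m) :
    (∃ K, I.Start j K) ↔ ∀ x ∈ S.X {e j}, ¬ S.edgeLT x (e j) := by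
  have hg := h.greedy_edge hj
  have hcl := isClique_X (isClique_singleton (h.e_mem j hj))
  obtain ⟨u, v, huv, h1, h2, h3⟩ := h.e_mk j hj
  have huK := hg.1 (Finset.mem_insert_self _ _)
  rw [h2] at huK
  constructor
  · rintro ⟨K, hK⟩ x hx hlt
    rw [h.X_edge hj hK.greedy] at hx
    have hl := hK.least
    simp only [Finset.mem_sdiff, Finset.mem_insert, Finset.mem_singleton, not_or, and_imp, h2, h3]
      at hl
    induction x using Sym2.ind with
    | _ a b =>
      wlog hab : a ≤ b generalizing a b
      · rw [Sym2.eq_swap] at hx hlt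
        exact this b a hx hlt (le_of_not_ge hab)
      rw [mk_mem_cl] at hx
      rw [h1, edgeLT_mk (lt_of_le_of_ne hab hx.1) huv] at hlt
      rcases hlt with h4 | ⟨rfl, h4⟩
      · have := hl _ hx.2.1 (fun hc => h4.ne (lbl_inj.1 hc)) fun hc => (h4.trans huv).ne (lbl_inj.1 hc)
        rw [lbl_le_lbl] at this
        exact absurd (h4.trans huv) this.not_gt
      · have := hl _ hx.2.2 (fun hc => hx.1 (lbl_inj.1 hc).symm) fun hc => h4.ne (lbl_inj.1 hc)
        rw [lbl_le_lbl] at this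
        exact absurd h4 this.not_gt
  · intro hmin
    refine ⟨_, hg, fun z hz => ?_⟩
    simp only [Finset.mem_sdiff, Finset.mem_insert, Finset.mem_singleton, not_or, h2, h3] at hz ⊢
    obtain ⟨hz, hzu, hzv⟩ := hz
    obtain ⟨w, hw, rfl⟩ := mem_vs.1 hz
    rw [lbl_mem_vs] at huK
    rw [lbl_le_lbl]
    by_contra hlt
    have hwu : w ≠ u := fun hc => hzu (by rw [hc])
    have hin := hcl.2 w hw u huK hwu
    rcases lt_or_gt_of_ne hwu with h4 | h4
    · refine hmin _ hin ?_
      rw [h1, edgeLT_mk h4 huv]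
      exact Or.inl h4
    · rw [Sym2.eq_swap] at hin
      refine hmin _ hin ?_
      rw [h1, edgeLT_mk h4 huv]
      exact Or.inr ⟨rfl, not_le.1 hlt⟩

theorem full_of_mem_root (h : S.Link I e R D) {j : ℕ} (hj : j < I.m) (hr : e j ∈ S.root) :
    I.Full j := by
  have ht : S.timeOf S.root = S.timeOf ∅ := timeOf_X isClique_empty
  have hsub : ∀ t, 1 ≤ t ∧ t ≤ S.tmax → I.lo j ≤ t ∧ t ≤ I.hi j := fun t h1 => by
    have : t ∈ S.timeOf S.root := by
      rw [ht, mem_timeOf]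
      exact ⟨h1, by simp⟩
    rw [← Finset.mem_Icc, ← h.e_time j hj]
    exact (mem_timeOf.1 this).2 _ hr
  have hT := S.tmax_pos
  exact ⟨(hsub 1 ⟨le_rfl, hT⟩).1, by rw [h.T_eq]; exact (hsub S.tmax ⟨hT, le_rfl⟩).2⟩

theorem root_eq_empty (h : S.Link I e R D) (hf : ∀ i < I.m, ¬ I.Full i) : S.root = ∅ := by
  rw [Finset.eq_empty_iff_forall_notMem]
  intro x hx
  obtain ⟨j, hj, rfl⟩ := h.e_surj x (closedActive_root.1.1 x hx)
  exact hf j hj (h.full_of_mem_root hj hx)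

/-- The completion of the edge is a candidate for the root. If the root were lexicographically
smaller, the first difference would be a root edge, thus active at all times and not before `e j`.
It comes after `e j`, so `e j` already lies in the root, and `X_mid` applies. -/
theorem root_eq_X (h : S.Link I e R D) {j : ℕ} (hj : j < I.m) (hf : I.Full j)
    (hmin : ∀ i < I.m, I.Full i → ¬ I.Before i j) : S.X {e j} = S.root := by
  have hs := isClique_singleton (h.e_mem j hj)
  have ht : S.timeOf {e j} = S.timeOf ∅ := by
    rw [timeOf_singleton (h.e_mem j hj), h.e_time j hj]
    ext t
    rw [mem_timeOf, Finset.mem_Icc]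
    have hT := h.T_eq
    have := h.good.edge j hj
    have h1 := hf.1
    have h2 := hf.2
    simp only [Finset.notMem_empty, false_imp_iff, implies_true, and_true]
    omega
  rcases (X_isCompletion isClique_empty).2 (S.X {e j}) (isClique_X hs) (isClosed_X hs)
    (Finset.empty_subset _) ((timeOf_X hs).trans ht) with h1 | ⟨x, hx, hxn, hlt⟩
  · exact h1
  · have hx' : x ∈ S.root := hx
    obtain ⟨i, hi, rfl⟩ := h.e_surj x (closedActive_root.1.1 x hx')
    have hij : ¬ I.Before i j := hmin i hi (h.full_of_mem_root hi hx')
    have hjm : e j ∈ S.X {e j} := subset_X hs (Finset.mem_singleton_self _)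
    have hji : I.Before j i := by
      by_contra hc
      rw [h.eq_of_not_before hi hj hij hc] at hxn
      exact hxn hjm
    have := (hlt (e j) ((h.edgeLT_iff hj hi).2 hji)).2 hjm
    exact X_mid isClique_empty hs (Finset.empty_subset _) (Finset.singleton_subset_iff.2 this)

/-- An edge that generates the root and is least in it can only be the first edge active at all
times. So the comparison with the root reduces to a comparison of edge numbers. -/
theorem acceptsEdge_iff (h : S.Link I e R D) {jm k : ℕ} (hf : I.FirstFull I.m jm) (hk : k < I.m) :
    S.AcceptsEdge (e k) ↔ k ≠ jm ∧ ∃ K, I.Start k K := by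
  have hmem : e k ∈ S.X {e k} :=
    subset_X (isClique_singleton (h.e_mem k hk)) (Finset.mem_singleton_self _)
  rw [AcceptsEdge, h.exists_start_iff hk]
  constructor
  · rintro ⟨h1, _, h2⟩
    refine ⟨?_, h2⟩
    rintro rfl
    rcases hf with ⟨h3, _⟩ | ⟨_, h4, h5⟩
    · omega
    · exact h1 (h.root_eq_X hk h4 h5)
  · rintro ⟨h1, h2⟩
    refine ⟨fun hr => ?_, hmem, h2⟩
    rcases hf with ⟨_, h3⟩ | ⟨h3, h4, h5⟩
    · rw [hr, h.root_eq_empty h3] at hmem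
      exact absurd hmem (Finset.notMem_empty _)
    · have hjm : e jm ∈ S.X {e k} := by
        rw [hr, ← h.root_eq_X h3 h4 h5]
        exact subset_X (isClique_singleton (h.e_mem jm h3)) (Finset.mem_singleton_self _)
      refine h1 (h.eq_of_not_before hk h3 (h5 k hk (h.full_of_mem_root hk (hr ▸ hmem))) ?_)
      rw [← h.edgeLT_iff h3 hk]
      exact h2 _ hjm

theorem two_le_card (h : S.Link I e R D) {j : ℕ} (hj : j < I.m) {K : Finset ℕ}
    (hg : I.Greedy (I.lo j) (I.hi j) {I.eu j, I.ev j} K) : 2 ≤ K.card :=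
  (h.card_pair hj).trans (Finset.card_le_card hg.1)

open Classical in
-- The program treats the edges in the order of their numbers. Skipped edges are the rejected ones,
-- and each taken edge contributes the call on its completion.
theorem calls_of_edgesOut (h : S.Link I e R D) {jm k : ℕ} (hf : I.FirstFull I.m jm)
    {out : List (Finset ℕ)} (ho : I.EdgesOut jm k out) (hk : k ≤ I.m) :
    Calls S ((((List.range k).map e).filter fun x => decide (S.AcceptsEdge x)).map fun x => S.X {x})
      (out.map S.cl) ∧ ∀ B ∈ out, ∀ u ∈ B, 1 ≤ u ∧ u ≤ S.n := by
  induction ho with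
  | zero => exact ⟨Calls.nil, by simp⟩
  | skip k out _ hs ih =>
    obtain ⟨ih1, ih2⟩ := ih (by omega)
    refine ⟨?_, ih2⟩
    have : ¬ S.AcceptsEdge (e k) := fun ha => by
      obtain ⟨h1, K, h2⟩ := (h.acceptsEdge_iff hf hk).1 ha
      exact hs.elim h1 fun h3 => h3 K h2
    rw [List.range_succ, List.map_append, List.filter_append, List.map_append]
    simpa [this] using ih1
  | take k out K out' _ hne hs hko ih =>
    obtain ⟨ih1, ih2⟩ := ih (by omega)
    have ha : S.AcceptsEdge (e k) := (h.acceptsEdge_iff hf hk).2 ⟨hne, K, hs⟩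
    have hsat := Net.sat_of_edge h.good hk hs.greedy
    have hX := h.X_edge hk hs.greedy
    have hcall := h.call_of_kidsOut hko hsat (h.two_le_card hk hs.greedy) (hX ▸ ha.1)
    constructor
    · rw [List.range_succ, List.map_append, List.filter_append, List.map_append, List.map_append]
      refine ih1.append ?_
      have := Calls.cons _ _ _ _ hcall Calls.nil
      simpa [ha, hX] using this
    · intro B hB
      rw [List.mem_append, List.mem_cons] at hB
      rcases hB with hB | rfl | hB
      · exact ih2 B hB
      · exact h.range hsat.cliq
      · exact h.range_of_kidsOut hko hsat B hB

theorem edgeChildren (h : S.Link I e R D) : ∃ cs : List S.Edges, S.EdgeChildren cs ∧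
    ∀ jm out, I.FirstFull I.m jm → I.EdgesOut jm I.m out → Calls S cs (out.map S.cl) := by
  classical
  refine ⟨_, ⟨(List.range I.m).map e, ?_, fun x => ?_, rfl⟩, fun jm out hf ho => ?_⟩
  · refine List.Nodup.map_on (fun i hi j hj hij => ?_) List.nodup_range
    exact h.e_inj (List.mem_range.1 hi) (List.mem_range.1 hj) hij
  · simp only [List.mem_map, List.mem_range]
    constructor
    · rintro ⟨j, hj, rfl⟩
      exact h.e_mem j hj
    · exact h.e_surj x
  · convert (h.calls_of_edgesOut hf ho le_rfl).1

theorem enumClosedActiveClique (h : S.Link I e R D) {out : List (Finset ℕ)} (ho : I.RunOut out) :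
    S.EnumClosedActiveClique (out.map S.cl) ∧ ∀ B ∈ out, ∀ u ∈ B, 1 ≤ u ∧ u ≤ S.n := by
  obtain ⟨jm, hf, out0, out1, rfl, he, h0⟩ := ho
  obtain ⟨bs, hbs, hcalls⟩ := h.edgeChildren
  have hc1 := hcalls jm out1 hf he
  have hr1 := (h.calls_of_edgesOut hf he le_rfl).2
  rcases h0 with ⟨h0, rfl⟩ | ⟨hjm, K, out', hg, hko, rfl⟩
  · have hno : ∀ i < I.m, ¬ I.Full i := hf.elim (fun h1 => h1.2) fun h1 => by
      have := h1.1
      omega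
    have hroot := h.root_eq_empty hno
    have hcl : S.cl ∅ = S.root := by
      rw [hroot, Finset.eq_empty_iff_forall_notMem]
      intro x hx
      induction x using Sym2.ind with
      | _ u v => exact Finset.notMem_empty _ (mk_mem_cl.1 hx).2.1
    constructor
    · rw [List.singleton_append, List.map_cons, hcl]
      refine Call.mk _ bs _ ⟨[], bs, ?_, rfl, by rwa [if_pos rfl]⟩ hc1
      rw [enumChildren_iff closedActive_root]
      -- A child found by the first loop shares the edges below its index with its parent. The empty
      -- root has none to share.
      refine ⟨List.nodup_nil, fun K' => ⟨fun hc => absurd hc List.not_mem_nil, ?_⟩⟩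
      rintro ⟨hk, x, hx⟩
      have := upTo_pred_subset_parent hk hx
      rw [hroot] at this
      exact absurd this (Finset.notMem_empty _)
    · intro B hB
      rcases List.mem_append.1 hB with hB | hB
      · rw [List.mem_singleton.1 hB]
        simp
      · exact hr1 B hB
  · have hfull := hf.resolve_left fun hc => by
      have := hc.1
      omega
    have hsat := Net.sat_of_edge h.good hjm hg
    have hX := (h.X_edge hjm hg).symm.trans (h.root_eq_X hjm hfull.2.1 hfull.2.2)
    obtain ⟨as, has, henum⟩ := h.exists_enumChildren hko hsat (h.two_le_card hjm hg)
    constructor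
    · rw [List.cons_append, List.map_cons, List.map_append, hX]
      rw [hX] at henum
      exact Call.mk _ _ _ ⟨as, bs, henum, rfl, by rwa [if_pos rfl]⟩ (has.append hc1)
    · intro B hB
      rw [List.cons_append, List.mem_cons, List.mem_append] at hB
      rcases hB with rfl | hB | hB
      · exact h.range hsat.cliq
      · exact h.range_of_kidsOut hko hsat B hB
      · exact hr1 B hB

end Link

end GraphSeq

-- Degree sums of cliques

namespace Net

variable {I : Net} {R D : ℕ}

theorem sum_deg_Icc (hst : ∀ v, 1 ≤ v → v ≤ I.n → I.st v ≤ I.st (v + 1)) (k : ℕ) (hk : k ≤ I.n) :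
    ∑ v ∈ Finset.Icc 1 k, I.deg v + I.st 1 = I.st (k + 1) := by
  induction k with
  | zero => simp
  | succ k ih =>
    have h1 := ih (by omega)
    have h2 := hst (k + 1) (by omega) hk
    rw [Finset.sum_Icc_succ_top (by omega)]
    unfold deg at *
    omega

theorem Good.card_erase_le (hI : I.Good R D) {a b u : ℕ} {B : Finset ℕ} (hB : I.Cliq a b B)
    (hu : u ∈ B) : (B.erase u).card ≤ I.deg u := by
  have : B.erase u ⊆ (Finset.Ico (I.st u) (I.st (u + 1))).image fun p => I.oth (I.inc p) u := by
    intro z hz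
    rw [Finset.mem_erase] at hz
    obtain ⟨j, hj, h1, _⟩ := hB.2 u hu z hz.2 hz.1.symm
    obtain ⟨p, p1, p2, _, p4⟩ := hI.exists_seg hj h1
    exact Finset.mem_image.2 ⟨p, Finset.mem_Ico.2 ⟨p1, p2⟩, p4⟩
  refine (Finset.card_le_card this).trans (Finset.card_image_le.trans ?_)
  rw [Nat.card_Ico]
  rfl

/-- A clique has at most `Δ + 1` vertices, each of degree at most `Δ`, and `Δ(Δ + 1) ≤ 2Δ²`. -/
theorem Good.sum_deg_le_sq (hI : I.Good R D) {Δ : ℕ} (hΔ : ∀ v, 1 ≤ v → v ≤ I.n → I.deg v ≤ Δ)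
    {a b : ℕ} {B : Finset ℕ} (hB : I.Cliq a b B) : ∑ v ∈ B, I.deg v ≤ 2 * Δ ^ 2 := by
  have h1 : ∀ v ∈ B, I.deg v ≤ Δ := fun v hv => hΔ v (hB.1 v hv).1 (hB.1 v hv).2
  rcases B.eq_empty_or_nonempty with rfl | ⟨u, hu⟩
  · simp
  have h2 := (hI.card_erase_le hB hu).trans (h1 u hu)
  rw [Finset.card_erase_of_mem hu] at h2
  have h3 := Finset.sum_le_card_nsmul B I.deg Δ h1
  rw [smul_eq_mul] at h3
  have h4 : B.card * Δ ≤ (Δ + 1) * Δ := Nat.mul_le_mul_right _ (by omega)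
  have h5 := Nat.le_self_pow (two_ne_zero) Δ
  nlinarith

end Net

-- Parameters of the encoded network and the final estimates

namespace GraphSeq

variable {S : GraphSeq}

variable (S) in
/-- The network that is given by the initial state `σ` of the machine. -/
noncomputable def net (σ : RAM.State) : Net :=
  ⟨S.n, S.numEdges, S.tmax, σ.mem 0, σ.mem 1, σ.mem 2, σ.mem 3, σ.mem 4, σ.mem 5⟩

theorem numEdges_eq [Fintype S.G.edgeSet] : S.numEdges = S.G.edgeFinset.card := by
  rw [numEdges, Set.ncard_eq_toFinset_card']
  rfl

theorem maxDeg_le_numEdges : S.maxDeg ≤ S.numEdges := by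
  classical
  rw [maxDeg, numEdges_eq]
  refine SimpleGraph.maxDegree_le_of_forall_degree_le _ _ fun v => ?_
  rw [← SimpleGraph.card_incidenceFinset_eq_degree]
  exact Finset.card_le_card (SimpleGraph.incidenceFinset_subset _ _)

theorem maxDeg_pos (h : S.numEdges ≠ 0) : 1 ≤ S.maxDeg := by
  classical
  obtain ⟨x, hx⟩ := Set.nonempty_of_ncard_ne_zero h
  induction x using Sym2.ind with
  | _ u v =>
    rw [maxDeg]
    refine le_trans ?_ (SimpleGraph.degree_le_maxDegree _ u)
    exact (SimpleGraph.degree_pos_iff_exists_adj _ _).2 ⟨v, hx⟩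

/-- The degree sum of a clique is at most that of all vertices, `2m`, and at most `2Δ²`. The maxima
with `1` cover graphs without edges. -/
theorem exists_good {σ : RAM.State} (hE : S.Encodes σ) :
    (S.net σ).Good (2 * max 1 (min S.numEdges (S.maxDeg ^ 2))) (max 1 S.maxDeg) := by
  classical
  obtain ⟨edge, h1, h2⟩ := hE.edges
  have hst : ∀ v, 1 ≤ v → v ≤ S.n → σ.mem 4 v ≤ σ.mem 4 (v + 1) := fun v hv hv' => by
    obtain ⟨w, rfl⟩ := exists_lbl hv hv'
    exact (h2 w).1
  have hmono : ∀ k ≤ S.n, σ.mem 4 (S.n + 1 - k) ≤ 2 * S.numEdges := fun k => by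
    induction k with
    | zero => exact fun _ => hE.seg_last.le
    | succ k ih =>
      intro hk
      have h3 := hst (S.n - k) (by omega) (by omega)
      have h4 := ih (by omega)
      rw [show S.n - k + 1 = S.n + 1 - k by omega] at h3
      rw [show S.n + 1 - (k + 1) = S.n - k by omega]
      exact h3.trans h4
  have hmem : ∀ (j : ℕ) (hj : j < S.numEdges) (v : Fin S.n),
      v ∈ (edge ⟨j, hj⟩ : Sym2 (Fin S.n)) ↔ σ.mem 0 j = lbl v ∨ σ.mem 1 j = lbl v := by
    intro j hj v
    obtain ⟨a, b, h3, _, h4, h5, _⟩ := h1 ⟨j, hj⟩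
    rw [h3, h4, h5, Sym2.mem_iff, lbl_inj, lbl_inj, eq_comm, @eq_comm _ v b]
  have hdeg : ∀ v, 1 ≤ v → v ≤ S.n → (S.net σ).deg v ≤ S.maxDeg := fun v hv hv' => by
    obtain ⟨w, rfl⟩ := exists_lbl hv hv'
    rw [maxDeg]
    refine le_trans ?_ (SimpleGraph.degree_le_maxDegree _ w)
    rw [← SimpleGraph.card_incidenceFinset_eq_degree, Net.deg, ← Nat.card_Ico]
    have hin : ∀ p ∈ Finset.Ico (σ.mem 4 (lbl w)) (σ.mem 4 (lbl w + 1)),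
        ∃ h : σ.mem 5 p < S.numEdges, w ∈ (edge ⟨_, h⟩ : Sym2 (Fin S.n)) := fun p hp =>
      (h2 w).2.mapsTo (Finset.mem_Ico.1 hp)
    refine Finset.card_le_card_of_injOn (fun p => if h : σ.mem 5 p < S.numEdges then
      (edge ⟨_, h⟩ : Sym2 (Fin S.n)) else s(w, w)) (fun p hp => ?_) fun p hp q hq hpq => ?_
    · obtain ⟨h3, h4⟩ := hin p hp
      simp only [h3, dif_pos, Finset.mem_coe, SimpleGraph.mem_incidenceFinset]
      exact ⟨(edge _).2, h4⟩
    · obtain ⟨h3, _⟩ := hin p hp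
      obtain ⟨h4, _⟩ := hin q hq
      simp only [h3, h4, dif_pos] at hpq
      have := edge.injective (Subtype.ext hpq)
      rw [Fin.mk.injEq] at this
      exact (h2 w).2.injOn (Finset.mem_Ico.1 hp) (Finset.mem_Ico.1 hq) this
  have hsum : ∀ a b B, (S.net σ).Cliq a b B → ∑ v ∈ B, (S.net σ).deg v ≤ 2 * S.numEdges := by
    intro a b B hB
    have h3 : B ⊆ Finset.Icc 1 S.n := fun u hu => Finset.mem_Icc.2 (hB.1 u hu)
    refine (Finset.sum_le_sum_of_subset h3).trans ?_
    have h4 := (S.net σ).sum_deg_Icc hst S.n le_rfl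
    have h5 : (S.net σ).st (S.n + 1) = 2 * S.numEdges := hE.seg_last
    omega
  -- The bound `2Δ²` is proved for good networks, so goodness is established first with the bound
  -- `2m` and then improved.
  have good : (S.net σ).Good (2 * max 1 S.numEdges) (max 1 S.maxDeg) := by
    refine ⟨S.tmax_pos, by omega, le_max_left _ _, ?_, ?_, hst, ?_, ?_, ?_, ?_,
      fun v hv hv' => (hdeg v hv hv').trans (le_max_right _ _), ?_⟩
    · intro j hj
      obtain ⟨u, v, _, h3, h4, h5, h6⟩ := h1 ⟨j, hj⟩
      have hne := S.τ_nonempty _ (edge ⟨j, hj⟩).2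
      have hsub := S.τ_subset _ (edge ⟨j, hj⟩).2
      rw [h6] at hne hsub
      rw [Finset.nonempty_Icc] at hne
      rw [Finset.Icc_subset_Icc_iff hne] at hsub
      have := lbl_pos u
      have := lbl_le v
      rw [← lbl_lt_lbl] at h3
      dsimp only [net] at *
      omega
    · intro i hi j hj hu hv
      obtain ⟨u, v, h3, _, h4, h5, _⟩ := h1 ⟨i, hi⟩
      obtain ⟨u', v', h3', _, h4', h5', _⟩ := h1 ⟨j, hj⟩
      have e1 : u = u' := lbl_inj.1 (h4.symm.trans (Eq.trans hu h4'))
      have e2 : v = v' := lbl_inj.1 (h5.symm.trans (Eq.trans hv h5'))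
      have := edge.injective (Subtype.ext (h3.trans (by rw [e1, e2, h3'])))
      exact congrArg Fin.val this
    · intro v hv hv'
      have := hmono (S.n + 1 - v) (by omega)
      dsimp only [net] at *
      rwa [show S.n + 1 - (S.n + 1 - v) = v by omega] at this
    · intro v p hv hv' h3 h4
      obtain ⟨w, rfl⟩ := exists_lbl hv hv'
      obtain ⟨h5, h6⟩ := (h2 w).2.mapsTo (show p ∈ Set.Ico _ _ from ⟨h3, h4⟩)
      exact ⟨h5, (hmem _ h5 w).1 h6⟩
    · intro v p q hv hv' h3 h4 h5 h6 h7
      obtain ⟨w, rfl⟩ := exists_lbl hv hv'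
      exact (h2 w).2.injOn (show p ∈ Set.Ico _ _ from ⟨h3, h4⟩)
        (show q ∈ Set.Ico _ _ from ⟨h5, h6⟩) h7
    · intro v j hj h3
      have : ∃ w : Fin S.n, lbl w = v := by
        obtain ⟨a, b, _, _, h4, h5, _⟩ := h1 ⟨j, hj⟩
        rcases h3 with h3 | h3
        · exact ⟨a, h4.symm.trans h3⟩
        · exact ⟨b, h5.symm.trans h3⟩
      obtain ⟨w, rfl⟩ := this
      obtain ⟨p, hp, h4⟩ := (h2 w).2.surjOn (show j ∈ _ from ⟨hj, (hmem j hj w).2 h3⟩)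
      exact ⟨p, hp.1, hp.2, h4⟩
    · intro a b B hB
      have := hsum a b B hB
      omega
  refine { good with R_pos := by omega, sum_deg_le := fun a b B hB => ?_ }
  have h3 := hsum a b B hB
  have h4 := good.sum_deg_le_sq hdeg hB
  omega

theorem exists_link {σ : RAM.State} (hE : S.Encodes σ) (h0 : S.numEdges ≠ 0) :
    ∃ e, S.Link (S.net σ) e (2 * max 1 (min S.numEdges (S.maxDeg ^ 2))) (max 1 S.maxDeg) := by
  obtain ⟨edge, h1, h2⟩ := hE.edges
  -- Truncating the number makes the enumeration total; this is where an edge must exist. Numbers in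
  -- range are unchanged.
  refine ⟨fun j => edge ⟨min j (S.numEdges - 1), by omega⟩, exists_good hE, rfl, rfl, ?_, ?_, ?_, ?_⟩
  all_goals
    have hmin : ∀ j < S.numEdges, min j (S.numEdges - 1) = j := fun j hj => by omega
  · intro j hj
    obtain ⟨u, v, h3, h4, h5, h6, _⟩ := h1 ⟨j, hj⟩
    simp only [hmin j hj]
    exact ⟨u, v, h4, h3, h5, h6⟩
  · intro j hj
    exact (edge _).2
  · intro x hx
    refine ⟨edge.symm ⟨x, hx⟩, (edge.symm ⟨x, hx⟩).2, ?_⟩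
    simp only [hmin _ (edge.symm ⟨x, hx⟩).2, Fin.eta, Equiv.apply_symm_apply]
  · intro j hj
    obtain ⟨u, v, _, _, _, _, h3⟩ := h1 ⟨j, hj⟩
    simp only [hmin j hj]
    exact h3

/-- Each edge of the clique is charged to an incidence at one of its endpoints, so the degree sum
bounds the number of edges. -/
theorem Link.card_le {I : Net} {e : ℕ → Sym2 (Fin S.n)} {R D : ℕ} (h : S.Link I e R D)
    {K : S.Edges} (hK : S.ClosedActive K) : K.card ≤ R := by
  obtain ⟨t, ht⟩ := hK.2.1
  have hc : I.Cliq t t (S.vs K) := h.cliq_vs le_rfl hK.1 (by simpa using ht)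
  refine le_trans ?_ (h.good.sum_deg_le t t _ hc)
  have hsub : K ⊆ (S.vs K).biUnion fun v =>
      (Finset.Ico (I.st v) (I.st (v + 1))).image fun p => e (I.inc p) := by
    intro x hx
    obtain ⟨j, hj, rfl⟩ := h.e_surj x (hK.1.1 x hx)
    obtain ⟨u, v, _, h1, h2, _⟩ := h.e_mk j hj
    obtain ⟨p, p1, p2, p3, _⟩ := h.good.exists_seg hj (Or.inl ⟨h2, rfl⟩)
    rw [h1] at hx
    exact Finset.mem_biUnion.2 ⟨lbl u, lbl_mem_vs.2 (left_mem_verts hx),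
      Finset.mem_image.2 ⟨p, Finset.mem_Ico.2 ⟨p1, p2⟩, by rw [p3]⟩⟩
  refine (Finset.card_le_card hsub).trans (Finset.card_biUnion_le.trans (Finset.sum_le_sum ?_))
  intro v _
  refine Finset.card_image_le.trans ?_
  rw [Nat.card_Ico]
  rfl

/-- Every edge lies in its completion, which is closed and active, and such a clique has at most `R`
edges. Thus the `O(mR)` spent on the edges is `O(N R²)`. -/
theorem Link.m_le {I : Net} {e : ℕ → Sym2 (Fin S.n)} {R D : ℕ} (h : S.Link I e R D)
    {Ks : List S.Edges} (hKs : S.EnumClosedActiveClique Ks) : I.m ≤ Ks.length * R := by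
  classical
  have hs := enumClosedActiveClique_spec hKs
  have h1 : (Finset.range I.m).image e ⊆ Ks.toFinset.biUnion id := by
    intro x hx
    obtain ⟨j, hj, rfl⟩ := Finset.mem_image.1 hx
    have hm := h.e_mem j (Finset.mem_range.1 hj)
    exact Finset.mem_biUnion.2 ⟨S.X {e j},
      List.mem_toFinset.2 ((hs.2 _).2 (closedActive_X_singleton hm)),
      subset_X (isClique_singleton hm) (Finset.mem_singleton_self _)⟩
  have h2 := (Finset.card_le_card h1).trans (Finset.card_biUnion_le_card_mul _ _ R fun K hK =>
    h.card_le ((hs.2 K).1 (List.mem_toFinset.1 hK)))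
  rw [Finset.card_image_of_injOn fun i hi j hj => h.e_inj (Finset.mem_range.1 hi) (Finset.mem_range.1 hj),
    Finset.card_range, List.toFinset_card_of_nodup hs.1] at h2
  exact h2

/-- Treated apart because `exists_link` needs an edge. The empty clique is the only closed active
one, and some run exists, so its output must be this list. -/
theorem enumClosedActiveClique_of_no_edges (h : S.numEdges = 0) :
    S.EnumClosedActiveClique [∅] := by
  obtain ⟨Ks, hKs⟩ := exists_call S.root closedActive_root
  have hs := enumClosedActiveClique_spec hKs
  have hempty : S.G.edgeSet = ∅ := (Set.ncard_eq_zero (Set.toFinite _)).1 h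
  have hall : ∀ K, S.ClosedActive K ↔ K = ∅ := by
    have h1 : ∀ K, S.ClosedActive K → K = ∅ := fun K hK => by
      rw [Finset.eq_empty_iff_forall_notMem]
      intro x hx
      have := hK.1.1 x hx
      rw [hempty] at this
      exact this
    exact fun K => ⟨h1 K, fun hK => hK ▸ h1 _ closedActive_root ▸ closedActive_root⟩
  have hp : Ks.Perm [∅] := (List.perm_ext_iff_of_nodup hs.1 (List.nodup_singleton _)).2 fun K => by
    rw [hs.2, hall, List.mem_singleton]
  rwa [List.perm_singleton.1 hp] at hKs

theorem enumClosedActiveClique_of_runOut {σ : RAM.State} (hE : S.Encodes σ)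
    {out : List (Finset ℕ)} (ho : (S.net σ).RunOut out) :
    S.EnumClosedActiveClique (out.map S.cl) ∧ (∀ B ∈ out, ∀ u ∈ B, 1 ≤ u ∧ u ≤ S.n) ∧
      S.numEdges ≤ out.length * (2 * max 1 (min S.numEdges (S.maxDeg ^ 2))) := by
  by_cases h0 : S.numEdges = 0
  · have hm : (S.net σ).m = 0 := h0
    obtain ⟨jm, hf, out0, out1, rfl, he, h1⟩ := ho
    rw [hm] at he
    cases he
    rcases h1 with ⟨_, rfl⟩ | ⟨h1, _⟩
    · have hcl : S.cl ∅ = ∅ := by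
        rw [Finset.eq_empty_iff_forall_notMem]
        intro x hx
        induction x using Sym2.ind with
        | _ u v => exact Finset.notMem_empty _ (mk_mem_cl.1 hx).2.1
      refine ⟨?_, by simp, by omega⟩
      simpa [hcl] using enumClosedActiveClique_of_no_edges h0
    · omega
  · obtain ⟨e, h⟩ := exists_link hE h0
    obtain ⟨h1, h2⟩ := h.enumClosedActiveClique ho
    refine ⟨h1, h2, ?_⟩
    have h3 := h.m_le h1
    rwa [List.length_map] at h3

/-- The largest numbers are the codes, of order `4m²`. The base of the power is at least `3`, as
`tmax` is positive, so a fourth power absorbs the constants. -/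
theorem ctx_net {σ : RAM.State} (hE : S.Encodes σ) {C : ℕ} (hC : 4 ≤ C) :
    RAM.Ctx (S.net σ) (2 * (S.n + S.numEdges) + 2) ((S.n + S.numEdges + S.tmax + 2) ^ C)
      (2 * max 1 (min S.numEdges (S.maxDeg ^ 2))) (max 1 S.maxDeg) := by
  have hT := S.tmax_pos
  refine ⟨exists_good hE, ?_, ?_, ?_⟩
  · dsimp only [net]
    omega
  · dsimp only [net]
    omega
  · dsimp only [net]
    generalize S.n = n, S.numEdges = m, S.tmax = T at hT
    refine le_trans ?_ (Nat.pow_le_pow_right (by omega) hC)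
    have h1 : m * m + 3 * (n + m + T + 2) ≤ 2 * (n + m + T + 2) ^ 2 := by nlinarith
    have h2 : 9 * (n + m + T + 2) ^ 2 ≤ (n + m + T + 2) ^ 4 := by
      have : 3 ^ 2 ≤ (n + m + T + 2) ^ 2 := Nat.pow_le_pow_left (by omega) 2
      calc 9 * (n + m + T + 2) ^ 2 ≤ (n + m + T + 2) ^ 2 * (n + m + T + 2) ^ 2 :=
            Nat.mul_le_mul_right _ this
        _ = _ := by ring
    omega

theorem env_net {σ : RAM.State} (hE : S.Encodes σ) : RAM.Env (S.net σ) σ :=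
  ⟨hE.reg_n, hE.reg_m, hE.reg_t, rfl, rfl, rfl, rfl, rfl, rfl⟩

theorem square_mul_le (m Δ : ℕ) (h1 : Δ ≤ m) (h2 : m ≠ 0 → 1 ≤ Δ) :
    (2 * max 1 (min m (Δ ^ 2))) * (2 * max 1 (min m (Δ ^ 2))) * max 1 Δ ≤
      4 * max 1 (min (Δ ^ 5) (m ^ 2 * Δ)) := by
  rcases Nat.eq_zero_or_pos m with rfl | hm
  · obtain rfl : Δ = 0 := by omega
    norm_num
  have hΔ := h2 hm.ne'
  have h3 : 1 ≤ Δ ^ 2 := Nat.one_le_pow _ _ hΔ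
  rw [max_eq_right (show 1 ≤ min m (Δ ^ 2) from le_min hm h3), max_eq_right hΔ]
  have h4 : min m (Δ ^ 2) * min m (Δ ^ 2) * Δ ≤ min (Δ ^ 5) (m ^ 2 * Δ) := by
    refine le_min ?_ ?_
    · calc _ ≤ Δ ^ 2 * Δ ^ 2 * Δ := Nat.mul_le_mul_right _
            (Nat.mul_le_mul (min_le_right _ _) (min_le_right _ _))
        _ = _ := by ring
    · calc _ ≤ m * m * Δ := Nat.mul_le_mul_right _
            (Nat.mul_le_mul (min_le_left _ _) (min_le_left _ _))
        _ = _ := by ring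
  calc _ = 4 * (min m (Δ ^ 2) * min m (Δ ^ 2) * Δ) := by ring
    _ ≤ _ := Nat.mul_le_mul_left _ (h4.trans (le_max_right _ _))

theorem time_le {m N R D M : ℕ} (hN : 1 ≤ N) (hR : 1 ≤ R) (hD : 1 ≤ D) (hm : m ≤ N * R)
    (hM : R * R * D ≤ 4 * M) :
    6000 * ((m + 1) * R) + 16000 * (N * (R * R * D)) ≤ 112000 * (N * M) := by
  have h1 : (m + 1) * R ≤ 2 * (N * (R * R * D)) := by
    have h2 : m + 1 ≤ 2 * (N * R) := by
      have := Nat.mul_le_mul hN hR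
      omega
    calc (m + 1) * R ≤ 2 * (N * R) * R := Nat.mul_le_mul_right _ h2
      _ = 2 * (N * R) * R * 1 := (Nat.mul_one _).symm
      _ ≤ 2 * (N * R) * R * D := Nat.mul_le_mul_left _ hD
      _ = _ := by ring
  have h3 : N * (R * R * D) ≤ 4 * (N * M) := by
    calc _ ≤ N * (4 * M) := Nat.mul_le_mul_left _ hM
      _ = _ := by ring
  omega

end GraphSeq

theorem mainTheorem5 :
    -- correctness of the algorithm
    (∀ S : GraphSeq, S.IntervalAssumption →
      (∃ Ks, S.EnumClosedActiveClique Ks) ∧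
      ∀ Ks, S.EnumClosedActiveClique Ks → Ks.Nodup ∧ ∀ K, K ∈ Ks ↔ S.ClosedActive K) ∧
    -- an implementation within the stated time and space
    ∃ (prog : RAM.Cmd) (C : ℕ), ∀ S : GraphSeq, S.IntervalAssumption →
      ∀ σ : RAM.State, S.Encodes σ →
        ∃ (Ks : List S.Edges) (L : ℕ) (σ' : RAM.State) (t : ℕ),
          S.EnumClosedActiveClique Ks ∧
          RAM.Exec L ((S.n + S.numEdges + S.tmax + 2) ^ C) prog σ σ' t ∧
          S.Prints σ'.out Ks ∧
          t ≤ C * (S.numClosedActive *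
            max 1 (min (S.maxDeg ^ 5) (S.numEdges ^ 2 * S.maxDeg))) ∧
          prog.space L ≤ C * max 1 (S.n + S.numEdges) := by
  refine ⟨fun S _ => ⟨GraphSeq.exists_call S.root GraphSeq.closedActive_root,
    fun Ks => GraphSeq.enumClosedActiveClique_spec⟩, RAM.main,
    -- The time needs `112000 = 4 * (2 * 6000 + 16000)`. The other summands bound the space, since
    -- the arrays have length at most `4 * max 1 (n + m)`.
    112000 + 4 * RAM.main.arrays.card + RAM.main.regs.card, fun S _ σ hE => ?_⟩
  obtain ⟨σ', t, hexec, out, hout, hprint, ht⟩ := RAM.main_spec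
    (GraphSeq.ctx_net hE (C := 112000 + 4 * RAM.main.arrays.card + RAM.main.regs.card) (by omega))
    (GraphSeq.env_net hE) (hE.reg_other 3 le_rfl) (hE.mem_other 8 (by norm_num))
    (hE.mem_other 9 (by norm_num)) hE.out_nil
  obtain ⟨h1, h2, h3⟩ := GraphSeq.enumClosedActiveClique_of_runOut hE hout
  have hN := GraphSeq.length_eq_numClosedActive h1
  rw [List.length_map] at hN
  refine ⟨out.map S.cl, _, σ', t, h1, hexec, GraphSeq.prints_of_printed h2 hprint, ?_, ?_⟩
  · have hpos : 1 ≤ out.length := by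
      have := ((GraphSeq.enumClosedActiveClique_spec h1).2 _).2 GraphSeq.closedActive_root
      have := List.length_pos_of_mem this
      rwa [List.length_map] at this
    rw [← hN]
    refine (ht.trans (GraphSeq.time_le hpos (by omega) (le_max_left _ _) h3
      (GraphSeq.square_mul_le _ _ GraphSeq.maxDeg_le_numEdges GraphSeq.maxDeg_pos))).trans ?_
    exact Nat.mul_le_mul_right _ (by omega)
  · rw [RAM.Cmd.space]
    have h4 : 2 * (S.n + S.numEdges) + 2 ≤ 4 * max 1 (S.n + S.numEdges) := by omega
    have h5 := Nat.mul_le_mul_left RAM.main.arrays.card h4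
    have h6 : 1 ≤ max 1 (S.n + S.numEdges) := le_max_left _ _
    generalize max 1 (S.n + S.numEdges) = M at *
    nlinarith [Nat.mul_le_mul_left RAM.main.regs.card h6]
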